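/- Let $n\in\{3,4\}$. Let $(M,g_0)$ be a closed (compact, without boundary) smooth $n$-dimensional Riemannian manifold; all norms, integrals, divergences and balls $B_r=B_r(x_0)$ on $M$ are taken with respect to $g_0$. Let $N\subset\mathbb R^L$ be a smooth embedded submanifold with the induced metric. Its second fundamental form $A$ carries the sign for which the tension field of a map $f:M\to N$ is $\Delta f+A(f)(df,df)$, and satisfies $\|A\|\le C_N$. Let $a,b>0$ be constants with $C_b:=\frac{nb}{2}-C_N-2C_N^2>0$, and let $\varepsilon\in[0,1]$. Write $$e_2(f)=\varepsilon+|df|^2,\qquad E^\varepsilon(f)=\frac1n\int_M e_2(f)^{n/2}.$$ A smooth solution of the regularized $n$-conformal heat flow on $M\times[0,t_2]$ is a pair of smooth functions $f:M\times[0,t_2]\to N$, $u:M\times[0,t_2]\to\mathbb R$ with $u(\cdot,0)=0$ and $$f_t=e^{-nu}\Big(\operatorname{div}\big(e_2(f)^{\frac n2-1}df\big)+e_2(f)^{\frac n2-1}A(f)(df,df)\Big),\qquad u_t=b\,e^{-nu}e_2(f)^{\frac n2}-a .$$ **Theorem.** There is $\varepsilon_2>0$, depending only on $n$, $L$, $C_N$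 and a bound $K$ for the Ricci curvature of $g_0$ ($|\mathrm{Ric}(v,v)|\le K|v|^2$), such that the following holds. Let $0\le t_1<t_2$, $t_1'=\frac{t_1+t_2}{2}$, $0<\rho<r$, $\beta\ge 0$, $C(\beta)\in\mathbb R$, and let $(f,u)$ be a smooth solution on $M\times[0,t_2]$ with $E^\varepsilon(f(0))\le E_0$. Assume that $$\sup_{t\in[t_1,t_2]}\int_{B_r}e_2(f)^{\frac n2}(t)\le\varepsilon_2,\qquad \int_{B_r}e^{nu}|f_t|^2(t_1)\le\varepsilon_2,\qquad \int_{B_r}e^{\frac{2(n-1+\beta)}{n-2}nu}(t_1')\le C(\beta).$$ 1. If $\beta\le n$, then for all $t\in[t_1',t_2]$ $$\int_{B_\rho}e_2(f)^{(n-1+\beta)\frac{n}{n-2}}(t)\le C_{15}.$$ 2. (Iteration.) For every $\beta\ge0$ and every $q$ with $0<q\le(n-1+\beta)\frac n{n-2}$, for all $t\in[t_1',t_2]$ $$\int_{B_\rho}e_2(f)^{q}(t)\le C_{15}.$$ Thus every finite $q$ is reached, by taking $\beta$ large. Here $C_{15}$ depends only on $(M,g_0)$ (in particular on its Ricci curvature),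 $n$, $L$, $C_N$, $a$, $b$, $r$, $\rho$, $E_0$, $t_1$, $t_2$, $\beta$, $q$ and $C(\beta)$. It does not depend on $\varepsilon$, $N$, $x_0$ or $(f,u)$. -/

import Mathlib

open Set MeasureTheory Manifold Bundle
open scoped ContDiff

noncomputable section

/-! ### Riemannian quantities in charts

`M` is an `n`-dimensional Riemannian manifold. A quantity written `Q x y` is computed in the
preferred chart at the point `x : M`, at the coordinate vector `y` of that chart. The invariant
quantity at `x` is the value at the coordinates `extChartAt (𝓡 n) x x` of `x` itself. -/

section Domain

variable {n L : ℕ} {M : Type*} [EMetricSpace M] [ChartedSpace (EuclideanSpace ℝ (Fin n)) M]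

/-- `i`-th partial derivative of a function of the coordinates. -/
def coordPartial {V : Type*} [NormedAddCommGroup V] [NormedSpace ℝ V] (i : Fin n)
    (h : EuclideanSpace ℝ (Fin n) → V) (y : EuclideanSpace ℝ (Fin n)) : V :=
  fderiv ℝ h y (EuclideanSpace.single i 1)

/-- The map `f` read in the chart at `x`. -/
def inChart {V : Type*} (f : M → V) (x : M) (y : EuclideanSpace ℝ (Fin n)) : V :=
  f ((extChartAt (𝓡 n) x).symm y)

variable [RiemannianBundle (fun x : M ↦ TangentSpace (𝓡 n) x)]

/-- The coordinate vector field `∂ᵢ` of the chart at `x`. -/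
def coordField (x : M) (y : EuclideanSpace ℝ (Fin n)) (i : Fin n) :
    TangentSpace (𝓡 n) ((extChartAt (𝓡 n) x).symm y) :=
  mfderiv (𝓡 n) (𝓡 n) (extChartAt (𝓡 n) x).symm y (EuclideanSpace.single i (1 : ℝ))

/-- The matrix `(g_{ij})` of the metric. -/
def metricMatrix (x : M) (y : EuclideanSpace ℝ (Fin n)) : Matrix (Fin n) (Fin n) ℝ :=
  Matrix.of fun i j ↦ inner ℝ (coordField x y i) (coordField x y j)

/-- The matrix `(g^{ij})` of the inverse metric. -/
def invMetric (x : M) (y : EuclideanSpace ℝ (Fin n)) : Matrix (Fin n) (Fin n) ℝ :=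
  (metricMatrix x y)⁻¹

/-- The volume density `√(det g)`. -/
def volDensity (x : M) (y : EuclideanSpace ℝ (Fin n)) : ℝ :=
  √ (metricMatrix x y).det

/-- The Riemannian volume on the domain of the chart at `x`, extended by zero. -/
def chartVolume [MeasurableSpace M] (x : M) : Measure M :=
  ((volume.restrict (extChartAt (𝓡 n) x).target).withDensity
    fun y ↦ ENNReal.ofReal (volDensity x y)).map (extChartAt (𝓡 n) x).symm

/-- The Riemannian volume measure: the least measure that dominates `chartVolume x` for all `x`.
The chart volumes agree on overlaps of chart domains, so this is the measure
which restricts to `√(det g) dy` on each chart domain. -/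
def riemannianVolume (n : ℕ) (M : Type*) [EMetricSpace M]
    [ChartedSpace (EuclideanSpace ℝ (Fin n)) M]
    [RiemannianBundle (fun x : M ↦ TangentSpace (𝓡 n) x)] [MeasurableSpace M] : Measure M :=
  ⨆ x : M, chartVolume (n := n) x

/-- Christoffel symbols `Γᵏᵢⱼ` of the Levi-Civita connection. -/
def christoffel (x : M) (k i j : Fin n) (y : EuclideanSpace ℝ (Fin n)) : ℝ :=
  (1 / 2) * ∑ l, invMetric x y k l *
    (coordPartial i (fun z ↦ metricMatrix x z j l) y
      + coordPartial j (fun z ↦ metricMatrix x z i l) y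
      - coordPartial l (fun z ↦ metricMatrix x z i j) y)

/-- Components `Rᵢⱼ` of the Ricci tensor. -/
def ricci (x : M) (i j : Fin n) (y : EuclideanSpace ℝ (Fin n)) : ℝ :=
  ∑ k, (coordPartial k (christoffel x k i j) y - coordPartial j (christoffel x k i k) y
    + ∑ l, (christoffel x k k l y * christoffel x l i j y
      - christoffel x k j l y * christoffel x l i k y))

/-- `|Ric(v, v)| ≤ K |v|²` for all tangent vectors `v` of `M`. -/
def RicciBoundedBy (n : ℕ) (M : Type*) [EMetricSpace M]
    [ChartedSpace (EuclideanSpace ℝ (Fin n)) M]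
    [RiemannianBundle (fun x : M ↦ TangentSpace (𝓡 n) x)] (K : ℝ) : Prop :=
  ∀ (x : M) (v : Fin n → ℝ),
    |∑ i, ∑ j, ricci x i j (extChartAt (𝓡 n) x x) * v i * v j| ≤
      K * ∑ i, ∑ j, metricMatrix x (extChartAt (𝓡 n) x x) i j * v i * v j

/-- `ε + |df|²`, with `|df|² = g^{ij} ⟨∂ᵢ f, ∂ⱼ f⟩`, in the chart at `x`. -/
def e2Chart (ε : ℝ) (f : M → EuclideanSpace ℝ (Fin L)) (x : M)
    (y : EuclideanSpace ℝ (Fin n)) : ℝ :=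
  ε + ∑ i, ∑ j, invMetric x y i j *
    inner ℝ (coordPartial i (inChart f x) y) (coordPartial j (inChart f x) y)

/-- `e₂(f) = ε + |df|²` as a function on `M`. -/
def e2 (n : ℕ) {L : ℕ} {M : Type*} [EMetricSpace M] [ChartedSpace (EuclideanSpace ℝ (Fin n)) M]
    [RiemannianBundle (fun x : M ↦ TangentSpace (𝓡 n) x)]
    (ε : ℝ) (f : M → EuclideanSpace ℝ (Fin L)) (x : M) : ℝ :=
  e2Chart (n := n) ε f x (extChartAt (𝓡 n) x x)

/-- The regularized `n`-Laplacian `Div ((ε + |df|²)^{n/2 - 1} df)`, that is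
`(√|g|)⁻¹ ∂ᵢ (√|g| (ε + |df|²)^{n/2 - 1} g^{ij} ∂ⱼ f)`. -/
def regNLaplacian (n : ℕ) {L : ℕ} {M : Type*} [EMetricSpace M]
    [ChartedSpace (EuclideanSpace ℝ (Fin n)) M]
    [RiemannianBundle (fun x : M ↦ TangentSpace (𝓡 n) x)]
    (ε : ℝ) (f : M → EuclideanSpace ℝ (Fin L)) (x : M) : EuclideanSpace ℝ (Fin L) :=
  (volDensity (n := n) x (extChartAt (𝓡 n) x x))⁻¹ •
    ∑ i : Fin n, coordPartial i (fun y ↦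
      (volDensity x y * e2Chart ε f x y ^ ((n : ℝ) / 2 - 1)) •
        ∑ j, invMetric x y i j • coordPartial j (inChart f x) y) (extChartAt (𝓡 n) x x)

/-- The regularized `n`-energy `(1/n) ∫_M (ε + |df|²)^{n/2}`. -/
def regNEnergy (n : ℕ) {L : ℕ} {M : Type*} [EMetricSpace M]
    [ChartedSpace (EuclideanSpace ℝ (Fin n)) M]
    [RiemannianBundle (fun x : M ↦ TangentSpace (𝓡 n) x)] [MeasurableSpace M]
    (ε : ℝ) (f : M → EuclideanSpace ℝ (Fin L)) : ℝ :=
  (1 / (n : ℝ)) * ∫ x, e2 n ε f x ^ ((n : ℝ) / 2) ∂(riemannianVolume n M)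

end Domain

/-! ### The target: a submanifold `N` of `ℝᴸ` with the induced metric -/

section Target

variable {L : ℕ}

/-- `N` is a smooth embedded submanifold of `ℝᴸ` (without boundary): near each of its points a
smooth diffeomorphism between open sets takes `N` to `ℝᵈ × {0}`. -/
def IsEmbeddedSubmanifold (N : Set (EuclideanSpace ℝ (Fin L))) : Prop :=
  ∃ d : ℕ, ∀ y ∈ N, ∃ Φ : OpenPartialHomeomorph (EuclideanSpace ℝ (Fin L))
      (EuclideanSpace ℝ (Fin L)),
    y ∈ Φ.source ∧ ContDiffOn ℝ ∞ Φ Φ.source ∧ ContDiffOn ℝ ∞ Φ.symm Φ.target ∧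
      ∀ z ∈ Φ.source, z ∈ N ↔ ∀ i : Fin L, d ≤ (i : ℕ) → Φ z i = 0

/-- The tangent space `T_y N` as a linear subspace of `ℝᴸ`. -/
def tangentSub (N : Set (EuclideanSpace ℝ (Fin L))) (y : EuclideanSpace ℝ (Fin L)) :
    Submodule ℝ (EuclideanSpace ℝ (Fin L)) :=
  Submodule.span ℝ (tangentConeAt ℝ N y)

/-- The orthogonal projection `P(y)` of `ℝᴸ` onto `T_y N`. -/
def tangentProj (N : Set (EuclideanSpace ℝ (Fin L))) (y : EuclideanSpace ℝ (Fin L)) :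
    EuclideanSpace ℝ (Fin L) →L[ℝ] EuclideanSpace ℝ (Fin L) :=
  (tangentSub N y).starProjection

/-- The second fundamental form `A(y) : T_y N × T_y N → (T_y N)^⊥`, with the sign for which the
tension field is `Δ f + A(f)(df, df)`. If `W` is a tangent field along a curve in `N` with velocity
`v`, then differentiating `P W = W` shows that the normal part of `W'` is `(D_v P) W`, so
`A(y)(v, w) = - (D_v P) w`. The derivative of `P` is taken along `N` only; its values at tangent
vectors `v` do not depend on any choice. -/
def secondFF (N : Set (EuclideanSpace ℝ (Fin L))) (y v w : EuclideanSpace ℝ (Fin L)) :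
    EuclideanSpace ℝ (Fin L) :=
  - (fderivWithin ℝ (tangentProj N) N y v) w

/-- `‖A‖ ≤ C` on `N`. -/
def SecondFFBoundedBy (N : Set (EuclideanSpace ℝ (Fin L))) (C : ℝ) : Prop :=
  ∀ y ∈ N, ∀ v ∈ tangentSub N y, ∀ w ∈ tangentSub N y, ‖secondFF N y v w‖ ≤ C * ‖v‖ * ‖w‖

end Target

/-! ### The flow -/

section Flow

variable {L : ℕ} {M : Type*} [EMetricSpace M]

/-- `A(f)(df, df) = g^{ij} A(f)(∂ᵢ f, ∂ⱼ f)`. -/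
def traceSecondFF (n : ℕ) [ChartedSpace (EuclideanSpace ℝ (Fin n)) M]
    [RiemannianBundle (fun x : M ↦ TangentSpace (𝓡 n) x)]
    (N : Set (EuclideanSpace ℝ (Fin L))) (f : M → EuclideanSpace ℝ (Fin L)) (x : M) :
    EuclideanSpace ℝ (Fin L) :=
  ∑ i : Fin n, ∑ j : Fin n, invMetric x (extChartAt (𝓡 n) x x) i j •
    secondFF N (f x) (coordPartial i (inChart f x) (extChartAt (𝓡 n) x x))
      (coordPartial j (inChart f x) (extChartAt (𝓡 n) x x))

/-- Time derivative on the interval `[0, T]` (one-sided at the end points). -/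
def timeDeriv {V : Type*} [NormedAddCommGroup V] [NormedSpace ℝ V] (T : ℝ) (h : ℝ → M → V)
    (t : ℝ) (x : M) : V :=
  derivWithin (fun s ↦ h s x) (Icc 0 T) t

/-- `(f, u)` is a smooth solution on `M × [0, T]`, with `f` taking values in `N` and `u(0) = 0`,
of the regularized `n`-conformal heat flow, written with respect to the fixed metric of `M`:
`f_t = e^{-nu} (Div ((ε + |df|²)^{n/2 - 1} df) + (ε + |df|²)^{n/2 - 1} A(f)(df, df))`,
`u_t = b e^{-nu} (ε + |df|²)^{n/2} - a`. -/
structure IsRegularizedCHF (n : ℕ) [ChartedSpace (EuclideanSpace ℝ (Fin n)) M]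
    [RiemannianBundle (fun x : M ↦ TangentSpace (𝓡 n) x)]
    (N : Set (EuclideanSpace ℝ (Fin L))) (ε a b T : ℝ)
    (f : ℝ → M → EuclideanSpace ℝ (Fin L)) (u : ℝ → M → ℝ) : Prop where
  smooth_f : ContMDiffOn (𝓘(ℝ, ℝ).prod (𝓡 n)) 𝓘(ℝ, EuclideanSpace ℝ (Fin L)) ∞
    (fun p : ℝ × M ↦ f p.1 p.2) (Icc 0 T ×ˢ univ)
  smooth_u : ContMDiffOn (𝓘(ℝ, ℝ).prod (𝓡 n)) 𝓘(ℝ, ℝ) ∞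
    (fun p : ℝ × M ↦ u p.1 p.2) (Icc 0 T ×ˢ univ)
  mem_target : ∀ t ∈ Icc 0 T, ∀ x, f t x ∈ N
  u_zero : ∀ x, u 0 x = 0
  eq_f : ∀ t ∈ Icc 0 T, ∀ x, timeDeriv T f t x =
    Real.exp (-(n * u t x)) • (regNLaplacian n ε (f t) x +
      (e2 n ε (f t) x ^ ((n : ℝ) / 2 - 1)) • traceSecondFF n N (f t) x)
  eq_u : ∀ t ∈ Icc 0 T, ∀ x, timeDeriv T u t x =
    b * Real.exp (-(n * u t x)) * e2 n ε (f t) x ^ ((n : ℝ) / 2) - a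

end Flow

end

/-! Write e = ε + |df|², κ = n/2 - 1, w = e^{nu}, ν = n/(n-2), j = n - 1 + β. At a fixed time the
flow is an elliptic system div(e^κ df) = R with R = w f_t - e^κ A(df,df), so that |R|² ≤ 2w²|f_t|² +
2C_N² e^n. Integrability of e follows from this system once w is integrable to a high power, and w
itself is driven by e through u_t. Three estimates are combined and closed by Grönwall's inequality.

Elliptic estimate. Put P = e^κ df and Q = φ^{2j} e^{κ+β} df with a cutoff φ. Two integrations by
parts give ∫ ∂_k Pⁱ ∂_i Qᵏ = ∫ div P · div Q. In an orthonormal frame the left integrand dominates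
φ^{2j} e^{j-1} |∇²f|², up to terms without second derivatives and products of one second derivative
with first order terms (`main_product_ge`, `second_order_pointwise`, `second_order_integral`). No
Bochner formula is needed: the geometry of M enters only through derivatives of the frame and of the
volume density, which are lower order. The Sobolev inequality for φ^j e^{j/2} then gives
(`exists_local_estimate`) (∫ φ^{2jν} e^{jν})^{1/ν} ≤ K ∫ φ^{2j} e^β |R|² + C ∫ φ^{2j-2} e^j. Here K
depends on n and β alone, because the charts are so small that the metric is almost constant; only C
sees M and the cutoff. This is why the smallness threshold is independent of M.

Velocity estimate. The aim is a bound for ∫ w|f_t|^n at times away from 0 (`exists_velocity_bound`).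
Differentiating the equation in time and testing with |f_t|^{2μ} f_t shows that W_μ = ∫
w|f_t|^{2μ+2} satisfies W_μ' ≤ C W_μ - c G_μ, where G_μ = ∫ e^κ|f_t|^{2μ}|df_t|² +
e^{n/2}|f_t|^{2μ+2} (`deriv_weightedEnergy_le`). The positivity of C_b pays for the curvature of N,
and coercivity needs κ ≤ 1 and μ ≤ 1, hence n ≤ 4. Testing the equation itself with |f_t|^{2μ+1} f_t
gives W_{μ+1/2} ≤ (1+μ) G_μ, a gain of one power of |f_t|. Starting from E' = -W_0, one such step
reaches |f_t|³ and two reach |f_t|⁴.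

Absorption. In the elliptic estimate e^β |R|² produces two terms. The velocity term e^β w²|f_t|² is
treated by Hölder against ∫ w|f_t|^n and by Young, leaving a small multiple of the left side and a
power of Y = ∫ φ^{2jν} w^{2j/(n-2)}. The critical term e^{j+1} is treated by Hölder with one factor
e in L^{n/2}. Once both are absorbed, X = ∫ φ^{2jν} e^{jν} satisfies X ≤ C'(1 + Y)
(`energy_le_of_absorb`). Since w_t = nb e^{n/2} - na w, Young gives Y' ≤ c(X + Y), and Grönwall
bounds Y and X (`exists_bound_of_critical`).

Two rounds. For β = 0 the critical term is absorbed by smallness of the local energy, which fixes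
the threshold independently of the desired exponent. This already puts e in L^{(n-1)ν}, above the
critical L^{n/2}, so for every β ≥ 0 interpolation on a smaller set absorbs the critical term
without any smallness (`critical_le_of_bound`). A single second round therefore reaches all finite
exponents (`exists_local_bound`), and a finite cover of M gives the ball estimate.

Degeneracy at ε = 0 is harmless: for κ ≥ 0 the map p ↦ (ε + |p|²)^κ p is C¹ even at p = 0
(`contDiff_powFlux`), so all fluxes are C¹ and no approximation in ε is needed. -/

noncomputable section

open Filter Topology

set_option linter.unusedSectionVars false

/-! ### Charts, transition maps and the metric in coordinates. -/

section Charts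

variable {n L : ℕ} {M : Type*} [EMetricSpace M] [ChartedSpace (EuclideanSpace ℝ (Fin n)) M]

/-- The domain of the coordinates of the chart at `c`. -/
abbrev chartTarget (n : ℕ) {M : Type*} [EMetricSpace M]
    [ChartedSpace (EuclideanSpace ℝ (Fin n)) M] (c : M) : Set (EuclideanSpace ℝ (Fin n)) :=
  (extChartAt (𝓡 n) c).target

/-- The domain of the chart at `c`. -/
abbrev chartSource (n : ℕ) {M : Type*} [EMetricSpace M]
    [ChartedSpace (EuclideanSpace ℝ (Fin n)) M] (c : M) : Set M :=
  (extChartAt (𝓡 n) c).source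

/-- The coordinates of `x` in the chart at `c`. -/
abbrev coords (n : ℕ) {M : Type*} [EMetricSpace M]
    [ChartedSpace (EuclideanSpace ℝ (Fin n)) M] (c x : M) : EuclideanSpace ℝ (Fin n) :=
  extChartAt (𝓡 n) c x

/-- The transition map from the chart at `c` to the chart at `c'`. -/
def transition (n : ℕ) {M : Type*} [EMetricSpace M]
    [ChartedSpace (EuclideanSpace ℝ (Fin n)) M] (c c' : M)
    (y : EuclideanSpace ℝ (Fin n)) : EuclideanSpace ℝ (Fin n) :=
  extChartAt (𝓡 n) c' ((extChartAt (𝓡 n) c).symm y)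

/-- The coordinates in the chart at `c` of the overlap with the chart at `c'`. -/
def overlap (n : ℕ) {M : Type*} [EMetricSpace M]
    [ChartedSpace (EuclideanSpace ℝ (Fin n)) M] (c c' : M) : Set (EuclideanSpace ℝ (Fin n)) :=
  chartTarget n c ∩ (extChartAt (𝓡 n) c).symm ⁻¹' chartSource n c'

lemma isOpen_chartTarget (c : M) : IsOpen (chartTarget n c) := isOpen_extChartAt_target c

lemma isOpen_chartSource (c : M) : IsOpen (chartSource n c) := isOpen_extChartAt_source c

lemma isOpen_overlap (c c' : M) : IsOpen (overlap n c c') :=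
  (continuousOn_extChartAt_symm c).isOpen_inter_preimage (isOpen_chartTarget c)
    (isOpen_chartSource c')

lemma symm_transition {c c' : M} {y : EuclideanSpace ℝ (Fin n)} (h : y ∈ overlap n c c') :
    (extChartAt (𝓡 n) c').symm (transition n c c' y) = (extChartAt (𝓡 n) c).symm y :=
  (extChartAt (𝓡 n) c').left_inv h.2

lemma transition_mem {c c' : M} {y : EuclideanSpace ℝ (Fin n)} (h : y ∈ overlap n c c') :
    transition n c c' y ∈ overlap n c' c := by
  refine ⟨(extChartAt (𝓡 n) c').map_source h.2, ?_⟩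
  simp only [mem_preimage, symm_transition h]
  exact (extChartAt (𝓡 n) c).map_target h.1

lemma transition_transition {c c' : M} {y : EuclideanSpace ℝ (Fin n)} (h : y ∈ overlap n c c') :
    transition n c' c (transition n c c' y) = y := by
  rw [transition, symm_transition h]
  exact (extChartAt (𝓡 n) c).right_inv h.1

variable [IsManifold (𝓡 n) ∞ M]

lemma contDiffOn_transition (c c' : M) :
    ContDiffOn ℝ ∞ (transition n c c') (overlap n c c') := by
  rw [← contMDiffOn_iff_contDiffOn]
  exact (contMDiffOn_extChartAt (n := ∞) (x := c')).comp
    ((contMDiffOn_extChartAt_symm (n := ∞) c).mono inter_subset_left)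
    (fun y hy ↦ by simpa only [mem_preimage, chartSource, extChartAt_source] using hy.2)

lemma mdifferentiableAt_chart_symm {c : M} {y : EuclideanSpace ℝ (Fin n)}
    (hy : y ∈ chartTarget n c) :
    MDifferentiableAt (𝓡 n) (𝓡 n) (extChartAt (𝓡 n) c).symm y :=
  ((contMDiffOn_extChartAt_symm (n := ∞) c).contMDiffAt
    ((isOpen_chartTarget c).mem_nhds hy)).mdifferentiableAt (by simp)

variable [RiemannianBundle (fun x : M ↦ TangentSpace (𝓡 n) x)]

lemma inChart_eventuallyEq {V : Type*} (α : M → V) {c c' : M} {y : EuclideanSpace ℝ (Fin n)}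
    (h : y ∈ overlap n c c') : inChart (n := n) α c =ᶠ[𝓝 y] inChart α c' ∘ transition n c c' := by
  filter_upwards [(isOpen_overlap c c').mem_nhds h] with z hz
  simp only [inChart, Function.comp, symm_transition hz]

/-- The Jacobian matrix of the transition map. -/
def jacobian (c c' : M) (y : EuclideanSpace ℝ (Fin n)) : Matrix (Fin n) (Fin n) ℝ :=
  Matrix.of fun k i ↦ fderiv ℝ (transition n c c') y (EuclideanSpace.single i 1) k

lemma fderiv_transition_single (c c' : M) (y : EuclideanSpace ℝ (Fin n)) (i : Fin n) :
    fderiv ℝ (transition n c c') y (EuclideanSpace.single i 1) =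
      ∑ k, jacobian c c' y k i • EuclideanSpace.single k (1 : ℝ) := by
  ext l
  simp [jacobian, Finset.sum_apply, Pi.single_apply]

lemma differentiableAt_transition {c c' : M} {y : EuclideanSpace ℝ (Fin n)}
    (h : y ∈ overlap n c c') : DifferentiableAt ℝ (transition n c c') y :=
  ((contDiffOn_transition c c').contDiffAt ((isOpen_overlap c c').mem_nhds h)).differentiableAt
    (by simp)

lemma coordPartial_inChart {V : Type*} [NormedAddCommGroup V] [NormedSpace ℝ V] {α : M → V}
    {c c' : M} {y : EuclideanSpace ℝ (Fin n)} (h : y ∈ overlap n c c')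
    (hα : DifferentiableAt ℝ (inChart α c') (transition n c c' y)) (i : Fin n) :
    coordPartial i (inChart α c) y =
      ∑ k, jacobian c c' y k i • coordPartial k (inChart α c') (transition n c c' y) := by
  rw [coordPartial, (inChart_eventuallyEq α h).fderiv_eq,
    fderiv_comp y hα (differentiableAt_transition h), ContinuousLinearMap.comp_apply,
    fderiv_transition_single, map_sum]
  simp [coordPartial]

/-- The derivative of the inverse chart as a map of the model space. -/
def chartDeriv (c : M) (y : EuclideanSpace ℝ (Fin n)) :
    EuclideanSpace ℝ (Fin n) →L[ℝ] EuclideanSpace ℝ (Fin n) :=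
  mfderiv (𝓡 n) (𝓡 n) (extChartAt (𝓡 n) c).symm y

lemma chartDeriv_transition {c c' : M} {y : EuclideanSpace ℝ (Fin n)} (h : y ∈ overlap n c c') :
    chartDeriv c y = (chartDeriv c' (transition n c c' y)).comp
      (fderiv ℝ (transition n c c') y) := by
  have h1 : (extChartAt (𝓡 n) c).symm =ᶠ[𝓝 y]
      (extChartAt (𝓡 n) c').symm ∘ transition n c c' := by
    filter_upwards [(isOpen_overlap c c').mem_nhds h] with z hz
    simp only [Function.comp, symm_transition hz]
  have h2 := mfderiv_comp (I := 𝓡 n) (I' := 𝓡 n) (I'' := 𝓡 n) y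
    (mdifferentiableAt_chart_symm (transition_mem h).1)
    (differentiableAt_transition h).mdifferentiableAt
  rw [mfderiv_eq_fderiv] at h2
  exact h1.mfderiv_eq.trans h2

lemma chartDeriv_injective {c : M} {y : EuclideanSpace ℝ (Fin n)} (hy : y ∈ chartTarget n c) :
    Function.Injective (chartDeriv c y) := by
  have := isInvertible_mfderivWithin_extChartAt_symm (I := 𝓡 n) hy
  rw [show range (𝓡 n) = univ from ModelWithCorners.range_eq_univ _,
    mfderivWithin_univ] at this
  exact this.injective

/-- The metric as a function of a base point and two vectors of the model space. -/
def metricAt (x : M) (v w : EuclideanSpace ℝ (Fin n)) : ℝ :=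
  inner ℝ (show TangentSpace (𝓡 n) x from v) (show TangentSpace (𝓡 n) x from w)

/-- Bilinearity of the metric, phrased for vectors of the model space. The tangent space agrees with
the model space only by unfolding, so the inner product lemmas are transported by `refine` rather
than by rewriting. -/
lemma metricAt_sum_sum {ι : Type*} (s : Finset ι) (x : M) (a b : ι → ℝ)
    (v w : ι → EuclideanSpace ℝ (Fin n)) :
    metricAt x (∑ k ∈ s, a k • v k) (∑ l ∈ s, b l • w l) =
      ∑ k ∈ s, ∑ l ∈ s, a k * b l * metricAt x (v k) (w l) := by
  have := sum_inner (𝕜 := ℝ) s (fun k ↦ (show TangentSpace (𝓡 n) x from a k • v k))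
    (show TangentSpace (𝓡 n) x from ∑ l ∈ s, b l • w l)
  refine this.trans (Finset.sum_congr rfl fun k _ ↦ ?_)
  have := inner_sum (𝕜 := ℝ) s (fun k ↦ (show TangentSpace (𝓡 n) x from b k • w k))
    (show TangentSpace (𝓡 n) x from a k • v k)
  refine this.trans (Finset.sum_congr rfl fun l _ ↦ ?_)
  have h1 := real_inner_smul_left (show TangentSpace (𝓡 n) x from v k)
    (show TangentSpace (𝓡 n) x from b l • w l) (a k)
  have h2 := real_inner_smul_right (show TangentSpace (𝓡 n) x from v k)
    (show TangentSpace (𝓡 n) x from w l) (b l)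
  refine h1.trans ?_
  rw [mul_assoc]
  exact congrArg _ h2

lemma metricAt_self_pos {x : M} {v : EuclideanSpace ℝ (Fin n)} (hv : v ≠ 0) :
    0 < metricAt x v v :=
  real_inner_self_pos (x := (show TangentSpace (𝓡 n) x from v)) |>.2 hv

/-- The coordinate vector field `∂ᵢ` with values in the model space. -/
def coordFieldE (c : M) (y : EuclideanSpace ℝ (Fin n)) (i : Fin n) : EuclideanSpace ℝ (Fin n) :=
  chartDeriv c y (EuclideanSpace.single i (1 : ℝ))

lemma metricMatrix_eq_metricAt (c : M) (y : EuclideanSpace ℝ (Fin n)) (i j : Fin n) :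
    metricMatrix c y i j =
      metricAt ((extChartAt (𝓡 n) c).symm y) (coordFieldE c y i) (coordFieldE c y j) := rfl

lemma metricMatrix_transition {c c' : M} {y : EuclideanSpace ℝ (Fin n)}
    (h : y ∈ overlap n c c') :
    metricMatrix c y = (jacobian c c' y).transpose *
      metricMatrix c' (transition n c c' y) * jacobian c c' y := by
  have key : ∀ i, coordFieldE c y i =
      ∑ k, jacobian c c' y k i • coordFieldE c' (transition n c c' y) k := by
    intro i
    rw [coordFieldE, chartDeriv_transition h, ContinuousLinearMap.comp_apply,
      fderiv_transition_single, map_sum]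
    simp only [map_smul, coordFieldE]
  ext i j
  rw [metricMatrix_eq_metricAt, key i, key j, metricAt_sum_sum]
  simp only [Matrix.mul_apply, Matrix.transpose_apply, metricMatrix_eq_metricAt,
    symm_transition h, Finset.sum_mul]
  rw [Finset.sum_comm]
  refine Finset.sum_congr rfl fun k _ ↦ Finset.sum_congr rfl fun l _ ↦ ?_
  ring

lemma posDef_metricMatrix {c : M} {y : EuclideanSpace ℝ (Fin n)} (hy : y ∈ chartTarget n c) :
    (metricMatrix c y).PosDef := by
  refine Matrix.PosDef.of_dotProduct_mulVec_pos ?_ ?_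
  · ext i j
    exact real_inner_comm (coordField c y i) (coordField c y j)
  · intro v hv
    have h1 : star v ⬝ᵥ (metricMatrix c y).mulVec v =
        metricAt ((extChartAt (𝓡 n) c).symm y) (∑ k, v k • coordFieldE c y k)
          (∑ k, v k • coordFieldE c y k) := by
      rw [metricAt_sum_sum]
      simp only [dotProduct, Matrix.mulVec, metricMatrix_eq_metricAt, Finset.mul_sum]
      refine Finset.sum_congr rfl fun k _ ↦ Finset.sum_congr rfl fun l _ ↦ ?_
      simp; ring
    rw [h1]
    refine metricAt_self_pos fun h0 ↦ hv ?_
    have h2 : chartDeriv c y (WithLp.toLp 2 v) = 0 := by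
      rw [← h0]
      have : (WithLp.toLp 2 v : EuclideanSpace ℝ (Fin n)) =
          ∑ k, v k • EuclideanSpace.single k (1 : ℝ) := by
        ext l; simp [Finset.sum_apply, Pi.single_apply]
      rw [this, map_sum]
      simp only [map_smul, coordFieldE]
    have h3 := chartDeriv_injective hy (h2.trans (map_zero _).symm)
    exact congrArg WithLp.ofLp h3

variable [IsContMDiffRiemannianBundle (𝓡 n) ∞ (EuclideanSpace ℝ (Fin n))
          (fun x : M ↦ TangentSpace (𝓡 n) x)]

/-- The coordinate fields are smooth sections, being the tangent map of the smooth inverse chart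
applied to constant sections; the smooth bundle metric then pairs them to smooth functions. -/
lemma contDiffOn_metricMatrix (c : M) (i j : Fin n) :
    ContDiffOn ℝ ∞ (fun y ↦ metricMatrix c y i j) (chartTarget n c) := by
  have hfield : ∀ i : Fin n, ContMDiffOn 𝓘(ℝ, EuclideanSpace ℝ (Fin n)) (𝓡 n).tangent ∞
      (fun y ↦ (⟨(extChartAt (𝓡 n) c).symm y, coordField c y i⟩ : TangentBundle (𝓡 n) M))
      (chartTarget n c) := by
    intro i
    have h1 := (contMDiffOn_extChartAt_symm (n := ∞) (I := 𝓡 n) c).contMDiffOn_tangentMapWithin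
      (m := ∞) (by simp) (isOpen_chartTarget c).uniqueMDiffOn
    have h2 : ContMDiff 𝓘(ℝ, EuclideanSpace ℝ (Fin n)) 𝓘(ℝ, EuclideanSpace ℝ (Fin n)).tangent ∞
        (fun y : EuclideanSpace ℝ (Fin n) ↦
          (⟨y, EuclideanSpace.single i (1 : ℝ)⟩ :
            TangentBundle 𝓘(ℝ, EuclideanSpace ℝ (Fin n)) (EuclideanSpace ℝ (Fin n)))) := by
      exact contMDiff_vectorSpace_iff_contDiff.2 contDiff_const
    refine (h1.comp h2.contMDiffOn (fun y hy ↦ hy)).congr fun y hy ↦ ?_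
    simp only [Function.comp, tangentMapWithin, coordField]
    rw [mfderivWithin_of_isOpen (isOpen_chartTarget c) hy]
  rw [← contMDiffOn_iff_contDiffOn]
  exact (hfield i).inner_bundle (hfield j)

end Charts

/-! ### Orthonormal frames and the pairing of differentials. -/

section Frames

variable {n L : ℕ} {M : Type*} [EMetricSpace M] [ChartedSpace (EuclideanSpace ℝ (Fin n)) M]
  [RiemannianBundle (fun x : M ↦ TangentSpace (𝓡 n) x)]

/-- The pairing `g^{ij} ⟨∂ᵢ α, ∂ⱼ β⟩` of the differentials of two functions of the coordinates. -/
def gradPair {V : Type*} [NormedAddCommGroup V] [InnerProductSpace ℝ V] (c : M)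
    (α β : EuclideanSpace ℝ (Fin n) → V) (y : EuclideanSpace ℝ (Fin n)) : ℝ :=
  ∑ i, ∑ j, invMetric c y i j * inner ℝ (coordPartial i α y) (coordPartial j β y)

/-- The pairing `⟨dα, dβ⟩` of the differentials of two maps on `M`. -/
def dPair (n : ℕ) {V M : Type*} [EMetricSpace M] [ChartedSpace (EuclideanSpace ℝ (Fin n)) M]
    [RiemannianBundle (fun x : M ↦ TangentSpace (𝓡 n) x)]
    [NormedAddCommGroup V] [InnerProductSpace ℝ V] (α β : M → V) (x : M) : ℝ :=
  gradPair (n := n) x (inChart α x) (inChart β x) (coords n x x)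

lemma e2_eq (ε : ℝ) (f : M → EuclideanSpace ℝ (Fin L)) (x : M) :
    e2 n ε f x = ε + dPair n f f x := rfl

lemma e2Chart_eq (ε : ℝ) (f : M → EuclideanSpace ℝ (Fin L)) (c : M)
    (y : EuclideanSpace ℝ (Fin n)) :
    e2Chart ε f c y = ε + gradPair c (inChart f c) (inChart f c) y := rfl

/-- The derivative of `h` in the direction of the `a`-th vector of the frame `S`. -/
def frameDeriv {V : Type*} [NormedAddCommGroup V] [NormedSpace ℝ V]
    (S : EuclideanSpace ℝ (Fin n) → Matrix (Fin n) (Fin n) ℝ) (a : Fin n)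
    (h : EuclideanSpace ℝ (Fin n) → V) (y : EuclideanSpace ℝ (Fin n)) : V :=
  ∑ i, S y a i • coordPartial i h y

/-- `S` is an orthonormal frame at the point with coordinates `y` in the chart at `c`. -/
def IsOrthoFrame (c : M) (S : Matrix (Fin n) (Fin n) ℝ) (y : EuclideanSpace ℝ (Fin n)) : Prop :=
  S * metricMatrix c y * S.transpose = 1

lemma IsOrthoFrame.invMetric_eq {c : M} {S : Matrix (Fin n) (Fin n) ℝ}
    {y : EuclideanSpace ℝ (Fin n)} (h : IsOrthoFrame c S y) :
    invMetric c y = S.transpose * S := by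
  refine Matrix.inv_eq_right_inv ?_
  have h1 : S * (metricMatrix c y * S.transpose) = 1 := by rw [← Matrix.mul_assoc]; exact h
  rw [← Matrix.mul_assoc]
  exact mul_eq_one_comm.1 h1

lemma IsOrthoFrame.det_mul {c : M} {S : Matrix (Fin n) (Fin n) ℝ}
    {y : EuclideanSpace ℝ (Fin n)} (h : IsOrthoFrame c S y) :
    S.det ^ 2 * (metricMatrix c y).det = 1 := by
  have := congrArg Matrix.det h
  rw [Matrix.det_mul, Matrix.det_mul, Matrix.det_transpose, Matrix.det_one] at this
  linarith

lemma IsOrthoFrame.volDensity_eq {c : M} {S : Matrix (Fin n) (Fin n) ℝ}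
    {y : EuclideanSpace ℝ (Fin n)} (h : IsOrthoFrame c S y) :
    volDensity c y = |S.det|⁻¹ := by
  have h1 := h.det_mul
  have h2 : (metricMatrix c y).det = (|S.det|⁻¹) ^ 2 := by
    rw [inv_pow, sq_abs]
    exact eq_inv_of_mul_eq_one_right h1
  rw [volDensity, h2, Real.sqrt_sq (by positivity)]

lemma sum_transpose_mul_self {V : Type*} [NormedAddCommGroup V] [InnerProductSpace ℝ V]
    (S : Matrix (Fin n) (Fin n) ℝ) (p q : Fin n → V) :
    ∑ i, ∑ j, (S.transpose * S) i j * inner ℝ (p i) (q j) =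
      ∑ a, inner ℝ (∑ i, S a i • p i) (∑ j, S a j • q j) := by
  simp only [Matrix.mul_apply, Matrix.transpose_apply, sum_inner, inner_sum, real_inner_smul_left,
    real_inner_smul_right, Finset.sum_mul]
  calc _ = ∑ i, ∑ a, ∑ j, S a i * S a j * inner ℝ (p i) (q j) :=
        Finset.sum_congr rfl fun i _ ↦ Finset.sum_comm
    _ = _ := by
        rw [Finset.sum_comm]
        refine Finset.sum_congr rfl fun a _ ↦ ?_
        rw [Finset.sum_comm]
        refine Finset.sum_congr rfl fun i _ ↦ Finset.sum_congr rfl fun j _ ↦ by ring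

lemma gradPair_eq_frame {V : Type*} [NormedAddCommGroup V] [InnerProductSpace ℝ V] {c : M}
    {S : EuclideanSpace ℝ (Fin n) → Matrix (Fin n) (Fin n) ℝ}
    {y : EuclideanSpace ℝ (Fin n)} (h : IsOrthoFrame c (S y) y)
    (α β : EuclideanSpace ℝ (Fin n) → V) :
    gradPair c α β y = ∑ a, inner ℝ (frameDeriv S a α y) (frameDeriv S a β y) := by
  rw [gradPair, h.invMetric_eq, sum_transpose_mul_self]
  rfl

/-- Gram-Schmidt orthonormalization of the standard basis for a metric depending on `y`. -/
lemma exists_orthoFrame_of_posDef {U : Set (EuclideanSpace ℝ (Fin n))}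
    {G : EuclideanSpace ℝ (Fin n) → Matrix (Fin n) (Fin n) ℝ}
    (hG : ∀ i j, ContDiffOn ℝ ∞ (fun y ↦ G y i j) U) (hpos : ∀ y ∈ U, (G y).PosDef) :
    ∃ S : EuclideanSpace ℝ (Fin n) → Matrix (Fin n) (Fin n) ℝ,
      (∀ a i, ContDiffOn ℝ ∞ (fun y ↦ S y a i) U) ∧
      ∀ y ∈ U, S y * G y * (S y).transpose = 1 := by
  -- Induction on the number of vectors already orthonormalized. The middle clause, that the first k
  -- vectors involve only the first k coordinates, is what keeps the next residual vector nonzero.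
  have key : ∀ k ≤ n, ∃ s : ℕ → EuclideanSpace ℝ (Fin n) → Fin n → ℝ,
      (∀ a < k, ∀ i, ContDiffOn ℝ ∞ (fun y ↦ s a y i) U) ∧
      (∀ a < k, ∀ y ∈ U, ∀ i : Fin n, k ≤ i → s a y i = 0) ∧
      ∀ a < k, ∀ b < k, ∀ y ∈ U, s a y ⬝ᵥ (G y).mulVec (s b y) = if a = b then 1 else 0 := by
    intro k
    induction k with
    | zero => exact fun _ ↦ ⟨fun _ _ _ ↦ 0, by simp⟩
    | succ k ih =>
      intro hk
      obtain ⟨s, hs, hs0, hso⟩ := ih (by omega)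
      let ek : Fin n → ℝ := Pi.single ⟨k, by omega⟩ 1
      let w : EuclideanSpace ℝ (Fin n) → Fin n → ℝ := fun y ↦
        ek - ∑ a ∈ Finset.range k, (s a y ⬝ᵥ (G y).mulVec ek) • s a y
      have hsym : ∀ y ∈ U, ∀ u v : Fin n → ℝ, u ⬝ᵥ (G y).mulVec v = v ⬝ᵥ (G y).mulVec u := by
        intro y hy u v
        have h1 : (G y).transpose = G y := by
          have := (hpos y hy).1
          rwa [Matrix.IsHermitian, Matrix.conjTranspose_eq_transpose_of_trivial] at this
        rw [Matrix.dotProduct_mulVec, ← Matrix.mulVec_transpose, h1, dotProduct_comm]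
      have hw : ∀ i, ContDiffOn ℝ ∞ (fun y ↦ w y i) U := by
        intro i
        have : (fun y ↦ w y i) = fun y ↦ ek i - ∑ a ∈ Finset.range k,
            (∑ l, s a y l * ∑ m, G y l m * ek m) * s a y i := by
          ext y; simp [w, dotProduct, Matrix.mulVec]
        rw [this]
        refine contDiffOn_const.sub (ContDiffOn.sum fun a ha ↦ ?_)
        have ha' := Finset.mem_range.1 ha
        exact (ContDiffOn.sum fun l _ ↦ (hs a ha' l).mul
          (ContDiffOn.sum fun m _ ↦ (hG l m).mul contDiffOn_const)).mul (hs a ha' i)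
      -- All earlier vectors have k-th coordinate 0, so the k-th coordinate of `w y` is still 1.
      have hwk : ∀ y ∈ U, w y ≠ 0 := by
        intro y hy h0
        have h1 := congrFun h0 ⟨k, by omega⟩
        simp only [w, Pi.sub_apply, Finset.sum_apply, Pi.smul_apply, Pi.zero_apply, ek,
          Pi.single_eq_same, smul_eq_mul] at h1
        rw [Finset.sum_eq_zero] at h1
        · norm_num at h1
        · intro a ha
          rw [hs0 a (Finset.mem_range.1 ha) y hy ⟨k, by omega⟩ le_rfl, mul_zero]
      have hwpos : ∀ y ∈ U, 0 < w y ⬝ᵥ (G y).mulVec (w y) := fun y hy ↦ by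
        simpa using (hpos y hy).dotProduct_mulVec_pos (hwk y hy)
      have hwo : ∀ a < k, ∀ y ∈ U, s a y ⬝ᵥ (G y).mulVec (w y) = 0 := by
        intro a ha y hy
        simp only [w, Matrix.mulVec_sub, dotProduct_sub, Matrix.mulVec_sum, Matrix.mulVec_smul,
          dotProduct_sum, dotProduct_smul, smul_eq_mul]
        rw [Finset.sum_congr rfl fun b hb ↦ by rw [hso a ha b (Finset.mem_range.1 hb) y hy]]
        simp [ha]
      let N : EuclideanSpace ℝ (Fin n) → ℝ := fun y ↦ w y ⬝ᵥ (G y).mulVec (w y)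
      have hN : ContDiffOn ℝ ∞ N U := by
        have : N = fun y ↦ ∑ l, w y l * ∑ m, G y l m * w y m := by
          ext y; simp [N, dotProduct, Matrix.mulVec]
        rw [this]
        exact ContDiffOn.sum fun l _ ↦ (hw l).mul
          (ContDiffOn.sum fun m _ ↦ (hG l m).mul (hw m))
      refine ⟨fun a y ↦ if a = k then (√ (N y))⁻¹ • w y else s a y, ?_, ?_, ?_⟩
      · intro a ha i
        by_cases hak : a = k
        · simp only [hak, if_true, Pi.smul_apply, smul_eq_mul]
          exact ((hN.sqrt fun y hy ↦ (hwpos y hy).ne').inv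
            fun y hy ↦ (Real.sqrt_pos.2 (hwpos y hy)).ne').mul (hw i)
        · simp only [hak, if_false]
          exact hs a (by omega) i
      · intro a ha y hy i hi
        by_cases hak : a = k
        · simp only [hak, if_true, Pi.smul_apply, smul_eq_mul, w, Pi.sub_apply, Finset.sum_apply,
            ek]
          rw [Finset.sum_eq_zero fun b hb ↦ by
            rw [hs0 b (Finset.mem_range.1 hb) y hy i (by omega), mul_zero]]
          rw [Pi.single_eq_of_ne (by rintro rfl; simp at hi)]
          simp
        · simp only [hak, if_false]
          exact hs0 a (by omega) y hy i (by omega)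
      · intro a ha b hb y hy
        by_cases hak : a = k <;> by_cases hbk : b = k
        · simp only [hak, hbk, if_true, Matrix.mulVec_smul, dotProduct_smul, smul_dotProduct,
            smul_eq_mul]
          have := hwpos y hy
          rw [show w y ⬝ᵥ (G y).mulVec (w y) = √ (N y) * √ (N y) from
            (Real.mul_self_sqrt this.le).symm]
          have : √ (N y) ≠ 0 := (Real.sqrt_pos.2 this).ne'
          field_simp
        · simp only [hak, hbk, if_true, if_false, smul_dotProduct, smul_eq_mul]
          rw [hsym y hy, hwo b (by omega) y hy, if_neg (fun h ↦ hbk h.symm), mul_zero]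
        · simp only [hak, hbk, if_true, if_false, Matrix.mulVec_smul, dotProduct_smul, smul_eq_mul]
          rw [hwo a (by omega) y hy, mul_zero]
        · simp only [hak, hbk, if_false]
          exact hso a (by omega) b (by omega) y hy
  obtain ⟨s, hs, -, hso⟩ := key n le_rfl
  refine ⟨fun y ↦ Matrix.of fun a i ↦ s a y i, fun a i ↦ hs a a.2 i, fun y hy ↦ ?_⟩
  ext a b
  have := hso a a.2 b b.2 y hy
  simp only [Matrix.mul_apply, Matrix.of_apply, Matrix.transpose_apply, Matrix.one_apply]
  simp only [dotProduct, Matrix.mulVec, Finset.mul_sum, Fin.val_inj] at this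
  rw [← this, Finset.sum_comm]
  simp only [Finset.sum_mul]
  refine Finset.sum_congr rfl fun k _ ↦ Finset.sum_congr rfl fun l _ ↦ by ring

variable [IsManifold (𝓡 n) ∞ M]

lemma volDensity_transition {c c' : M} {y : EuclideanSpace ℝ (Fin n)} (h : y ∈ overlap n c c') :
    volDensity c y = |(jacobian c c' y).det| * volDensity c' (transition n c c' y) := by
  rw [volDensity, metricMatrix_transition h, Matrix.det_mul, Matrix.det_mul,
    Matrix.det_transpose, mul_comm, ← mul_assoc, ← sq, Real.sqrt_mul (sq_nonneg _),
    Real.sqrt_sq_eq_abs]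
  rfl

lemma exists_orthoFrame_at {c : M} {y : EuclideanSpace ℝ (Fin n)} (hy : y ∈ chartTarget n c) :
    ∃ S : Matrix (Fin n) (Fin n) ℝ, IsOrthoFrame c S y := by
  obtain ⟨S, -, hS⟩ := exists_orthoFrame_of_posDef (U := {y}) (G := fun _ ↦ metricMatrix c y)
    (fun i j ↦ contDiffOn_const) (fun z _ ↦ posDef_metricMatrix hy)
  exact ⟨S y, hS y rfl⟩

lemma frameDeriv_transition {V : Type*} [NormedAddCommGroup V] [NormedSpace ℝ V] {α : M → V}
    {c c' : M} {y : EuclideanSpace ℝ (Fin n)} (h : y ∈ overlap n c c')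
    (hα : DifferentiableAt ℝ (inChart α c') (transition n c c' y))
    (S : Matrix (Fin n) (Fin n) ℝ) (a : Fin n) :
    frameDeriv (fun _ ↦ S) a (inChart α c) y =
      frameDeriv (fun _ ↦ S * (jacobian c c' y).transpose) a (inChart α c')
        (transition n c c' y) := by
  simp only [frameDeriv, coordPartial_inChart h hα, Matrix.mul_apply, Matrix.transpose_apply,
    Finset.smul_sum, Finset.sum_smul, smul_smul]
  exact Finset.sum_comm

lemma IsOrthoFrame.transition {c c' : M} {S : Matrix (Fin n) (Fin n) ℝ}
    {y : EuclideanSpace ℝ (Fin n)} (hS : IsOrthoFrame c S y) (h : y ∈ overlap n c c') :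
    IsOrthoFrame c' (S * (jacobian c c' y).transpose) (transition n c c' y) := by
  rw [IsOrthoFrame, metricMatrix_transition h] at hS
  rw [IsOrthoFrame, Matrix.transpose_mul, Matrix.transpose_transpose, ← hS]
  simp only [Matrix.mul_assoc]

/-- Both sides are sums over an orthonormal frame, and the Jacobian carries a frame that is
orthonormal in one chart to one that is orthonormal in the other. This avoids transforming the
inverse metric. -/
lemma gradPair_transition {V : Type*} [NormedAddCommGroup V] [InnerProductSpace ℝ V]
    {α β : M → V} {c c' : M} {y : EuclideanSpace ℝ (Fin n)} (h : y ∈ overlap n c c')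
    (hα : DifferentiableAt ℝ (inChart α c') (transition n c c' y))
    (hβ : DifferentiableAt ℝ (inChart β c') (transition n c c' y)) :
    gradPair c (inChart α c) (inChart β c) y =
      gradPair c' (inChart α c') (inChart β c') (transition n c c' y) := by
  obtain ⟨S, hS⟩ := exists_orthoFrame_at h.1
  rw [gradPair_eq_frame (S := fun _ ↦ S) hS, gradPair_eq_frame
    (S := fun _ ↦ S * (jacobian c c' y).transpose) (hS.transition h)]
  simp only [frameDeriv_transition h hα, frameDeriv_transition h hβ]

lemma volDensity_pos {c : M} {y : EuclideanSpace ℝ (Fin n)} (hy : y ∈ chartTarget n c) :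
    0 < volDensity c y := Real.sqrt_pos.2 (posDef_metricMatrix hy).det_pos

variable [IsContMDiffRiemannianBundle (𝓡 n) ∞ (EuclideanSpace ℝ (Fin n))
          (fun x : M ↦ TangentSpace (𝓡 n) x)]

lemma exists_orthoFrame (c : M) :
    ∃ S : EuclideanSpace ℝ (Fin n) → Matrix (Fin n) (Fin n) ℝ,
      (∀ a i, ContDiffOn ℝ ∞ (fun y ↦ S y a i) (chartTarget n c)) ∧
      ∀ y ∈ chartTarget n c, IsOrthoFrame c (S y) y :=
  exists_orthoFrame_of_posDef (contDiffOn_metricMatrix c) fun _ hy ↦ posDef_metricMatrix hy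

lemma contDiffOn_det_metricMatrix (c : M) :
    ContDiffOn ℝ ∞ (fun y ↦ (metricMatrix c y).det) (chartTarget n c) := by
  simp only [Matrix.det_apply]
  refine ContDiffOn.sum fun σ _ ↦ ContDiffOn.const_smul _ ?_
  exact contDiffOn_prod fun i _ ↦ contDiffOn_metricMatrix c _ _

lemma contDiffOn_volDensity (c : M) :
    ContDiffOn ℝ ∞ (volDensity c) (chartTarget n c) :=
  (contDiffOn_det_metricMatrix c).sqrt fun _ hy ↦ (posDef_metricMatrix hy).det_pos.ne'

/-- For a smooth orthonormal frame S the inverse metric is SᵀS, so smoothness needs no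
differentiation of a matrix inverse. -/
lemma contDiffOn_invMetric (c : M) (i j : Fin n) :
    ContDiffOn ℝ ∞ (fun y ↦ invMetric c y i j) (chartTarget n c) := by
  obtain ⟨S, hS, hSo⟩ := exists_orthoFrame (n := n) c
  have : ∀ y ∈ chartTarget n c, invMetric c y i j = ∑ a, S y a i * S y a j := fun y hy ↦ by
    rw [(hSo y hy).invMetric_eq]; simp [Matrix.mul_apply]
  exact (ContDiffOn.sum fun a _ ↦ (hS a i).mul (hS a j)).congr this

end Frames

/-! ### The Riemannian volume as a measure that is √(det g) dy in every chart. -/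

section Volume

variable {n L : ℕ} {M : Type*} [EMetricSpace M] [ChartedSpace (EuclideanSpace ℝ (Fin n)) M]
  [RiemannianBundle (fun x : M ↦ TangentSpace (𝓡 n) x)]
  [IsManifold (𝓡 n) ∞ M] [MeasurableSpace M] [BorelSpace M]
  [IsContMDiffRiemannianBundle (𝓡 n) ∞ (EuclideanSpace ℝ (Fin n))
          (fun x : M ↦ TangentSpace (𝓡 n) x)]

/-- The measure `√(det g) dy` on the target of the chart at `c`. -/
def densityMeasure (c : M) : Measure (EuclideanSpace ℝ (Fin n)) :=
  (volume.restrict (chartTarget n c)).withDensity fun y ↦ ENNReal.ofReal (volDensity c y)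

lemma measurableSet_chartTarget (c : M) : MeasurableSet (chartTarget n c) :=
  (isOpen_chartTarget c).measurableSet

lemma measurableSet_chartSource (c : M) : MeasurableSet (chartSource n c) :=
  (isOpen_chartSource c).measurableSet

lemma aemeasurable_chart_symm (c : M) :
    AEMeasurable (extChartAt (𝓡 n) c).symm (densityMeasure (n := n) c) :=
  ((continuousOn_extChartAt_symm c).aemeasurable (measurableSet_chartTarget c)).mono_ac
    (withDensity_absolutelyContinuous _ _)

lemma aemeasurable_volDensity (c : M) :
    AEMeasurable (fun y ↦ ENNReal.ofReal (volDensity c y))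
      (volume.restrict (chartTarget n c)) :=
  ((contDiffOn_volDensity c).continuousOn.aemeasurable
    (measurableSet_chartTarget c)).ennreal_ofReal

lemma measurableSet_chart_preimage (c : M) {A : Set M} (hA : MeasurableSet A) :
    MeasurableSet (chartTarget n c ∩ (extChartAt (𝓡 n) c).symm ⁻¹' A) := by
  have h1 := (continuousOn_iff_continuous_domRestrict.1
    (continuousOn_extChartAt_symm (I := 𝓡 n) c)).measurable hA
  have h2 := (MeasurableEmbedding.subtype_coe
    (measurableSet_chartTarget (n := n) c)).measurableSet_image.2 h1
  convert h2 using 1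
  ext y
  simp [chartTarget, and_comm]

lemma chartVolume_apply (c : M) {A : Set M} (hA : MeasurableSet A) :
    chartVolume (n := n) c A = ∫⁻ y in chartTarget n c ∩ (extChartAt (𝓡 n) c).symm ⁻¹' A,
      ENNReal.ofReal (volDensity (n := n) c y) := by
  have h := Measure.map_apply_of_aemeasurable (aemeasurable_chart_symm (n := n) c) hA
  rw [chartVolume]
  refine h.trans ?_
  rw [densityMeasure, withDensity_apply', Measure.restrict_restrict' (measurableSet_chartTarget c),
    inter_comm]

lemma det_fderiv_transition (c c' : M) (y : EuclideanSpace ℝ (Fin n)) :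
    (fderiv ℝ (transition n c c') y).det = (jacobian c c' y).det := by
  rw [ContinuousLinearMap.det, ← LinearMap.det_toMatrix
    (EuclideanSpace.basisFun (Fin n) ℝ).toBasis]
  congr 1

/-- Change of variables under the transition map: its Jacobian determinant is exactly the factor by
which the two densities differ. -/
lemma chartVolume_eq_of_subset {c c' : M} {A : Set M} (hA : MeasurableSet A)
    (h : A ⊆ chartSource n c) (h' : A ⊆ chartSource n c') :
    chartVolume (n := n) c A = chartVolume (n := n) c' A := by
  rw [chartVolume_apply c hA, chartVolume_apply c' hA]
  have himg : chartTarget n c' ∩ (extChartAt (𝓡 n) c').symm ⁻¹' A =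
      transition n c c' '' (chartTarget n c ∩ (extChartAt (𝓡 n) c).symm ⁻¹' A) := by
    ext z
    constructor
    · rintro ⟨hz, hzA⟩
      have hz' : z ∈ overlap n c' c := ⟨hz, h hzA⟩
      refine ⟨transition n c' c z, ⟨(transition_mem hz').1, ?_⟩, transition_transition hz'⟩
      rw [mem_preimage, symm_transition hz']
      exact hzA
    · rintro ⟨y, ⟨hy, hyA⟩, rfl⟩
      have hy' : y ∈ overlap n c c' := ⟨hy, h' hyA⟩
      refine ⟨(transition_mem hy').1, ?_⟩
      rw [mem_preimage, symm_transition hy']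
      exact hyA
  have hsub : chartTarget n c ∩ (extChartAt (𝓡 n) c).symm ⁻¹' A ⊆ overlap n c c' :=
    fun y hy ↦ ⟨hy.1, h' hy.2⟩
  rw [himg, lintegral_image_eq_lintegral_abs_det_fderiv_mul volume
    (measurableSet_chart_preimage c hA)
    (fun y hy ↦ (differentiableAt_transition (hsub hy)).hasFDerivAt.hasFDerivWithinAt)
    (fun y hy z hz hyz ↦ by
      rw [← transition_transition (hsub hy), ← transition_transition (hsub hz), hyz])]
  refine setLIntegral_congr_fun (measurableSet_chart_preimage c hA) fun y hy ↦ ?_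
  simp only [det_fderiv_transition]
  rw [volDensity_transition (hsub hy), ENNReal.ofReal_mul (abs_nonneg _)]

lemma chartVolume_eq_inter (c : M) {A : Set M} (hA : MeasurableSet A) :
    chartVolume (n := n) c A = chartVolume (n := n) c (A ∩ chartSource n c) := by
  rw [chartVolume_apply c hA, chartVolume_apply c (hA.inter (measurableSet_chartSource c))]
  congr 2
  ext y
  constructor
  · rintro ⟨h1, h2⟩
    exact ⟨h1, h2, (extChartAt (𝓡 n) c).map_target h1⟩
  · rintro ⟨h1, h2, -⟩
    exact ⟨h1, h2⟩

lemma riemannianVolume_of_subset {c : M} {A : Set M} (hA : MeasurableSet A)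
    (h : A ⊆ chartSource n c) : riemannianVolume n M A = chartVolume (n := n) c A := by
  refine le_antisymm ?_ (Measure.le_iff'.1 (le_iSup (fun x : M ↦ chartVolume (n := n) x) c) A)
  -- A measure equal to the volume of the chart at c on its domain and to the largest measure
  -- outside. It dominates every chart volume because they agree on overlaps, hence it dominates
  -- their supremum, and on the domain of the chart the infinite part is not seen.
  let ν : Measure M := chartVolume (n := n) c + (⊤ : Measure M).restrict (chartSource n c)ᶜ
  have hν : riemannianVolume n M ≤ ν := by
    refine iSup_le fun x ↦ Measure.le_iff.2 fun B hB ↦ ?_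
    have hB1 := hB.inter (measurableSet_chartSource (n := n) c)
    rw [← measure_inter_add_sdiff B (measurableSet_chartSource (n := n) c)]
    refine add_le_add ?_ ?_
    · rw [chartVolume_eq_inter x hB1, chartVolume_eq_of_subset (c' := c)
        (hB1.inter (measurableSet_chartSource x)) inter_subset_right
        (inter_subset_left.trans inter_subset_right)]
      exact measure_mono (inter_subset_left.trans inter_subset_left)
    · change _ ≤ (⊤ : Measure M).restrict (chartSource n c)ᶜ B
      rw [Measure.restrict_apply hB]
      rw [← Set.sdiff_eq]
      exact Measure.le_iff'.1 le_top _
  refine (Measure.le_iff'.1 hν A).trans ?_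
  simp only [ν, Measure.add_apply]
  rw [Measure.restrict_apply hA, ← Set.sdiff_eq, sdiff_eq_empty.2 h]
  simp

lemma riemannianVolume_restrict (c : M) :
    (riemannianVolume n M).restrict (chartSource n c) =
      (densityMeasure (n := n) c).map (extChartAt (𝓡 n) c).symm := by
  ext A hA
  rw [Measure.restrict_apply hA, riemannianVolume_of_subset (c := c)
    (hA.inter (measurableSet_chartSource c)) inter_subset_right, ← chartVolume_eq_inter c hA]
  rfl

lemma volDensity_nonneg (c : M) (y : EuclideanSpace ℝ (Fin n)) : 0 ≤ volDensity c y :=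
  Real.sqrt_nonneg _

lemma setIntegral_chartSource {V : Type*} [NormedAddCommGroup V] [NormedSpace ℝ V] (c : M)
    {h : M → V}
    (hm : AEStronglyMeasurable h ((riemannianVolume n M).restrict (chartSource n c))) :
    ∫ x in chartSource n c, h x ∂(riemannianVolume n M) =
      ∫ y in chartTarget n c, volDensity c y • h ((extChartAt (𝓡 n) c).symm y) := by
  rw [riemannianVolume_restrict] at hm ⊢
  rw [integral_map (aemeasurable_chart_symm c) hm, densityMeasure,
    integral_withDensity_eq_integral_toReal_smul₀ (aemeasurable_volDensity c)
      (Eventually.of_forall fun _ ↦ ENNReal.ofReal_lt_top)]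
  simp only [ENNReal.toReal_ofReal (volDensity_nonneg _ _)]

instance isLocallyFiniteMeasure_riemannianVolume :
    IsLocallyFiniteMeasure (riemannianVolume n M) := by
  refine ⟨fun c ↦ ?_⟩
  have hc : coords n c c ∈ chartTarget n c := mem_extChartAt_target c
  obtain ⟨r, hr, hsub⟩ := Metric.nhds_basis_closedBall.mem_iff.1
    ((isOpen_chartTarget c).mem_nhds hc)
  let A : Set M := (extChartAt (𝓡 n) c).symm '' Metric.ball (coords n c c) r
  have hsub' : Metric.ball (coords n c c) r ⊆ chartTarget n c :=
    Metric.ball_subset_closedBall.trans hsub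
  have hAeq : A = chartSource n c ∩ (extChartAt (𝓡 n) c) ⁻¹' Metric.ball (coords n c c) r :=
    (extChartAt (𝓡 n) c).symm_image_eq_source_inter_preimage hsub'
  have hAo : IsOpen A := by
    rw [hAeq]
    exact (continuousOn_extChartAt c).isOpen_inter_preimage (isOpen_chartSource c)
      Metric.isOpen_ball
  have hAs : A ⊆ chartSource n c := by rw [hAeq]; exact inter_subset_left
  refine ⟨A, hAo.mem_nhds ⟨_, Metric.mem_ball_self hr, extChartAt_to_inv c⟩, ?_⟩
  rw [riemannianVolume_of_subset hAo.measurableSet hAs, chartVolume_apply c hAo.measurableSet]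
  have hpre : chartTarget n c ∩ (extChartAt (𝓡 n) c).symm ⁻¹' A ⊆
      Metric.closedBall (coords n c c) r := by
    rintro y ⟨hy, z, hz, hzy⟩
    have := (extChartAt (𝓡 n) c).symm.injOn (hsub' hz) hy hzy
    exact Metric.ball_subset_closedBall (this ▸ hz)
  have hcont : ContinuousOn (volDensity c) (Metric.closedBall (coords n c c) r) :=
    (contDiffOn_volDensity c).continuousOn.mono hsub
  obtain ⟨C, hC⟩ := (isCompact_closedBall (coords n c c) r).exists_bound_of_continuousOn hcont
  calc ∫⁻ y in chartTarget n c ∩ (extChartAt (𝓡 n) c).symm ⁻¹' A, ENNReal.ofReal (volDensity c y)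
      ≤ ∫⁻ y in Metric.closedBall (coords n c c) r, ENNReal.ofReal (volDensity c y) :=
        lintegral_mono_set hpre
    _ ≤ ∫⁻ _ in Metric.closedBall (coords n c c) r, ENNReal.ofReal C := by
        refine setLIntegral_mono measurable_const fun y hy ↦ ENNReal.ofReal_le_ofReal ?_
        exact (le_abs_self _).trans (hC y hy)
    _ < ⊤ := by
        rw [setLIntegral_const]
        exact ENNReal.mul_lt_top ENNReal.ofReal_lt_top
          (isCompact_closedBall (coords n c c) r).measure_lt_top

instance isOpenPosMeasure_riemannianVolume :
    (riemannianVolume n M).IsOpenPosMeasure := by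
  refine ⟨fun U hU ⟨c, hc⟩ h0 ↦ ?_⟩
  let A := U ∩ chartSource n c
  have hA : IsOpen A := hU.inter (isOpen_chartSource c)
  have h1 : chartVolume (n := n) c A = 0 := by
    rw [← riemannianVolume_of_subset hA.measurableSet inter_subset_right]
    exact measure_mono_null inter_subset_left h0
  have hB : IsOpen (chartTarget n c ∩ (extChartAt (𝓡 n) c).symm ⁻¹' A) :=
    (continuousOn_extChartAt_symm c).isOpen_inter_preimage (isOpen_chartTarget c) hA
  have hcB : coords n c c ∈ chartTarget n c ∩ (extChartAt (𝓡 n) c).symm ⁻¹' A := by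
    refine ⟨mem_extChartAt_target c, ?_⟩
    rw [mem_preimage, extChartAt_to_inv]
    exact ⟨hc, mem_extChartAt_source c⟩
  rw [chartVolume_apply c hA.measurableSet, lintegral_eq_zero_iff'
    ((aemeasurable_volDensity c).mono_measure (Measure.restrict_mono inter_subset_left le_rfl)),
    Filter.EventuallyEq, ae_restrict_iff' hB.measurableSet, ae_iff] at h1
  refine (hB.measure_pos volume ⟨_, hcB⟩).ne' (measure_mono_null ?_ h1)
  intro y hy
  simp only [mem_ofPred_eq, Classical.not_imp, Pi.zero_apply, ENNReal.ofReal_eq_zero, not_le]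
  exact ⟨hy, volDensity_pos hy.1⟩

lemma isFiniteMeasure_riemannianVolume [CompactSpace M] :
    IsFiniteMeasure (riemannianVolume n M) :=
  ⟨isCompact_univ.measure_lt_top⟩

end Volume

/-! ### The nonlinear flux (ε + |p|²)^κ p and its derivative. -/

section PowFlux

variable {H : Type*} [NormedAddCommGroup H] [InnerProductSpace ℝ H]

/-- The map `p ↦ (ε + |p|²)^κ p`. -/
def powFlux (ε κ : ℝ) (p : H) : H := (ε + ‖p‖ ^ 2) ^ κ • p

/-- The derivative of `powFlux ε κ`. -/
def powFluxDeriv (ε κ : ℝ) (p : H) : H →L[ℝ] H :=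
  (ε + ‖p‖ ^ 2) ^ κ • ContinuousLinearMap.id ℝ H +
    (2 * κ * (ε + ‖p‖ ^ 2) ^ (κ - 1)) • (innerSL ℝ p).smulRight p

lemma powFluxDeriv_apply (ε κ : ℝ) (p q : H) :
    powFluxDeriv ε κ p q =
      (ε + ‖p‖ ^ 2) ^ κ • q + (2 * κ * (ε + ‖p‖ ^ 2) ^ (κ - 1) * inner ℝ p q) • p := by
  simp [powFluxDeriv, smul_smul]

/-- Three regimes. For κ = 0 the map is the identity. Where ε + |p|² > 0 the ordinary chain rule
applies. In the remaining case ε = 0 and p = 0, and with κ > 0 the map is o(|p|), so its derivative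
is 0; the formula also gives 0 there, whatever value the power with exponent κ - 1 takes, since it
multiplies p. -/
lemma hasFDerivAt_powFlux {ε κ : ℝ} (hε : 0 ≤ ε) (hκ : 0 ≤ κ) (p : H) :
    HasFDerivAt (powFlux ε κ) (powFluxDeriv ε κ p) p := by
  rcases hκ.eq_or_lt with rfl | hκ
  · have : (powFlux ε 0 : H → H) = id := by ext q; simp [powFlux]
    have h2 : powFluxDeriv ε 0 p = ContinuousLinearMap.id ℝ H := by
      ext q; rw [powFluxDeriv_apply]; simp
    rw [this, h2]
    exact hasFDerivAt_id p
  rcases (add_nonneg hε (sq_nonneg ‖p‖)).eq_or_lt with h0 | h0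
  · have hp : p = 0 := by
      have : ‖p‖ ^ 2 = 0 := by nlinarith [sq_nonneg ‖p‖]
      simpa using this
    have hε0 : ε = 0 := by simpa [hp] using h0.symm
    subst hp hε0
    have hD : powFluxDeriv 0 κ (0 : H) = 0 := by
      ext q; rw [powFluxDeriv_apply]; simp [Real.zero_rpow hκ.ne']
    rw [hD, hasFDerivAt_iff_isLittleO_nhds_zero]
    simp only [powFlux, zero_add, smul_zero, sub_zero, zero_apply]
    have h1 : Tendsto (fun h : H ↦ (‖h‖ ^ 2) ^ κ) (𝓝 0) (𝓝 0) := by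
      have : Continuous fun h : H ↦ (‖h‖ ^ 2) ^ κ :=
        (continuous_norm.pow 2).rpow_const fun _ ↦ Or.inr hκ.le
      simpa [Real.zero_rpow hκ.ne'] using this.tendsto 0
    have h2 := ((Asymptotics.isLittleO_one_iff ℝ).2 h1).smul_isBigO
      (Asymptotics.isBigO_refl (fun h : H ↦ h) (𝓝 0))
    simpa using h2
  · have h1 : HasFDerivAt (fun q : H ↦ ε + ‖q‖ ^ 2) (2 • innerSL ℝ p) p :=
      (hasStrictFDerivAt_norm_sq p).hasFDerivAt.const_add ε
    have h2 := (h1.rpow_const (p := κ) (Or.inl h0.ne')).smul (hasFDerivAt_id p)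
    refine h2.congr_fderiv ?_
    ext q
    rw [powFluxDeriv_apply]
    simp only [add_apply, smul_apply,
      ContinuousLinearMap.smulRight_apply, ContinuousLinearMap.id_apply, innerSL_apply_apply,
      smul_eq_mul, nsmul_eq_mul, id_eq]
    congr 2
    push_cast
    ring

lemma norm_powFluxDeriv_le {ε κ : ℝ} (hε : 0 ≤ ε) (hκ : 0 ≤ κ) (p : H) :
    ‖powFluxDeriv ε κ p‖ ≤ (1 + 2 * κ) * (ε + ‖p‖ ^ 2) ^ κ := by
  have h0 : 0 ≤ ε + ‖p‖ ^ 2 := by positivity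
  refine ContinuousLinearMap.opNorm_le_bound _ (by positivity) fun q ↦ ?_
  rw [powFluxDeriv_apply]
  refine (norm_add_le _ _).trans ?_
  rw [norm_smul, norm_smul, Real.norm_eq_abs, Real.norm_eq_abs,
    abs_of_nonneg (Real.rpow_nonneg h0 _), abs_mul, abs_of_nonneg (by positivity)]
  have h1 : |inner ℝ p q| ≤ ‖p‖ * ‖q‖ := abs_real_inner_le_norm p q
  have h2 : (ε + ‖p‖ ^ 2) ^ (κ - 1) * (‖p‖ * ‖p‖) ≤ (ε + ‖p‖ ^ 2) ^ κ := by
    rcases h0.eq_or_lt with h0' | h0'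
    · have : ‖p‖ ^ 2 = 0 := by nlinarith [sq_nonneg ‖p‖]
      have hp : ‖p‖ = 0 := by simpa using this
      rw [hp]; simp; positivity
    · calc (ε + ‖p‖ ^ 2) ^ (κ - 1) * (‖p‖ * ‖p‖)
          ≤ (ε + ‖p‖ ^ 2) ^ (κ - 1) * (ε + ‖p‖ ^ 2) := by gcongr; nlinarith
        _ = (ε + ‖p‖ ^ 2) ^ κ := by
            rw [Real.rpow_sub_one h0'.ne']; field_simp
  calc _ ≤ (ε + ‖p‖ ^ 2) ^ κ * ‖q‖ +
        2 * κ * (ε + ‖p‖ ^ 2) ^ (κ - 1) * (‖p‖ * ‖q‖) * ‖p‖ := by gcongr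
    _ = (ε + ‖p‖ ^ 2) ^ κ * ‖q‖ +
        2 * κ * ‖q‖ * ((ε + ‖p‖ ^ 2) ^ (κ - 1) * (‖p‖ * ‖p‖)) := by ring
    _ ≤ (ε + ‖p‖ ^ 2) ^ κ * ‖q‖ + 2 * κ * ‖q‖ * (ε + ‖p‖ ^ 2) ^ κ := by gcongr
    _ = _ := by ring

/-- Where ε + |p|² vanishes and κ > 0, the derivative tends to 0 by the bound
`norm_powFluxDeriv_le`. This C¹ regularity at zeros of df is what allows ε = 0 throughout. -/
lemma contDiff_powFlux {ε κ : ℝ} (hε : 0 ≤ ε) (hκ : 0 ≤ κ) :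
    ContDiff ℝ 1 (powFlux ε κ : H → H) := by
  rw [contDiff_one_iff_fderiv]
  refine ⟨fun p ↦ (hasFDerivAt_powFlux hε hκ p).differentiableAt, ?_⟩
  have : fderiv ℝ (powFlux ε κ : H → H) = powFluxDeriv ε κ :=
    funext fun p ↦ (hasFDerivAt_powFlux hε hκ p).fderiv
  rw [this]
  rcases hκ.eq_or_lt with rfl | hκ
  · have : (powFluxDeriv ε 0 : H → H →L[ℝ] H) = fun _ ↦ ContinuousLinearMap.id ℝ H := by
      ext p q; rw [powFluxDeriv_apply]; simp
    rw [this]; exact continuous_const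
  rw [continuous_iff_continuousAt]
  intro p
  rcases (add_nonneg hε (sq_nonneg ‖p‖)).eq_or_lt with h0 | h0
  · have h1 : Continuous fun p : H ↦ (1 + 2 * κ) * (ε + ‖p‖ ^ 2) ^ κ :=
      continuous_const.mul ((continuous_const.add (continuous_norm.pow 2)).rpow_const
        fun _ ↦ Or.inr hκ.le)
    have h2 : powFluxDeriv ε κ p = 0 := by
      have := norm_powFluxDeriv_le hε hκ.le p
      rw [← h0, Real.zero_rpow hκ.ne', mul_zero] at this
      exact norm_le_zero_iff.1 this
    rw [ContinuousAt, h2, tendsto_zero_iff_norm_tendsto_zero]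
    refine squeeze_zero (fun _ ↦ norm_nonneg _) (fun q ↦ norm_powFluxDeriv_le hε hκ.le q) ?_
    have := h1.tendsto p
    rwa [← h0, Real.zero_rpow hκ.ne', mul_zero] at this
  · have hb : ContinuousAt (fun p : H ↦ ε + ‖p‖ ^ 2) p :=
      (continuous_const.add (continuous_norm.pow 2)).continuousAt
    unfold powFluxDeriv
    have hs : Continuous fun p : H ↦ (innerSL ℝ p).smulRight p := by fun_prop
    exact ((hb.rpow_const (Or.inl h0.ne')).smul continuousAt_const).add
      (((continuousAt_const.mul (hb.rpow_const (Or.inl h0.ne'))).smul hs.continuousAt))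

end PowFlux

/-! ### Regularity of maps and flows read in charts. -/

section Flows

variable {n L : ℕ} {M : Type*} [EMetricSpace M] [ChartedSpace (EuclideanSpace ℝ (Fin n)) M]
  {V : Type*} [NormedAddCommGroup V] [InnerProductSpace ℝ V]

/-- A map on `M` which is of class `C^r` in the charts. -/
def ChartReg (n : ℕ) {M : Type*} [EMetricSpace M] [ChartedSpace (EuclideanSpace ℝ (Fin n)) M]
    {V : Type*} [NormedAddCommGroup V] [NormedSpace ℝ V] (r : WithTop ℕ∞) (α : M → V) : Prop :=
  ∀ c : M, ContDiffOn ℝ r (inChart α c) (chartTarget n c)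

/-- A time dependent map on `M` which is of class `C^r` in time and the chart coordinates,
for times in `(0, T)`. -/
def FlowReg (n : ℕ) {M : Type*} [EMetricSpace M] [ChartedSpace (EuclideanSpace ℝ (Fin n)) M]
    {V : Type*} [NormedAddCommGroup V] [NormedSpace ℝ V] (T : ℝ) (r : WithTop ℕ∞)
    (k : ℝ → M → V) : Prop :=
  ∀ c : M, ContDiffOn ℝ r (fun z : ℝ × EuclideanSpace ℝ (Fin n) ↦ inChart (k z.1) c z.2)
    (Ioo 0 T ×ˢ chartTarget n c)

lemma isOpen_cylinder (T : ℝ) (c : M) : IsOpen (Ioo (0 : ℝ) T ×ˢ chartTarget n c) :=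
  isOpen_Ioo.prod (isOpen_chartTarget c)

lemma inChart_coords {V : Type*} (α : M → V) {c x : M} (hx : x ∈ chartSource n c) :
    inChart α c (coords n c x) = α x := by
  simp only [inChart, coords, (extChartAt (𝓡 n) c).left_inv hx]

lemma continuous_of_inChart {W : Type*} [TopologicalSpace W] {α : M → W}
    (h : ∀ c : M, ContinuousOn (inChart α c) (chartTarget n c)) : Continuous α := by
  rw [continuous_iff_continuousAt]
  intro c
  have h1 : ContinuousOn (inChart α c ∘ coords n c) (chartSource n c) :=
    (h c).comp (continuousOn_extChartAt c) fun x hx ↦ (extChartAt (𝓡 n) c).map_source hx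
  have h2 : ContinuousOn α (chartSource n c) :=
    h1.congr fun x hx ↦ (inChart_coords α hx).symm
  exact h2.continuousAt ((isOpen_chartSource c).mem_nhds (mem_extChartAt_source c))

lemma ChartReg.continuous {r : WithTop ℕ∞} {α : M → V} (h : ChartReg n r α) : Continuous α :=
  continuous_of_inChart fun c ↦ (h c).continuousOn

lemma continuousOn_of_inChart_flow {W : Type*} [TopologicalSpace W] {I : Set ℝ}
    {k : ℝ → M → W}
    (h : ∀ c : M, ContinuousOn (fun z : ℝ × EuclideanSpace ℝ (Fin n) ↦ inChart (k z.1) c z.2)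
      (I ×ˢ chartTarget n c)) :
    ContinuousOn (fun z : ℝ × M ↦ k z.1 z.2) (I ×ˢ univ) := by
  rintro ⟨t, c⟩ ⟨ht, -⟩
  have h1 : ContinuousOn (fun z : ℝ × M ↦ inChart (k z.1) c (coords n c z.2))
      (I ×ˢ chartSource n c) := by
    refine (h c).comp (f := fun z : ℝ × M ↦ (z.1, coords n c z.2)) ?_ ?_
    · exact continuousOn_fst.prodMk ((continuousOn_extChartAt c).comp continuousOn_snd
        fun z hz ↦ hz.2)
    · exact fun z hz ↦ ⟨hz.1, (extChartAt (𝓡 n) c).map_source hz.2⟩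
  have h2 : ContinuousOn (fun z : ℝ × M ↦ k z.1 z.2) (I ×ˢ chartSource n c) :=
    h1.congr fun z hz ↦ (inChart_coords _ hz.2).symm
  have h3 := h2 (t, c) ⟨ht, mem_extChartAt_source c⟩
  have h4 : I ×ˢ chartSource n c = (I ×ˢ univ) ∩ (Prod.snd ⁻¹' chartSource n c : Set (ℝ × M)) := by
    ext z; simp [chartSource]
  rw [h4] at h3
  exact (continuousWithinAt_inter (((isOpen_chartSource c).preimage continuous_snd).mem_nhds
    (mem_extChartAt_source c))).1 h3

lemma FlowReg.continuousOn {T : ℝ} {r : WithTop ℕ∞} {k : ℝ → M → V} (h : FlowReg n T r k) :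
    ContinuousOn (fun z : ℝ × M ↦ k z.1 z.2) (Ioo 0 T ×ˢ univ) :=
  continuousOn_of_inChart_flow fun c ↦ (h c).continuousOn

lemma FlowReg.of_le {T : ℝ} {r s : WithTop ℕ∞} {k : ℝ → M → V} (h : FlowReg n T r k)
    (hs : s ≤ r) : FlowReg n T s k := fun c ↦ (h c).of_le hs

lemma FlowReg.slice {T : ℝ} {r : WithTop ℕ∞} {k : ℝ → M → V} (h : FlowReg n T r k) {t : ℝ}
    (ht : t ∈ Ioo 0 T) : ChartReg n r (k t) := fun c ↦
  (h c).comp (f := fun y ↦ (t, y)) (contDiff_prodMk_right t).contDiffOn fun _ hy ↦ ⟨ht, hy⟩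

lemma ChartReg.flow {r : WithTop ℕ∞} {α : M → V} (h : ChartReg n r α) (T : ℝ) :
    FlowReg n T r (fun _ ↦ α) := fun c ↦
  (h c).comp (f := Prod.snd) contDiff_snd.contDiffOn fun _ hz ↦ hz.2

lemma FlowReg.coordPartial_eq {T : ℝ} {k : ℝ → M → V} (h : FlowReg n T 1 k)
    {c : M} {z : ℝ × EuclideanSpace ℝ (Fin n)} (hz : z ∈ Ioo 0 T ×ˢ chartTarget n c) (i : Fin n) :
    coordPartial i (inChart (k z.1) c) z.2 =
      fderiv ℝ (fun z : ℝ × EuclideanSpace ℝ (Fin n) ↦ inChart (k z.1) c z.2) z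
        (0, EuclideanSpace.single i 1) := by
  have h1 : DifferentiableAt ℝ
      (fun z : ℝ × EuclideanSpace ℝ (Fin n) ↦ inChart (k z.1) c z.2) z :=
    ((h c).contDiffAt ((isOpen_cylinder T c).mem_nhds hz)).differentiableAt (by simp)
  have h3 : HasFDerivAt (inChart (n := n) (k z.1) c) _ z.2 :=
    HasFDerivAt.comp z.2 (f := fun y ↦ (z.1, y)) h1.hasFDerivAt
      (hasFDerivAt_prodMk_right z.1 z.2)
  rw [coordPartial, h3.fderiv]
  simp

lemma FlowReg.contDiffOn_coordPartial {T : ℝ} {r s : WithTop ℕ∞} {k : ℝ → M → V} (h : FlowReg n T r k)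
    (hs : s + 1 ≤ r) (c : M) (i : Fin n) :
    ContDiffOn ℝ s (fun z : ℝ × EuclideanSpace ℝ (Fin n) ↦
      coordPartial i (inChart (k z.1) c) z.2) (Ioo 0 T ×ˢ chartTarget n c) := by
  have h1 := ((h c).fderiv_of_isOpen (isOpen_cylinder T c) hs).clm_apply
    (contDiffOn_const (c := ((0 : ℝ), EuclideanSpace.single i (1 : ℝ))))
  exact h1.congr fun z hz ↦ FlowReg.coordPartial_eq (h.of_le (le_trans (by simp) hs)) hz i

lemma FlowReg.hasDerivAt_inChart {T : ℝ} {k : ℝ → M → V} (h : FlowReg n T 1 k)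
    {c : M} {z : ℝ × EuclideanSpace ℝ (Fin n)} (hz : z ∈ Ioo 0 T ×ˢ chartTarget n c) :
    HasDerivAt (fun t ↦ inChart (k t) c z.2)
      (fderiv ℝ (fun z : ℝ × EuclideanSpace ℝ (Fin n) ↦ inChart (k z.1) c z.2) z (1, 0)) z.1 := by
  have h1 : DifferentiableAt ℝ
      (fun z : ℝ × EuclideanSpace ℝ (Fin n) ↦ inChart (k z.1) c z.2) z :=
    ((h c).contDiffAt ((isOpen_cylinder T c).mem_nhds hz)).differentiableAt (by simp)
  have h2 := (HasFDerivAt.comp z.1 (f := fun t ↦ (t, z.2)) h1.hasFDerivAt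
    (hasFDerivAt_prodMk_left z.1 z.2)).hasDerivAt
  simpa [Function.comp_def] using h2

lemma FlowReg.hasDerivAt {T : ℝ} {k : ℝ → M → V} (h : FlowReg n T 1 k) {t : ℝ}
    (ht : t ∈ Ioo 0 T) (x : M) : HasDerivAt (fun s ↦ k s x) (deriv (fun s ↦ k s x) t) t := by
  have h1 := h.hasDerivAt_inChart (c := x) (z := (t, coords n x x))
    ⟨ht, mem_extChartAt_target x⟩
  simp only [inChart_coords _ (mem_extChartAt_source x)] at h1
  exact h1.differentiableAt.hasDerivAt

lemma FlowReg.deriv_time {T : ℝ} {r s : WithTop ℕ∞} {k : ℝ → M → V} (h : FlowReg n T r k)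
    (hs : s + 1 ≤ r) : FlowReg n T s (fun t x ↦ deriv (fun s ↦ k s x) t) := by
  intro c
  have h1 := ((h c).fderiv_of_isOpen (isOpen_cylinder T c) hs).clm_apply
    (contDiffOn_const (c := ((1 : ℝ), (0 : EuclideanSpace ℝ (Fin n)))))
  refine h1.congr fun z hz ↦ ?_
  exact (FlowReg.hasDerivAt_inChart (h.of_le (le_trans (by simp) hs)) hz).deriv

end Flows

/-! ### Integration by parts in coordinates with compact support. -/

section EuclideanParts

variable {n : ℕ} {V : Type*} [NormedAddCommGroup V] [InnerProductSpace ℝ V]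

lemma integrable_of_continuousOn_compact {W : Type*} [NormedAddCommGroup W]
    {K : Set (EuclideanSpace ℝ (Fin n))} (hK : IsCompact K)
    {F : EuclideanSpace ℝ (Fin n) → W} (hF : ContinuousOn F K) (h0 : ∀ y ∉ K, F y = 0) :
    Integrable F :=
  (integrableOn_iff_integrable_of_support_subset
    fun y hy ↦ by_contra fun h ↦ hy (h0 y h)).1 (hF.integrableOn_compact hK)

lemma coordPartial_eventuallyEq {W : Type*} [NormedAddCommGroup W] [NormedSpace ℝ W]
    {f g : EuclideanSpace ℝ (Fin n) → W} {y : EuclideanSpace ℝ (Fin n)} (h : f =ᶠ[𝓝 y] g)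
    (i : Fin n) : coordPartial i f y = coordPartial i g y := by
  rw [coordPartial, coordPartial, h.fderiv_eq]

lemma continuousOn_coordPartial {W : Type*} [NormedAddCommGroup W] [NormedSpace ℝ W]
    {U : Set (EuclideanSpace ℝ (Fin n))} (hU : IsOpen U)
    {f : EuclideanSpace ℝ (Fin n) → W} (hf : ContDiffOn ℝ 1 f U) (i : Fin n) :
    ContinuousOn (coordPartial i f) U :=
  (hf.continuousOn_fderiv_of_isOpen hU le_rfl).clm_apply continuousOn_const

lemma contDiff_of_compact_subset {W : Type*} [NormedAddCommGroup W] [NormedSpace ℝ W]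
    {U K : Set (EuclideanSpace ℝ (Fin n))} (hU : IsOpen U) (hK : IsCompact K)
    {r : WithTop ℕ∞} {f : EuclideanSpace ℝ (Fin n) → W} (hKU : K ⊆ U) (hf : ContDiffOn ℝ r f U)
    (h0 : ∀ y ∉ K, f y = 0) : ContDiff ℝ r f := by
  rw [contDiff_iff_contDiffAt]
  intro y
  by_cases hy : y ∈ K
  · exact hf.contDiffAt (hU.mem_nhds (hKU hy))
  · have : f =ᶠ[𝓝 y] fun _ ↦ 0 := by
      filter_upwards [hK.isClosed.isOpen_compl.mem_nhds hy] with z hz using h0 z hz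
    exact contDiffAt_const.congr_of_eventuallyEq this

lemma integral_inner_coordPartial {U K : Set (EuclideanSpace ℝ (Fin n))} (hU : IsOpen U)
    (hK : IsCompact K) (hKU : K ⊆ U) {F ψ : EuclideanSpace ℝ (Fin n) → V}
    (hF : ContDiffOn ℝ 1 F U) (hψ : ContDiffOn ℝ 1 ψ U) (h0 : ∀ y ∉ K, ψ y = 0) (i : Fin n) :
    Integrable (fun y ↦ inner ℝ (coordPartial i F y) (ψ y)) ∧
    Integrable (fun y ↦ inner ℝ (F y) (coordPartial i ψ y)) ∧
    ∫ y, inner ℝ (coordPartial i F y) (ψ y) = -∫ y, inner ℝ (F y) (coordPartial i ψ y) := by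
  have hψ1 := contDiff_of_compact_subset hU hK hKU hψ h0
  have hd0 : ∀ y ∉ K, coordPartial i ψ y = 0 := by
    intro y hy
    have : ψ =ᶠ[𝓝 y] fun _ ↦ 0 := by
      filter_upwards [hK.isClosed.isOpen_compl.mem_nhds hy] with z hz using h0 z hz
    rw [coordPartial_eventuallyEq this]; simp [coordPartial]
  have i1 : Integrable (fun y ↦ inner ℝ (coordPartial i F y) (ψ y)) :=
    integrable_of_continuousOn_compact hK
      (((continuousOn_coordPartial hU hF i).inner hψ.continuousOn).mono hKU)
      fun y hy ↦ by rw [h0 y hy, inner_zero_right]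
  have i2 : Integrable (fun y ↦ inner ℝ (F y) (coordPartial i ψ y)) :=
    integrable_of_continuousOn_compact hK
      ((hF.continuousOn.inner (continuousOn_coordPartial hU hψ i)).mono hKU)
      fun y hy ↦ by rw [hd0 y hy, inner_zero_right]
  have i3 : Integrable (fun y ↦ inner ℝ (F y) (ψ y)) :=
    integrable_of_continuousOn_compact hK
      ((hF.continuousOn.inner hψ.continuousOn).mono hKU)
      fun y hy ↦ by rw [h0 y hy, inner_zero_right]
  have hts : tsupport ψ ⊆ K :=
    closure_minimal (fun y hy ↦ by_contra fun h ↦ hy (h0 y h)) hK.isClosed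
  have := integral_bilinear_fderiv_right_eq_neg_left_of_integrable (μ := volume)
    (B := innerSL ℝ) (f := F) (g := ψ) (v := EuclideanSpace.single i (1 : ℝ)) i1 i2 i3
    (fun y hy ↦ (hF.contDiffAt (hU.mem_nhds (hKU (hts hy)))).differentiableAt (by simp))
    (fun y _ ↦ hψ1.differentiable (by simp) y)
  refine ⟨i1, i2, ?_⟩
  refine (neg_eq_iff_eq_neg.1 ?_)
  exact this.symm

end EuclideanParts

/-! ### The divergence of the flux in a chart and its weak form. -/

section Divergence

variable {n L : ℕ} {M : Type*} [EMetricSpace M] [ChartedSpace (EuclideanSpace ℝ (Fin n)) M]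
  [RiemannianBundle (fun x : M ↦ TangentSpace (𝓡 n) x)]
  {V : Type*} [NormedAddCommGroup V] [InnerProductSpace ℝ V]

/-- The components `√g (ε + |df|²)^κ g^{ij} ∂ⱼ f` of the flux in the chart at `c`. -/
def fluxChart (c : M) (ε κ : ℝ) (f : M → EuclideanSpace ℝ (Fin L)) (i : Fin n)
    (y : EuclideanSpace ℝ (Fin n)) : EuclideanSpace ℝ (Fin L) :=
  (volDensity c y * e2Chart ε f c y ^ κ) •
    ∑ j, invMetric c y i j • coordPartial j (inChart f c) y

/-- The divergence of `(ε + |df|²)^κ df`, computed in the chart at `c`. -/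
def divChart (c : M) (ε κ : ℝ) (f : M → EuclideanSpace ℝ (Fin L)) (x : M) :
    EuclideanSpace ℝ (Fin L) :=
  (volDensity (n := n) c (coords n c x))⁻¹ •
    ∑ i : Fin n, coordPartial i (fluxChart c ε κ f i) (coords n c x)

lemma regNLaplacian_eq_divChart (ε : ℝ) (f : M → EuclideanSpace ℝ (Fin L)) (x : M) :
    regNLaplacian n ε f x = divChart (n := n) x ε ((n : ℝ) / 2 - 1) f x := rfl

/-- The components of the differential in the frame `S`, as an element of a Hilbert space. -/
def frameGrad (S : EuclideanSpace ℝ (Fin n) → Matrix (Fin n) (Fin n) ℝ)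
    (h : EuclideanSpace ℝ (Fin n) → V) (y : EuclideanSpace ℝ (Fin n)) :
    PiLp 2 (fun _ : Fin n ↦ V) :=
  WithLp.toLp 2 fun a ↦ frameDeriv S a h y

lemma gradPair_eq_inner {c : M} {S : EuclideanSpace ℝ (Fin n) → Matrix (Fin n) (Fin n) ℝ}
    {y : EuclideanSpace ℝ (Fin n)} (h : IsOrthoFrame c (S y) y)
    (α β : EuclideanSpace ℝ (Fin n) → V) :
    gradPair c α β y = inner ℝ (frameGrad S α y) (frameGrad S β y) := by
  rw [gradPair_eq_frame h]
  simp [frameGrad, PiLp.inner_apply]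

lemma e2Chart_eq_frame {c : M} {S : EuclideanSpace ℝ (Fin n) → Matrix (Fin n) (Fin n) ℝ}
    {y : EuclideanSpace ℝ (Fin n)} (h : IsOrthoFrame c (S y) y) (ε : ℝ)
    (f : M → EuclideanSpace ℝ (Fin L)) :
    e2Chart ε f c y = ε + ‖frameGrad S (inChart f c) y‖ ^ 2 := by
  rw [e2Chart_eq, gradPair_eq_inner h, real_inner_self_eq_norm_sq]

/-- In a frame the flux is a linear image of `powFlux` applied to the gradient. Its C¹ regularity
then follows from that of `powFlux`, also at points where e vanishes and the power of e alone need
not be differentiable. -/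
lemma fluxChart_eq_frame {c : M} {S : EuclideanSpace ℝ (Fin n) → Matrix (Fin n) (Fin n) ℝ}
    {y : EuclideanSpace ℝ (Fin n)} (h : IsOrthoFrame c (S y) y) (ε κ : ℝ)
    (f : M → EuclideanSpace ℝ (Fin L)) (i : Fin n) :
    fluxChart c ε κ f i y = volDensity c y •
      ∑ a, S y a i • powFlux ε κ (frameGrad S (inChart f c) y) a := by
  have h1 : ∑ j, invMetric c y i j • coordPartial j (inChart f c) y =
      ∑ a, S y a i • frameGrad S (inChart f c) y a := by
    simp only [frameGrad, frameDeriv, h.invMetric_eq, Matrix.mul_apply,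
      Matrix.transpose_apply, Finset.sum_smul, Finset.smul_sum, smul_smul]
    exact Finset.sum_comm
  rw [fluxChart, h1, e2Chart_eq_frame h, mul_smul]
  simp only [powFlux, Finset.smul_sum, PiLp.smul_apply]
  congr 1
  funext a
  rw [smul_comm (S y a i)]

variable [IsManifold (𝓡 n) ∞ M]

lemma mem_overlap_self {c : M} {y : EuclideanSpace ℝ (Fin n)} (hy : y ∈ chartTarget n c) :
    y ∈ overlap n c ((extChartAt (𝓡 n) c).symm y) :=
  ⟨hy, mem_extChartAt_source _⟩

lemma ChartReg.differentiableAt {α : M → V} (h : ChartReg n 1 α) {c : M}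
    {y : EuclideanSpace ℝ (Fin n)} (hy : y ∈ chartTarget n c) :
    DifferentiableAt ℝ (inChart α c) y :=
  ((h c).contDiffAt ((isOpen_chartTarget c).mem_nhds hy)).differentiableAt (by simp)

lemma ChartReg.of_le {r s : WithTop ℕ∞} {α : M → V} (h : ChartReg n r α) (hs : s ≤ r) :
    ChartReg n s α := fun c ↦ (h c).of_le hs

lemma dPair_inChart {α β : M → V} (hα : ChartReg n 1 α) (hβ : ChartReg n 1 β) {c : M}
    {y : EuclideanSpace ℝ (Fin n)} (hy : y ∈ chartTarget n c) :
    inChart (dPair n α β) c y = gradPair c (inChart α c) (inChart β c) y := by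
  have h := mem_overlap_self hy
  exact (gradPair_transition h (hα.differentiableAt (transition_mem h).1)
    (hβ.differentiableAt (transition_mem h).1)).symm

lemma e2_inChart {f : M → EuclideanSpace ℝ (Fin L)} (hf : ChartReg n 1 f) (ε : ℝ) {c : M}
    {y : EuclideanSpace ℝ (Fin n)} (hy : y ∈ chartTarget n c) :
    inChart (e2 n ε f) c y = e2Chart ε f c y := by
  rw [e2Chart_eq, ← dPair_inChart hf hf hy]
  rfl

lemma dPair_self_nonneg (α : M → V) (x : M) : 0 ≤ dPair n α α x := by
  obtain ⟨S, hS⟩ := exists_orthoFrame_at (mem_extChartAt_target (I := 𝓡 n) x)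
  rw [dPair, gradPair_eq_inner (S := fun _ ↦ S) hS]
  exact real_inner_self_nonneg

variable [IsContMDiffRiemannianBundle (𝓡 n) ∞ (EuclideanSpace ℝ (Fin n))
          (fun x : M ↦ TangentSpace (𝓡 n) x)]

lemma FlowReg.contDiffOn_frameGrad {T : ℝ} {r s : WithTop ℕ∞} {k : ℝ → M → V} (h : FlowReg n T r k)
    (hs : s + 1 ≤ r) (hs' : s ≤ ∞) {c : M}
    {S : EuclideanSpace ℝ (Fin n) → Matrix (Fin n) (Fin n) ℝ}
    (hS : ∀ a i, ContDiffOn ℝ ∞ (fun y ↦ S y a i) (chartTarget n c)) :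
    ContDiffOn ℝ s (fun z : ℝ × EuclideanSpace ℝ (Fin n) ↦
      frameGrad S (inChart (k z.1) c) z.2) (Ioo 0 T ×ˢ chartTarget n c) := by
  refine contDiffOn_piLp' 2 fun a ↦ ?_
  have : ∀ i, ContDiffOn ℝ s (fun z : ℝ × EuclideanSpace ℝ (Fin n) ↦ S z.2 a i)
      (Ioo 0 T ×ˢ chartTarget n c) := fun i ↦
    ((hS a i).of_le hs').comp contDiff_snd.contDiffOn fun z hz ↦ hz.2
  exact ContDiffOn.sum (s := Finset.univ) fun i _ ↦ (this i).smul (h.contDiffOn_coordPartial hs c i)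

lemma contDiffOn_volDensity_snd (T : ℝ) (c : M) :
    ContDiffOn ℝ ∞ (fun z : ℝ × EuclideanSpace ℝ (Fin n) ↦ volDensity c z.2)
      (Ioo 0 T ×ˢ chartTarget n c) :=
  (contDiffOn_volDensity c).comp contDiff_snd.contDiffOn fun _ hz ↦ hz.2

lemma FlowReg.contDiffOn_fluxChart {T : ℝ} {f : ℝ → M → EuclideanSpace ℝ (Fin L)} (hf : FlowReg n T 2 f)
    {ε κ : ℝ} (hε : 0 ≤ ε) (hκ : 0 ≤ κ) (c : M) (i : Fin n) :
    ContDiffOn ℝ 1 (fun z : ℝ × EuclideanSpace ℝ (Fin n) ↦ fluxChart c ε κ (f z.1) i z.2)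
      (Ioo 0 T ×ˢ chartTarget n c) := by
  obtain ⟨S, hS, hSo⟩ := exists_orthoFrame (n := n) c
  have h1 := (contDiff_powFlux (H := PiLp 2 (fun _ : Fin n ↦ EuclideanSpace ℝ (Fin L)))
    hε hκ).comp_contDiffOn (hf.contDiffOn_frameGrad (s := 1) (by norm_num) (by simp) hS)
  have h2 : ∀ a, ContDiffOn ℝ 1 (fun z : ℝ × EuclideanSpace ℝ (Fin n) ↦ S z.2 a i)
      (Ioo 0 T ×ˢ chartTarget n c) := fun a ↦
    ((hS a i).of_le (by simp)).comp contDiff_snd.contDiffOn fun z hz ↦ hz.2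
  refine (((contDiffOn_volDensity_snd T c).of_le (by simp)).smul
    (ContDiffOn.sum (s := Finset.univ) fun a _ ↦ (h2 a).smul
      ((contDiffOn_piLp 2).1 h1 a))).congr fun z hz ↦ ?_
  exact fluxChart_eq_frame (hSo z.2 hz.2) ε κ (f z.1) i

lemma FlowReg.contDiffOn_gradPair {T : ℝ} {r s : WithTop ℕ∞} {k l : ℝ → M → V} (hk : FlowReg n T r k)
    (hl : FlowReg n T r l) (hs : s + 1 ≤ r) (hs' : s ≤ ∞) (c : M) :
    ContDiffOn ℝ s (fun z : ℝ × EuclideanSpace ℝ (Fin n) ↦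
      gradPair c (inChart (k z.1) c) (inChart (l z.1) c) z.2) (Ioo 0 T ×ˢ chartTarget n c) := by
  obtain ⟨S, hS, hSo⟩ := exists_orthoFrame (n := n) c
  refine ((hk.contDiffOn_frameGrad hs hs' hS).inner ℝ (hl.contDiffOn_frameGrad hs hs' hS)).congr fun z hz ↦ ?_
  exact gradPair_eq_inner (hSo z.2 hz.2) _ _

lemma FlowReg.flowReg_dPair {T : ℝ} {r s : WithTop ℕ∞} {k l : ℝ → M → V} (hk : FlowReg n T r k)
    (hl : FlowReg n T r l) (hs : s + 1 ≤ r) (hs' : s ≤ ∞) :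
    FlowReg n T s (fun t x ↦ dPair n (k t) (l t) x) := fun c ↦
  (hk.contDiffOn_gradPair hl hs hs' c).congr fun z hz ↦
    dPair_inChart ((hk.slice hz.1).of_le (le_trans (by simp) hs))
      ((hl.slice hz.1).of_le (le_trans (by simp) hs)) hz.2

/-- A single map is a constant flow on (0, 1), so regularity statements for flows specialize to maps
by slicing at time 1/2. -/
lemma ChartReg.slice_one {r : WithTop ℕ∞} {k : ℝ → M → V} (h : FlowReg n 1 r k) :
    ChartReg n r (k (1 / 2)) := h.slice (by norm_num)

lemma ChartReg.chartReg_dPair {α β : M → V} (hα : ChartReg n 1 α) (hβ : ChartReg n 1 β) :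
    ChartReg n 0 (dPair n α β) :=
  ChartReg.slice_one ((hα.flow 1).flowReg_dPair (hβ.flow 1) (by simp) (by simp))

lemma e2_nonneg {ε : ℝ} (hε : 0 ≤ ε) (f : M → EuclideanSpace ℝ (Fin L)) (x : M) :
    0 ≤ e2 n ε f x := add_nonneg hε (dPair_self_nonneg f x)

lemma continuous_e2_rpow {f : M → EuclideanSpace ℝ (Fin L)} (hf : ChartReg n 1 f) (ε : ℝ)
    {κ : ℝ} (hκ : 0 ≤ κ) : Continuous fun x ↦ e2 n ε f x ^ κ :=
  (continuous_const.add (hf.chartReg_dPair hf).continuous).rpow_const fun _ ↦ Or.inr hκ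

lemma dPair_eq_zero_of_notMem_tsupport {α β : M → V} {x : M} (hx : x ∉ tsupport β) :
    dPair n α β x = 0 := by
  have h0 : inChart (n := n) β x =ᶠ[𝓝 (coords n x x)] fun _ ↦ 0 := by
    have h1 : β =ᶠ[𝓝 x] fun _ ↦ 0 := notMem_tsupport_iff_eventuallyEq.1 hx
    have h2 := (continuousAt_extChartAt_symm (I := 𝓡 n) x)
    rw [ContinuousAt, extChartAt_to_inv] at h2
    exact h2.eventually h1
  have h1 : ∀ j, coordPartial j (inChart (n := n) β x) (coords n x x) = 0 := fun j ↦ by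
    rw [coordPartial_eventuallyEq h0]; simp [coordPartial]
  simp only [dPair, gradPair, h1, inner_zero_right, mul_zero, Finset.sum_const_zero]

lemma invMetric_symm {c : M} {y : EuclideanSpace ℝ (Fin n)} (hy : y ∈ chartTarget n c)
    (i j : Fin n) : invMetric c y i j = invMetric c y j i := by
  obtain ⟨S, hS⟩ := exists_orthoFrame_at hy
  simp only [hS.invMetric_eq, Matrix.mul_apply, Matrix.transpose_apply]
  exact Finset.sum_congr rfl fun a _ ↦ mul_comm _ _

lemma inner_sum_flux {c : M} {ε κ : ℝ} {f : M → EuclideanSpace ℝ (Fin L)}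
    {ψ : EuclideanSpace ℝ (Fin n) → EuclideanSpace ℝ (Fin L)} {y : EuclideanSpace ℝ (Fin n)}
    (hy : y ∈ chartTarget n c) :
    ∑ i, inner ℝ (fluxChart c ε κ f i y) (coordPartial i ψ y) =
      volDensity c y * (e2Chart ε f c y ^ κ * gradPair c (inChart f c) ψ y) := by
  simp only [fluxChart, gradPair, real_inner_smul_left, sum_inner, Finset.mul_sum]
  rw [Finset.sum_comm]
  refine Finset.sum_congr rfl fun i _ ↦ Finset.sum_congr rfl fun j _ ↦ ?_
  rw [invMetric_symm hy j i]
  ring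

variable [MeasurableSpace M] [BorelSpace M] [CompactSpace M]

/-- The divergence in the chart at `c` represents the weak divergence
on test functions supported in the chart domain. -/
lemma integral_inner_divChart {f : M → EuclideanSpace ℝ (Fin L)} (hf : ChartReg n 1 f)
    {ε κ : ℝ} {c : M} (hκ : 0 ≤ κ)
    (hflux : ∀ i, ContDiffOn ℝ 1 (fluxChart c ε κ f i) (chartTarget n c))
    {ψ : M → EuclideanSpace ℝ (Fin L)} (hψ : ChartReg n 1 ψ)
    (hsupp : tsupport ψ ⊆ chartSource n c) :
    ∫ x, inner ℝ (divChart (n := n) c ε κ f x) (ψ x) ∂(riemannianVolume n M) =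
      -∫ x, e2 n ε f x ^ κ * dPair n f ψ x ∂(riemannianVolume n M) := by
  have hψ0 : ∀ x ∉ chartSource n c, ψ x = 0 := fun x hx ↦
    image_eq_zero_of_notMem_tsupport fun h ↦ hx (hsupp h)
  set K : Set (EuclideanSpace ℝ (Fin n)) := coords n c '' tsupport ψ with hKdef
  have hK : IsCompact K := (isClosed_tsupport ψ).isCompact.image_of_continuousOn
    ((continuousOn_extChartAt c).mono hsupp)
  have hKU : K ⊆ chartTarget n c := by
    rintro _ ⟨x, hx, rfl⟩
    exact (extChartAt (𝓡 n) c).map_source (hsupp hx)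
  -- Outside the chart target the coordinate expression of ψ has no meaning, so it is cut off there;
  -- the result is C¹ on the target and vanishes off the compact image of the support.
  set χ : EuclideanSpace ℝ (Fin n) → EuclideanSpace ℝ (Fin L) :=
    (chartTarget n c).indicator (inChart ψ c) with hχ
  have hχeq : EqOn χ (inChart ψ c) (chartTarget n c) := fun y hy ↦ indicator_of_mem hy _
  have hχ0 : ∀ y ∉ K, χ y = 0 := by
    intro y hy
    by_cases hyt : y ∈ chartTarget n c
    · rw [hχeq hyt]
      refine image_eq_zero_of_notMem_tsupport (f := ψ) fun h ↦ hy ⟨_, h, ?_⟩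
      exact (extChartAt (𝓡 n) c).right_inv hyt
    · exact indicator_of_notMem hyt _
  have hχ1 : ContDiffOn ℝ 1 χ (chartTarget n c) := (hψ c).congr hχeq
  have hparts := fun i ↦ integral_inner_coordPartial (isOpen_chartTarget c) hK hKU (hflux i)
    hχ1 hχ0 i
  have hdiv : ContinuousOn (fun x ↦ divChart (n := n) c ε κ f x) (chartSource n c) := by
    have h1 : ContinuousOn (fun y ↦ (volDensity (n := n) c y)⁻¹ •
        ∑ i : Fin n, coordPartial i (fluxChart c ε κ f i) y) (chartTarget n c) :=
      ((contDiffOn_volDensity c).continuousOn.inv₀ fun y hy ↦ (volDensity_pos hy).ne').smul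
        (continuousOn_finsetSum _ fun i _ ↦
          continuousOn_coordPartial (isOpen_chartTarget c) (hflux i) i)
    exact h1.comp (continuousOn_extChartAt c) fun x hx ↦ (extChartAt (𝓡 n) c).map_source hx
  have hleft : ∫ x, inner ℝ (divChart (n := n) c ε κ f x) (ψ x) ∂(riemannianVolume n M) =
      ∫ y, ∑ i, inner ℝ (coordPartial i (fluxChart c ε κ f i) y) (χ y) := by
    rw [← setIntegral_eq_integral_of_forall_compl_eq_zero (s := chartSource n c)
      (fun x hx ↦ by rw [hψ0 x hx, inner_zero_right]), setIntegral_chartSource c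
      ((hdiv.inner hψ.continuous.continuousOn).aestronglyMeasurable
        (measurableSet_chartSource c)),
      ← setIntegral_eq_integral_of_forall_compl_eq_zero (s := chartTarget n c)
      (f := fun y ↦ ∑ i, inner ℝ (coordPartial i (fluxChart c ε κ f i) y) (χ y))
      (fun y hy ↦ Finset.sum_eq_zero fun i _ ↦ by
        rw [hχ0 y (fun h ↦ hy (hKU h)), inner_zero_right])]
    refine setIntegral_congr_fun (measurableSet_chartTarget c) fun y hy ↦ ?_
    have hv := (volDensity_pos hy).ne'
    simp only [divChart, coords, (extChartAt (𝓡 n) c).right_inv hy, real_inner_smul_left,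
      smul_eq_mul, mul_inv_cancel_left₀ hv, sum_inner, hχeq hy]
    rfl
  have hright : ∫ x, e2 n ε f x ^ κ * dPair n f ψ x ∂(riemannianVolume n M) =
      ∫ y, ∑ i, inner ℝ (fluxChart c ε κ f i y) (coordPartial i χ y) := by
    rw [← setIntegral_eq_integral_of_forall_compl_eq_zero (s := chartSource n c)
      (fun x hx ↦ by rw [dPair_eq_zero_of_notMem_tsupport fun h ↦ hx (hsupp h), mul_zero]),
      setIntegral_chartSource c (h := fun x ↦ e2 n ε f x ^ κ * dPair n f ψ x)
      (((continuous_e2_rpow hf ε hκ).mul (hf.chartReg_dPair hψ).continuous).aestronglyMeasurable),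
      ← setIntegral_eq_integral_of_forall_compl_eq_zero (s := chartTarget n c)
      (f := fun y ↦ ∑ i, inner ℝ (fluxChart c ε κ f i y) (coordPartial i χ y))
      (fun y hy ↦ Finset.sum_eq_zero fun i _ ↦ by
        have : χ =ᶠ[𝓝 y] fun _ ↦ 0 := by
          filter_upwards [hK.isClosed.isOpen_compl.mem_nhds fun h ↦ hy (hKU h)] with z hz
            using hχ0 z hz
        rw [coordPartial_eventuallyEq this]
        simp [coordPartial])]
    refine setIntegral_congr_fun (measurableSet_chartTarget c) fun y hy ↦ ?_
    have h1 : χ =ᶠ[𝓝 y] inChart ψ c := by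
      filter_upwards [(isOpen_chartTarget c).mem_nhds hy] with z hz using hχeq hz
    have h2 : ∀ i, coordPartial i χ y = coordPartial i (inChart ψ c) y := fun i ↦
      coordPartial_eventuallyEq h1 i
    simp only [h2]
    rw [inner_sum_flux hy, ← dPair_inChart hf hψ hy, ← e2_inChart hf ε hy]
    rfl
  rw [hleft, hright, integral_finsetSum _ fun i _ ↦ (hparts i).1,
    integral_finsetSum _ fun i _ ↦ (hparts i).2.1, ← Finset.sum_neg_distrib]
  exact Finset.sum_congr rfl fun i _ ↦ (hparts i).2.2

end Divergence

/-! ### Chart independence of the divergence and integration by parts on M. -/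

section GlobalDivergence

variable {n L : ℕ} {M : Type*} [EMetricSpace M] [ChartedSpace (EuclideanSpace ℝ (Fin n)) M]
  [RiemannianBundle (fun x : M ↦ TangentSpace (𝓡 n) x)]
  {V : Type*} [NormedAddCommGroup V] [InnerProductSpace ℝ V]
  [IsManifold (𝓡 n) ∞ M]

lemma chartReg_of_contMDiff {g : M → V} {r : WithTop ℕ∞} (hr : r ≤ ∞)
    (hg : ContMDiff (𝓡 n) 𝓘(ℝ, V) r g) : ChartReg n r g := by
  intro c
  rw [← contMDiffOn_iff_contDiffOn]
  exact hg.comp_contMDiffOn ((contMDiffOn_extChartAt_symm (n := ∞) c).of_le hr)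

lemma coordPartial_sum {ι W : Type*} [NormedAddCommGroup W] [NormedSpace ℝ W] (s : Finset ι)
    {h : ι → EuclideanSpace ℝ (Fin n) → W} {y : EuclideanSpace ℝ (Fin n)}
    (hh : ∀ k ∈ s, DifferentiableAt ℝ (h k) y) (i : Fin n) :
    coordPartial i (fun z ↦ ∑ k ∈ s, h k z) y = ∑ k ∈ s, coordPartial i (h k) y := by
  rw [coordPartial, fderiv_fun_sum hh, sum_apply]
  rfl

lemma dPair_sum_right {ι : Type*} (s : Finset ι) (α : M → V) {β : ι → M → V}
    (hβ : ∀ k ∈ s, ChartReg n 1 (β k)) (x : M) :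
    dPair n α (fun x ↦ ∑ k ∈ s, β k x) x = ∑ k ∈ s, dPair n α (β k) x := by
  have h1 : ∀ j, coordPartial j (inChart (n := n) (fun x ↦ ∑ k ∈ s, β k x) x) (coords n x x) =
      ∑ k ∈ s, coordPartial j (inChart (β k) x) (coords n x x) := fun j ↦
    coordPartial_sum s (fun k hk ↦ (hβ k hk).differentiableAt (mem_extChartAt_target x)) j
  simp only [dPair, gradPair, h1, inner_sum, Finset.mul_sum]
  rw [Finset.sum_comm]
  calc _ = ∑ j, ∑ k ∈ s, ∑ i, invMetric x (coords n x x) i j *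
        inner ℝ (coordPartial i (inChart α x) (coords n x x))
          (coordPartial j (inChart (β k) x) (coords n x x)) :=
        Finset.sum_congr rfl fun j _ ↦ Finset.sum_comm
    _ = _ := by
        rw [Finset.sum_comm]
        exact Finset.sum_congr rfl fun k _ ↦ Finset.sum_comm

lemma ChartReg.smul {r : WithTop ℕ∞} {g : M → ℝ} {ψ : M → V} (hg : ChartReg n r g)
    (hψ : ChartReg n r ψ) : ChartReg n r (fun x ↦ g x • ψ x) := fun c ↦ (hg c).smul (hψ c)

variable [IsContMDiffRiemannianBundle (𝓡 n) ∞ (EuclideanSpace ℝ (Fin n))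
          (fun x : M ↦ TangentSpace (𝓡 n) x)]

lemma continuousOn_divChart {f : M → EuclideanSpace ℝ (Fin L)} {ε κ : ℝ} {c : M}
    (hflux : ∀ i, ContDiffOn ℝ 1 (fluxChart c ε κ f i) (chartTarget n c)) :
    ContinuousOn (fun x ↦ divChart (n := n) c ε κ f x) (chartSource n c) := by
  have h1 : ContinuousOn (fun y ↦ (volDensity (n := n) c y)⁻¹ •
      ∑ i : Fin n, coordPartial i (fluxChart c ε κ f i) y) (chartTarget n c) :=
    ((contDiffOn_volDensity c).continuousOn.inv₀ fun y hy ↦ (volDensity_pos hy).ne').smul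
      (continuousOn_finsetSum _ fun i _ ↦
        continuousOn_coordPartial (isOpen_chartTarget c) (hflux i) i)
  exact h1.comp (continuousOn_extChartAt c) fun x hx ↦ (extChartAt (𝓡 n) c).map_source hx

variable [MeasurableSpace M] [BorelSpace M] [CompactSpace M]

lemma integrable_of_continuous {W : Type*} [NormedAddCommGroup W] {h : M → W}
    (hh : Continuous h) : Integrable h (riemannianVolume n M) :=
  hh.integrable_of_hasCompactSupport (HasCompactSupport.of_compactSpace h)

lemma integrable_inner_divChart {f : M → EuclideanSpace ℝ (Fin L)} {ε κ : ℝ} {c : M}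
    (hflux : ∀ i, ContDiffOn ℝ 1 (fluxChart c ε κ f i) (chartTarget n c))
    {ψ : M → EuclideanSpace ℝ (Fin L)} (hψ : Continuous ψ)
    (hsupp : tsupport ψ ⊆ chartSource n c) :
    Integrable (fun x ↦ inner ℝ (divChart (n := n) c ε κ f x) (ψ x)) (riemannianVolume n M) := by
  refine (integrableOn_iff_integrable_of_support_subset (s := tsupport ψ) fun x hx ↦ ?_).1
    (((continuousOn_divChart hflux).inner hψ.continuousOn).mono hsupp
      |>.integrableOn_compact (isClosed_tsupport ψ).isCompact)
  refine subset_tsupport _ fun h ↦ hx ?_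
  simp [h]

/-- Both expressions represent the same weak divergence on test maps supported in the overlap of the
two charts, and both are continuous there. Since nonempty open sets have positive volume, they agree
pointwise. This replaces a computation with second derivatives of the transition map, which a C¹
flux would make awkward. -/
lemma divChart_eq {f : M → EuclideanSpace ℝ (Fin L)} (hf : ChartReg n 1 f) {ε κ : ℝ}
    (hκ : 0 ≤ κ)
    (hflux : ∀ (c : M) i, ContDiffOn ℝ 1 (fluxChart c ε κ f i) (chartTarget n c))
    {c c' x₀ : M} (hc : x₀ ∈ chartSource n c) (hc' : x₀ ∈ chartSource n c') :
    divChart (n := n) c ε κ f x₀ = divChart (n := n) c' ε κ f x₀ := by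
  set O := chartSource n c ∩ chartSource n c'
  have hO : IsOpen O := (isOpen_chartSource c).inter (isOpen_chartSource c')
  set e := divChart (n := n) c ε κ f x₀ - divChart (n := n) c' ε κ f x₀ with he
  set h : M → ℝ := fun x ↦ inner ℝ (divChart (n := n) c ε κ f x - divChart (n := n) c' ε κ f x) e
  have hcont : ContinuousOn h O :=
    (((continuousOn_divChart (hflux c)).mono inter_subset_left).sub
      ((continuousOn_divChart (hflux c')).mono inter_subset_right)).inner continuousOn_const
  have hae := IsOpen.ae_eq_zero_of_integral_contMDiff_smul_eq_zero (I := 𝓡 n)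
    (μ := riemannianVolume n M) hO
    (hcont.locallyIntegrableOn hO.measurableSet) (fun g hg _ hgs ↦ by
      have hψ : ChartReg n 1 (fun x ↦ g x • e) :=
        ((chartReg_of_contMDiff le_rfl hg).of_le (by simp)).smul fun c ↦ contDiffOn_const
      have hs : tsupport (fun x ↦ g x • e) ⊆ O := (tsupport_smul_subset_left g _).trans hgs
      have h1 := integral_inner_divChart hf hκ (hflux c) hψ (hs.trans inter_subset_left)
      have h2 := integral_inner_divChart hf hκ (hflux c') hψ (hs.trans inter_subset_right)
      have h3 := integral_sub
        (integrable_inner_divChart (hflux c) hψ.continuous (hs.trans inter_subset_left))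
        (integrable_inner_divChart (hflux c') hψ.continuous (hs.trans inter_subset_right))
      rw [h1, h2, sub_self] at h3
      rw [← h3]
      refine integral_congr_ae (Eventually.of_forall fun x ↦ ?_)
      simp only [h, inner_sub_left, real_inner_smul_right, smul_eq_mul]
      ring)
  have heq : EqOn h (fun _ ↦ 0) O := by
    refine Measure.eqOn_open_of_ae_eq (μ := riemannianVolume n M) ?_ hO hcont continuousOn_const
    exact (ae_restrict_iff' hO.measurableSet).2 hae
  have h0 : inner ℝ e e = (0 : ℝ) := heq ⟨hc, hc'⟩
  exact sub_eq_zero.1 (inner_self_eq_zero.1 h0)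

lemma continuous_regNLaplacian {f : M → EuclideanSpace ℝ (Fin L)} (hf : ChartReg n 1 f) {ε : ℝ}
    (hn : 2 ≤ n)
    (hflux : ∀ (c : M) i, ContDiffOn ℝ 1 (fluxChart c ε ((n : ℝ) / 2 - 1) f i)
      (chartTarget n c)) :
    Continuous (regNLaplacian n ε f) := by
  have hκ : (0 : ℝ) ≤ (n : ℝ) / 2 - 1 := by
    have : (2 : ℝ) ≤ n := by exact_mod_cast hn
    linarith
  rw [continuous_iff_continuousAt]
  intro c
  have h1 : ContinuousOn (regNLaplacian n ε f) (chartSource n c) :=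
    (continuousOn_divChart (hflux c)).congr fun x hx ↦
      divChart_eq hf hκ hflux (mem_extChartAt_source x) hx
  exact h1.continuousAt ((isOpen_chartSource c).mem_nhds (mem_extChartAt_source c))

/-- Integration by parts for the regularized `n`-Laplacian on the closed manifold `M`. -/
lemma integral_inner_regNLaplacian {f : M → EuclideanSpace ℝ (Fin L)} (hf : ChartReg n 1 f)
    {ε : ℝ} (hn : 2 ≤ n)
    (hflux : ∀ (c : M) i, ContDiffOn ℝ 1 (fluxChart c ε ((n : ℝ) / 2 - 1) f i)
      (chartTarget n c))
    {ψ : M → EuclideanSpace ℝ (Fin L)} (hψ : ChartReg n 1 ψ) :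
    ∫ x, inner ℝ (regNLaplacian n ε f x) (ψ x) ∂(riemannianVolume n M) =
      -∫ x, e2 n ε f x ^ ((n : ℝ) / 2 - 1) * dPair n f ψ x ∂(riemannianVolume n M) := by
  have hκ : (0 : ℝ) ≤ (n : ℝ) / 2 - 1 := by
    have : (2 : ℝ) ≤ n := by exact_mod_cast hn
    linarith
  obtain ⟨t, ht⟩ := (isCompact_univ (X := M)).elim_nhds_subcover (fun c ↦ chartSource n c)
    fun c _ ↦ (isOpen_chartSource c).mem_nhds (mem_extChartAt_source c)
  -- The test map is split into pieces supported in single charts; on each piece the invariant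
  -- divergence may be replaced by that of the fixed chart.
  obtain ⟨χ, hχ⟩ := SmoothPartitionOfUnity.exists_isSubordinate (𝓡 n) (isClosed_univ (X := M))
    (fun c : t ↦ chartSource n (c : M)) (fun c ↦ isOpen_chartSource _) (fun x hx ↦ by
      obtain ⟨c, hc, hxc⟩ := mem_iUnion₂.1 (ht.2 hx)
      exact mem_iUnion.2 ⟨⟨c, hc⟩, hxc⟩)
  have hsum : ∀ x, ψ x = ∑ c : t, χ c x • ψ x := by
    intro x
    rw [← Finset.sum_smul, ← finsum_eq_sum_of_fintype, χ.sum_eq_one (mem_univ x), one_smul]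
  have hreg : ∀ c : t, ChartReg n 1 (fun x ↦ χ c x • ψ x) := fun c ↦
    ((chartReg_of_contMDiff le_rfl (χ c).contMDiff).of_le (by simp)).smul hψ
  have hs : ∀ c : t, tsupport (fun x ↦ χ c x • ψ x) ⊆ chartSource n (c : M) := fun c ↦
    (tsupport_smul_subset_left _ _).trans (hχ c)
  have hpiece : ∀ c : t, ∫ x, inner ℝ (regNLaplacian n ε f x) (χ c x • ψ x)
        ∂(riemannianVolume n M) = -∫ x, e2 n ε f x ^ ((n : ℝ) / 2 - 1) *
          dPair n f (fun x ↦ χ c x • ψ x) x ∂(riemannianVolume n M) := by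
    intro c
    rw [← integral_inner_divChart hf hκ (hflux c) (hreg c) (hs c)]
    refine integral_congr_ae (Eventually.of_forall fun x ↦ ?_)
    by_cases hx : x ∈ chartSource n (c : M)
    · simp only [regNLaplacian_eq_divChart]
      rw [divChart_eq hf hκ hflux (mem_extChartAt_source x) hx]
    · have : χ c x • ψ x = 0 :=
        image_eq_zero_of_notMem_tsupport (f := fun x ↦ χ c x • ψ x) fun h ↦ hx (hs c h)
      simp only [this, inner_zero_right]
  have hψ' : ψ = fun x ↦ ∑ c : t, χ c x • ψ x := funext hsum
  calc ∫ x, inner ℝ (regNLaplacian n ε f x) (ψ x) ∂(riemannianVolume n M)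
      = ∫ x, ∑ c : t, inner ℝ (regNLaplacian n ε f x) (χ c x • ψ x)
          ∂(riemannianVolume n M) := by
        refine integral_congr_ae (Eventually.of_forall fun x ↦ ?_)
        simp only [← inner_sum, ← hsum]
    _ = ∑ c : t, ∫ x, inner ℝ (regNLaplacian n ε f x) (χ c x • ψ x)
          ∂(riemannianVolume n M) :=
        integral_finsetSum _ fun c _ ↦ integrable_of_continuous
          ((continuous_regNLaplacian hf hn hflux).inner (hreg c).continuous)
    _ = -∑ c : t, ∫ x, e2 n ε f x ^ ((n : ℝ) / 2 - 1) *
          dPair n f (fun x ↦ χ c x • ψ x) x ∂(riemannianVolume n M) := by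
        rw [← Finset.sum_neg_distrib]
        exact Finset.sum_congr rfl fun c _ ↦ hpiece c
    _ = -∫ x, ∑ c : t, e2 n ε f x ^ ((n : ℝ) / 2 - 1) *
          dPair n f (fun x ↦ χ c x • ψ x) x ∂(riemannianVolume n M) := by
        congr 1
        exact (integral_finsetSum _ fun c _ ↦ integrable_of_continuous
          ((continuous_e2_rpow hf ε hκ).mul (hf.chartReg_dPair (hreg c)).continuous)).symm
    _ = _ := by
        congr 1
        refine integral_congr_ae (Eventually.of_forall fun x ↦ ?_)
        simp only []
        rw [← Finset.mul_sum, ← dPair_sum_right _ f (fun c _ ↦ hreg c), ← hψ']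

end GlobalDivergence

/-! ### The target N: tangent projection and second fundamental form. -/

section TargetGeometry

variable {L : ℕ} {N : Set (EuclideanSpace ℝ (Fin L))}

lemma mem_tangentConeAt_of_hasDerivAt {γ : ℝ → EuclideanSpace ℝ (Fin L)}
    {v : EuclideanSpace ℝ (Fin L)} {t : ℝ} (hγ : HasDerivAt γ v t) (hN : ∀ᶠ s in 𝓝 t, γ s ∈ N) :
    v ∈ tangentConeAt ℝ N (γ t) := by
  have h1 := (hγ.hasFDerivAt.hasFDerivWithinAt (s := γ ⁻¹' N)).mapsTo_tangent_cone
  rw [tangentConeAt_of_mem_nhds (show γ ⁻¹' N ∈ 𝓝 t from hN)] at h1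
  have h2 := h1 (mem_univ (1 : ℝ))
  exact tangentConeAt_mono (image_preimage_subset _ _) (by simpa using h2)

lemma mem_tangentSub_of_hasDerivAt {γ : ℝ → EuclideanSpace ℝ (Fin L)}
    {v : EuclideanSpace ℝ (Fin L)} {t : ℝ} (hγ : HasDerivAt γ v t) (hN : ∀ᶠ s in 𝓝 t, γ s ∈ N) :
    v ∈ tangentSub N (γ t) :=
  Submodule.subset_span (mem_tangentConeAt_of_hasDerivAt hγ hN)

lemma tangentProj_of_mem {y v : EuclideanSpace ℝ (Fin L)} (hv : v ∈ tangentSub N y) :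
    tangentProj N y v = v := Submodule.starProjection_eq_self_iff.2 hv

/-- The coordinate subspace `ℝᵈ × {0}`. -/
def coordSubspace (L d : ℕ) : Submodule ℝ (EuclideanSpace ℝ (Fin L)) where
  carrier := {x | ∀ i : Fin L, d ≤ (i : ℕ) → x i = 0}
  add_mem' := fun hx hy i hi ↦ by simp [hx i hi, hy i hi]
  zero_mem' := fun i _ ↦ rfl
  smul_mem' := fun c x hx i hi ↦ by simp [hx i hi]

section Straightening

variable {d : ℕ} {Φ : OpenPartialHomeomorph (EuclideanSpace ℝ (Fin L)) (EuclideanSpace ℝ (Fin L))}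
  (hΦ : ContDiffOn ℝ ∞ Φ Φ.source) (hΦs : ContDiffOn ℝ ∞ Φ.symm Φ.target)
  (hN : ∀ z ∈ Φ.source, z ∈ N ↔ ∀ i : Fin L, d ≤ (i : ℕ) → Φ z i = 0)

include hΦ hΦs in
lemma fderiv_symm_comp_fderiv {z : EuclideanSpace ℝ (Fin L)} (hz : z ∈ Φ.source) :
    DifferentiableAt ℝ Φ z ∧ DifferentiableAt ℝ Φ.symm (Φ z) ∧
      (∀ v, fderiv ℝ Φ.symm (Φ z) (fderiv ℝ Φ z v) = v) ∧
      (∀ v, fderiv ℝ Φ z (fderiv ℝ Φ.symm (Φ z) v) = v) := by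
  have h1 : DifferentiableAt ℝ Φ z :=
    (hΦ.contDiffAt (Φ.open_source.mem_nhds hz)).differentiableAt (by simp)
  have h2 : DifferentiableAt ℝ Φ.symm (Φ z) :=
    (hΦs.contDiffAt (Φ.open_target.mem_nhds (Φ.map_source hz))).differentiableAt (by simp)
  refine ⟨h1, h2, fun v ↦ ?_, fun v ↦ ?_⟩
  · have h3 : HasFDerivAt (Φ.symm ∘ Φ) (ContinuousLinearMap.id ℝ _) z :=
      (hasFDerivAt_id z).congr_of_eventuallyEq (by
        filter_upwards [Φ.open_source.mem_nhds hz] with w hw using Φ.left_inv hw)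
    exact congrArg (fun A : _ →L[ℝ] _ ↦ A v) ((h2.hasFDerivAt.comp z h1.hasFDerivAt).unique h3)
  · have h3 : HasFDerivAt (Φ ∘ Φ.symm) (ContinuousLinearMap.id ℝ _) (Φ z) :=
      (hasFDerivAt_id _).congr_of_eventuallyEq (by
        filter_upwards [Φ.open_target.mem_nhds (Φ.map_source hz)] with w hw
          using Φ.right_inv hw)
    have h4 : DifferentiableAt ℝ Φ (Φ.symm (Φ z)) := by rwa [Φ.left_inv hz]
    have h5 := (h4.hasFDerivAt.comp (Φ z) h2.hasFDerivAt).unique h3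
    rw [Φ.left_inv hz] at h5
    exact congrArg (fun A : _ →L[ℝ] _ ↦ A v) h5

include hΦ hΦs hN in
-- One inclusion: the last components of Φ vanish on N, so their derivatives kill the tangent cone.
-- The other: straight lines in ℝᵈ × {0} pull back under Φ to curves in N with the required
-- velocity.
lemma tangentSub_eq_map {z : EuclideanSpace ℝ (Fin L)} (hz : z ∈ Φ.source) (hzN : z ∈ N) :
    tangentSub N z = (coordSubspace L d).map
      (fderiv ℝ Φ.symm (Φ z) : EuclideanSpace ℝ (Fin L) →ₗ[ℝ] EuclideanSpace ℝ (Fin L)) := by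
  obtain ⟨h1, h2, h3, h4⟩ := fderiv_symm_comp_fderiv hΦ hΦs hz
  refine le_antisymm (Submodule.span_le.2 fun v hv ↦ ?_) ?_
  · refine Submodule.mem_map.2 ⟨fderiv ℝ Φ z v, fun i hi ↦ ?_, h3 v⟩
    let pr : EuclideanSpace ℝ (Fin L) →L[ℝ] ℝ := PiLp.proj 2 (fun _ : Fin L ↦ ℝ) i
    have h5 : HasFDerivWithinAt (fun w ↦ pr (Φ w)) (pr.comp (fderiv ℝ Φ z)) N z :=
      (pr.hasFDerivAt.comp z h1.hasFDerivAt).hasFDerivWithinAt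
    have h6 : HasFDerivWithinAt (fun w ↦ pr (Φ w)) (0 : EuclideanSpace ℝ (Fin L) →L[ℝ] ℝ) N z := by
      refine HasFDerivWithinAt.congr_of_eventuallyEq (f := fun _ ↦ (0 : ℝ))
        (hasFDerivWithinAt_const _ _ _) ?_ ?_
      · filter_upwards [self_mem_nhdsWithin,
          mem_nhdsWithin_of_mem_nhds (Φ.open_source.mem_nhds hz)] with w hwN hw
        exact (hN w hw).1 hwN i hi
      · exact (hN z hz).1 hzN i hi
    exact h5.unique_on h6 hv
  · rintro _ ⟨w, hw, rfl⟩
    let γ : ℝ → EuclideanSpace ℝ (Fin L) := fun s ↦ Φ.symm (Φ z + s • w)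
    have hl : HasDerivAt (fun s : ℝ ↦ Φ z + s • w) w 0 := by
      simpa using ((hasDerivAt_id (0 : ℝ)).smul_const w).const_add (Φ z)
    have hγ0 : γ 0 = z := by simp [γ, Φ.left_inv hz]
    have hγ : HasDerivAt γ (fderiv ℝ Φ.symm (Φ z) w) 0 := by
      have h2' : HasFDerivAt Φ.symm (fderiv ℝ Φ.symm (Φ z)) (Φ z + (0 : ℝ) • w) := by
        simpa using h2.hasFDerivAt
      exact h2'.comp_hasDerivAt 0 hl
    have hev : ∀ᶠ s in 𝓝 (0 : ℝ), γ s ∈ N := by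
      have : ∀ᶠ s in 𝓝 (0 : ℝ), Φ z + s • w ∈ Φ.target :=
        hl.continuousAt.eventually (Φ.open_target.mem_nhds (by simpa using Φ.map_source hz))
      filter_upwards [this] with s hs
      rw [hN _ (Φ.map_target hs)]
      intro i hi
      rw [Φ.right_inv hs]
      simp [(hN z hz).1 hzN i hi, hw i hi]
    have := mem_tangentSub_of_hasDerivAt hγ hev
    rwa [hγ0] at this

end Straightening

/-- The orthogonal projection onto the range of an injective map is `A (A* A)⁻¹ A*`. -/
lemma starProjection_range {W H : Type*} [NormedAddCommGroup W] [InnerProductSpace ℝ W]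
    [FiniteDimensional ℝ W] [NormedAddCommGroup H] [InnerProductSpace ℝ H]
    [FiniteDimensional ℝ H] {A : W →L[ℝ] H} (hA : Function.Injective A) (K : Submodule ℝ H)
    (hK : ∀ v, v ∈ K ↔ ∃ w, A w = v) :
    IsUnit ((ContinuousLinearMap.adjoint A).comp A) ∧
    K.starProjection = A.comp ((Ring.inverse ((ContinuousLinearMap.adjoint A).comp A)).comp
      (ContinuousLinearMap.adjoint A)) := by
  set G : W →L[ℝ] W := (ContinuousLinearMap.adjoint A).comp A with hG
  have hinj : Function.Injective G := by
    rw [injective_iff_map_eq_zero]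
    intro w hw
    have h1 : inner ℝ (A w) (A w) = (0 : ℝ) := by
      rw [← ContinuousLinearMap.adjoint_inner_right A w (A w)]
      have : ContinuousLinearMap.adjoint A (A w) = 0 := hw
      rw [this, inner_zero_right]
    exact hA ((inner_self_eq_zero.1 h1).trans (map_zero A).symm)
  have hu : IsUnit G := by
    rw [ContinuousLinearMap.isUnit_iff_bijective]
    exact ⟨hinj, (LinearMap.injective_iff_surjective (f := (G : W →ₗ[ℝ] W))).1 hinj⟩
  refine ⟨hu, ?_⟩
  ext1 v
  have hGi : ∀ w, G (Ring.inverse G w) = w := fun w ↦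
    congrArg (fun B : W →L[ℝ] W ↦ B w) (Ring.mul_inverse_cancel G hu)
  symm
  refine (Submodule.eq_starProjection_of_mem_of_inner_eq_zero ?_ ?_).symm
  · exact (hK _).2 ⟨_, rfl⟩
  · intro z hz
    obtain ⟨w, rfl⟩ := (hK z).1 hz
    rw [← ContinuousLinearMap.adjoint_inner_left A w, map_sub]
    have : ContinuousLinearMap.adjoint A (A (Ring.inverse G (ContinuousLinearMap.adjoint A v))) =
        ContinuousLinearMap.adjoint A v := hGi _
    simp only [ContinuousLinearMap.comp_apply, this, sub_self, inner_zero_left]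

lemma differentiableAt_proj_formula {X W H : Type*} [NormedAddCommGroup X] [NormedSpace ℝ X]
    [NormedAddCommGroup W] [InnerProductSpace ℝ W]
    [FiniteDimensional ℝ W] [NormedAddCommGroup H] [InnerProductSpace ℝ H]
    [FiniteDimensional ℝ H] {A : X → W →L[ℝ] H} {y : X} (hAd : DifferentiableAt ℝ A y)
    (hu : IsUnit ((ContinuousLinearMap.adjoint (A y)).comp (A y))) :
    DifferentiableAt ℝ (fun z ↦ (A z).comp
      ((Ring.inverse ((ContinuousLinearMap.adjoint (A z)).comp (A z))).comp
      (ContinuousLinearMap.adjoint (A z)))) y := by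
  have hadj : DifferentiableAt ℝ (fun z ↦ ContinuousLinearMap.adjoint (A z)) y := by
    have : IsBoundedLinearMap ℝ (fun B : W →L[ℝ] H ↦ ContinuousLinearMap.adjoint B) :=
      ⟨⟨fun B C ↦ map_add _ B C, fun c B ↦ by simp⟩, 1, one_pos, fun B ↦ by simp⟩
    exact this.differentiableAt.comp y hAd
  have hmul : DifferentiableAt ℝ (fun z ↦ (ContinuousLinearMap.adjoint (A z)).comp (A z)) y :=
    hadj.clm_comp hAd
  have hinv : DifferentiableAt ℝ
      (fun z ↦ Ring.inverse ((ContinuousLinearMap.adjoint (A z)).comp (A z))) y := by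
    obtain ⟨G, hG⟩ := hu
    have h1 : DifferentiableAt ℝ (Ring.inverse : (W →L[ℝ] W) → (W →L[ℝ] W))
        ((ContinuousLinearMap.adjoint (A y)).comp (A y)) := by
      rw [← hG]
      exact (contDiffAt_ringInverse (n := 1) ℝ G).differentiableAt (by simp)
    exact h1.comp y hmul
  exact hAd.clm_comp (hinv.clm_comp hadj)

/-- Along N the projection is A(A*A)⁻¹A* for the derivative A of the inverse straightening map,
restricted to ℝᵈ. This expression makes sense near the point in the ambient space and is
differentiable there, so the projection is differentiable within N. -/
lemma IsEmbeddedSubmanifold.differentiableWithinAt (h : IsEmbeddedSubmanifold N)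
    {y : EuclideanSpace ℝ (Fin L)} (hy : y ∈ N) :
    DifferentiableWithinAt ℝ (tangentProj N) N y := by
  obtain ⟨d, hd⟩ := h
  obtain ⟨Φ, hyΦ, hΦ, hΦs, hN⟩ := hd y hy
  let A : EuclideanSpace ℝ (Fin L) → coordSubspace L d →L[ℝ] EuclideanSpace ℝ (Fin L) := fun z ↦
    (fderiv ℝ Φ.symm (Φ z)).comp (coordSubspace L d).subtypeL
  have hAinj : ∀ z ∈ Φ.source, Function.Injective (A z) := by
    intro z hz u v huv
    have h4 := (fderiv_symm_comp_fderiv hΦ hΦs hz).2.2.2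
    have h5 := congrArg (fderiv ℝ Φ z) huv
    have h6 : ∀ u : coordSubspace L d, fderiv ℝ Φ z (A z u) = u := fun u ↦ h4 u
    rw [h6, h6] at h5
    exact Subtype.ext h5
  have hAd : DifferentiableAt ℝ A y := by
    have h1 : DifferentiableAt ℝ (fderiv ℝ Φ.symm) (Φ y) :=
      ((hΦs.contDiffAt (Φ.open_target.mem_nhds (Φ.map_source hyΦ))).fderiv_right
        (m := ∞) (by simp)).differentiableAt (by simp)
    have h2 : DifferentiableAt ℝ (fun z ↦ fderiv ℝ Φ.symm (Φ z)) y :=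
      h1.comp y (fderiv_symm_comp_fderiv hΦ hΦs hyΦ).1
    exact h2.clm_comp (differentiableAt_const _)
  have hK : ∀ z ∈ Φ.source, z ∈ N → ∀ v, v ∈ tangentSub N z ↔ ∃ w, A z w = v := by
    intro z hz hzN v
    rw [tangentSub_eq_map hΦ hΦs hN hz hzN, Submodule.mem_map]
    exact ⟨fun ⟨w, hw, h⟩ ↦ ⟨⟨w, hw⟩, h⟩, fun ⟨w, h⟩ ↦ ⟨w, w.2, h⟩⟩
  have hproj := fun z hz hzN ↦ (starProjection_range (hAinj z hz) _ (hK z hz hzN)).2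
  have hd := differentiableAt_proj_formula hAd
    (starProjection_range (hAinj y hyΦ) _ (hK y hyΦ hy)).1
  refine (hd.differentiableWithinAt (s := N)).congr_of_eventuallyEq ?_ (hproj y hyΦ hy)
  filter_upwards [self_mem_nhdsWithin,
    mem_nhdsWithin_of_mem_nhds (Φ.open_source.mem_nhds hyΦ)] with z hzN hz using hproj z hz hzN

variable (hemb : IsEmbeddedSubmanifold N)

include hemb in
-- Differentiate P∘P = P along N: P'P + PP' = P'. Applied to w = Pw this leaves P P' w = 0. The
-- identity holds first for directions in the tangent cone and extends to its span by linearity.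
lemma tangentProj_secondFF {y v w : EuclideanSpace ℝ (Fin L)} (hy : y ∈ N)
    (hv : v ∈ tangentSub N y) (hw : w ∈ tangentSub N y) :
    tangentProj N y (secondFF N y v w) = 0 := by
  have hP := (hemb.differentiableWithinAt hy).hasFDerivWithinAt
  have h2 := hP.clm_comp hP
  have hidem : ∀ z, (tangentProj N z).comp (tangentProj N z) = tangentProj N z := fun z ↦ by
    ext1 u
    exact tangentProj_of_mem (Submodule.starProjection_apply_mem _ _)
  have heq := (h2.congr (fun z _ ↦ (hidem z).symm) (hidem y).symm).unique_on hP
  have hv' := LinearMap.eqOn_span (f := ContinuousLinearMap.toLinearMap _)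
    (g := ContinuousLinearMap.toLinearMap _) heq hv
  have h3 := congrArg (fun B : _ →L[ℝ] _ ↦ B w) hv'
  simp [tangentProj_of_mem hw] at h3
  simp [secondFF, h3]

include hemb in
/-- The normal part of the second derivative of a curve in `N`. -/
lemma inner_deriv_deriv_curve {γ γ' : ℝ → EuclideanSpace ℝ (Fin L)}
    {a B : EuclideanSpace ℝ (Fin L)} {t : ℝ} (hγ : ∀ᶠ s in 𝓝 t, HasDerivAt γ (γ' s) s)
    (hγ' : HasDerivAt γ' a t) (hN : ∀ᶠ s in 𝓝 t, γ s ∈ N)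
    (hB : tangentProj N (γ t) B = 0) :
    inner ℝ B a = -inner ℝ B (secondFF N (γ t) (γ' t) (γ' t)) := by
  have hP := (hemb.differentiableWithinAt hN.self_of_nhds).hasFDerivWithinAt
  have h1 : HasDerivAt (fun s ↦ tangentProj N (γ s))
      (fderivWithin ℝ (tangentProj N) N (γ t) (γ' t)) t := by
    have h2 := hP.comp_hasDerivWithinAt (s := γ ⁻¹' N) t
      hγ.self_of_nhds.hasDerivWithinAt (mapsTo_preimage _ _)
    exact h2.hasDerivAt hN
  have h2 : HasDerivAt (fun s ↦ tangentProj N (γ s) (γ' s)) _ t := h1.clm_apply hγ'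
  -- The velocity stays tangent, Pγ' = γ'. Differentiating, a = (D_{γ'}P)γ' + Pa, and pairing with
  -- the normal vector B removes Pa.
  have h3 : (fun s ↦ tangentProj N (γ s) (γ' s)) =ᶠ[𝓝 t] γ' := by
    filter_upwards [hγ, hN.eventually_nhds] with s hs hsN
    exact tangentProj_of_mem (mem_tangentSub_of_hasDerivAt hs hsN)
  have h4 := (h2.congr_of_eventuallyEq h3.symm).unique hγ'
  have h5 : inner ℝ B (tangentProj N (γ t) a) = (0 : ℝ) := by
    have := Submodule.inner_starProjection_left_eq_right (tangentSub N (γ t)) B a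
    rw [tangentProj] at hB ⊢
    rw [← this, hB, inner_zero_left]
  rw [← h4, inner_add_right, h5, secondFF, inner_neg_right]
  simp

end TargetGeometry

/-! ### Coercivity of the linearized flux against the test map |v|^{2μ} v. -/

section Coercivity

variable {n : ℕ} {V : Type*} [NormedAddCommGroup V] [InnerProductSpace ℝ V]

/-- `powFluxDeriv 0 μ v` applied to each component. -/
def fluxComp (μ : ℝ) (v : V) (r : PiLp 2 (fun _ : Fin n ↦ V)) : PiLp 2 (fun _ : Fin n ↦ V) :=
  WithLp.toLp 2 fun a ↦ powFluxDeriv 0 μ v (r a)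

lemma fluxComp_eq (μ : ℝ) (v : V) (r : PiLp 2 (fun _ : Fin n ↦ V)) :
    fluxComp μ v r = (‖v‖ ^ 2) ^ μ • r +
      (2 * μ * (‖v‖ ^ 2) ^ (μ - 1)) • WithLp.toLp 2 fun a ↦ inner ℝ v (r a) • v := by
  ext a
  simp [fluxComp, powFluxDeriv_apply, smul_smul]

lemma norm_fluxComp_le {μ : ℝ} (hμ : 0 ≤ μ) (v : V) (r : PiLp 2 (fun _ : Fin n ↦ V)) :
    ‖fluxComp μ v r‖ ≤ (1 + 2 * μ) * (‖v‖ ^ 2) ^ μ * ‖r‖ := by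
  have h0 : 0 ≤ (1 + 2 * μ) * (‖v‖ ^ 2) ^ μ := by positivity
  rw [← abs_of_nonneg (norm_nonneg (fluxComp μ v r)),
    ← abs_of_nonneg (mul_nonneg h0 (norm_nonneg r)), ← sq_le_sq, mul_pow,
    PiLp.norm_sq_eq_of_L2, PiLp.norm_sq_eq_of_L2, Finset.mul_sum]
  refine Finset.sum_le_sum fun a _ ↦ ?_
  rw [← mul_pow]
  refine pow_le_pow_left₀ (norm_nonneg _) ?_ 2
  have := norm_powFluxDeriv_le (le_refl (0 : ℝ)) hμ v
  rw [zero_add] at this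
  exact ((powFluxDeriv 0 μ v).le_opNorm (r a)).trans (by gcongr)

/-- Besides the leading term, the product contains two nonnegative terms, one from each radial part,
and one mixed term of undetermined sign. By Cauchy-Schwarz the mixed term is dominated by the two
others as soon as κμ ≤ 1. With κ = n/2 - 1 this is where the restrictions n ≤ 4 and μ ≤ 1 come from.
-/
lemma coercive_flux {ε κ μ : ℝ} (hε : 0 ≤ ε) (hκ0 : 0 ≤ κ) (hκ : κ ≤ 1) (hμ0 : 0 ≤ μ)
    (hμ : μ ≤ 1) (p r : PiLp 2 (fun _ : Fin n ↦ V)) (v : V) :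
    (ε + ‖p‖ ^ 2) ^ κ * (‖v‖ ^ 2) ^ μ * ‖r‖ ^ 2 ≤
      inner ℝ (powFluxDeriv ε κ p r) (fluxComp μ v r) := by
  set s : PiLp 2 (fun _ : Fin n ↦ V) := WithLp.toLp 2 fun a ↦ inner ℝ v (r a) • v with hs
  set Q : ℝ := ∑ a, inner ℝ v (r a) ^ 2 with hQ
  have hQ0 : 0 ≤ Q := Finset.sum_nonneg fun a _ ↦ sq_nonneg _
  have hrs : inner ℝ r s = Q := by
    rw [hQ, PiLp.inner_apply]
    refine Finset.sum_congr rfl fun a _ ↦ ?_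
    simp only [hs, real_inner_smul_right, real_inner_comm v (r a)]
    ring
  have hps : inner ℝ p s ^ 2 ≤ Q * (‖v‖ ^ 2 * ‖p‖ ^ 2) := by
    have h1 : inner ℝ p s = ∑ a, inner ℝ v (r a) * inner ℝ v (p a) := by
      rw [PiLp.inner_apply]
      refine Finset.sum_congr rfl fun a _ ↦ ?_
      simp only [hs, real_inner_smul_right, real_inner_comm v (p a)]
    rw [h1]
    refine (Finset.sum_mul_sq_le_sq_mul_sq _ _ _).trans ?_
    rw [PiLp.norm_sq_eq_of_L2, Finset.mul_sum _ _ (‖v‖ ^ 2)]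
    refine mul_le_mul_of_nonneg_left (Finset.sum_le_sum fun a _ ↦ ?_) hQ0
    rw [← mul_pow, sq_le_sq, abs_of_nonneg (by positivity : 0 ≤ ‖v‖ * ‖p a‖)]
    exact abs_real_inner_le_norm _ _
  have hexp : inner ℝ (powFluxDeriv ε κ p r) (fluxComp μ v r) =
      (ε + ‖p‖ ^ 2) ^ κ * ((‖v‖ ^ 2) ^ μ * ‖r‖ ^ 2 + 2 * μ * (‖v‖ ^ 2) ^ (μ - 1) * Q) +
      2 * κ * (ε + ‖p‖ ^ 2) ^ (κ - 1) * inner ℝ p r *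
        ((‖v‖ ^ 2) ^ μ * inner ℝ p r + 2 * μ * (‖v‖ ^ 2) ^ (μ - 1) * inner ℝ p s) := by
    rw [powFluxDeriv_apply, fluxComp_eq]
    simp only [inner_add_left, inner_add_right, real_inner_smul_left, real_inner_smul_right,
      ← hs, hrs, real_inner_self_eq_norm_sq]
    ring
  have he0 : 0 ≤ ε + ‖p‖ ^ 2 := by positivity
  rw [hexp]
  rcases hκ0.eq_or_lt with rfl | hκ0'
  · have : 0 ≤ 2 * μ * (‖v‖ ^ 2) ^ (μ - 1) * Q := by positivity
    simp only [Real.rpow_zero, mul_zero, zero_mul]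
    linarith
  rcases hμ0.eq_or_lt with rfl | hμ0'
  · have : 0 ≤ 2 * κ * (ε + ‖p‖ ^ 2) ^ (κ - 1) * inner ℝ p r * inner ℝ p r := by
      rw [mul_assoc]; exact mul_nonneg (by positivity) (mul_self_nonneg _)
    simp only [Real.rpow_zero, mul_zero, zero_mul, one_mul, add_zero, mul_one]
    linarith
  rcases he0.eq_or_lt with h0 | h0
  · have hp : ‖p‖ = 0 := by
      have : ‖p‖ ^ 2 = 0 := by nlinarith [sq_nonneg ‖p‖]
      simpa using this
    rw [← h0, Real.zero_rpow hκ0'.ne', norm_eq_zero.1 hp]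
    simp
  rcases (sq_nonneg ‖v‖).eq_or_lt with hv | hv
  · have hv' : v = 0 := by simpa using hv.symm
    have hQz : Q = 0 := by simp [hQ, hv']
    have hsz : s = 0 := by ext a; simp [hs, hv']
    rw [hQz, hsz, ← hv, Real.zero_rpow hμ0'.ne']
    simp
  · set e := ε + ‖p‖ ^ 2
    set V2 := ‖v‖ ^ 2
    have e1 : e ^ κ = e ^ (κ - 1) * e := by rw [Real.rpow_sub_one h0.ne']; field_simp
    have e2 : V2 ^ μ = V2 ^ (μ - 1) * V2 := by rw [Real.rpow_sub_one hv.ne']; field_simp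
    set P := inner ℝ p r
    set R := inner ℝ p s
    have hR : R ^ 2 ≤ Q * (V2 * e) := hps.trans (by
      gcongr; simp only [e]; linarith)
    -- Multiply by |v|² and complete the square in V2 · P + μR; what remains is a multiple of (1 -
    -- κμ) R².
    have key : 0 ≤ 2 * μ * e * Q + 2 * κ * V2 * P ^ 2 + 4 * κ * μ * P * R := by
      have h1 : μ * R ^ 2 ≤ μ * (Q * (V2 * e)) := by gcongr
      have h2 : 0 ≤ V2 * (2 * μ * e * Q + 2 * κ * V2 * P ^ 2 + 4 * κ * μ * P * R) := by
        have h3 : 0 ≤ 2 * κ * (V2 * P + μ * R) ^ 2 := by positivity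
        have h4 : 0 ≤ 2 * μ * R ^ 2 * (1 - κ * μ) := by
          have : κ * μ ≤ 1 := by nlinarith
          have : 0 ≤ 1 - κ * μ := by linarith
          positivity
        nlinarith
      exact nonneg_of_mul_nonneg_right h2 hv
    have h5 : 0 ≤ e ^ (κ - 1) * V2 ^ (μ - 1) *
      (2 * μ * e * Q + 2 * κ * V2 * P ^ 2 + 4 * κ * μ * P * R) := by positivity
    rw [e1, e2]
    linarith

end Coercivity

/-! ### Time derivatives of differentials. -/

section TimeDerivatives

variable {n L : ℕ} {M : Type*} [EMetricSpace M] [ChartedSpace (EuclideanSpace ℝ (Fin n)) M]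
  {V : Type*} [NormedAddCommGroup V] [InnerProductSpace ℝ V]

/-- Symmetry of the second derivative of the flow on the space-time cylinder. -/
lemma FlowReg.hasDerivAt_coordPartial {T : ℝ} {k : ℝ → M → V} (h : FlowReg n T 2 k)
    {c : M} {z : ℝ × EuclideanSpace ℝ (Fin n)} (hz : z ∈ Ioo 0 T ×ˢ chartTarget n c) (i : Fin n) :
    HasDerivAt (fun t ↦ coordPartial i (inChart (k t) c) z.2)
      (coordPartial i (inChart (fun x ↦ deriv (fun s ↦ k s x) z.1) c) z.2) z.1 := by
  set g : ℝ × EuclideanSpace ℝ (Fin n) → V := fun z ↦ inChart (k z.1) c z.2 with hg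
  have hmem := (isOpen_cylinder T c).mem_nhds hz
  have hc : ContDiffAt ℝ 2 g z := (h c).contDiffAt hmem
  have h1 : DifferentiableAt ℝ (fderiv ℝ g) z :=
    (hc.fderiv_right (m := 1) (by norm_num)).differentiableAt (by simp)
  have hsymm := hc.isSymmSndFDerivAt (by simp) (1, 0) (0, EuclideanSpace.single i 1)
  have hk1 : FlowReg n T 1 k := h.of_le (by norm_num)
  have h2 : HasDerivAt (fun t ↦ fderiv ℝ g (t, z.2) (0, EuclideanSpace.single i 1))
      (fderiv ℝ (fderiv ℝ g) z (1, 0) (0, EuclideanSpace.single i 1)) z.1 := by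
    have h3 : HasDerivAt (fun t ↦ fderiv ℝ g (t, z.2)) (fderiv ℝ (fderiv ℝ g) z (1, 0)) z.1 := by
      have h4 := (HasFDerivAt.comp z.1 (f := fun t ↦ (t, z.2)) h1.hasFDerivAt
        (hasFDerivAt_prodMk_left z.1 z.2)).hasDerivAt
      simpa [Function.comp_def] using h4
    simpa using h3.clm_apply (hasDerivAt_const z.1 ((0 : ℝ), EuclideanSpace.single i (1 : ℝ)))
  have h5 : HasFDerivAt (fun y ↦ fderiv ℝ g (z.1, y) (1, 0))
      (((ContinuousLinearMap.apply ℝ V ((1 : ℝ), (0 : EuclideanSpace ℝ (Fin n)))).comp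
        (fderiv ℝ (fderiv ℝ g) z)).comp
        (ContinuousLinearMap.inr ℝ ℝ (EuclideanSpace ℝ (Fin n)))) z.2 := by
    have h6 : HasFDerivAt (fderiv ℝ g) (fderiv ℝ (fderiv ℝ g) z) (z.1, z.2) := h1.hasFDerivAt
    exact (ContinuousLinearMap.apply ℝ V ((1 : ℝ), (0 : EuclideanSpace ℝ (Fin n)))).hasFDerivAt.comp
      z.2 (h6.comp z.2 (hasFDerivAt_prodMk_right z.1 z.2))
  have h7 : inChart (n := n) (fun x ↦ deriv (fun s ↦ k s x) z.1) c =ᶠ[𝓝 z.2]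
      fun y ↦ fderiv ℝ g (z.1, y) (1, 0) := by
    filter_upwards [(isOpen_chartTarget c).mem_nhds hz.2] with y hy
    exact (hk1.hasDerivAt_inChart (z := (z.1, y)) ⟨hz.1, hy⟩).deriv
  have h8 : coordPartial i (inChart (fun x ↦ deriv (fun s ↦ k s x) z.1) c) z.2 =
      fderiv ℝ (fderiv ℝ g) z (1, 0) (0, EuclideanSpace.single i 1) := by
    rw [coordPartial_eventuallyEq h7, coordPartial, h5.fderiv, hsymm]
    simp
  rw [h8]
  refine h2.congr_of_eventuallyEq ?_
  filter_upwards [isOpen_Ioo.mem_nhds hz.1] with t ht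
  exact hk1.coordPartial_eq (z := (t, z.2)) ⟨ht, hz.2⟩ i

lemma FlowReg.hasDerivAt_frameGrad {T : ℝ} {k : ℝ → M → V} (h : FlowReg n T 2 k)
    {c : M} {z : ℝ × EuclideanSpace ℝ (Fin n)} (hz : z ∈ Ioo 0 T ×ˢ chartTarget n c)
    (S : EuclideanSpace ℝ (Fin n) → Matrix (Fin n) (Fin n) ℝ) :
    HasDerivAt (fun t ↦ frameGrad S (inChart (k t) c) z.2)
      (frameGrad S (inChart (fun x ↦ deriv (fun s ↦ k s x) z.1) c) z.2) z.1 := by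
  have h1 : HasDerivAt (fun t a ↦ frameDeriv S a (inChart (k t) c) z.2)
      (fun a ↦ frameDeriv S a (inChart (fun x ↦ deriv (fun s ↦ k s x) z.1) c) z.2) z.1 := by
    rw [hasDerivAt_pi]
    intro a
    exact HasDerivAt.fun_sum fun i _ ↦ (h.hasDerivAt_coordPartial hz i).const_smul _
  exact ((PiLp.continuousLinearEquiv 2 ℝ (fun _ : Fin n ↦ V)).symm.toContinuousLinearMap.hasFDerivAt
    |>.comp_hasDerivAt z.1 h1)

lemma frameGrad_comp {W : Type*} [NormedAddCommGroup W] [InnerProductSpace ℝ W] {μ : ℝ}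
    (hμ : 0 ≤ μ) {h : EuclideanSpace ℝ (Fin n) → W} {y : EuclideanSpace ℝ (Fin n)}
    (hh : DifferentiableAt ℝ h y)
    (S : EuclideanSpace ℝ (Fin n) → Matrix (Fin n) (Fin n) ℝ) :
    frameGrad S (fun z ↦ powFlux 0 μ (h z)) y = fluxComp μ (h y) (frameGrad S h y) := by
  ext a
  have h1 : HasFDerivAt (fun z ↦ powFlux 0 μ (h z)) ((powFluxDeriv 0 μ (h y)).comp (fderiv ℝ h y)) y :=
    (hasFDerivAt_powFlux le_rfl hμ (h y)).comp y hh.hasFDerivAt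
  simp only [frameGrad, fluxComp, frameDeriv, coordPartial, h1.fderiv, map_sum, map_smul]
  rfl

end TimeDerivatives

/-! ### Differentiation of integrals over M in time. -/

section ParametricIntegrals

variable {n : ℕ} {M : Type*} [EMetricSpace M] [ChartedSpace (EuclideanSpace ℝ (Fin n)) M]
  [RiemannianBundle (fun x : M ↦ TangentSpace (𝓡 n) x)] [IsManifold (𝓡 n) ∞ M]
  [IsContMDiffRiemannianBundle (𝓡 n) ∞ (EuclideanSpace ℝ (Fin n))
          (fun x : M ↦ TangentSpace (𝓡 n) x)]
  [MeasurableSpace M] [BorelSpace M] [CompactSpace M]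

lemma exists_uniform_bound {X : Type*} [NormedAddCommGroup X] {T t : ℝ} (ht : t ∈ Ioo 0 T)
    {k : ℝ → M → X} (hk : ContinuousOn (fun z : ℝ × M ↦ k z.1 z.2) (Ioo 0 T ×ˢ univ)) :
    ∃ δ > 0, Metric.ball t δ ⊆ Ioo 0 T ∧ ∃ C, ∀ s ∈ Metric.ball t δ, ∀ x, ‖k s x‖ ≤ C := by
  obtain ⟨δ, hδ, hsub⟩ := Metric.nhds_basis_closedBall.mem_iff.1 (isOpen_Ioo.mem_nhds ht)
  have hK : IsCompact (Metric.closedBall t δ ×ˢ (univ : Set M)) :=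
    (isCompact_closedBall t δ).prod isCompact_univ
  obtain ⟨C, hC⟩ := hK.exists_bound_of_continuousOn (hk.mono (prod_mono hsub subset_rfl))
  exact ⟨δ, hδ, Metric.ball_subset_closedBall.trans hsub, C,
    fun s hs x ↦ hC (s, x) ⟨Metric.ball_subset_closedBall hs, mem_univ x⟩⟩

lemma continuous_slice {X : Type*} [TopologicalSpace X] {I : Set ℝ} {t : ℝ} (ht : t ∈ I)
    {k : ℝ → M → X} (hk : ContinuousOn (fun z : ℝ × M ↦ k z.1 z.2) (I ×ˢ univ)) :
    Continuous (k t) := by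
  rw [← continuousOn_univ]
  exact hk.comp (f := fun x ↦ (t, x)) (by fun_prop) fun x _ ↦ ⟨ht, mem_univ x⟩

lemma hasDerivAt_integral_flow {T t : ℝ} (ht : t ∈ Ioo 0 T) {k k' : ℝ → M → ℝ}
    (hk : ∀ s ∈ Ioo 0 T, Continuous (k s))
    (hd : ∀ s ∈ Ioo 0 T, ∀ x, HasDerivAt (fun s ↦ k s x) (k' s x) s)
    (hk' : ContinuousOn (fun z : ℝ × M ↦ k' z.1 z.2) (Ioo 0 T ×ˢ univ)) :
    HasDerivAt (fun s ↦ ∫ x, k s x ∂(riemannianVolume n M))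
      (∫ x, k' t x ∂(riemannianVolume n M)) t := by
  have := isFiniteMeasure_riemannianVolume (n := n) (M := M)
  obtain ⟨δ, hδ, hsub, C, hC⟩ := exists_uniform_bound ht hk'
  refine (hasDerivAt_integral_of_dominated_loc_of_deriv_le (bound := fun _ ↦ C)
    (Metric.ball_mem_nhds t hδ) ?_ ?_ ?_ ?_ (integrable_const C) ?_).2
  · filter_upwards [Metric.ball_mem_nhds t hδ] with s hs
    exact (hk s (hsub hs)).aestronglyMeasurable
  · exact integrable_of_continuous (hk t ht)
  · exact (continuous_slice ht hk').aestronglyMeasurable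
  · exact Eventually.of_forall fun x s hs ↦ hC s hs x
  · exact Eventually.of_forall fun x s hs ↦ hd s (hsub hs) x

/-- The derivative of `∫ ⟨B(s), ψ(s) - ψ(t)⟩` at `s = t` when `B` is merely continuous. -/
lemma hasDerivAt_integral_inner_sub {V : Type*} [NormedAddCommGroup V] [InnerProductSpace ℝ V]
    {T t : ℝ} (ht : t ∈ Ioo 0 T) {B ψ ψ' : ℝ → M → V}
    (hB : ContinuousOn (fun z : ℝ × M ↦ B z.1 z.2) (Ioo 0 T ×ˢ univ))
    (hψ : ∀ s ∈ Ioo 0 T, Continuous (ψ s))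
    (hd : ∀ s ∈ Ioo 0 T, ∀ x, HasDerivAt (fun s ↦ ψ s x) (ψ' s x) s)
    (hψ' : ContinuousOn (fun z : ℝ × M ↦ ψ' z.1 z.2) (Ioo 0 T ×ˢ univ)) :
    HasDerivAt (fun s ↦ ∫ x, inner ℝ (B s x) (ψ s x - ψ t x) ∂(riemannianVolume n M))
      (∫ x, inner ℝ (B t x) (ψ' t x) ∂(riemannianVolume n M)) t := by
  have := isFiniteMeasure_riemannianVolume (n := n) (M := M)
  obtain ⟨δ, hδ, hsub, C, hC⟩ := exists_uniform_bound ht hψ'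
  obtain ⟨δ', hδ', hsub', C', hC'⟩ := exists_uniform_bound ht hB
  rw [hasDerivAt_iff_tendsto_slope]
  -- The factor ψ(s) - ψ(t) vanishes at s = t, so the difference quotient falls entirely on ψ and B
  -- is only evaluated; dominated convergence then needs no more than continuity of B.
  have hslope : ∀ s, slope (fun s ↦ ∫ x, inner ℝ (B s x) (ψ s x - ψ t x) ∂(riemannianVolume n M)) t s
      = ∫ x, inner ℝ (B s x) (slope (fun s ↦ ψ s x) t s) ∂(riemannianVolume n M) := by
    intro s
    simp only [slope_def_module, sub_self, inner_zero_right, integral_zero, sub_zero,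
      real_inner_smul_right, integral_const_mul, smul_eq_mul]
  refine Tendsto.congr (fun s ↦ (hslope s).symm) ?_
  have hball : ∀ᶠ s in 𝓝[≠] t, s ∈ Metric.ball t (min δ δ') :=
    mem_nhdsWithin_of_mem_nhds (Metric.ball_mem_nhds t (lt_min hδ hδ'))
  refine tendsto_integral_filter_of_dominated_convergence (fun _ ↦ C' * C) ?_ ?_
    (integrable_const _) ?_
  · filter_upwards [hball] with s hs
    have hs1 := hsub (Metric.ball_subset_ball (min_le_left _ _) hs)
    simp only [slope_def_module]
    exact ((continuous_slice hs1 hB).inner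
      (((hψ s hs1).sub (hψ t ht)).const_smul _)).aestronglyMeasurable
  · filter_upwards [hball] with s hs
    refine Eventually.of_forall fun x ↦ ?_
    have hB1 := hC' s (Metric.ball_subset_ball (min_le_right _ _) hs) x
    refine (norm_inner_le_norm _ _).trans ?_
    refine mul_le_mul hB1 ?_ (norm_nonneg _) ((norm_nonneg _).trans hB1)
    have h1 := (convex_ball t δ).norm_image_sub_le_of_norm_hasDerivWithin_le
      (f := fun s ↦ ψ s x) (f' := fun s ↦ ψ' s x) (C := C)
      (fun s hs ↦ (hd s (hsub hs) x).hasDerivWithinAt) (fun s hs ↦ hC s hs x)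
      (Metric.mem_ball_self hδ) (Metric.ball_subset_ball (min_le_left _ _) hs)
    rw [slope_def_module, norm_smul, norm_inv]
    rcases eq_or_ne s t with rfl | hne
    · simpa using (norm_nonneg _).trans (hC s (Metric.mem_ball_self hδ) x)
    · rw [inv_mul_le_iff₀ (norm_pos_iff.2 (sub_ne_zero.2 hne))]
      linarith
  · refine Eventually.of_forall fun x ↦ ?_
    have h1 : Tendsto (fun s ↦ B s x) (𝓝[≠] t) (𝓝 (B t x)) := by
      have h2 : ContinuousOn (fun s ↦ B s x) (Ioo 0 T) :=
        hB.comp (f := fun s ↦ (s, x)) (by fun_prop) fun s hs ↦ ⟨hs, mem_univ x⟩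
      exact (h2.continuousAt (isOpen_Ioo.mem_nhds ht)).tendsto.mono_left nhdsWithin_le_nhds
    exact h1.inner (hasDerivAt_iff_tendsto_slope.1 (hd t ht x))

end ParametricIntegrals

/-! ### The trace A(df,df): norm bound and normality. -/

section Trace

variable {n L : ℕ} {M : Type*} [EMetricSpace M] [ChartedSpace (EuclideanSpace ℝ (Fin n)) M]
  [RiemannianBundle (fun x : M ↦ TangentSpace (𝓡 n) x)] [IsManifold (𝓡 n) ∞ M]
  {N : Set (EuclideanSpace ℝ (Fin L))}

lemma coordPartial_mem_tangentSub {f : M → EuclideanSpace ℝ (Fin L)} (hf : ChartReg n 1 f)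
    (hN : ∀ x, f x ∈ N) (x : M) (i : Fin n) :
    coordPartial i (inChart f x) (coords n x x) ∈ tangentSub N (f x) := by
  have h1 := (hf.differentiableAt (mem_extChartAt_target (I := 𝓡 n) x)).hasFDerivAt
  have hl : HasDerivAt (fun s : ℝ ↦ coords n x x + s • EuclideanSpace.single i (1 : ℝ))
      (EuclideanSpace.single i (1 : ℝ)) 0 := by
    simpa using ((hasDerivAt_id (0 : ℝ)).smul_const
      (EuclideanSpace.single i (1 : ℝ))).const_add (coords n x x)
  have h1' : HasFDerivAt (inChart f x) (fderiv ℝ (inChart f x) (coords n x x))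
      (coords n x x + (0 : ℝ) • EuclideanSpace.single i (1 : ℝ)) := by
    rw [zero_smul, add_zero]; exact h1
  have h2 := h1'.comp_hasDerivAt 0 hl
  have h3 := mem_tangentSub_of_hasDerivAt (N := N) h2 (Eventually.of_forall fun s ↦ hN _)
  simp only [Function.comp, zero_smul, add_zero] at h3
  rwa [inChart_coords _ (mem_extChartAt_source x)] at h3

lemma traceSecondFF_eq_frame {x : M} {S : Matrix (Fin n) (Fin n) ℝ}
    (hS : IsOrthoFrame x S (coords n x x)) (f : M → EuclideanSpace ℝ (Fin L)) :
    traceSecondFF n N f x = ∑ a, secondFF N (f x)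
      (frameDeriv (fun _ ↦ S) a (inChart f x) (coords n x x))
      (frameDeriv (fun _ ↦ S) a (inChart f x) (coords n x x)) := by
  have h : invMetric x (extChartAt (𝓡 n) x x) = S.transpose * S := hS.invMetric_eq
  simp only [traceSecondFF, h, frameDeriv, secondFF, map_sum, map_smul, sum_apply, smul_apply,
    Matrix.mul_apply, Matrix.transpose_apply, coords]
  simp only [Finset.sum_smul, Finset.smul_sum, smul_neg, Finset.sum_neg_distrib, neg_inj,
    smul_smul]
  calc _ = ∑ i, ∑ a, ∑ j, _ := Finset.sum_congr rfl fun i _ ↦ Finset.sum_comm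
    _ = ∑ a, ∑ i, ∑ j, _ := Finset.sum_comm
    _ = _ := Finset.sum_congr rfl fun a _ ↦ by
      rw [Finset.sum_comm]
      refine Finset.sum_congr rfl fun i _ ↦ Finset.sum_congr rfl fun j _ ↦ ?_
      first
        | rfl
        | rw [mul_comm]

lemma frameDeriv_mem_tangentSub {f : M → EuclideanSpace ℝ (Fin L)} (hf : ChartReg n 1 f)
    (hN : ∀ x, f x ∈ N) (x : M) (S : Matrix (Fin n) (Fin n) ℝ) (a : Fin n) :
    frameDeriv (fun _ ↦ S) a (inChart f x) (coords n x x) ∈ tangentSub N (f x) :=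
  Submodule.sum_mem _ fun i _ ↦ Submodule.smul_mem _ _ (coordPartial_mem_tangentSub hf hN x i)

lemma norm_traceSecondFF_le {C : ℝ} (hC : SecondFFBoundedBy N C)
    {f : M → EuclideanSpace ℝ (Fin L)} (hf : ChartReg n 1 f) (hN : ∀ x, f x ∈ N) (x : M) :
    ‖traceSecondFF n N f x‖ ≤ C * dPair n f f x := by
  obtain ⟨S, hS⟩ := exists_orthoFrame_at (mem_extChartAt_target (I := 𝓡 n) x)
  rw [traceSecondFF_eq_frame hS, dPair, gradPair_eq_frame (S := fun _ ↦ S) hS, Finset.mul_sum]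
  refine (norm_sum_le _ _).trans (Finset.sum_le_sum fun a _ ↦ ?_)
  have h := frameDeriv_mem_tangentSub hf hN x S a
  rw [real_inner_self_eq_norm_sq, sq, ← mul_assoc]
  exact hC _ (hN x) _ h _ h

lemma tangentProj_traceSecondFF (hemb : IsEmbeddedSubmanifold N)
    {f : M → EuclideanSpace ℝ (Fin L)} (hf : ChartReg n 1 f) (hN : ∀ x, f x ∈ N) (x : M) :
    tangentProj N (f x) (traceSecondFF n N f x) = 0 := by
  obtain ⟨S, hS⟩ := exists_orthoFrame_at (mem_extChartAt_target (I := 𝓡 n) x)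
  rw [traceSecondFF_eq_frame hS, map_sum]
  exact Finset.sum_eq_zero fun a _ ↦ tangentProj_secondFF hemb (hN x)
    (frameDeriv_mem_tangentSub hf hN x S a) (frameDeriv_mem_tangentSub hf hN x S a)

lemma inner_eq_zero_of_tangentProj {y B v : EuclideanSpace ℝ (Fin L)}
    (hB : tangentProj N y B = 0) (hv : v ∈ tangentSub N y) : inner ℝ B v = (0 : ℝ) := by
  rw [← tangentProj_of_mem hv, tangentProj, ← Submodule.inner_starProjection_left_eq_right]
  rw [tangentProj] at hB
  rw [hB, inner_zero_left]

end Trace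

/-! ### Smooth flows, the linearized flux pairing and its continuity. -/

section SmoothFlows

variable {n L : ℕ} {M : Type*} [EMetricSpace M] [ChartedSpace (EuclideanSpace ℝ (Fin n)) M]
  [RiemannianBundle (fun x : M ↦ TangentSpace (𝓡 n) x)] [IsManifold (𝓡 n) ∞ M]
  {V : Type*} [NormedAddCommGroup V] [InnerProductSpace ℝ V]

lemma contDiffOn_inChart_of_contMDiffOn {k : ℝ → M → V} {T : ℝ}
    (hk : ContMDiffOn (𝓘(ℝ, ℝ).prod (𝓡 n)) 𝓘(ℝ, V) ∞ (fun p : ℝ × M ↦ k p.1 p.2)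
      (Icc 0 T ×ˢ univ)) (c : M) :
    ContDiffOn ℝ ∞ (fun z : ℝ × EuclideanSpace ℝ (Fin n) ↦ inChart (k z.1) c z.2)
      (Icc 0 T ×ˢ chartTarget n c) := by
  rw [← contMDiffOn_iff_contDiffOn]
  have h1 : ContMDiffOn 𝓘(ℝ, ℝ × EuclideanSpace ℝ (Fin n)) (𝓘(ℝ, ℝ).prod (𝓡 n)) ∞
      (fun z : ℝ × EuclideanSpace ℝ (Fin n) ↦ (z.1, (extChartAt (𝓡 n) c).symm z.2))
      (Icc 0 T ×ˢ chartTarget n c) := by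
    refine ContMDiffOn.prodMk ?_ ?_
    · exact (contMDiff_iff_contDiff.2 contDiff_fst).contMDiffOn
    · exact (contMDiffOn_extChartAt_symm (n := ∞) c).comp
        (contMDiff_iff_contDiff.2 contDiff_snd).contMDiffOn fun z hz ↦ hz.2
  exact hk.comp h1 fun z hz ↦ ⟨hz.1, mem_univ _⟩

lemma flowReg_of_contMDiffOn {k : ℝ → M → V} {T : ℝ}
    (hk : ContMDiffOn (𝓘(ℝ, ℝ).prod (𝓡 n)) 𝓘(ℝ, V) ∞ (fun p : ℝ × M ↦ k p.1 p.2)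
      (Icc 0 T ×ˢ univ)) : FlowReg n T ∞ k := fun c ↦
  (contDiffOn_inChart_of_contMDiffOn hk c).mono (prod_mono Ioo_subset_Icc_self subset_rfl)

lemma chartReg_of_contMDiffOn {k : ℝ → M → V} {T t : ℝ} (ht : t ∈ Icc 0 T)
    (hk : ContMDiffOn (𝓘(ℝ, ℝ).prod (𝓡 n)) 𝓘(ℝ, V) ∞ (fun p : ℝ × M ↦ k p.1 p.2)
      (Icc 0 T ×ˢ univ)) : ChartReg n ∞ (k t) := fun c ↦
  (contDiffOn_inChart_of_contMDiffOn hk c).comp (f := fun y ↦ (t, y))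
    (contDiff_prodMk_right t).contDiffOn fun _ hy ↦ ⟨ht, hy⟩

/-- Continuity up to the end points of time, where smoothness is one-sided: the spatial partial
derivative is read off from the derivative within the closed cylinder, which is unique because T >
0. -/
lemma continuousOn_coordPartial_of_contMDiffOn {k : ℝ → M → V} {T : ℝ} (hT : 0 < T)
    (hk : ContMDiffOn (𝓘(ℝ, ℝ).prod (𝓡 n)) 𝓘(ℝ, V) ∞ (fun p : ℝ × M ↦ k p.1 p.2)
      (Icc 0 T ×ˢ univ)) (c : M) (i : Fin n) :
    ContinuousOn (fun z : ℝ × EuclideanSpace ℝ (Fin n) ↦ coordPartial i (inChart (k z.1) c) z.2)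
      (Icc 0 T ×ˢ chartTarget n c) := by
  have h := contDiffOn_inChart_of_contMDiffOn hk c
  have hu : UniqueDiffOn ℝ (Icc 0 T ×ˢ chartTarget n c) :=
    (uniqueDiffOn_Icc hT).prod (isOpen_chartTarget c).uniqueDiffOn
  refine ((h.continuousOn_fderivWithin hu (by simp)).clm_apply
    (continuousOn_const (c := ((0 : ℝ), EuclideanSpace.single i (1 : ℝ))))).congr fun z hz ↦ ?_
  have h1 := (h.differentiableOn (by simp) z hz).hasFDerivWithinAt
  have h2 : HasFDerivWithinAt (inChart (n := n) (k z.1) c) _ (chartTarget n c) z.2 :=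
    HasFDerivWithinAt.comp z.2 (f := fun y ↦ (z.1, y)) h1
      (hasFDerivAt_prodMk_right z.1 z.2).hasFDerivWithinAt fun y hy ↦ ⟨hz.1, hy⟩
  rw [coordPartial, (h2.hasFDerivAt ((isOpen_chartTarget c).mem_nhds hz.2)).fderiv]
  simp

variable [IsContMDiffRiemannianBundle (𝓡 n) ∞ (EuclideanSpace ℝ (Fin n))
          (fun x : M ↦ TangentSpace (𝓡 n) x)]

lemma continuousOn_e2_of_contMDiffOn {f : ℝ → M → EuclideanSpace ℝ (Fin L)} {T : ℝ} (hT : 0 < T)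
    (hf : ContMDiffOn (𝓘(ℝ, ℝ).prod (𝓡 n)) 𝓘(ℝ, EuclideanSpace ℝ (Fin L)) ∞
      (fun p : ℝ × M ↦ f p.1 p.2) (Icc 0 T ×ˢ univ)) (ε : ℝ) :
    ContinuousOn (fun z : ℝ × M ↦ e2 n ε (f z.1) z.2) (Icc 0 T ×ˢ univ) := by
  refine continuousOn_of_inChart_flow (n := n) (k := fun t ↦ e2 n ε (f t)) fun c ↦ ?_
  have h1 := continuousOn_coordPartial_of_contMDiffOn hT hf c
  have h2 : ∀ i j, ContinuousOn (fun z : ℝ × EuclideanSpace ℝ (Fin n) ↦ invMetric c z.2 i j)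
      (Icc 0 T ×ˢ chartTarget n c) := fun i j ↦
    (contDiffOn_invMetric c i j).continuousOn.comp continuousOn_snd fun z hz ↦ hz.2
  have h3 : ContinuousOn (fun z : ℝ × EuclideanSpace ℝ (Fin n) ↦ e2Chart ε (f z.1) c z.2)
      (Icc 0 T ×ˢ chartTarget n c) :=
    continuousOn_const.add (continuousOn_finsetSum _ fun i _ ↦ continuousOn_finsetSum _ fun j _ ↦
      (h2 i j).mul ((h1 i).inner (h1 j)))
  exact h3.congr fun z hz ↦
    e2_inChart ((chartReg_of_contMDiffOn hz.1 hf).of_le (by simp)) ε hz.2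

/-- The linearization of `f ↦ (ε + |df|²)^κ ⟨df, dψ⟩` at `f` in the direction `v`. -/
def linFluxPair (n : ℕ) {V M : Type*} [EMetricSpace M] [ChartedSpace (EuclideanSpace ℝ (Fin n)) M]
    [RiemannianBundle (fun x : M ↦ TangentSpace (𝓡 n) x)]
    [NormedAddCommGroup V] [InnerProductSpace ℝ V] (ε κ : ℝ) (f v ψ : M → V) (x : M) : ℝ :=
  (ε + dPair n f f x) ^ κ * dPair n v ψ x +
    2 * κ * (ε + dPair n f f x) ^ (κ - 1) * dPair n f v x * dPair n f ψ x

lemma linFluxPair_inChart {ε κ : ℝ} {f v ψ : M → V} (hf : ChartReg n 1 f) (hv : ChartReg n 1 v)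
    (hψ : ChartReg n 1 ψ) {c : M} {y : EuclideanSpace ℝ (Fin n)} (hy : y ∈ chartTarget n c)
    {S : EuclideanSpace ℝ (Fin n) → Matrix (Fin n) (Fin n) ℝ} (hS : IsOrthoFrame c (S y) y) :
    inChart (linFluxPair n ε κ f v ψ) c y = inner ℝ (powFluxDeriv ε κ
      (frameGrad S (inChart f c) y) (frameGrad S (inChart v c) y))
      (frameGrad S (inChart ψ c) y) := by
  have h1 := dPair_inChart hf hf hy
  have h2 := dPair_inChart hv hψ hy
  have h3 := dPair_inChart hf hv hy
  have h4 := dPair_inChart hf hψ hy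
  rw [gradPair_eq_inner hS] at h1 h2 h3 h4
  simp only [inChart] at h1 h2 h3 h4 ⊢
  rw [linFluxPair, h1, h2, h3, h4, powFluxDeriv_apply, inner_add_left, real_inner_smul_left,
    real_inner_smul_left, real_inner_self_eq_norm_sq]

lemma linFluxPair_eq {ε κ : ℝ} {f v ψ : M → V} {x : M} {S : Matrix (Fin n) (Fin n) ℝ}
    (hS : IsOrthoFrame x S (coords n x x)) :
    linFluxPair n ε κ f v ψ x = inner ℝ (powFluxDeriv ε κ
      (frameGrad (fun _ ↦ S) (inChart f x) (coords n x x))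
        (frameGrad (fun _ ↦ S) (inChart v x) (coords n x x)))
      (frameGrad (fun _ ↦ S) (inChart ψ x) (coords n x x)) := by
  rw [linFluxPair, dPair, dPair, dPair, dPair]
  simp only [gradPair_eq_inner (S := fun _ ↦ S) hS]
  rw [powFluxDeriv_apply, inner_add_left, real_inner_smul_left,
    real_inner_smul_left, real_inner_self_eq_norm_sq]

/-- The exponent κ - 1 may be negative, so continuity at zeros of e cannot be seen termwise; it
comes from the continuity of `powFluxDeriv` in a frame. -/
lemma continuousOn_linFluxPair {T ε κ : ℝ} (hε : 0 ≤ ε) (hκ : 0 ≤ κ) {f v ψ : ℝ → M → V}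
    (hf : FlowReg n T 1 f) (hv : FlowReg n T 1 v) (hψ : FlowReg n T 1 ψ) :
    ContinuousOn (fun z : ℝ × M ↦ linFluxPair n ε κ (f z.1) (v z.1) (ψ z.1) z.2)
      (Ioo 0 T ×ˢ univ) := by
  refine continuousOn_of_inChart_flow (n := n) (k := fun t ↦ linFluxPair n ε κ (f t) (v t) (ψ t))
    fun c ↦ ?_
  obtain ⟨S, hS, hSo⟩ := exists_orthoFrame (n := n) c
  have h1 := (hf.contDiffOn_frameGrad (s := 0) (by simp) (by simp) hS).continuousOn
  have h2 := (hv.contDiffOn_frameGrad (s := 0) (by simp) (by simp) hS).continuousOn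
  have h3 := (hψ.contDiffOn_frameGrad (s := 0) (by simp) (by simp) hS).continuousOn
  have h4 : Continuous (powFluxDeriv ε κ : PiLp 2 (fun _ : Fin n ↦ V) → _) := by
    have : fderiv ℝ (powFlux ε κ : PiLp 2 (fun _ : Fin n ↦ V) → _) = powFluxDeriv ε κ :=
      funext fun p ↦ (hasFDerivAt_powFlux hε hκ p).fderiv
    rw [← this]
    exact (contDiff_powFlux hε hκ).continuous_fderiv (by simp)
  refine (((h4.comp_continuousOn h1).clm_apply h2).inner h3).congr fun z hz ↦ ?_
  exact linFluxPair_inChart (hf.slice hz.1) (hv.slice hz.1) (hψ.slice hz.1) hz.2 (hSo z.2 hz.2)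

lemma hasDerivAt_fluxPair {T ε κ : ℝ} (hε : 0 ≤ ε) (hκ : 0 ≤ κ) {f : ℝ → M → V}
    (hf : FlowReg n T 2 f) (ψ : M → V) {t : ℝ} (ht : t ∈ Ioo 0 T) (x : M) :
    HasDerivAt (fun s ↦ (ε + dPair n (f s) (f s) x) ^ κ * dPair n (f s) ψ x)
      (linFluxPair n ε κ (f t) (fun x ↦ deriv (fun s ↦ f s x) t) ψ x) t := by
  obtain ⟨S, hS⟩ := exists_orthoFrame_at (mem_extChartAt_target (I := 𝓡 n) x)
  have h1 := hf.hasDerivAt_frameGrad (z := (t, coords n x x)) ⟨ht, mem_extChartAt_target x⟩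
    (fun _ ↦ S)
  have h2 := (hasFDerivAt_powFlux hε hκ
    (frameGrad (fun _ ↦ S) (inChart (f t) x) (coords n x x))).comp_hasDerivAt t h1
  have h3 := h2.inner ℝ (hasDerivAt_const t (frameGrad (fun _ ↦ S) (inChart ψ x) (coords n x x)))
  rw [inner_zero_right, zero_add] at h3
  rw [linFluxPair_eq hS]
  refine h3.congr_of_eventuallyEq (Eventually.of_forall fun s ↦ ?_)
  simp only [dPair, gradPair_eq_inner (S := fun _ ↦ S) hS, Function.comp, powFlux,
    real_inner_smul_left, real_inner_self_eq_norm_sq]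

lemma hasDerivAt_dPair_self {T : ℝ} {f : ℝ → M → V}
    (hf : FlowReg n T 2 f) {t : ℝ} (ht : t ∈ Ioo 0 T) (x : M) :
    HasDerivAt (fun s ↦ dPair n (f s) (f s) x)
      (2 * dPair n (f t) (fun x ↦ deriv (fun s ↦ f s x) t) x) t := by
  obtain ⟨S, hS⟩ := exists_orthoFrame_at (mem_extChartAt_target (I := 𝓡 n) x)
  have h1 := hf.hasDerivAt_frameGrad (z := (t, coords n x x)) ⟨ht, mem_extChartAt_target x⟩
    (fun _ ↦ S)
  have h2 := h1.inner ℝ h1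
  simp only [dPair, gradPair_eq_inner (S := fun _ ↦ S) hS]
  refine h2.congr_deriv ?_
  rw [two_mul]
  congr 1
  rw [real_inner_comm]

lemma dPair_sq_le (α β : M → V) (x : M) :
    dPair n α β x ^ 2 ≤ dPair n α α x * dPair n β β x := by
  obtain ⟨S, hS⟩ := exists_orthoFrame_at (mem_extChartAt_target (I := 𝓡 n) x)
  simp only [dPair, gradPair_eq_inner (S := fun _ ↦ S) hS]
  rw [sq]
  exact real_inner_mul_inner_self_le _ _

lemma dPair_powFlux_le {μ : ℝ} (hμ : 0 ≤ μ) {v : M → V} (hv : ChartReg n 1 v) (x : M) :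
    dPair n (fun x ↦ powFlux 0 μ (v x)) (fun x ↦ powFlux 0 μ (v x)) x ≤
      ((1 + 2 * μ) * (‖v x‖ ^ 2) ^ μ) ^ 2 * dPair n v v x := by
  obtain ⟨S, hS⟩ := exists_orthoFrame_at (mem_extChartAt_target (I := 𝓡 n) x)
  have h1 : frameGrad (fun _ ↦ S) (inChart (fun x ↦ powFlux 0 μ (v x)) x) (coords n x x) = _ :=
    frameGrad_comp hμ (hv.differentiableAt (mem_extChartAt_target x)) (fun _ ↦ S)
  simp only [dPair, gradPair_eq_inner (S := fun _ ↦ S) hS, h1, real_inner_self_eq_norm_sq]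
  rw [inChart_coords _ (mem_extChartAt_source x), ← mul_pow]
  exact pow_le_pow_left₀ (norm_nonneg _) (norm_fluxComp_le hμ _ _) 2

/-- `coercive_flux` in an orthonormal frame at x, with p = df, r = dv and the vector v itself. It
makes the linearized operator dissipative when tested with |v|^{2μ} v. -/
lemma le_linFluxPair {ε κ μ : ℝ} (hε : 0 ≤ ε) (hκ0 : 0 ≤ κ) (hκ : κ ≤ 1) (hμ0 : 0 ≤ μ)
    (hμ : μ ≤ 1) (f : M → V) {v : M → V} (hv : ChartReg n 1 v) (x : M) :
    (ε + dPair n f f x) ^ κ * (‖v x‖ ^ 2) ^ μ * dPair n v v x ≤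
      linFluxPair n ε κ f v (fun x ↦ powFlux 0 μ (v x)) x := by
  obtain ⟨S, hS⟩ := exists_orthoFrame_at (mem_extChartAt_target (I := 𝓡 n) x)
  have h1 : frameGrad (fun _ ↦ S) (inChart (fun x ↦ powFlux 0 μ (v x)) x) (coords n x x) = _ :=
    frameGrad_comp hμ0 (hv.differentiableAt (mem_extChartAt_target x)) (fun _ ↦ S)
  rw [linFluxPair_eq hS, h1]
  simp only [dPair, gradPair_eq_inner (S := fun _ ↦ S) hS, real_inner_self_eq_norm_sq]
  rw [inChart_coords _ (mem_extChartAt_source x)]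
  exact coercive_flux hε hκ0 hκ hμ0 hμ _ _ _

lemma FlowReg.continuousOn_regNLaplacian {T ε : ℝ} (hε : 0 ≤ ε) (hn : 2 ≤ n)
    {f : ℝ → M → EuclideanSpace ℝ (Fin L)} (hf : FlowReg n T 2 f)
    [MeasurableSpace M] [BorelSpace M] [CompactSpace M] :
    ContinuousOn (fun z : ℝ × M ↦ regNLaplacian n ε (f z.1) z.2) (Ioo 0 T ×ˢ univ) := by
  have hκ : (0 : ℝ) ≤ (n : ℝ) / 2 - 1 := by
    have : (2 : ℝ) ≤ n := by exact_mod_cast hn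
    linarith
  refine continuousOn_of_inChart_flow (n := n) (k := fun t ↦ regNLaplacian n ε (f t)) fun c ↦ ?_
  have hfl := fun c i ↦ hf.contDiffOn_fluxChart hε hκ c i
  have hsl : ∀ t ∈ Ioo 0 T, ∀ (c : M) i,
      ContDiffOn ℝ 1 (fluxChart c ε ((n : ℝ) / 2 - 1) (f t) i) (chartTarget n c) :=
    fun t ht c i ↦ (hfl c i).comp (f := fun y ↦ (t, y))
      (contDiff_prodMk_right t).contDiffOn fun _ hy ↦ ⟨ht, hy⟩
  have h1 : ∀ i, ContinuousOn (fun z : ℝ × EuclideanSpace ℝ (Fin n) ↦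
      coordPartial i (fluxChart c ε ((n : ℝ) / 2 - 1) (f z.1) i) z.2)
      (Ioo 0 T ×ˢ chartTarget n c) := by
    intro i
    refine (((hfl c i).continuousOn_fderiv_of_isOpen (isOpen_cylinder T c) le_rfl).clm_apply
      (continuousOn_const (c := ((0 : ℝ), EuclideanSpace.single i (1 : ℝ))))).congr fun z hz ↦ ?_
    have h2 := (((hfl c i).contDiffAt ((isOpen_cylinder T c).mem_nhds hz)).differentiableAt
      (by simp)).hasFDerivAt
    have h3 : HasFDerivAt (fluxChart c ε ((n : ℝ) / 2 - 1) (f z.1) i) _ z.2 :=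
      HasFDerivAt.comp z.2 (f := fun y ↦ (z.1, y)) h2 (hasFDerivAt_prodMk_right z.1 z.2)
    rw [coordPartial, h3.fderiv]
    simp
  have h4 : ContinuousOn (fun z : ℝ × EuclideanSpace ℝ (Fin n) ↦ (volDensity (n := n) c z.2)⁻¹ •
      ∑ i : Fin n, coordPartial i (fluxChart c ε ((n : ℝ) / 2 - 1) (f z.1) i) z.2)
      (Ioo 0 T ×ˢ chartTarget n c) :=
    ((contDiffOn_volDensity_snd T c).continuousOn.inv₀ fun z hz ↦ (volDensity_pos hz.2).ne').smul
      (continuousOn_finsetSum _ fun i _ ↦ h1 i)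
  refine h4.congr fun z hz ↦ ?_
  have h5 : (extChartAt (𝓡 n) c).symm z.2 ∈ chartSource n c :=
    (extChartAt (𝓡 n) c).map_target hz.2
  have h6 := divChart_eq ((hf.slice hz.1).of_le (by norm_num)) hκ (hsl z.1 hz.1)
    (mem_extChartAt_source _) h5
  have h7 : coords n c ((extChartAt (𝓡 n) c).symm z.2) = z.2 := (extChartAt (𝓡 n) c).right_inv hz.2
  simp only [inChart]
  rw [regNLaplacian_eq_divChart, h6, divChart, h7]

end SmoothFlows

lemma two_le_infty : (2 : WithTop ℕ∞) ≤ ∞ := WithTop.coe_le_coe.2 le_top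

/-! ### Algebraic identities for |v|^{2μ} v. -/

section PowFluxIdentities

variable {V : Type*} [NormedAddCommGroup V] [InnerProductSpace ℝ V]

lemma inner_powFluxDeriv_self {μ : ℝ} (hμ : 0 ≤ μ) (v w : V) :
    inner ℝ v (powFluxDeriv 0 μ v w) = (1 + 2 * μ) * (‖v‖ ^ 2) ^ μ * inner ℝ v w := by
  rw [powFluxDeriv_apply, inner_add_right, real_inner_smul_right, real_inner_smul_right,
    real_inner_self_eq_norm_sq, zero_add]
  rcases eq_or_ne v 0 with rfl | hv
  · simp
  · have h : 0 < ‖v‖ ^ 2 := by positivity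
    rw [Real.rpow_sub_one h.ne']
    field_simp

lemma inner_powFlux_self {μ : ℝ} (hμ : 0 ≤ μ) (v : V) :
    inner ℝ v (powFlux 0 μ v) = (‖v‖ ^ 2) ^ (μ + 1) := by
  rw [powFlux, real_inner_smul_right, real_inner_self_eq_norm_sq, zero_add,
    Real.rpow_add_one' (by positivity) (by positivity)]

/-- Used with B normal to N and v = f_t tangent: the radial part of the derivative is a multiple of
v and disappears. -/
lemma inner_powFluxDeriv_of_inner_eq_zero {μ : ℝ} {v B : V} (w : V) (h : inner ℝ B v = (0 : ℝ)) :
    inner ℝ B (powFluxDeriv 0 μ v w) = (‖v‖ ^ 2) ^ μ * inner ℝ B w := by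
  rw [powFluxDeriv_apply, inner_add_right, real_inner_smul_right, real_inner_smul_right, h,
    zero_add]
  ring

end PowFluxIdentities

/-! ### The flow tested with |f_t|^{2μ} f_t and differentiated in time. -/

section FlowEstimates

variable {n L : ℕ} {M : Type*} [EMetricSpace M] [ChartedSpace (EuclideanSpace ℝ (Fin n)) M]
  [RiemannianBundle (fun x : M ↦ TangentSpace (𝓡 n) x)] [IsManifold (𝓡 n) ∞ M]
  {V : Type*} [NormedAddCommGroup V] [InnerProductSpace ℝ V]

/-- The time derivative of a flow. -/
def vel (f : ℝ → M → V) (t : ℝ) (x : M) : V := deriv (fun s ↦ f s x) t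

/-- The conformal factor `e^{nu}`. -/
def confFactor (n : ℕ) (u : ℝ → M → ℝ) (t : ℝ) (x : M) : ℝ := Real.exp (n * u t x)

/-- `e^{nu} f_t - Div ((ε + |df|²)^{n/2 - 1} df)`. -/
def flowDefect (n : ℕ) [ChartedSpace (EuclideanSpace ℝ (Fin n)) M]
    [RiemannianBundle (fun x : M ↦ TangentSpace (𝓡 n) x)] (ε : ℝ)
    (f : ℝ → M → EuclideanSpace ℝ (Fin L)) (u : ℝ → M → ℝ) (t : ℝ) (x : M) :
    EuclideanSpace ℝ (Fin L) :=
  confFactor n u t x • vel f t x - regNLaplacian n ε (f t) x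

lemma confFactor_pos (u : ℝ → M → ℝ) (t : ℝ) (x : M) : 0 < confFactor n u t x := Real.exp_pos _

lemma FlowReg.vel {T : ℝ} {r s : WithTop ℕ∞} {k : ℝ → M → V} (h : FlowReg n T r k)
    (hs : s + 1 ≤ r) : FlowReg n T s (_root_.vel k) := h.deriv_time hs

lemma FlowReg.powFlux {T μ : ℝ} (hμ : 0 ≤ μ) {k : ℝ → M → V} (h : FlowReg n T 1 k) :
    FlowReg n T 1 (fun t x ↦ _root_.powFlux 0 μ (k t x)) := fun c ↦
  (contDiff_powFlux le_rfl hμ).comp_contDiffOn (h c)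

lemma timeDeriv_eq_vel {T t : ℝ} (ht : t ∈ Ioo 0 T) (k : ℝ → M → V) (x : M) :
    timeDeriv T k t x = vel k t x := derivWithin_of_mem_nhds (Icc_mem_nhds ht.1 ht.2)

variable {N : Set (EuclideanSpace ℝ (Fin L))} {ε a b T C_N : ℝ}
  {f : ℝ → M → EuclideanSpace ℝ (Fin L)} {u : ℝ → M → ℝ}

namespace IsRegularizedCHF

lemma flowReg_f (hfl : IsRegularizedCHF n N ε a b T f u) : FlowReg n T ∞ f :=
  flowReg_of_contMDiffOn hfl.smooth_f

lemma flowReg_u (hfl : IsRegularizedCHF n N ε a b T f u) : FlowReg n T ∞ u :=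
  flowReg_of_contMDiffOn hfl.smooth_u

lemma flowReg_vel (hfl : IsRegularizedCHF n N ε a b T f u) : FlowReg n T ∞ (vel f) :=
  hfl.flowReg_f.vel (by simp)

lemma flowReg_confFactor (hfl : IsRegularizedCHF n N ε a b T f u) :
    FlowReg n T ∞ (confFactor n u) := fun c ↦
  Real.contDiff_exp.comp_contDiffOn (contDiffOn_const.mul (hfl.flowReg_u c))

lemma flowReg_momentum (hfl : IsRegularizedCHF n N ε a b T f u) :
    FlowReg n T ∞ (fun t x ↦ confFactor n u t x • vel f t x) := fun c ↦
  (hfl.flowReg_confFactor c).smul (hfl.flowReg_vel c)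

/-- By the flow equation the defect is e^κ A(df,df). Its definition through the divergence gives
continuity in time without any regularity of A along N, while this form gives its size and its
normality. -/
lemma flowDefect_eq (hfl : IsRegularizedCHF n N ε a b T f u) {t : ℝ} (ht : t ∈ Ioo 0 T) (x : M) :
    flowDefect n ε f u t x =
      (e2 n ε (f t) x ^ ((n : ℝ) / 2 - 1)) • traceSecondFF n N (f t) x := by
  have h := hfl.eq_f t (Ioo_subset_Icc_self ht) x
  rw [timeDeriv_eq_vel ht] at h
  rw [flowDefect, h, confFactor, smul_smul, ← Real.exp_add]
  simp

lemma mem_target' (hfl : IsRegularizedCHF n N ε a b T f u) {t : ℝ} (ht : t ∈ Ioo 0 T) (x : M) :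
    f t x ∈ N := hfl.mem_target t (Ioo_subset_Icc_self ht) x

lemma hasDerivAt_f (hfl : IsRegularizedCHF n N ε a b T f u) {t : ℝ} (ht : t ∈ Ioo 0 T) (x : M) :
    HasDerivAt (fun s ↦ f s x) (vel f t x) t :=
  (hfl.flowReg_f.of_le (s := 1) (by simp)).hasDerivAt ht x

lemma hasDerivAt_vel (hfl : IsRegularizedCHF n N ε a b T f u) {t : ℝ} (ht : t ∈ Ioo 0 T) (x : M) :
    HasDerivAt (fun s ↦ vel f s x) (vel (vel f) t x) t :=
  (hfl.flowReg_vel.of_le (s := 1) (by simp)).hasDerivAt ht x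

/-- The exponential in u_t cancels, so w = e^{nu} solves a linear equation with source nb e^{n/2}.
This source is good in the evolution of the velocity, and it is the term to be controlled in the
growth of w. -/
lemma hasDerivAt_confFactor (hfl : IsRegularizedCHF n N ε a b T f u) {t : ℝ} (ht : t ∈ Ioo 0 T)
    (x : M) : HasDerivAt (fun s ↦ confFactor n u s x)
      (n * b * e2 n ε (f t) x ^ ((n : ℝ) / 2) - n * a * confFactor n u t x) t := by
  have h := hfl.eq_u t (Ioo_subset_Icc_self ht) x
  rw [timeDeriv_eq_vel ht] at h
  have h1 : HasDerivAt (fun s ↦ u s x) (vel u t x) t :=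
    (hfl.flowReg_u.of_le (s := 1) (by simp)).hasDerivAt ht x
  refine ((h1.const_mul (n : ℝ)).exp).congr_deriv ?_
  rw [h, confFactor, Real.exp_neg]
  field_simp

lemma vel_mem (hfl : IsRegularizedCHF n N ε a b T f u) {t : ℝ} (ht : t ∈ Ioo 0 T) (x : M) :
    vel f t x ∈ tangentSub N (f t x) := by
  refine mem_tangentSub_of_hasDerivAt (γ := fun s ↦ f s x) (hfl.hasDerivAt_f ht x) ?_
  filter_upwards [isOpen_Ioo.mem_nhds ht] with s hs using hfl.mem_target' hs x

variable [IsContMDiffRiemannianBundle (𝓡 n) ∞ (EuclideanSpace ℝ (Fin n))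
          (fun x : M ↦ TangentSpace (𝓡 n) x)]

lemma chartReg_slice (hfl : IsRegularizedCHF n N ε a b T f u) {t : ℝ} (ht : t ∈ Ioo 0 T) :
    ChartReg n 1 (f t) := (hfl.flowReg_f.slice ht).of_le (by simp)

lemma tangentProj_flowDefect (hemb : IsEmbeddedSubmanifold N)
    (hfl : IsRegularizedCHF n N ε a b T f u) {t : ℝ} (ht : t ∈ Ioo 0 T) (x : M) :
    tangentProj N (f t x) (flowDefect n ε f u t x) = 0 := by
  rw [hfl.flowDefect_eq ht, map_smul, tangentProj_traceSecondFF hemb (hfl.chartReg_slice ht)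
    (hfl.mem_target' ht), smul_zero]

lemma inner_flowDefect_vel (hemb : IsEmbeddedSubmanifold N)
    (hfl : IsRegularizedCHF n N ε a b T f u) {t : ℝ} (ht : t ∈ Ioo 0 T) (x : M) :
    inner ℝ (flowDefect n ε f u t x) (vel f t x) = (0 : ℝ) :=
  inner_eq_zero_of_tangentProj (hfl.tangentProj_flowDefect hemb ht x) (hfl.vel_mem ht x)

lemma norm_flowDefect_le (hC : SecondFFBoundedBy N C_N) (hC0 : 0 ≤ C_N) (hε : 0 ≤ ε) (hn : 3 ≤ n)
    (hfl : IsRegularizedCHF n N ε a b T f u) {t : ℝ} (ht : t ∈ Ioo 0 T) (x : M) :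
    ‖flowDefect n ε f u t x‖ ≤ C_N * e2 n ε (f t) x ^ ((n : ℝ) / 2) := by
  have hn' : (3 : ℝ) ≤ n := by exact_mod_cast hn
  have he := e2_nonneg (n := n) hε (f t) x
  have h1 := norm_traceSecondFF_le hC (hfl.chartReg_slice ht) (hfl.mem_target' ht) x
  have h2 : dPair n (f t) (f t) x ≤ e2 n ε (f t) x := by rw [e2_eq]; linarith
  rw [hfl.flowDefect_eq ht, norm_smul, Real.norm_of_nonneg (by positivity)]
  have h3 : e2 n ε (f t) x ^ ((n : ℝ) / 2) =
      e2 n ε (f t) x ^ ((n : ℝ) / 2 - 1) * e2 n ε (f t) x := by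
    rw [← Real.rpow_add_one' he (by linarith)]
    congr 1; ring
  rw [h3]
  calc _ ≤ e2 n ε (f t) x ^ ((n : ℝ) / 2 - 1) * (C_N * e2 n ε (f t) x) := by
        gcongr
        exact h1.trans (by gcongr)
    _ = _ := by ring

/-- Against a normal vector the acceleration f_tt is -A(f_t, f_t), so no second time derivative
survives. One factor C_N comes from the defect and one from the acceleration. -/
lemma abs_inner_flowDefect_acc_le (hemb : IsEmbeddedSubmanifold N)
    (hC : SecondFFBoundedBy N C_N) (hC0 : 0 ≤ C_N) (hε : 0 ≤ ε) (hn : 3 ≤ n)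
    (hfl : IsRegularizedCHF n N ε a b T f u) {t : ℝ} (ht : t ∈ Ioo 0 T) (x : M) :
    |inner ℝ (flowDefect n ε f u t x) (vel (vel f) t x)| ≤
      C_N ^ 2 * e2 n ε (f t) x ^ ((n : ℝ) / 2) * ‖vel f t x‖ ^ 2 := by
  have h1 := inner_deriv_deriv_curve hemb (γ := fun s ↦ f s x) (γ' := fun s ↦ vel f s x)
    (a := vel (vel f) t x) (B := flowDefect n ε f u t x) (t := t)
    (by filter_upwards [isOpen_Ioo.mem_nhds ht] with s hs using hfl.hasDerivAt_f hs x)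
    (hfl.hasDerivAt_vel ht x)
    (by filter_upwards [isOpen_Ioo.mem_nhds ht] with s hs using hfl.mem_target' hs x)
    (hfl.tangentProj_flowDefect hemb ht x)
  rw [h1, abs_neg]
  have h2 := hfl.norm_flowDefect_le hC hC0 hε hn ht x
  have h3 := hC _ (hfl.mem_target' ht x) _ (hfl.vel_mem ht x) _ (hfl.vel_mem ht x)
  refine (abs_real_inner_le_norm _ _).trans ?_
  calc _ ≤ (C_N * e2 n ε (f t) x ^ ((n : ℝ) / 2)) * (C_N * ‖vel f t x‖ * ‖vel f t x‖) := by
        have := Real.rpow_nonneg (e2_nonneg (n := n) hε (f t) x) ((n : ℝ) / 2)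
        gcongr
    _ = _ := by ring

variable [MeasurableSpace M] [BorelSpace M] [CompactSpace M]

lemma continuousOn_flowDefect (hε : 0 ≤ ε) (hn : 3 ≤ n)
    (hfl : IsRegularizedCHF n N ε a b T f u) :
    ContinuousOn (fun z : ℝ × M ↦ flowDefect n ε f u z.1 z.2) (Ioo 0 T ×ˢ univ) :=
  hfl.flowReg_momentum.continuousOn.sub
    ((hfl.flowReg_f.of_le (s := 2) two_le_infty).continuousOn_regNLaplacian hε (by omega))

lemma integral_inner_regNLaplacian' (hε : 0 ≤ ε) (hn : 3 ≤ n)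
    (hfl : IsRegularizedCHF n N ε a b T f u) {t : ℝ} (ht : t ∈ Ioo 0 T)
    {ψ : M → EuclideanSpace ℝ (Fin L)} (hψ : ChartReg n 1 ψ) :
    ∫ x, inner ℝ (regNLaplacian n ε (f t) x) (ψ x) ∂(riemannianVolume n M) =
      -∫ x, e2 n ε (f t) x ^ ((n : ℝ) / 2 - 1) * dPair n (f t) ψ x ∂(riemannianVolume n M) := by
  have hκ : (0 : ℝ) ≤ (n : ℝ) / 2 - 1 := by
    have : (3 : ℝ) ≤ n := by exact_mod_cast hn
    linarith
  refine integral_inner_regNLaplacian (hfl.chartReg_slice ht) (by omega) (fun c i ↦ ?_) hψ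
  exact ((hfl.flowReg_f.of_le (s := 2) two_le_infty).contDiffOn_fluxChart hε hκ c i).comp
    (f := fun y ↦ (t, y)) (contDiff_prodMk_right t).contDiffOn fun _ hy ↦ ⟨ht, hy⟩

lemma hasDerivAt_integral_momentum (hfl : IsRegularizedCHF n N ε a b T f u) {t : ℝ}
    (ht : t ∈ Ioo 0 T) {ψ : M → EuclideanSpace ℝ (Fin L)} (hψ : Continuous ψ) :
    HasDerivAt (fun s ↦ ∫ x, inner ℝ (confFactor n u s x • vel f s x) (ψ x)
        ∂(riemannianVolume n M))
      (∫ x, inner ℝ (vel (fun t x ↦ confFactor n u t x • vel f t x) t x) (ψ x)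
        ∂(riemannianVolume n M)) t := by
  have hW1 := hfl.flowReg_momentum.of_le (s := 1) (by simp)
  refine hasDerivAt_integral_flow (n := n) ht
    (k := fun s x ↦ inner ℝ (confFactor n u s x • vel f s x) (ψ x))
    (k' := fun s x ↦ inner ℝ (vel (fun t x ↦ confFactor n u t x • vel f t x) s x) (ψ x))
    (fun s hs ↦ (hW1.slice hs).continuous.inner hψ) (fun s hs x ↦ ?_) ?_
  · have := (hW1.hasDerivAt hs x).inner ℝ (hasDerivAt_const s (ψ x))
    rwa [inner_zero_right, zero_add] at this
  · exact (hW1.vel (s := 0) (by simp)).continuousOn.inner (hψ.comp_continuousOn continuousOn_snd)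

lemma hasDerivAt_integral_fluxPair (hε : 0 ≤ ε) {κ : ℝ} (hκ : 0 ≤ κ)
    (hfl : IsRegularizedCHF n N ε a b T f u) {t : ℝ}
    (ht : t ∈ Ioo 0 T) {ψ : M → EuclideanSpace ℝ (Fin L)} (hψ : ChartReg n 1 ψ) :
    HasDerivAt (fun s ↦ ∫ x, e2 n ε (f s) x ^ κ * dPair n (f s) ψ x ∂(riemannianVolume n M))
      (∫ x, linFluxPair n ε κ (f t) (vel f t) ψ x ∂(riemannianVolume n M)) t := by
  have hf1 : FlowReg n T 1 f := hfl.flowReg_f.of_le (by simp)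
  have hv1 : FlowReg n T 1 (vel f) := hfl.flowReg_vel.of_le (by simp)
  have hf2 : FlowReg n T 2 f := hfl.flowReg_f.of_le two_le_infty
  have h1 : ∀ s ∈ Ioo 0 T, Continuous fun x ↦ e2 n ε (f s) x ^ κ * dPair n (f s) ψ x :=
    fun s hs ↦ (continuous_e2_rpow (hf1.slice hs) ε hκ).mul
      ((hf1.slice hs).chartReg_dPair hψ).continuous
  have h2 := continuousOn_linFluxPair hε hκ hf1 hv1 (hψ.flow T)
  have h3 : ∀ s ∈ Ioo 0 T, ∀ x, HasDerivAt (fun s ↦ e2 n ε (f s) x ^ κ * dPair n (f s) ψ x)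
      (linFluxPair n ε κ (f s) (vel f s) ψ x) s := fun s hs x ↦ by
    simp only [e2_eq]
    exact hasDerivAt_fluxPair hε hκ hf2 ψ hs x
  exact hasDerivAt_integral_flow (n := n) (T := T) ht
    (k := fun s x ↦ e2 n ε (f s) x ^ κ * dPair n (f s) ψ x)
    (k' := fun s ↦ linFluxPair n ε κ (f s) (vel f s) ψ) h1 h3 h2

/-- The defect is normal and |f_t|^{2μ} f_t is tangent, so that term can be inserted for free. With
ψ frozen at its value at time t, the last integrand contains a difference that vanishes at s = t;
the identity can therefore be differentiated at t although the defect is only known to be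
continuous. -/
lemma integral_inner_momentum (hemb : IsEmbeddedSubmanifold N) (hε : 0 ≤ ε) (hn : 3 ≤ n)
    (hfl : IsRegularizedCHF n N ε a b T f u) {s μ : ℝ} (hs : s ∈ Ioo 0 T) (hμ : 0 ≤ μ)
    {ψ : M → EuclideanSpace ℝ (Fin L)} (hψ : ChartReg n 1 ψ) :
    ∫ x, inner ℝ (confFactor n u s x • vel f s x) (ψ x) ∂(riemannianVolume n M) =
      -(∫ x, e2 n ε (f s) x ^ ((n : ℝ) / 2 - 1) * dPair n (f s) ψ x ∂(riemannianVolume n M)) -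
      ∫ x, inner ℝ (flowDefect n ε f u s x) (powFlux 0 μ (vel f s x) - ψ x)
        ∂(riemannianVolume n M) := by
  have hv1 : FlowReg n T 1 (fun t x ↦ powFlux 0 μ (vel f t x)) :=
    (hfl.flowReg_vel.of_le (s := 1) (by simp)).powFlux hμ
  have hB : ∀ x, inner ℝ (flowDefect n ε f u s x) (powFlux 0 μ (vel f s x)) = (0 : ℝ) := fun x ↦ by
    rw [powFlux, real_inner_smul_right, hfl.inner_flowDefect_vel hemb hs, mul_zero]
  have hDc : Continuous (flowDefect n ε f u s) :=
    continuous_slice hs (hfl.continuousOn_flowDefect hε hn)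
  have hRc : Continuous (regNLaplacian n ε (f s)) :=
    continuous_slice (k := fun t x ↦ regNLaplacian n ε (f t) x) hs
      ((hfl.flowReg_f.of_le two_le_infty).continuousOn_regNLaplacian hε (by omega))
  have h1 : ∀ x, inner ℝ (confFactor n u s x • vel f s x) (ψ x) =
      inner ℝ (regNLaplacian n ε (f s) x) (ψ x) -
        inner ℝ (flowDefect n ε f u s x) (powFlux 0 μ (vel f s x) - ψ x) := fun x ↦ by
    rw [inner_sub_right, hB, flowDefect, inner_sub_left]
    ring
  rw [integral_congr_ae (Eventually.of_forall h1), integral_sub,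
    hfl.integral_inner_regNLaplacian' hε hn hs hψ]
  · exact integrable_of_continuous (hRc.inner hψ.continuous)
  · exact integrable_of_continuous (hDc.inner ((hv1.slice hs).continuous.sub hψ.continuous))

/-- The time derivative of the weak form of the flow equation, tested with `|f_t|^{2μ} f_t`. -/
lemma integral_inner_deriv_momentum (hemb : IsEmbeddedSubmanifold N) (hε : 0 ≤ ε) (hn : 3 ≤ n)
    (hfl : IsRegularizedCHF n N ε a b T f u) {t μ : ℝ} (ht : t ∈ Ioo 0 T) (hμ : 0 ≤ μ) :
    ∫ x, inner ℝ (vel (fun t x ↦ confFactor n u t x • vel f t x) t x) (powFlux 0 μ (vel f t x))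
        ∂(riemannianVolume n M) =
      -∫ x, linFluxPair n ε ((n : ℝ) / 2 - 1) (f t) (vel f t) (fun x ↦ powFlux 0 μ (vel f t x)) x
        ∂(riemannianVolume n M)
      - ∫ x, inner ℝ (flowDefect n ε f u t x) (vel (fun t x ↦ powFlux 0 μ (vel f t x)) t x)
        ∂(riemannianVolume n M) := by
  have hκ : (0 : ℝ) ≤ (n : ℝ) / 2 - 1 := by
    have : (3 : ℝ) ≤ n := by exact_mod_cast hn
    linarith
  have hψ : FlowReg n T 1 (fun t x ↦ powFlux 0 μ (vel f t x)) :=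
    (hfl.flowReg_vel.of_le (s := 1) (by simp)).powFlux hμ
  have hψ0 : ChartReg n 1 (fun x ↦ powFlux 0 μ (vel f t x)) := hψ.slice ht
  have d1 := hfl.hasDerivAt_integral_momentum ht hψ0.continuous
  have d2 := hfl.hasDerivAt_integral_fluxPair hε hκ ht hψ0
  -- The only term in which the other factor need not be differentiable in time.
  have d3 := hasDerivAt_integral_inner_sub (n := n) ht (B := flowDefect n ε f u)
    (ψ := fun t x ↦ powFlux 0 μ (vel f t x)) (ψ' := vel (fun t x ↦ powFlux 0 μ (vel f t x)))
    (hfl.continuousOn_flowDefect hε hn) (fun s hs ↦ (hψ.slice hs).continuous)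
    (fun s hs x ↦ hψ.hasDerivAt hs x) (hψ.vel (s := 0) (by simp)).continuousOn
  refine d1.unique ((d2.neg.sub d3).congr_of_eventuallyEq ?_)
  filter_upwards [isOpen_Ioo.mem_nhds ht] with s hs
  exact hfl.integral_inner_momentum hemb hε hn hs hμ hψ0

end IsRegularizedCHF

end FlowEstimates

/-! ### Differential inequalities. -/

section ODE

lemma le_exp_mul_of_deriv_le {F : ℝ → ℝ} {C s t : ℝ} (hst : s ≤ t)
    (h : ∀ r ∈ Icc s t, ∃ d, HasDerivAt F d r ∧ d ≤ C * F r) :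
    F t ≤ Real.exp (C * (t - s)) * F s := by
  have hd : ∀ r ∈ Icc s t, ∃ d, HasDerivAt (fun r ↦ Real.exp (-(C * r)) * F r) d r ∧ d ≤ 0 := by
    intro r hr
    obtain ⟨d, hd, hle⟩ := h r hr
    have h1 : HasDerivAt (fun r : ℝ ↦ Real.exp (-(C * r))) (Real.exp (-(C * r)) * (-C)) r := by
      have := ((hasDerivAt_id r).const_mul C).neg.exp
      simpa using this
    refine ⟨_, h1.mul hd, ?_⟩
    have : 0 < Real.exp (-(C * r)) := Real.exp_pos _
    nlinarith
  have hanti : AntitoneOn (fun r ↦ Real.exp (-(C * r)) * F r) (Icc s t) := by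
    refine antitoneOn_of_deriv_nonpos (convex_Icc s t) (fun r hr ↦ ?_) (fun r hr ↦ ?_)
      (fun r hr ↦ ?_)
    · obtain ⟨d, hd, -⟩ := hd r hr; exact hd.continuousAt.continuousWithinAt
    · rw [interior_Icc] at hr
      obtain ⟨d, hd, -⟩ := hd r (Ioo_subset_Icc_self hr)
      exact hd.differentiableAt.differentiableWithinAt
    · rw [interior_Icc] at hr
      obtain ⟨d, hd, hle⟩ := hd r (Ioo_subset_Icc_self hr)
      rwa [hd.deriv]
  have h1 : Real.exp (-(C * t)) * F t ≤ Real.exp (-(C * s)) * F s :=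
    hanti (left_mem_Icc.2 hst) (right_mem_Icc.2 hst) hst
  have h2 : Real.exp (C * t) * (Real.exp (-(C * t)) * F t) = F t := by
    rw [← mul_assoc, ← Real.exp_add]; simp
  have h3 : Real.exp (C * t) * (Real.exp (-(C * s)) * F s) = Real.exp (C * (t - s)) * F s := by
    rw [← mul_assoc, ← Real.exp_add]; ring_nf
  rw [← h2, ← h3]
  exact mul_le_mul_of_nonneg_left h1 (Real.exp_pos _).le

/-- Since 0 ≤ F₀ ≤ B, the mean value theorem gives an instant ξ between s and s' at which F₀' ≥
-B/(s' - s). There the dissipation G is bounded, hence so is F₁, and Grönwall carries the bound from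
ξ to all later times. No integration of G in time is required. -/
lemma bootstrap_step {F₀ F₁ G : ℝ → ℝ} {T C c K s s' B : ℝ} (hc : 0 < c) (hK : 0 ≤ K)
    (hC : 0 ≤ C) (hs : 0 < s) (hss' : s < s')
    (hF0 : ∀ t ∈ Ioo 0 T, ∃ d, HasDerivAt F₀ d t ∧ d ≤ C * F₀ t - c * G t)
    (hF1 : ∀ t ∈ Ioo 0 T, ∃ d, HasDerivAt F₁ d t ∧ d ≤ C * F₁ t)
    (hF1G : ∀ t ∈ Ioo 0 T, F₁ t ≤ K * G t) (hpos0 : ∀ t, 0 ≤ F₀ t) (hpos1 : ∀ t, 0 ≤ F₁ t)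
    (hbound : ∀ t ∈ Ico s T, F₀ t ≤ B) :
    ∀ t ∈ Ico s' T, F₁ t ≤ Real.exp (C * T) * (K * ((C * B + B / (s' - s)) / c)) := by
  intro t ht
  have hT : s' < T := ht.1.trans_lt ht.2
  have hmem : ∀ r, s ≤ r → r ≤ t → r ∈ Ioo 0 T := fun r h1 h2 ↦
    ⟨hs.trans_le h1, h2.trans_lt ht.2⟩
  choose! d hd hle using hF0
  obtain ⟨ξ, hξ, hslope⟩ := exists_hasDerivAt_eq_slope F₀ d hss'
    (fun r hr ↦ (hd r (hmem r hr.1 (hr.2.trans ht.1))).continuousAt.continuousWithinAt)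
    (fun r hr ↦ hd r (hmem r hr.1.le (hr.2.le.trans ht.1)))
  have hξm := hmem ξ hξ.1.le (hξ.2.le.trans ht.1)
  have h1 : -(B / (s' - s)) ≤ d ξ := by
    rw [hslope, ← neg_div]
    have h2 : 0 < s' - s := by linarith
    gcongr
    have := hbound s ⟨le_rfl, hss'.trans hT⟩
    linarith [hpos0 s']
  have h2 : G ξ ≤ (C * B + B / (s' - s)) / c := by
    rw [le_div_iff₀ hc]
    have h3 := hle ξ hξm
    have h4 : C * F₀ ξ ≤ C * B :=
      mul_le_mul_of_nonneg_left (hbound ξ ⟨hξ.1.le, hξm.2⟩) hC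
    linarith
  have h5 : F₁ ξ ≤ K * ((C * B + B / (s' - s)) / c) :=
    (hF1G ξ hξm).trans (mul_le_mul_of_nonneg_left h2 hK)
  have h6 := le_exp_mul_of_deriv_le (F := F₁) (C := C) (hξ.2.le.trans ht.1) fun r hr ↦
    hF1 r (hmem r (hξ.1.le.trans hr.1) hr.2)
  refine h6.trans ?_
  have h7 : Real.exp (C * (t - ξ)) ≤ Real.exp (C * T) := by
    apply Real.exp_le_exp.2
    have : t - ξ ≤ T := by linarith [ht.2, hξm.1]
    gcongr
  exact mul_le_mul h7 h5 (hpos1 ξ) (Real.exp_pos _).le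

end ODE

/-! ### Continuity of integrals in time. -/

section ParametricContinuity

variable {M : Type*} [EMetricSpace M] [MeasurableSpace M] [BorelSpace M] [CompactSpace M]

lemma continuousOn_integral_flow (ν : Measure M) [IsFiniteMeasure ν] {I : Set ℝ}
    (hI : IsCompact I) {k : ℝ → M → ℝ}
    (hk : ContinuousOn (fun z : ℝ × M ↦ k z.1 z.2) (I ×ˢ univ)) :
    ContinuousOn (fun t ↦ ∫ x, k t x ∂ν) I := by
  obtain ⟨C, hC⟩ := (hI.prod isCompact_univ).exists_bound_of_continuousOn hk
  refine continuousOn_of_dominated (bound := fun _ ↦ C) (fun t ht ↦ ?_) (fun t ht ↦ ?_)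
    (integrable_const C) ?_
  · have : Continuous (k t) := by
      rw [← continuousOn_univ]
      exact hk.comp (f := fun x ↦ (t, x)) (by fun_prop) fun x _ ↦ ⟨ht, mem_univ x⟩
    exact this.aestronglyMeasurable
  · exact Eventually.of_forall fun x ↦ hC (t, x) ⟨ht, mem_univ x⟩
  · exact Eventually.of_forall fun x ↦
      hk.comp (f := fun t ↦ (t, x)) (by fun_prop) fun t ht ↦ ⟨ht, mem_univ x⟩

end ParametricContinuity

/-! ### Evolution of the weighted velocity energies. -/

section VelocityBound

variable {n L : ℕ} {M : Type*} [EMetricSpace M] [ChartedSpace (EuclideanSpace ℝ (Fin n)) M]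
  [RiemannianBundle (fun x : M ↦ TangentSpace (𝓡 n) x)] [IsManifold (𝓡 n) ∞ M]
  [IsContMDiffRiemannianBundle (𝓡 n) ∞ (EuclideanSpace ℝ (Fin n))
          (fun x : M ↦ TangentSpace (𝓡 n) x)]
  [MeasurableSpace M] [BorelSpace M] [CompactSpace M]
  {N : Set (EuclideanSpace ℝ (Fin L))} {ε a b T C_N : ℝ}
  {f : ℝ → M → EuclideanSpace ℝ (Fin L)} {u : ℝ → M → ℝ}

/-- `∫ e^{nu} |f_t|^{2μ + 2}`. -/
def weightedEnergy (n : ℕ) [ChartedSpace (EuclideanSpace ℝ (Fin n)) M]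
    [RiemannianBundle (fun x : M ↦ TangentSpace (𝓡 n) x)] (μ : ℝ)
    (f : ℝ → M → EuclideanSpace ℝ (Fin L)) (u : ℝ → M → ℝ) (t : ℝ) : ℝ :=
  ∫ x, confFactor n u t x * (‖vel f t x‖ ^ 2) ^ (μ + 1) ∂(riemannianVolume n M)

/-- `∫ e₂^{n/2 - 1} |f_t|^{2μ} |df_t|² + e₂^{n/2} |f_t|^{2μ + 2}`. -/
def dissipation (n : ℕ) [ChartedSpace (EuclideanSpace ℝ (Fin n)) M]
    [RiemannianBundle (fun x : M ↦ TangentSpace (𝓡 n) x)] (ε μ : ℝ)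
    (f : ℝ → M → EuclideanSpace ℝ (Fin L)) (t : ℝ) : ℝ :=
  ∫ x, (e2 n ε (f t) x ^ ((n : ℝ) / 2 - 1) * (‖vel f t x‖ ^ 2) ^ μ *
      dPair n (vel f t) (vel f t) x +
    e2 n ε (f t) x ^ ((n : ℝ) / 2) * (‖vel f t x‖ ^ 2) ^ (μ + 1)) ∂(riemannianVolume n M)

lemma weightedEnergy_nonneg (μ t : ℝ) : 0 ≤ weightedEnergy n μ f u t :=
  integral_nonneg fun x ↦ mul_nonneg (confFactor_pos u t x).le (by positivity)

namespace IsRegularizedCHF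

lemma continuous_norm_vel_rpow (hfl : IsRegularizedCHF n N ε a b T f u) {t : ℝ}
    (ht : t ∈ Ioo 0 T) {μ : ℝ} (hμ : 0 ≤ μ) : Continuous fun x ↦ (‖vel f t x‖ ^ 2) ^ μ :=
  ((hfl.flowReg_vel.slice ht).continuous.norm.pow 2).rpow_const fun _ ↦ Or.inr hμ

lemma continuous_e2_rpow (hfl : IsRegularizedCHF n N ε a b T f u) {t : ℝ}
    (ht : t ∈ Ioo 0 T) {κ : ℝ} (hκ : 0 ≤ κ) : Continuous fun x ↦ e2 n ε (f t) x ^ κ :=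
  _root_.continuous_e2_rpow (hfl.chartReg_slice ht) ε hκ

lemma continuous_dissipation (hn : 3 ≤ n) (hfl : IsRegularizedCHF n N ε a b T f u) {t : ℝ}
    (ht : t ∈ Ioo 0 T) {μ : ℝ} (hμ : 0 ≤ μ) :
    Continuous fun x ↦ e2 n ε (f t) x ^ ((n : ℝ) / 2 - 1) * (‖vel f t x‖ ^ 2) ^ μ *
      dPair n (vel f t) (vel f t) x +
    e2 n ε (f t) x ^ ((n : ℝ) / 2) * (‖vel f t x‖ ^ 2) ^ (μ + 1) := by
  have hn' : (3 : ℝ) ≤ n := by exact_mod_cast hn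
  have hv : ChartReg n 1 (vel f t) := (hfl.flowReg_vel.slice ht).of_le (by simp)
  exact (((hfl.continuous_e2_rpow ht (by linarith)).mul (hfl.continuous_norm_vel_rpow ht hμ)).mul
    (hv.chartReg_dPair hv).continuous).add
    ((hfl.continuous_e2_rpow ht (by linarith)).mul (hfl.continuous_norm_vel_rpow ht (by linarith)))

lemma vel_momentum (hfl : IsRegularizedCHF n N ε a b T f u) {t : ℝ} (ht : t ∈ Ioo 0 T) (x : M) :
    vel (fun t x ↦ confFactor n u t x • vel f t x) t x =
      confFactor n u t x • vel (vel f) t x +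
      (n * b * e2 n ε (f t) x ^ ((n : ℝ) / 2) - n * a * confFactor n u t x) • vel f t x :=
  ((hfl.hasDerivAt_confFactor ht x).smul (hfl.hasDerivAt_vel ht x)).deriv

lemma vel_powFlux (hfl : IsRegularizedCHF n N ε a b T f u) {t μ : ℝ} (ht : t ∈ Ioo 0 T)
    (hμ : 0 ≤ μ) (x : M) :
    vel (fun t x ↦ powFlux 0 μ (vel f t x)) t x =
      powFluxDeriv 0 μ (vel f t x) (vel (vel f) t x) :=
  ((hasFDerivAt_powFlux le_rfl hμ (vel f t x)).comp_hasDerivAt t (hfl.hasDerivAt_vel ht x)).deriv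

/-- The energy is the pairing of the momentum w f_t with |f_t|^{2μ} f_t. The derivative of the
second factor contributes (2μ + 1)|f_t|^{2μ}⟨f_t, w f_tt⟩, and w f_tt is the derivative of the
momentum minus w_t f_t. Hence the weights 2μ + 2 and -(2μ + 1). -/
lemma hasDerivAt_weightedEnergy (hfl : IsRegularizedCHF n N ε a b T f u) {t μ : ℝ}
    (ht : t ∈ Ioo 0 T) (hμ : 0 ≤ μ) :
    HasDerivAt (weightedEnergy n μ f u)
      (∫ x, ((2 * μ + 2) * inner ℝ (vel (fun t x ↦ confFactor n u t x • vel f t x) t x)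
          (powFlux 0 μ (vel f t x)) -
        (2 * μ + 1) * ((n * b * e2 n ε (f t) x ^ ((n : ℝ) / 2) - n * a * confFactor n u t x) *
          (‖vel f t x‖ ^ 2) ^ (μ + 1))) ∂(riemannianVolume n M)) t := by
  have hW1 := hfl.flowReg_momentum.of_le (s := 1) (by simp)
  have hψ : FlowReg n T 1 (fun t x ↦ powFlux 0 μ (vel f t x)) :=
    (hfl.flowReg_vel.of_le (s := 1) (by simp)).powFlux hμ
  have hd : ∀ s ∈ Ioo 0 T, ∀ x, HasDerivAt (fun s ↦ inner ℝ (confFactor n u s x • vel f s x)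
        (powFlux 0 μ (vel f s x)))
      (inner ℝ (confFactor n u s x • vel f s x) (vel (fun t x ↦ powFlux 0 μ (vel f t x)) s x) +
      inner ℝ (vel (fun t x ↦ confFactor n u t x • vel f t x) s x) (powFlux 0 μ (vel f s x))) s :=
    fun s hs x ↦ (hW1.hasDerivAt hs x).inner ℝ (hψ.hasDerivAt hs x)
  have hc : ContinuousOn (fun z : ℝ × M ↦ inner ℝ (confFactor n u z.1 z.2 • vel f z.1 z.2)
        (vel (fun t x ↦ powFlux 0 μ (vel f t x)) z.1 z.2) +
      inner ℝ (vel (fun t x ↦ confFactor n u t x • vel f t x) z.1 z.2)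
        (powFlux 0 μ (vel f z.1 z.2))) (Ioo 0 T ×ˢ univ) :=
    (hW1.continuousOn.inner (hψ.vel (s := 0) (by simp)).continuousOn).add
      ((hW1.vel (s := 0) (by simp)).continuousOn.inner hψ.continuousOn)
  have hk : ∀ s ∈ Ioo 0 T, Continuous fun x ↦ inner ℝ (confFactor n u s x • vel f s x)
      (powFlux 0 μ (vel f s x)) :=
    fun s hs ↦ (hW1.slice hs).continuous.inner (hψ.slice hs).continuous
  have h1 := hasDerivAt_integral_flow (n := n) (T := T) ht
    (k := fun s x ↦ inner ℝ (confFactor n u s x • vel f s x) (powFlux 0 μ (vel f s x)))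
    (k' := fun s x ↦ inner ℝ (confFactor n u s x • vel f s x)
        (vel (fun t x ↦ powFlux 0 μ (vel f t x)) s x) +
      inner ℝ (vel (fun t x ↦ confFactor n u t x • vel f t x) s x) (powFlux 0 μ (vel f s x)))
    hk hd hc
  have h2 : weightedEnergy n μ f u = fun s ↦ ∫ x, inner ℝ (confFactor n u s x • vel f s x)
      (powFlux 0 μ (vel f s x)) ∂(riemannianVolume n M) := by
    ext s
    refine integral_congr_ae (Eventually.of_forall fun x ↦ ?_)
    simp only [real_inner_smul_left, inner_powFlux_self hμ]
  rw [h2]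
  refine h1.congr_deriv (integral_congr_ae (Eventually.of_forall fun x ↦ ?_))
  simp only [hfl.vel_momentum ht, hfl.vel_powFlux ht hμ, real_inner_smul_left,
    inner_powFluxDeriv_self hμ, inner_add_left, inner_powFlux_self hμ]
  rw [powFlux, real_inner_smul_right, real_inner_comm, zero_add]
  ring

lemma integral_linFluxPair_ge (hε : 0 ≤ ε) (hn : 3 ≤ n) (hn' : n ≤ 4)
    (hfl : IsRegularizedCHF n N ε a b T f u) {t μ : ℝ} (ht : t ∈ Ioo 0 T) (hμ : 0 ≤ μ)
    (hμ1 : μ ≤ 1) :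
    ∫ x, e2 n ε (f t) x ^ ((n : ℝ) / 2 - 1) * (‖vel f t x‖ ^ 2) ^ μ *
      dPair n (vel f t) (vel f t) x ∂(riemannianVolume n M) ≤
    ∫ x, linFluxPair n ε ((n : ℝ) / 2 - 1) (f t) (vel f t) (fun x ↦ powFlux 0 μ (vel f t x)) x
      ∂(riemannianVolume n M) := by
  have hn3 : (3 : ℝ) ≤ n := by exact_mod_cast hn
  have hn4 : (n : ℝ) ≤ 4 := by exact_mod_cast hn'
  have hκ : (0 : ℝ) ≤ (n : ℝ) / 2 - 1 := by linarith
  have hf1 : FlowReg n T 1 f := hfl.flowReg_f.of_le (by simp)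
  have hv1 : FlowReg n T 1 (vel f) := hfl.flowReg_vel.of_le (by simp)
  have hv := hv1.slice ht
  have hψ : FlowReg n T 1 (fun t x ↦ powFlux 0 μ (vel f t x)) := hv1.powFlux hμ
  have c4 : ContinuousOn (fun z : ℝ × M ↦ linFluxPair n ε ((n : ℝ) / 2 - 1) (f z.1) (vel f z.1)
      (fun x ↦ powFlux 0 μ (vel f z.1 x)) z.2) (Ioo 0 T ×ˢ univ) :=
    continuousOn_linFluxPair (ψ := fun t x ↦ powFlux 0 μ (vel f t x)) hε hκ hf1 hv1 hψ
  have c3 : Continuous fun x ↦ linFluxPair n ε ((n : ℝ) / 2 - 1) (f t) (vel f t)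
      (fun x ↦ powFlux 0 μ (vel f t x)) x := by
    rw [← continuousOn_univ]
    exact c4.comp (f := fun x ↦ (t, x)) (by fun_prop) fun x _ ↦ ⟨ht, mem_univ x⟩
  have c1 := ((hfl.continuous_e2_rpow ht hκ).mul (hfl.continuous_norm_vel_rpow ht hμ)).mul
    (hv.chartReg_dPair hv).continuous
  refine integral_mono (integrable_of_continuous (n := n) c1)
    (integrable_of_continuous (n := n) c3) fun x ↦ ?_
  exact le_linFluxPair (n := n) hε hκ (by linarith) hμ hμ1 (f t) hv x

/-- Normality of the defect reduces the derivative of |f_t|^{2μ} f_t to |f_t|^{2μ} f_tt, and the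
normal part of f_tt is quadratic in f_t. -/
lemma integral_inner_flowDefect_ge (hemb : IsEmbeddedSubmanifold N)
    (hC : SecondFFBoundedBy N C_N) (hC0 : 0 ≤ C_N) (hε : 0 ≤ ε) (hn : 3 ≤ n)
    (hfl : IsRegularizedCHF n N ε a b T f u) {t μ : ℝ} (ht : t ∈ Ioo 0 T) (hμ : 0 ≤ μ) :
    -(C_N ^ 2 * ∫ x, e2 n ε (f t) x ^ ((n : ℝ) / 2) * (‖vel f t x‖ ^ 2) ^ (μ + 1)
      ∂(riemannianVolume n M)) ≤
    ∫ x, inner ℝ (flowDefect n ε f u t x) (vel (fun t x ↦ powFlux 0 μ (vel f t x)) t x)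
      ∂(riemannianVolume n M) := by
  have hv1 : FlowReg n T 1 (vel f) := hfl.flowReg_vel.of_le (by simp)
  have hψ : FlowReg n T 1 (fun t x ↦ powFlux 0 μ (vel f t x)) := hv1.powFlux hμ
  have c4 := (continuous_slice ht (hfl.continuousOn_flowDefect hε hn)).inner (𝕜 := ℝ)
      ((hψ.vel (s := 0) (by simp)).slice ht).continuous
  have c1 := (hfl.continuous_e2_rpow ht (κ := (n : ℝ) / 2) (by positivity)).mul
    (hfl.continuous_norm_vel_rpow ht (μ := μ + 1) (by linarith))
  rw [← integral_const_mul, ← integral_neg]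
  refine integral_mono (((integrable_of_continuous (n := n) c1).const_mul _).neg)
    (integrable_of_continuous (n := n) c4) fun x ↦ ?_
  have hacc := hfl.abs_inner_flowDefect_acc_le hemb hC hC0 hε hn ht x
  have hB := hfl.inner_flowDefect_vel hemb ht x
  have hV : (‖vel f t x‖ ^ 2) ^ (μ + 1) = (‖vel f t x‖ ^ 2) ^ μ * ‖vel f t x‖ ^ 2 :=
    Real.rpow_add_one' (by positivity) (by positivity)
  have hVμ : 0 ≤ (‖vel f t x‖ ^ 2) ^ μ := by positivity
  simp only [hfl.vel_powFlux ht hμ, inner_powFluxDeriv_of_inner_eq_zero _ hB, hV]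
  have h2 := mul_le_mul_of_nonneg_left (neg_le_of_abs_le hacc) hVμ
  refine le_trans (le_of_eq ?_) h2
  ring

/-- The evolution inequality for the weighted energies. -/
lemma deriv_weightedEnergy_le (hemb : IsEmbeddedSubmanifold N)
    (hC : SecondFFBoundedBy N C_N) (hC0 : 0 ≤ C_N) (hε : 0 ≤ ε) (hn : 3 ≤ n) (hn' : n ≤ 4)
    (ha : 0 < a) (hCb : 0 < n * b / 2 - C_N - 2 * C_N ^ 2)
    (hfl : IsRegularizedCHF n N ε a b T f u) {t μ : ℝ} (ht : t ∈ Ioo 0 T) (hμ : 0 ≤ μ)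
    (hμ1 : μ ≤ 1) :
    ∃ d, HasDerivAt (weightedEnergy n μ f u) d t ∧
      d ≤ 3 * n * a * weightedEnergy n μ f u t - min 2 (n * b / 2) * dissipation n ε μ f t := by
  have hn3 : (3 : ℝ) ≤ n := by exact_mod_cast hn
  have hκ : (0 : ℝ) ≤ (n : ℝ) / 2 - 1 := by linarith
  refine ⟨_, hfl.hasDerivAt_weightedEnergy ht hμ, ?_⟩
  have hv1 : FlowReg n T 1 (vel f) := hfl.flowReg_vel.of_le (by simp)
  have hv := hv1.slice ht
  have hW1 := hfl.flowReg_momentum.of_le (s := 1) (by simp)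
  have hψ : FlowReg n T 1 (fun t x ↦ powFlux 0 μ (vel f t x)) := hv1.powFlux hμ
  have hwc : Continuous (confFactor n u t) := (hfl.flowReg_confFactor.slice ht).continuous
  have i1 : Integrable (fun x ↦ inner ℝ (vel (fun t x ↦ confFactor n u t x • vel f t x) t x)
      (powFlux 0 μ (vel f t x))) (riemannianVolume n M) :=
    integrable_of_continuous
      (((hW1.vel (s := 0) (by simp)).slice ht).continuous.inner (hψ.slice ht).continuous)
  have cV := hfl.continuous_norm_vel_rpow ht (μ := μ + 1) (by linarith)
  have iQ : Integrable (fun x ↦ e2 n ε (f t) x ^ ((n : ℝ) / 2) * (‖vel f t x‖ ^ 2) ^ (μ + 1))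
      (riemannianVolume n M) :=
    integrable_of_continuous ((hfl.continuous_e2_rpow ht (by linarith)).mul cV)
  have iW : Integrable (fun x ↦ confFactor n u t x * (‖vel f t x‖ ^ 2) ^ (μ + 1))
      (riemannianVolume n M) := integrable_of_continuous (hwc.mul cV)
  have iP : Integrable (fun x ↦ e2 n ε (f t) x ^ ((n : ℝ) / 2 - 1) * (‖vel f t x‖ ^ 2) ^ μ *
      dPair n (vel f t) (vel f t) x) (riemannianVolume n M) :=
    integrable_of_continuous (((hfl.continuous_e2_rpow ht hκ).mul
      (hfl.continuous_norm_vel_rpow ht hμ)).mul (hv.chartReg_dPair hv).continuous)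
  have e2' : ∀ x, (2 * μ + 1) * ((n * b * e2 n ε (f t) x ^ ((n : ℝ) / 2) -
      n * a * confFactor n u t x) * (‖vel f t x‖ ^ 2) ^ (μ + 1)) =
      (2 * μ + 1) * (n * b) * (e2 n ε (f t) x ^ ((n : ℝ) / 2) * (‖vel f t x‖ ^ 2) ^ (μ + 1)) -
      (2 * μ + 1) * (n * a) * (confFactor n u t x * (‖vel f t x‖ ^ 2) ^ (μ + 1)) :=
    fun x ↦ by ring
  have iQW : Integrable (fun x ↦
      (2 * μ + 1) * (n * b) * (e2 n ε (f t) x ^ ((n : ℝ) / 2) * (‖vel f t x‖ ^ 2) ^ (μ + 1)) -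
      (2 * μ + 1) * (n * a) * (confFactor n u t x * (‖vel f t x‖ ^ 2) ^ (μ + 1)))
      (riemannianVolume n M) := (iQ.const_mul _).sub (iW.const_mul _)
  have hL := hfl.integral_linFluxPair_ge hε hn hn' ht hμ hμ1
  have hA := hfl.integral_inner_flowDefect_ge hemb hC hC0 hε hn ht hμ
  have hsplit := hfl.integral_inner_deriv_momentum hemb hε hn ht hμ
  have hdiss : dissipation n ε μ f t = _ := integral_add iP iQ
  have hP0 : 0 ≤ ∫ x, e2 n ε (f t) x ^ ((n : ℝ) / 2 - 1) * (‖vel f t x‖ ^ 2) ^ μ *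
      dPair n (vel f t) (vel f t) x ∂(riemannianVolume n M) :=
    integral_nonneg fun x ↦ mul_nonneg (mul_nonneg
      (Real.rpow_nonneg (e2_nonneg (n := n) hε (f t) x) _) (by positivity))
      (dPair_self_nonneg _ x)
  have hQ0 : 0 ≤ ∫ x, e2 n ε (f t) x ^ ((n : ℝ) / 2) * (‖vel f t x‖ ^ 2) ^ (μ + 1)
      ∂(riemannianVolume n M) :=
    integral_nonneg fun x ↦ mul_nonneg
      (Real.rpow_nonneg (e2_nonneg (n := n) hε (f t) x) _) (by positivity)
  have hW0 : 0 ≤ weightedEnergy n μ f u t := weightedEnergy_nonneg μ t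
  simp only [e2']
  rw [integral_sub (i1.const_mul _) iQW,
    integral_sub (iQ.const_mul _) (iW.const_mul _), integral_const_mul, integral_const_mul,
    integral_const_mul, hsplit, hdiss]
  change _ - (_ - (2 * μ + 1) * (n * a) * weightedEnergy n μ f u t) ≤ _
  generalize weightedEnergy n μ f u t = W at *
  generalize (∫ x, e2 n ε (f t) x ^ ((n : ℝ) / 2) * (‖vel f t x‖ ^ 2) ^ (μ + 1)
      ∂(riemannianVolume n M)) = Q at *
  generalize (∫ x, e2 n ε (f t) x ^ ((n : ℝ) / 2 - 1) * (‖vel f t x‖ ^ 2) ^ μ *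
      dPair n (vel f t) (vel f t) x ∂(riemannianVolume n M)) = P at *
  generalize (∫ x, linFluxPair n ε ((n : ℝ) / 2 - 1) (f t) (vel f t)
      (fun x ↦ powFlux 0 μ (vel f t x)) x ∂(riemannianVolume n M)) = lin at *
  generalize (∫ x, inner ℝ (flowDefect n ε f u t x) (vel (fun t x ↦ powFlux 0 μ (vel f t x)) t x)
      ∂(riemannianVolume n M)) = A at *
  clear hdiss hsplit e2'
  have hm1 : min 2 (n * b / 2) ≤ 2 := min_le_left _ _
  have hm2 : min 2 (n * b / 2) ≤ n * b / 2 := min_le_right _ _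
  generalize min 2 (n * b / 2) = c at *
  have g1 : (2 * μ + 2) * (P - C_N ^ 2 * Q) ≤ (2 * μ + 2) * (lin + A) :=
    mul_le_mul_of_nonneg_left (by linarith) (by linarith)
  have g3 : c * P ≤ (2 * μ + 2) * P := mul_le_mul_of_nonneg_right (by linarith) hP0
  have g4 : (2 * μ + 1) * (n * a) * W ≤ 3 * n * a * W := by
    have : 0 ≤ n * a * W := by positivity
    nlinarith
  -- Positivity of C_b enters here: nb/2 > 2C_N² gives (2μ+1)nb ≥ nb/2 + (2μ+2)C_N², so the source
  -- of w pays for the curvature of N and still leaves c ≤ nb/2 for the dissipation.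
  have g5 : (c + (2 * μ + 2) * C_N ^ 2) * Q ≤ ((2 * μ + 1) * (n * b)) * Q := by
    refine mul_le_mul_of_nonneg_right ?_ hQ0
    nlinarith [sq_nonneg C_N, mul_nonneg hμ (sq_nonneg C_N)]
  linarith

end IsRegularizedCHF

end VelocityBound

/-! ### Raising the power of the velocity up to n. -/

section VelocityBound

variable {n L : ℕ} {M : Type*} [EMetricSpace M] [ChartedSpace (EuclideanSpace ℝ (Fin n)) M]
  [RiemannianBundle (fun x : M ↦ TangentSpace (𝓡 n) x)] [IsManifold (𝓡 n) ∞ M]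
  [IsContMDiffRiemannianBundle (𝓡 n) ∞ (EuclideanSpace ℝ (Fin n))
          (fun x : M ↦ TangentSpace (𝓡 n) x)]
  [MeasurableSpace M] [BorelSpace M] [CompactSpace M]
  {N : Set (EuclideanSpace ℝ (Fin L))} {ε a b T C_N : ℝ}
  {f : ℝ → M → EuclideanSpace ℝ (Fin L)} {u : ℝ → M → ℝ}

namespace IsRegularizedCHF

lemma integral_inner_momentum_self (hemb : IsEmbeddedSubmanifold N) (hε : 0 ≤ ε) (hn : 3 ≤ n)
    (hfl : IsRegularizedCHF n N ε a b T f u) {t μ : ℝ} (ht : t ∈ Ioo 0 T) (hμ : 0 ≤ μ) :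
    weightedEnergy n μ f u t =
      -∫ x, e2 n ε (f t) x ^ ((n : ℝ) / 2 - 1) *
        dPair n (f t) (fun x ↦ powFlux 0 μ (vel f t x)) x ∂(riemannianVolume n M) := by
  have hψ : FlowReg n T 1 (fun t x ↦ powFlux 0 μ (vel f t x)) :=
    (hfl.flowReg_vel.of_le (s := 1) (by simp)).powFlux hμ
  have h := hfl.integral_inner_momentum hemb hε hn ht hμ (hψ.slice ht)
  simp only [sub_self, inner_zero_right, integral_zero, sub_zero] at h
  rw [← h]
  refine integral_congr_ae (Eventually.of_forall fun x ↦ ?_)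
  simp only [real_inner_smul_left, inner_powFlux_self hμ]

/-- The equation is tested with |f_t|^{2μ+1} f_t, against which the defect vanishes. The remaining
integrand is at most 2(1+μ) e^κ |df| |f_t|^{2μ+1} |df_t|; splitting it as |df_t| times |df||f_t| by
the arithmetic-geometric mean inequality gives the two parts of the dissipation. This is the gain of
one power of |f_t|. -/
lemma weightedEnergy_le_dissipation (hemb : IsEmbeddedSubmanifold N) (hε : 0 ≤ ε) (hn : 3 ≤ n)
    (hfl : IsRegularizedCHF n N ε a b T f u) {t μ : ℝ} (ht : t ∈ Ioo 0 T) (hμ : 0 ≤ μ) :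
    weightedEnergy n (μ + 1 / 2) f u t ≤ (1 + μ) * dissipation n ε μ f t := by
  have hn3 : (3 : ℝ) ≤ n := by exact_mod_cast hn
  have hκ : (0 : ℝ) ≤ (n : ℝ) / 2 - 1 := by linarith
  have hμ' : 0 ≤ μ + 1 / 2 := by linarith
  have hv1 : FlowReg n T 1 (vel f) := hfl.flowReg_vel.of_le (by simp)
  have hψ : ChartReg n 1 (fun x ↦ powFlux 0 (μ + 1 / 2) (vel f t x)) := (hv1.powFlux hμ').slice ht
  have c1 : Continuous fun x ↦ e2 n ε (f t) x ^ ((n : ℝ) / 2 - 1) *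
      dPair n (f t) (fun x ↦ powFlux 0 (μ + 1 / 2) (vel f t x)) x :=
    (hfl.continuous_e2_rpow ht hκ).mul ((hfl.chartReg_slice ht).chartReg_dPair hψ).continuous
  rw [hfl.integral_inner_momentum_self hemb hε hn ht hμ', dissipation, ← integral_const_mul,
    ← integral_neg]
  refine integral_mono (integrable_of_continuous c1).neg
    ((integrable_of_continuous (hfl.continuous_dissipation hn ht hμ)).const_mul _) fun x ↦ ?_
  have he := e2_nonneg (n := n) hε (f t) x
  have hd := dPair_self_nonneg (n := n) (vel f t) x
  have hEk := Real.rpow_nonneg he ((n : ℝ) / 2 - 1)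
  have hE : e2 n ε (f t) x ^ ((n : ℝ) / 2) =
      e2 n ε (f t) x ^ ((n : ℝ) / 2 - 1) * e2 n ε (f t) x := by
    rw [← Real.rpow_add_one' he (by linarith)]
    congr 1; ring
  have hV : (‖vel f t x‖ ^ 2) ^ (μ + 1) = (‖vel f t x‖ ^ 2) ^ μ * ‖vel f t x‖ ^ 2 :=
    Real.rpow_add_one' (by positivity) (by positivity)
  have hV2 : ((‖vel f t x‖ ^ 2) ^ (μ + 1 / 2)) ^ 2 =
      ((‖vel f t x‖ ^ 2) ^ μ) ^ 2 * ‖vel f t x‖ ^ 2 := by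
    have h0 : 0 ≤ ‖vel f t x‖ ^ 2 := by positivity
    generalize ‖vel f t x‖ ^ 2 = V at h0 ⊢
    rw [Real.rpow_add_of_nonneg h0 hμ (by norm_num), mul_pow, ← Real.sqrt_eq_rpow,
      Real.sq_sqrt h0]
  have h1 := dPair_sq_le (n := n) (f t) (fun x ↦ powFlux 0 (μ + 1 / 2) (vel f t x)) x
  have h2 := dPair_powFlux_le hμ' (hv1.slice ht) x
  have h3 : dPair n (f t) (f t) x ≤ e2 n ε (f t) x := by rw [e2_eq]; linarith
  have hVμ : 0 ≤ (‖vel f t x‖ ^ 2) ^ μ := by positivity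
  have hv2 : 0 ≤ ‖vel f t x‖ ^ 2 := by positivity
  have h0 := dPair_self_nonneg (n := n) (fun x ↦ powFlux 0 (μ + 1 / 2) (vel f t x)) x
  rw [mul_pow, hV2] at h2
  simp only [hE, hV]
  generalize dPair n (f t) (fun x ↦ powFlux 0 (μ + 1 / 2) (vel f t x)) x = Z at *
  generalize dPair n (fun x ↦ powFlux 0 (μ + 1 / 2) (vel f t x))
    (fun x ↦ powFlux 0 (μ + 1 / 2) (vel f t x)) x = Y at *
  generalize dPair n (f t) (f t) x = X at *
  generalize dPair n (vel f t) (vel f t) x = D at *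
  generalize e2 n ε (f t) x ^ ((n : ℝ) / 2 - 1) = Ek at *
  generalize e2 n ε (f t) x = e at *
  generalize (‖vel f t x‖ ^ 2) ^ μ = Vμ at *
  generalize ‖vel f t x‖ ^ 2 = V at *
  have h4 : Z ^ 2 ≤ ((1 + μ) * (Vμ * D + e * Vμ * V)) ^ 2 := by
    calc Z ^ 2 ≤ X * Y := h1
      _ ≤ e * ((1 + 2 * (μ + 1 / 2)) ^ 2 * (Vμ ^ 2 * V) * D) := by gcongr
      _ ≤ _ := by nlinarith [sq_nonneg ((1 + μ) * Vμ * (D - e * V))]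
  have h5 := abs_le_of_sq_le_sq h4 (by positivity)
  have h6 : -Z ≤ (1 + μ) * (Vμ * D + e * Vμ * V) := by linarith [neg_abs_le Z]
  calc -(Ek * Z) = Ek * (-Z) := by ring
    _ ≤ Ek * ((1 + μ) * (Vμ * D + e * Vμ * V)) := by gcongr
    _ = _ := by ring

/-- The first variation of the energy is ∫ e^κ ⟨df, df_t⟩, and the weak equation tested with f_t (μ
= 0) turns it into -∫ w|f_t|². -/
lemma hasDerivAt_regNEnergy (hemb : IsEmbeddedSubmanifold N) (hε : 0 ≤ ε) (hn : 3 ≤ n)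
    (hfl : IsRegularizedCHF n N ε a b T f u) {t : ℝ} (ht : t ∈ Ioo 0 T) :
    HasDerivAt (fun s ↦ regNEnergy n ε (f s)) (-weightedEnergy n 0 f u t) t := by
  have hn3 : (3 : ℝ) ≤ n := by exact_mod_cast hn
  have hκ : (0 : ℝ) ≤ (n : ℝ) / 2 - 1 := by linarith
  have hf2 : FlowReg n T 2 f := hfl.flowReg_f.of_le two_le_infty
  have hf1 : FlowReg n T 1 f := hfl.flowReg_f.of_le (by simp)
  have hv1 : FlowReg n T 1 (vel f) := hfl.flowReg_vel.of_le (by simp)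
  have hd : ∀ s ∈ Ioo 0 T, ∀ x, HasDerivAt (fun s ↦ e2 n ε (f s) x ^ ((n : ℝ) / 2))
      (n * (e2 n ε (f s) x ^ ((n : ℝ) / 2 - 1) * dPair n (f s) (vel f s) x)) s := fun s hs x ↦ by
    have h1 : HasDerivAt (fun s ↦ e2 n ε (f s) x) (2 * dPair n (f s) (vel f s) x) s :=
      (hasDerivAt_dPair_self hf2 hs x).const_add ε
    refine (h1.rpow_const (p := (n : ℝ) / 2) (Or.inr (by linarith))).congr_deriv ?_
    ring
  have hc1 : ContinuousOn (fun z : ℝ × M ↦ e2 n ε (f z.1) z.2) (Ioo 0 T ×ˢ univ) :=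
    continuousOn_const.add (hf1.flowReg_dPair hf1 (s := 0) (by simp) (by simp)).continuousOn
  have hc2 : ContinuousOn (fun z : ℝ × M ↦ dPair n (f z.1) (vel f z.1) z.2) (Ioo 0 T ×ˢ univ) :=
    (hf1.flowReg_dPair hv1 (s := 0) (by simp) (by simp)).continuousOn
  have hc : ContinuousOn (fun z : ℝ × M ↦ n * (e2 n ε (f z.1) z.2 ^ ((n : ℝ) / 2 - 1) *
      dPair n (f z.1) (vel f z.1) z.2)) (Ioo 0 T ×ˢ univ) :=
    continuousOn_const.mul ((hc1.rpow_const fun _ _ ↦ Or.inr hκ).mul hc2)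
  have h1 := (hasDerivAt_integral_flow (n := n) (T := T) ht
    (k := fun s x ↦ e2 n ε (f s) x ^ ((n : ℝ) / 2))
    (k' := fun s x ↦ n * (e2 n ε (f s) x ^ ((n : ℝ) / 2 - 1) * dPair n (f s) (vel f s) x))
    (fun s hs ↦ hfl.continuous_e2_rpow hs (by linarith)) hd hc).const_mul (1 / (n : ℝ))
  refine h1.congr_deriv ?_
  rw [integral_const_mul, hfl.integral_inner_momentum_self hemb hε hn ht le_rfl, neg_neg,
    one_div, inv_mul_cancel_left₀ (by positivity)]
  simp [powFlux]

lemma regNEnergy_nonneg (hε : 0 ≤ ε) (g : M → EuclideanSpace ℝ (Fin L)) :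
    0 ≤ regNEnergy n ε g :=
  mul_nonneg (by positivity)
    (integral_nonneg fun x ↦ Real.rpow_nonneg (e2_nonneg hε g x) _)

/-- The derivative is known only on the open interval; continuity of the energy up to time 0
connects it with the initial bound. -/
lemma regNEnergy_le (hemb : IsEmbeddedSubmanifold N) (hε : 0 ≤ ε) (hn : 3 ≤ n)
    (hfl : IsRegularizedCHF n N ε a b T f u) {t : ℝ} (ht : t ∈ Ioo 0 T) :
    regNEnergy n ε (f t) ≤ regNEnergy n ε (f 0) := by
  have := isFiniteMeasure_riemannianVolume (n := n) (M := M)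
  have hT : 0 < T := ht.1.trans ht.2
  have hcont : ContinuousOn (fun s ↦ regNEnergy n ε (f s)) (Icc 0 T) := by
    have h1 := continuousOn_integral_flow (riemannianVolume n M) (isCompact_Icc (a := 0) (b := T))
      (k := fun s x ↦ e2 n ε (f s) x ^ ((n : ℝ) / 2))
      ((continuousOn_e2_of_contMDiffOn hT hfl.smooth_f ε).rpow_const
        fun _ _ ↦ Or.inr (by positivity))
    exact continuousOn_const.mul h1
  refine antitoneOn_of_deriv_nonpos (convex_Icc 0 T) hcont (fun s hs ↦ ?_) (fun s hs ↦ ?_)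
    (left_mem_Icc.2 hT.le) (Ioo_subset_Icc_self ht) ht.1.le
  · rw [interior_Icc] at hs
    exact (hfl.hasDerivAt_regNEnergy hemb hε hn hs).differentiableAt.differentiableWithinAt
  · rw [interior_Icc] at hs
    rw [(hfl.hasDerivAt_regNEnergy hemb hε hn hs).deriv]
    simpa using weightedEnergy_nonneg 0 s

end IsRegularizedCHF

variable (n L M) in
/-- A uniform bound for `∫ e^{nu} |f_t|^n` away from the initial time. -/
lemma exists_velocity_bound (hC0 : 0 ≤ C_N) (hn : 3 ≤ n) (hn' : n ≤ 4)
    (ha : 0 < a) (hb : 0 < b) (hCb : 0 < n * b / 2 - C_N - 2 * C_N ^ 2) (E₀ T : ℝ) {τ : ℝ}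
    (hτ : 0 < τ) :
    ∃ B : ℝ, 0 ≤ B ∧ ∀ (N : Set (EuclideanSpace ℝ (Fin L))), IsEmbeddedSubmanifold N →
      SecondFFBoundedBy N C_N → ∀ ε : ℝ, 0 ≤ ε →
      ∀ (f : ℝ → M → EuclideanSpace ℝ (Fin L)) (u : ℝ → M → ℝ),
        IsRegularizedCHF n N ε a b T f u → regNEnergy n ε (f 0) ≤ E₀ →
        ∀ t ∈ Ico τ T, ∫ x, confFactor n u t x * ‖vel f t x‖ ^ n ∂(riemannianVolume n M) ≤ B := by
  set C : ℝ := 3 * n * a with hCdef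
  have hC : 0 ≤ C := by positivity
  set c : ℝ := min 2 (n * b / 2)
  have hc : 0 < c := lt_min (by norm_num) (by positivity)
  -- The interval before τ is divided at τ/4, τ/2 and 3τ/4; each step loses a quarter. Mean value on
  -- [τ/4, τ/2] finds an instant where -E' ≤ E₀/(τ/4), and the two later constants have the form
  -- produced by `bootstrap_step` for μ = 0 and μ = 1/2.
  set B₀ : ℝ := Real.exp (C * T) * (E₀ / (τ / 4)) with hB₀
  set B₁ : ℝ := Real.exp (C * T) * ((1 + 0) * ((C * B₀ + B₀ / (3 * τ / 4 - τ / 2)) / c)) with hB₁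
  set B₂ : ℝ := Real.exp (C * T) * ((1 + 1 / 2) * ((C * B₁ + B₁ / (τ - 3 * τ / 4)) / c)) with hB₂
  refine ⟨max 0 (max B₁ B₂), le_max_left _ _, ?_⟩
  intro N hemb hA ε hε f u hfl hE t ht
  have hd : ∀ μ : ℝ, 0 ≤ μ → μ ≤ 1 → ∀ t ∈ Ioo 0 T, ∃ d,
      HasDerivAt (weightedEnergy n μ f u) d t ∧
      d ≤ C * weightedEnergy n μ f u t - c * dissipation n ε μ f t := fun μ hμ hμ1 t ht ↦
    hfl.deriv_weightedEnergy_le hemb hA hC0 hε hn hn' ha hCb ht hμ hμ1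
  have hG : ∀ μ : ℝ, ∀ t, 0 ≤ dissipation n ε μ f t := fun μ t ↦ integral_nonneg fun x ↦ by
    have h1 := e2_nonneg (n := n) hε (f t) x
    have h2 := dPair_self_nonneg (n := n) (vel f t) x
    positivity
  have hd' : ∀ μ : ℝ, 0 ≤ μ → μ ≤ 1 → ∀ t ∈ Ioo 0 T, ∃ d,
      HasDerivAt (weightedEnergy n μ f u) d t ∧ d ≤ C * weightedEnergy n μ f u t :=
    fun μ hμ hμ1 t ht ↦ by
      obtain ⟨d, h1, h2⟩ := hd μ hμ hμ1 t ht
      exact ⟨d, h1, h2.trans (by linarith [mul_nonneg hc.le (hG μ t)])⟩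
  have h0 : ∀ t ∈ Ico (τ / 2) T, weightedEnergy n 0 f u t ≤ B₀ := by
    intro t ht
    have hmem : ∀ r, τ / 4 ≤ r → r ≤ t → r ∈ Ioo 0 T := fun r h1 h2 ↦
      ⟨by linarith, h2.trans_lt ht.2⟩
    obtain ⟨ξ, hξ, hslope⟩ := exists_hasDerivAt_eq_slope (fun s ↦ regNEnergy n ε (f s))
      (fun s ↦ -weightedEnergy n 0 f u s) (show τ / 4 < τ / 2 by linarith)
      (fun r hr ↦ (hfl.hasDerivAt_regNEnergy hemb hε hn
        (hmem r hr.1 (hr.2.trans ht.1))).continuousAt.continuousWithinAt)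
      (fun r hr ↦ hfl.hasDerivAt_regNEnergy hemb hε hn (hmem r hr.1.le (hr.2.le.trans ht.1)))
    have hξm := hmem ξ hξ.1.le (hξ.2.le.trans ht.1)
    have h1 : weightedEnergy n 0 f u ξ ≤ E₀ / (τ / 4) := by
      have h2 : weightedEnergy n 0 f u ξ =
          (regNEnergy n ε (f (τ / 4)) - regNEnergy n ε (f (τ / 2))) / (τ / 4) := by
        rw [← neg_neg (weightedEnergy n 0 f u ξ), hslope, ← neg_div]
        congr 1 <;> ring
      rw [h2]
      have h3 := hfl.regNEnergy_le hemb hε hn (hmem (τ / 4) le_rfl (by linarith [ht.1]))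
      have h4 := IsRegularizedCHF.regNEnergy_nonneg (n := n) hε (f (τ / 2))
      gcongr
      linarith
    refine (le_exp_mul_of_deriv_le (C := C) (hξ.2.le.trans ht.1) fun r hr ↦
      hd' 0 le_rfl zero_le_one r (hmem r (hξ.1.le.trans hr.1) hr.2)).trans ?_
    refine mul_le_mul (Real.exp_le_exp.2 ?_) h1 (weightedEnergy_nonneg 0 ξ) (Real.exp_pos _).le
    have : t - ξ ≤ T := by linarith [ht.2, hξm.1]
    gcongr
  have h1 : ∀ t ∈ Ico (3 * τ / 4) T, weightedEnergy n (0 + 1 / 2) f u t ≤ B₁ :=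
    bootstrap_step hc (by norm_num) hC (by linarith) (by linarith)
      (hd 0 le_rfl zero_le_one) (hd' _ (by norm_num) (by norm_num))
      (fun t ht ↦ hfl.weightedEnergy_le_dissipation hemb hε hn ht le_rfl)
      (fun t ↦ weightedEnergy_nonneg _ t) (fun t ↦ weightedEnergy_nonneg _ t) h0
  rw [zero_add] at h1
  have h2 : ∀ t ∈ Ico τ T, weightedEnergy n (1 / 2 + 1 / 2) f u t ≤ B₂ :=
    bootstrap_step hc (by norm_num) hC (by linarith) (by linarith)
      (hd (1 / 2) (by norm_num) (by norm_num)) (hd' _ (by norm_num) (by norm_num))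
      (fun t ht ↦ hfl.weightedEnergy_le_dissipation hemb hε hn ht (by norm_num))
      (fun t ↦ weightedEnergy_nonneg _ t) (fun t ↦ weightedEnergy_nonneg _ t) h1
  have hpow : ∀ (v : EuclideanSpace ℝ (Fin L)) (μ : ℝ), 2 * (μ + 1) = n →
      ‖v‖ ^ n = (‖v‖ ^ 2) ^ (μ + 1) := fun v μ hμ ↦ by
    rw [← Real.rpow_natCast ‖v‖ 2, ← Real.rpow_mul (norm_nonneg _), ← Real.rpow_natCast]
    congr 1
    rw [← hμ]; norm_num
  have hcases : n = 3 ∨ n = 4 := by omega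
  -- The exponent 2μ + 2 equals n for μ = 1/2 if n = 3, reached after one bootstrap step, and for μ
  -- = 1 if n = 4, reached after two.
  rcases hcases with h3 | h4
  · have h5 : 2 * ((1 / 2 : ℝ) + 1) = n := by rw [h3]; norm_num
    simp only [fun v ↦ hpow v _ h5]
    exact (h1 t ⟨by linarith [ht.1], ht.2⟩).trans ((le_max_left _ _).trans (le_max_right _ _))
  · have h5 : 2 * ((1 / 2 + 1 / 2 : ℝ) + 1) = n := by rw [h4]; norm_num
    simp only [fun v ↦ hpow v _ h5]
    exact (h2 t ht).trans ((le_max_right _ _).trans (le_max_right _ _))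

end VelocityBound

/-! ### Exchanging derivatives under the integral. -/

section Swap

variable {n : ℕ} {V : Type*} [NormedAddCommGroup V] [InnerProductSpace ℝ V]

set_option synthInstance.maxHeartbeats 400000 in
set_option maxHeartbeats 1000000 in
open scoped Convolution in
/-- Exchange of derivatives under the integral sign for functions of class `C¹`. -/
lemma integral_inner_fderiv_swap {E : Type*} [NormedAddCommGroup E] [InnerProductSpace ℝ E]
    [FiniteDimensional ℝ E] [MeasurableSpace E] [BorelSpace E] {F G : E → V}
    (hF : ContDiff ℝ 1 F) (hG : ContDiff ℝ 1 G) (hFc : HasCompactSupport F)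
    (hGc : HasCompactSupport G) (v w : E) :
    ∫ y, inner ℝ (fderiv ℝ F y v) (fderiv ℝ G y w) = ∫ y, inner ℝ (fderiv ℝ F y w) (fderiv ℝ G y v) := by
  set B : V →L[ℝ] V →L[ℝ] ℝ := innerSL ℝ
  -- F and G are only C¹, so two integrations by parts are not available. Instead the convolution of
  -- F with G(-·) is differentiated twice, once on each factor; its second derivative at 0 is, up to
  -- sign, the integral in question, and symmetry of second derivatives gives the claim.
  set g : E → V := fun y ↦ G (-y) with hg
  have hgd : ContDiff ℝ 1 g := hG.comp contDiff_neg
  have hgc : HasCompactSupport g := hGc.comp_homeomorph (Homeomorph.neg E)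
  have hg' : ∀ y u, fderiv ℝ g y u = -fderiv ℝ G (-y) u := fun y u ↦ by
    have h1 : HasFDerivAt g ((fderiv ℝ G (-y)).comp (-ContinuousLinearMap.id ℝ E)) y :=
      ((hG.differentiable (by simp) (-y)).hasFDerivAt).comp y (hasFDerivAt_id y).neg
    rw [h1.fderiv]; simp
  have h1 : ∀ z, HasFDerivAt (F ⋆[B, volume] g) ((F ⋆[B.precompR E, volume] fderiv ℝ g) z) z :=
    fun z ↦ hgc.hasFDerivAt_convolution_right B hF.continuous.locallyIntegrable hgd z
  have h2 := hFc.hasFDerivAt_convolution_left (B.precompR E) hF (μ := volume)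
    (hgd.continuous_fderiv (by simp)).locallyIntegrable (0 : E)
  have hsymm := second_derivative_symmetric h1 h2 v w
  have hex : Integrable (fun t ↦ (B.precompR E).precompL E (fderiv ℝ F t) (fderiv ℝ g (0 - t)))
      (volume : Measure E) := by
    have hc1 : Continuous (fderiv ℝ F) := hF.continuous_fderiv (by simp)
    have hc2 : Continuous (fderiv ℝ g) := hgd.continuous_fderiv (by simp)
    refine Continuous.integrable_of_hasCompactSupport (E := E →L[ℝ] E →L[ℝ] ℝ) (X := E) ?_ ?_
    · have hL : Continuous fun q : E →L[ℝ] V ↦ (B.precompR E).precompL E q :=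
        ((B.precompR E).precompL E).cont
      exact (hL.comp hc1).clm_apply
        (hc2.comp (continuous_const.sub continuous_id))
    · have hc : HasCompactSupport (fderiv ℝ F) := hFc.fderiv (𝕜 := ℝ)
      refine HasCompactSupport.intro hc fun t ht ↦ ?_
      rw [image_eq_zero_of_notMem_tsupport ht, map_zero, zero_apply]
  have key : ∀ v w, convolution (𝕜 := ℝ) (F := E →L[ℝ] E →L[ℝ] ℝ) (fderiv ℝ F) (fderiv ℝ g)
      ((B.precompR E).precompL E) volume 0 v w =
      -∫ y, inner ℝ (fderiv ℝ F y v) (fderiv ℝ G y w) := by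
    intro v w
    rw [convolution, ContinuousLinearMap.integral_apply hex, ContinuousLinearMap.integral_apply
      (hex.apply_continuousLinearMap v), ← integral_neg]
    refine integral_congr_ae (Eventually.of_forall fun y ↦ ?_)
    simp [ContinuousLinearMap.precompR_apply, ContinuousLinearMap.precompL_apply, hg', B]
    rfl
  rw [key, key] at hsymm
  exact neg_injective hsymm

/-- Only G has compact support; multiplying F by a cutoff that is 1 near the support set of G
changes nothing in the integrands. -/
lemma integral_inner_coordPartial_swap {U K : Set (EuclideanSpace ℝ (Fin n))} (hU : IsOpen U)
    (hK : IsCompact K) (hKU : K ⊆ U) {F G : EuclideanSpace ℝ (Fin n) → V}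
    (hF : ContDiffOn ℝ 1 F U) (hG : ContDiffOn ℝ 1 G U) (h0 : ∀ y ∉ K, G y = 0) (i k : Fin n) :
    ∫ y, inner ℝ (coordPartial i F y) (coordPartial k G y) =
      ∫ y, inner ℝ (coordPartial k F y) (coordPartial i G y) := by
  obtain ⟨K', hK', hKK', hK'U⟩ := exists_compact_between hK hU hKU
  obtain ⟨χ, hχ1, hχ0, -⟩ := exists_contMDiffMap_one_nhds_of_subset_interior
    (n := 1) 𝓘(ℝ, EuclideanSpace ℝ (Fin n)) hK.isClosed hKK'
  have hχ : ContDiff ℝ 1 χ := contMDiff_iff_contDiff.1 χ.contMDiff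
  have hG1 := contDiff_of_compact_subset hU hK hKU hG h0
  have hGc : HasCompactSupport G := HasCompactSupport.intro hK h0
  have hF1 : ContDiff ℝ 1 (fun y ↦ χ y • F y) :=
    contDiff_of_compact_subset hU hK' hK'U (hχ.contDiffOn.smul hF)
      fun y hy ↦ by rw [hχ0 y hy, zero_smul]
  have hFc : HasCompactSupport (fun y ↦ χ y • F y) :=
    HasCompactSupport.intro hK' fun y hy ↦ by rw [hχ0 y hy, zero_smul]
  have hmain := integral_inner_fderiv_swap hF1 hG1 hFc hGc (EuclideanSpace.single i (1 : ℝ))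
    (EuclideanSpace.single k (1 : ℝ))
  have heq : ∀ y u w, inner ℝ (fderiv ℝ (fun y ↦ χ y • F y) y u) (fderiv ℝ G y w) =
      inner ℝ (fderiv ℝ F y u) (fderiv ℝ G y w) := by
    intro y u w
    by_cases hy : y ∈ K
    · have : (fun y ↦ χ y • F y) =ᶠ[𝓝 y] F := by
        filter_upwards [(eventually_nhdsSet_iff_forall.1 hχ1) y hy] with z hz
        rw [hz, one_smul]
      rw [this.fderiv_eq]
    · have : G =ᶠ[𝓝 y] fun _ ↦ 0 := by
        filter_upwards [hK.isClosed.isOpen_compl.mem_nhds hy] with z hz using h0 z hz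
      rw [this.fderiv_eq]; simp
  simp only [heq] at hmain
  exact hmain

end Swap

/-! ### Positivity of the principal second order term. -/

section MainProduct

variable {n : ℕ} {V : Type*} [NormedAddCommGroup V] [InnerProductSpace ℝ V]

/-- The almost symmetric second order term is coercive up to the commutator `q b a - q a b`. -/
lemma main_product_ge {ε κ s C D : ℝ} (hε : 0 ≤ ε) (hκ : 0 ≤ κ) (hs : 0 ≤ s) (hC : 0 ≤ C)
    (hD : 0 ≤ D) (p : PiLp 2 (fun _ : Fin n ↦ V)) (q : Fin n → PiLp 2 (fun _ : Fin n ↦ V))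
    (hDq : D ^ 2 = ∑ b, ‖q b‖ ^ 2)
    (hc : ∀ a b, ‖q b a - q a b‖ ≤ C * ‖p‖) :
    (ε + ‖p‖ ^ 2) ^ κ * (ε + ‖p‖ ^ 2) ^ s *
        (D ^ 2 - (1 + 2 * κ + 2 * s) * n ^ 2 * C * ‖p‖ * D) ≤
      ∑ a, ∑ b, inner ℝ (powFluxDeriv ε κ p (q b) a) (powFluxDeriv ε s p (q a) b) := by
  have he0 : 0 ≤ ε + ‖p‖ ^ 2 := by positivity
  have hqb : ∀ b, ‖q b‖ ≤ D := fun b ↦ by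
    refine abs_le_of_sq_le_sq' ?_ hD |>.2
    rw [hDq]
    exact Finset.single_le_sum (f := fun b ↦ ‖q b‖ ^ 2) (fun _ _ ↦ by positivity) (Finset.mem_univ b)
  have hqba : ∀ b a, ‖q b a‖ ≤ D := fun b a ↦ (PiLp.norm_apply_le (q b) a).trans (hqb b)
  set E : Fin n → ℝ := fun b ↦ inner ℝ p (q b) with hE
  have hEb : ∀ b, |E b| ≤ ‖p‖ * D := fun b ↦
    (abs_real_inner_le_norm _ _).trans (by gcongr; exact hqb b)
  -- The product expands into these three sums, with E_a = ⟨p, q_a⟩. If q were symmetric, like a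
  -- Hessian, S1 would be D² and S2 would be Σ E_a²; S4 is |Σ E_a p_a|² in any case. The commutator
  -- bound `hc` measures the failure of symmetry in S1 and S2.
  set S1 := ∑ a, ∑ b, inner ℝ (q b a) (q a b) with hS1
  set S2 := ∑ a, ∑ b, E a * inner ℝ (q b a) (p b) with hS2
  set S4 := ∑ a, ∑ b, E b * E a * inner ℝ (p a) (p b) with hS4
  have hcardsum : ∀ {x : ℝ} {g : Fin n → Fin n → ℝ}, (∀ a b, -x ≤ g a b) →
      -(n ^ 2 * x) ≤ ∑ a, ∑ b, g a b := fun {x g} h ↦ by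
    have : ∑ a : Fin n, ∑ b : Fin n, -x ≤ ∑ a, ∑ b, g a b :=
      Finset.sum_le_sum fun a _ ↦ Finset.sum_le_sum fun b _ ↦ h a b
    simp only [Finset.sum_const, Finset.card_univ, Fintype.card_fin, nsmul_eq_mul] at this
    linarith
  have b1 : D ^ 2 - n ^ 2 * (C * ‖p‖ * D) ≤ S1 := by
    have h1 : S1 = D ^ 2 + ∑ a, ∑ b, -inner ℝ (q b a) (q b a - q a b) := by
      have h3 : D ^ 2 = ∑ a, ∑ b, ‖q b a‖ ^ 2 := by
        rw [hDq, Finset.sum_comm]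
        exact Finset.sum_congr rfl fun b _ ↦ PiLp.norm_sq_eq_of_L2 _ (q b)
      rw [h3, ← Finset.sum_add_distrib]
      refine Finset.sum_congr rfl fun a _ ↦ ?_
      rw [← Finset.sum_add_distrib]
      refine Finset.sum_congr rfl fun b _ ↦ ?_
      rw [inner_sub_right, real_inner_self_eq_norm_sq]; ring
    have h2 := hcardsum (x := C * ‖p‖ * D) (g := fun a b ↦ -inner ℝ (q b a) (q b a - q a b))
      fun a b ↦ neg_le_neg ((real_inner_le_norm _ _).trans (by
        rw [mul_comm (C * ‖p‖)]
        exact mul_le_mul (hqba b a) (hc a b) (norm_nonneg _) hD))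
    linarith
  have b2 : -(n ^ 2 * (C * ‖p‖ ^ 3 * D)) ≤ S2 := by
    have h1 : S2 = ∑ a, E a ^ 2 + ∑ a, ∑ b, E a * inner ℝ (q b a - q a b) (p b) := by
      rw [← Finset.sum_add_distrib]
      refine Finset.sum_congr rfl fun a _ ↦ ?_
      have h3 : E a = ∑ b, inner ℝ (q a b) (p b) := by
        rw [hE]; simp only [PiLp.inner_apply]
        exact Finset.sum_congr rfl fun b _ ↦ real_inner_comm _ _
      rw [sq]
      nth_rewrite 3 [h3]
      rw [Finset.mul_sum, ← Finset.sum_add_distrib]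
      refine Finset.sum_congr rfl fun b _ ↦ ?_
      rw [inner_sub_left]; ring
    have h2 := hcardsum (x := C * ‖p‖ ^ 3 * D) (g := fun a b ↦ E a * inner ℝ (q b a - q a b) (p b))
      fun a b ↦ by
        refine neg_le_of_abs_le ?_
        rw [abs_mul]
        calc _ ≤ (‖p‖ * D) * (C * ‖p‖ * ‖p‖) := by
              refine mul_le_mul (hEb a) ?_ (abs_nonneg _) (by positivity)
              exact (abs_real_inner_le_norm _ _).trans
                (mul_le_mul (hc a b) (PiLp.norm_apply_le p b) (norm_nonneg _) (by positivity))
          _ = _ := by ring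
    have h3 : 0 ≤ ∑ a, E a ^ 2 := Finset.sum_nonneg fun _ _ ↦ sq_nonneg _
    linarith
  have b4 : 0 ≤ S4 := by
    have : S4 = ‖∑ a, E a • p a‖ ^ 2 := by
      rw [← real_inner_self_eq_norm_sq, sum_inner]
      simp only [inner_sum, real_inner_smul_left, real_inner_smul_right, hS4]
      exact Finset.sum_congr rfl fun a _ ↦ Finset.sum_congr rfl fun b _ ↦ by ring
    rw [this]; positivity
  set e := ε + ‖p‖ ^ 2 with he
  have hexp : ∑ a, ∑ b, inner ℝ (powFluxDeriv ε κ p (q b) a) (powFluxDeriv ε s p (q a) b) =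
      e ^ κ * e ^ s * S1 + (2 * s * (e ^ κ * e ^ (s - 1)) + 2 * κ * (e ^ (κ - 1) * e ^ s)) * S2 +
        4 * κ * s * (e ^ (κ - 1) * e ^ (s - 1)) * S4 := by
    -- The two mixed sums, one from each radial part, coincide after renaming the indices.
    have hS3 : S2 = ∑ a, ∑ b, E b * inner ℝ (p a) (q a b) := by
      rw [hS2, Finset.sum_comm]
      exact Finset.sum_congr rfl fun a _ ↦ Finset.sum_congr rfl fun b _ ↦ by
        rw [real_inner_comm]
    rw [add_mul]
    nth_rewrite 2 [hS3]
    simp only [hS1, hS2, hS4, Finset.mul_sum, ← Finset.sum_add_distrib]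
    refine Finset.sum_congr rfl fun a _ ↦ Finset.sum_congr rfl fun b _ ↦ ?_
    simp only [powFluxDeriv_apply, PiLp.add_apply, PiLp.smul_apply, inner_add_left,
      inner_add_right, real_inner_smul_left, real_inner_smul_right, ← he, hE]
    ring
  rw [hexp]
  rcases he0.eq_or_lt with h0 | h0
  · have hp : ‖p‖ = 0 := by
      have : ‖p‖ ^ 2 = 0 := by nlinarith [sq_nonneg ‖p‖]
      simpa using this
    have hE0 : ∀ b, E b = 0 := fun b ↦ by
      have := hEb b
      rw [hp, zero_mul] at this
      exact abs_nonpos_iff.1 this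
    have hS20 : S2 = 0 := by simp [hS2, hE0]
    have hS40 : S4 = 0 := by simp [hS4, hE0]
    have hb : D ^ 2 ≤ S1 := by simpa [hp] using b1
    have h1 : 0 ≤ e ^ κ * e ^ s := by positivity
    rw [hS20, hS40, hp]
    have := mul_le_mul_of_nonneg_left hb h1
    linarith
  · have e1 : e ^ κ = e ^ (κ - 1) * e := by rw [Real.rpow_sub_one h0.ne']; field_simp
    have e2 : e ^ s = e ^ (s - 1) * e := by rw [Real.rpow_sub_one h0.ne']; field_simp
    have hpe : ‖p‖ ^ 2 ≤ e := by rw [he]; linarith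
    have hA : 0 ≤ e ^ (κ - 1) * e ^ (s - 1) := by positivity
    have g1 : e * -(n ^ 2 * (C * ‖p‖ * D)) ≤ S2 := by
      refine le_trans ?_ b2
      have : 0 ≤ n ^ 2 * (C * ‖p‖ * D) := by positivity
      nlinarith
    rw [e1, e2]
    have g2 : (e ^ (κ - 1) * e ^ (s - 1)) * (e * e * (D ^ 2 - n ^ 2 * (C * ‖p‖ * D)) +
        (2 * s + 2 * κ) * e * (e * -(n ^ 2 * (C * ‖p‖ * D)))) ≤
        (e ^ (κ - 1) * e ^ (s - 1)) * (e * e * S1 + (2 * s + 2 * κ) * e * S2 + 4 * κ * s * S4) := by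
      have : 0 ≤ 4 * κ * s * S4 := by positivity
      have h1 : e * e * (D ^ 2 - n ^ 2 * (C * ‖p‖ * D)) ≤ e * e * S1 := by gcongr
      have h2 : (2 * s + 2 * κ) * e * (e * -(n ^ 2 * (C * ‖p‖ * D))) ≤
        (2 * s + 2 * κ) * e * S2 := by gcongr
      refine mul_le_mul_of_nonneg_left ?_ hA
      linarith
    refine le_trans (le_of_eq ?_) (g2.trans (le_of_eq ?_)) <;> ring

end MainProduct

/-! ### The pointwise second order estimate as algebra. -/

section SecondOrder

variable {n : ℕ} {V : Type*} [NormedAddCommGroup V] [InnerProductSpace ℝ V]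

lemma norm_sum_smul_le (w : Fin n → ℝ) (v : Fin n → V) {Λ d : ℝ} (hΛ : 0 ≤ Λ)
    (hw : ∀ a, |w a| ≤ Λ) (hv : ∀ a, ‖v a‖ ≤ d) : ‖∑ a, w a • v a‖ ≤ n * (Λ * d) := by
  refine (norm_sum_le _ _).trans ?_
  have h := Finset.sum_le_card_nsmul Finset.univ (fun a ↦ ‖w a • v a‖) (Λ * d) fun a _ ↦ by
    rw [norm_smul, Real.norm_eq_abs]
    exact mul_le_mul (hw a) (hv a) (norm_nonneg _) hΛ
  simpa using h

/-- The principal part of the product of two flux derivatives, in terms of frame derivatives. -/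
lemma sum_inner_principal (ε κ s γ μ : ℝ) (S : Matrix (Fin n) (Fin n) ℝ)
    (p : PiLp 2 (fun _ : Fin n ↦ V)) (d : Fin n → PiLp 2 (fun _ : Fin n ↦ V)) :
    ∑ i, ∑ k, inner ℝ (γ • ∑ a, S a i • powFluxDeriv ε κ p (d k) a)
        (μ • ∑ b, S b k • powFluxDeriv ε s p (d i) b) =
      γ * μ * ∑ a, ∑ b, inner ℝ (powFluxDeriv ε κ p (∑ k, S b k • d k) a)
        (powFluxDeriv ε s p (∑ i, S a i • d i) b) := by
  simp only [real_inner_smul_left, real_inner_smul_right, sum_inner, inner_sum, map_sum, map_smul,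
    WithLp.ofLp_sum, WithLp.ofLp_smul, Finset.sum_apply, Pi.smul_apply, Finset.mul_sum]
  calc _ = ∑ i, ∑ a, ∑ k, ∑ b, γ * (μ * (S a i * (S b k *
        inner ℝ (powFluxDeriv ε κ p (d k) a) (powFluxDeriv ε s p (d i) b)))) := by
        refine Finset.sum_congr rfl fun i _ ↦ ?_
        refine (Finset.sum_congr rfl fun k _ ↦ Finset.sum_comm).trans ?_
        rw [Finset.sum_comm]
        refine Finset.sum_congr rfl fun a _ ↦ Finset.sum_congr rfl fun k _ ↦
          Finset.sum_congr rfl fun b _ ↦ by ring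
    _ = ∑ a, ∑ i, ∑ b, ∑ k, γ * (μ * (S a i * (S b k *
        inner ℝ (powFluxDeriv ε κ p (d k) a) (powFluxDeriv ε s p (d i) b)))) := by
        rw [Finset.sum_comm]
        exact Finset.sum_congr rfl fun a _ ↦ Finset.sum_congr rfl fun i _ ↦ Finset.sum_comm
    _ = _ := by
        refine Finset.sum_congr rfl fun a _ ↦ ?_
        rw [Finset.sum_comm]
        refine Finset.sum_congr rfl fun b _ ↦ Finset.sum_congr rfl fun i _ ↦
          Finset.sum_congr rfl fun k _ ↦ by ring

lemma sum_inner_ge {T₁ T₂ E₁ E₂ : Fin n → Fin n → V} {t₁ t₂ e₁ e₂ : ℝ} (ht₁ : 0 ≤ t₁)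
    (he₁ : 0 ≤ e₁) (h1 : ∀ i k, ‖T₁ i k‖ ≤ t₁) (h2 : ∀ i k, ‖T₂ i k‖ ≤ t₂)
    (h3 : ∀ i k, ‖E₁ i k‖ ≤ e₁) (h4 : ∀ i k, ‖E₂ i k‖ ≤ e₂) :
    ∑ i, ∑ k, inner ℝ (T₁ i k) (T₂ i k) - n ^ 2 * (t₁ * e₂ + e₁ * t₂ + e₁ * e₂) ≤
      ∑ i, ∑ k, inner ℝ (E₁ i k + T₁ i k) (E₂ i k + T₂ i k) := by
  have : ∑ i : Fin n, ∑ k : Fin n, (inner ℝ (T₁ i k) (T₂ i k) -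
      (t₁ * e₂ + e₁ * t₂ + e₁ * e₂)) ≤
      ∑ i, ∑ k, inner ℝ (E₁ i k + T₁ i k) (E₂ i k + T₂ i k) := by
    refine Finset.sum_le_sum fun i _ ↦ Finset.sum_le_sum fun k _ ↦ ?_
    simp only [inner_add_left, inner_add_right]
    have g1 := neg_le_of_abs_le ((abs_real_inner_le_norm (T₁ i k) (E₂ i k)).trans
      (mul_le_mul (h1 i k) (h4 i k) (norm_nonneg _) ht₁))
    have g2 := neg_le_of_abs_le ((abs_real_inner_le_norm (E₁ i k) (T₂ i k)).trans
      (mul_le_mul (h3 i k) (h2 i k) (norm_nonneg _) he₁))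
    have g3 := neg_le_of_abs_le ((abs_real_inner_le_norm (E₁ i k) (E₂ i k)).trans
      (mul_le_mul (h3 i k) (h4 i k) (norm_nonneg _) he₁))
    linarith
  simp only [Finset.sum_sub_distrib, Finset.sum_const, Finset.card_univ, Fintype.card_fin,
    nsmul_eq_mul] at this
  linarith

/-- Here α = m x D carries the second derivatives, B = l x |p| and B' = m x |p| the first order
terms, and ρ = m z |R| the divergence. Two applications of Young's inequality spend 1/4 of α² each.
The coefficient of ρ² must stay free of the geometric bound Λ, because it enters the smallness
threshold; all dependence on Λ is moved to B². -/
lemma second_order_scalar {α B B' ρ c₀ c₁ c₂ Λ C₁ : ℝ} (hc₀ : 0 ≤ c₀) (hc₁ : 0 ≤ c₁)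
    (hc₂ : 0 ≤ c₂) (hΛ : 0 ≤ Λ) (hα : 0 ≤ α) (hB : 0 ≤ B) (hBB : B' ≤ B) (n : ℕ) :
    1 / 2 * α ^ 2 - (C₁ ^ 2 + 1) * ρ ^ 2 -
        ((c₀ + n ^ 2 * Λ * (c₁ + c₂)) ^ 2 + 2 * n ^ 2 * Λ ^ 2) * B ^ 2 ≤
      (α ^ 2 - c₀ * (α * B')) -
        n ^ 2 * (Λ * c₁ * (α * B) + Λ * c₂ * (α * B') + Λ ^ 2 * (B' * B)) -
        (n * Λ * (ρ * B) + C₁ * (ρ * α)) := by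
  have k1 : α * B' ≤ α * B := by gcongr
  have k2 : B' * B ≤ B * B := by gcongr
  have k3 : c₀ * (α * B') + n ^ 2 * (Λ * c₁ * (α * B) + Λ * c₂ * (α * B') + Λ ^ 2 * (B' * B)) ≤
      c₀ * (α * B) + n ^ 2 * (Λ * c₁ * (α * B) + Λ * c₂ * (α * B) + Λ ^ 2 * (B * B)) := by
    gcongr
  set c₃ := c₀ + n ^ 2 * Λ * (c₁ + c₂) with hc₃
  have k4 : c₀ * (α * B) + n ^ 2 * (Λ * c₁ * (α * B) + Λ * c₂ * (α * B) + Λ ^ 2 * (B * B)) =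
      α * (c₃ * B) + n ^ 2 * Λ ^ 2 * B ^ 2 := by rw [hc₃]; ring
  have k5 : α * (c₃ * B) ≤ 1 / 4 * α ^ 2 + c₃ ^ 2 * B ^ 2 := by
    linarith [sq_nonneg (1 / 2 * α - c₃ * B), mul_pow c₃ B 2,
      (by ring : (1 / 2 * α - c₃ * B) ^ 2 = 1 / 4 * α ^ 2 - α * (c₃ * B) + c₃ ^ 2 * B ^ 2)]
  have k6 : C₁ * (ρ * α) ≤ 1 / 4 * α ^ 2 + C₁ ^ 2 * ρ ^ 2 := by
    linarith [sq_nonneg (1 / 2 * α - C₁ * ρ),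
      (by ring : (1 / 2 * α - C₁ * ρ) ^ 2 = 1 / 4 * α ^ 2 - C₁ * (ρ * α) + C₁ ^ 2 * ρ ^ 2)]
  have k7 : n * Λ * (ρ * B) ≤ 1 * ρ ^ 2 + n ^ 2 * Λ ^ 2 * B ^ 2 := by
    have k8 : 0 ≤ (n : ℝ) ^ 2 * Λ ^ 2 * B ^ 2 := by positivity
    linarith [sq_nonneg (ρ - n * Λ * B), sq_nonneg ρ, k8,
      (by ring : (ρ - n * Λ * B) ^ 2 = ρ ^ 2 - 2 * (n * Λ * (ρ * B)) + n ^ 2 * Λ ^ 2 * B ^ 2)]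
  simp only [add_mul, mul_add] at k3 k4 k5 k6 k7 ⊢
  linarith

set_option maxHeartbeats 800000 in
/-- The algebraic form of the second order estimate for the flux `(ε + |p|²)^κ p`: a bound from
below for `∂ₖPⁱ ∂ᵢQᵏ - ∂ᵢPⁱ ∂ₖQᵏ`. -/
lemma second_order_pointwise (n : ℕ) {κ s Λ : ℝ} (hκ : 0 ≤ κ) (hs : 0 ≤ s) (hΛ : 0 ≤ Λ) :
    ∃ C : ℝ, 0 ≤ C ∧ ∀ (ε γ l m x z D : ℝ) (S σ : Matrix (Fin n) (Fin n) ℝ)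
      (p : PiLp 2 (fun _ : Fin n ↦ V)) (d : Fin n → PiLp 2 (fun _ : Fin n ↦ V))
      (E₁ E₂ : Fin n → Fin n → V) (R : V), 0 ≤ ε → 0 ≤ γ → 0 ≤ m → m ≤ l → 0 ≤ x → 0 ≤ z →
      0 ≤ D → x ^ 2 = (ε + ‖p‖ ^ 2) ^ κ * (ε + ‖p‖ ^ 2) ^ s → x * z = (ε + ‖p‖ ^ 2) ^ s →
      D ^ 2 = ∑ b, ‖∑ k, S b k • d k‖ ^ 2 → σ * S = 1 →
      (∀ a i, |S a i| ≤ Λ) → (∀ a i, |σ a i| ≤ Λ) →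
      (∀ a b, ‖(∑ k, S b k • d k) a - (∑ k, S a k • d k) b‖ ≤ Λ * ‖p‖) →
      (∀ i k, ‖E₁ i k‖ ≤ Λ * γ * (ε + ‖p‖ ^ 2) ^ κ * ‖p‖) →
      (∀ i k, ‖E₂ i k‖ ≤ Λ * (l * m) * (ε + ‖p‖ ^ 2) ^ s * ‖p‖) →
      γ * (1 / 2 * (m ^ 2 * x ^ 2 * D ^ 2) - ((n * (1 + 2 * s)) ^ 2 + 1) * (m ^ 2 * z ^ 2 * ‖R‖ ^ 2)
          - C * (l ^ 2 * x ^ 2 * ‖p‖ ^ 2)) ≤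
        ∑ i, ∑ k, inner ℝ (E₁ i k + γ • ∑ a, S a i • powFluxDeriv ε κ p (d k) a)
          (E₂ i k + m ^ 2 • ∑ b, S b k • powFluxDeriv ε s p (d i) b) -
        inner ℝ (γ • R) (∑ k, (E₂ k k + m ^ 2 • ∑ b, S b k • powFluxDeriv ε s p (d k) b)) := by
  set c₀ : ℝ := (1 + 2 * κ + 2 * s) * n ^ 2 * Λ with hc₀
  set c₁ : ℝ := n * (Λ * ((1 + 2 * κ) * (n * Λ))) with hc₁
  set c₂ : ℝ := n * (Λ * ((1 + 2 * s) * (n * Λ))) with hc₂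
  set c₃ : ℝ := c₀ + n ^ 2 * Λ * (c₁ + c₂) with hc₃
  have hc₀0 : 0 ≤ c₀ := by positivity
  have hc₁0 : 0 ≤ c₁ := by positivity
  have hc₂0 : 0 ≤ c₂ := by positivity
  have hc₃0 : 0 ≤ c₃ := by positivity
  refine ⟨c₃ ^ 2 + 2 * n ^ 2 * Λ ^ 2, by positivity, ?_⟩
  -- The intended values are γ the volume density, m = φ^j and l = φ^{j-1}, x = e^{(j-1)/2} and z =
  -- e^{β/2}, D the norm of the second derivatives, σ the inverse of the frame. E₁ and E₂ are the
  -- parts of the flux derivatives that contain no second derivatives of the map.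
  intro ε γ l m x z D S σ p d E₁ E₂ R hε hγ hm hml hx hz hD hx2 hxz hD2 hσ hSΛ hσΛ hcomm hE₁ hE₂
  set e := ε + ‖p‖ ^ 2 with he
  have he0 : 0 ≤ e := by positivity
  have hl : 0 ≤ l := hm.trans hml
  set q : Fin n → PiLp 2 (fun _ : Fin n ↦ V) := fun b ↦ ∑ k, S b k • d k with hq
  have hqD : ∀ b, ‖q b‖ ≤ D := fun b ↦ by
    refine abs_le_of_sq_le_sq' ?_ hD |>.2
    rw [hD2]
    exact Finset.single_le_sum (f := fun b ↦ ‖q b‖ ^ 2) (fun _ _ ↦ by positivity)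
      (Finset.mem_univ b)
  -- The coordinate derivatives d are recovered from the frame derivatives q by the inverse matrix
  -- σ, so they are bounded by D as well.
  have hd : ∀ k, d k = ∑ b, σ k b • q b := fun k ↦ by
    have h1 : ∀ k', ∑ b, σ k b * S b k' = if k = k' then 1 else 0 := fun k' ↦ by
      rw [← Matrix.mul_apply, hσ, Matrix.one_apply]
    simp only [hq, Finset.smul_sum, smul_smul]
    rw [Finset.sum_comm]
    simp only [← Finset.sum_smul, h1, ite_smul, one_smul, zero_smul, Finset.sum_ite_eq,
      Finset.mem_univ, if_true]
  have hdD : ∀ k, ‖d k‖ ≤ n * (Λ * D) := fun k ↦ by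
    rw [hd k]; exact norm_sum_smul_le _ _ hΛ (hσΛ k) hqD
  have hPFD : ∀ τ, 0 ≤ τ → ∀ (v : PiLp 2 (fun _ : Fin n ↦ V)) (δ : ℝ), ‖v‖ ≤ δ → ∀ a,
      ‖powFluxDeriv ε τ p v a‖ ≤ (1 + 2 * τ) * e ^ τ * δ := by
    intro τ hτ v δ hv a
    refine (PiLp.norm_apply_le _ a).trans (((powFluxDeriv ε τ p).le_opNorm v).trans ?_)
    exact mul_le_mul (norm_powFluxDeriv_le hε hτ p) hv (norm_nonneg _) (by positivity)
  have hT₁ : ∀ i k, ‖γ • ∑ a, S a i • powFluxDeriv ε κ p (d k) a‖ ≤ γ * (c₁ * e ^ κ * D) := by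
    intro i k
    rw [norm_smul, Real.norm_eq_abs, abs_of_nonneg hγ]
    refine mul_le_mul_of_nonneg_left ((norm_sum_smul_le _ _ hΛ (fun a ↦ hSΛ a i)
      (hPFD κ hκ (d k) _ (hdD k))).trans (le_of_eq ?_)) hγ
    rw [hc₁]; ring
  have hT₂ : ∀ i k, ‖m ^ 2 • ∑ b, S b k • powFluxDeriv ε s p (d i) b‖ ≤
      m ^ 2 * (c₂ * e ^ s * D) := by
    intro i k
    rw [norm_smul, Real.norm_eq_abs, abs_of_nonneg (sq_nonneg m)]
    refine mul_le_mul_of_nonneg_left ((norm_sum_smul_le _ _ hΛ (fun b ↦ hSΛ b k)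
      (hPFD s hs (d i) _ (hdD i))).trans (le_of_eq ?_)) (sq_nonneg m)
    rw [hc₂]; ring
  have hmain := main_product_ge hε hκ hs hΛ hD p q hD2 hcomm
  have h1 := sum_inner_ge (by positivity) (by positivity) hT₁ hT₂ hE₁ hE₂
  rw [sum_inner_principal] at h1
  have h2 := mul_le_mul_of_nonneg_left hmain (by positivity : 0 ≤ γ * m ^ 2)
  have hdiv : ∑ k, (E₂ k k + m ^ 2 • ∑ b, S b k • powFluxDeriv ε s p (d k) b) =
      ∑ k, E₂ k k + m ^ 2 • ∑ b, powFluxDeriv ε s p (q b) b := by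
    rw [Finset.sum_add_distrib, ← Finset.smul_sum, Finset.sum_comm]
    congr 2
    refine Finset.sum_congr rfl fun b _ ↦ ?_
    simp only [hq, map_sum, map_smul, WithLp.ofLp_sum, WithLp.ofLp_smul, Finset.sum_apply,
      Pi.smul_apply]
  have hdivle : ‖∑ k, (E₂ k k + m ^ 2 • ∑ b, S b k • powFluxDeriv ε s p (d k) b)‖ ≤
      n * (Λ * (l * m) * e ^ s * ‖p‖) + m ^ 2 * (n * ((1 + 2 * s) * e ^ s * D)) := by
    rw [hdiv]
    refine (norm_add_le _ _).trans (add_le_add ?_ ?_)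
    · refine (norm_sum_le _ _).trans ?_
      have := Finset.sum_le_card_nsmul Finset.univ _ _ fun k _ ↦ hE₂ k k
      simpa using this
    · rw [norm_smul, Real.norm_eq_abs, abs_of_nonneg (sq_nonneg m)]
      refine mul_le_mul_of_nonneg_left ((norm_sum_le _ _).trans ?_) (sq_nonneg m)
      have := Finset.sum_le_card_nsmul Finset.univ _ _ fun b _ ↦ hPFD s hs (q b) D (hqD b) b
      simpa using this
  have hin : inner ℝ (γ • R) (∑ k, (E₂ k k + m ^ 2 • ∑ b, S b k • powFluxDeriv ε s p (d k) b)) ≤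
      γ * (‖R‖ * (n * (Λ * (l * m) * e ^ s * ‖p‖) + m ^ 2 * (n * ((1 + 2 * s) * e ^ s * D)))) := by
    rw [real_inner_smul_left]
    exact mul_le_mul_of_nonneg_left ((real_inner_le_norm _ _).trans
      (mul_le_mul_of_nonneg_left hdivle (norm_nonneg _))) hγ
  rw [← hxz] at hin
  have e1 : γ * m ^ 2 * (e ^ κ * e ^ s * (D ^ 2 - c₀ * ‖p‖ * D)) =
      γ * ((m * x * D) ^ 2 - c₀ * ((m * x * D) * (m * x * ‖p‖))) := by
    rw [← hx2]; ring
  have e2 : n ^ 2 * (γ * (c₁ * e ^ κ * D) * (Λ * (l * m) * e ^ s * ‖p‖) +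
      Λ * γ * e ^ κ * ‖p‖ * (m ^ 2 * (c₂ * e ^ s * D)) +
      Λ * γ * e ^ κ * ‖p‖ * (Λ * (l * m) * e ^ s * ‖p‖)) =
      γ * (n ^ 2 * (Λ * c₁ * ((m * x * D) * (l * x * ‖p‖)) +
        Λ * c₂ * ((m * x * D) * (m * x * ‖p‖)) + Λ ^ 2 * ((m * x * ‖p‖) * (l * x * ‖p‖)))) := by
    have : ∀ y, e ^ κ * e ^ s * y = x ^ 2 * y := fun y ↦ by rw [hx2]
    linear_combination n ^ 2 * (γ * Λ * (l * m) * c₁ * D * ‖p‖ + Λ * γ * m ^ 2 * c₂ * D * ‖p‖ +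
      Λ ^ 2 * γ * (l * m) * ‖p‖ ^ 2) * (-hx2)
  have e3 : γ * (‖R‖ * (n * (Λ * (l * m) * (x * z) * ‖p‖) +
      m ^ 2 * (n * ((1 + 2 * s) * (x * z) * D)))) =
      γ * (n * Λ * ((m * z * ‖R‖) * (l * x * ‖p‖)) +
        (n * (1 + 2 * s)) * ((m * z * ‖R‖) * (m * x * D))) := by ring
  set α := m * x * D with hα
  set B := l * x * ‖p‖ with hB
  set B' := m * x * ‖p‖ with hB'
  set ρ := m * z * ‖R‖ with hρ
  set C₁ : ℝ := n * (1 + 2 * s) with hC₁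
  have hα0 : 0 ≤ α := by positivity
  have hB0 : 0 ≤ B := by positivity
  have hBB : B' ≤ B := by
    rw [hB, hB']; gcongr
  have hfinal := second_order_scalar hc₀0 hc₁0 hc₂0 hΛ hα0 hB0 hBB (ρ := ρ) (C₁ := C₁) n
  have hfin := mul_le_mul_of_nonneg_left hfinal hγ
  have e4 : m ^ 2 * x ^ 2 * D ^ 2 = α ^ 2 := by rw [hα]; ring
  have e5 : m ^ 2 * z ^ 2 * ‖R‖ ^ 2 = ρ ^ 2 := by rw [hρ]; ring
  have e6 : l ^ 2 * x ^ 2 * ‖p‖ ^ 2 = B ^ 2 := by rw [hB]; ring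
  rw [e4, e5, e6]
  rw [e2] at h1
  rw [e3] at hin
  rw [e1] at h2
  simp only [mul_sub, mul_add] at h1 h2 hin hfin ⊢
  linarith

end SecondOrder

/-! ### Calculus of frame derivatives. -/

section FrameCalculus

variable {n : ℕ} {V : Type*} [NormedAddCommGroup V] [InnerProductSpace ℝ V]
  {U K : Set (EuclideanSpace ℝ (Fin n))}
  {S σ : EuclideanSpace ℝ (Fin n) → Matrix (Fin n) (Fin n) ℝ}

lemma exists_bound_family {ι : Type*} [Finite ι] (hK : IsCompact K)
    (F : ι → EuclideanSpace ℝ (Fin n) → ℝ) (hF : ∀ i, ContinuousOn (F i) K) :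
    ∃ Λ : ℝ, 0 ≤ Λ ∧ ∀ i, ∀ y ∈ K, |F i y| ≤ Λ := by
  cases nonempty_fintype ι
  have h : ∀ i, ∃ C : ℝ, ∀ y ∈ K, |F i y| ≤ C := fun i ↦ hK.exists_bound_of_continuousOn (hF i)
  choose C hC using h
  refine ⟨∑ i, |C i|, Finset.sum_nonneg fun _ _ ↦ abs_nonneg _, fun i y hy ↦ ?_⟩
  exact ((hC i y hy).trans (le_abs_self _)).trans
    (Finset.single_le_sum (f := fun i ↦ |C i|) (fun _ _ ↦ abs_nonneg _) (Finset.mem_univ i))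

lemma contDiffOn_coordPartial_one (hU : IsOpen U) {h : EuclideanSpace ℝ (Fin n) → V}
    (hh : ContDiffOn ℝ 2 h U) (i : Fin n) : ContDiffOn ℝ 1 (coordPartial i h) U :=
  (hh.fderiv_of_isOpen hU (by norm_num)).clm_apply contDiffOn_const

lemma contDiffOn_frameGrad (hU : IsOpen U) (hS : ∀ a i, ContDiffOn ℝ 1 (fun y ↦ S y a i) U)
    {h : EuclideanSpace ℝ (Fin n) → V} (hh : ContDiffOn ℝ 2 h U) :
    ContDiffOn ℝ 1 (frameGrad S h) U := by
  refine contDiffOn_piLp' 2 fun a ↦ ?_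
  exact ContDiffOn.sum (s := Finset.univ) fun i _ ↦
    (hS a i).smul (contDiffOn_coordPartial_one hU hh i)

lemma differentiableAt_of_contDiffOn {W : Type*} [NormedAddCommGroup W] [NormedSpace ℝ W]
    (hU : IsOpen U) {h : EuclideanSpace ℝ (Fin n) → W} (hh : ContDiffOn ℝ 1 h U)
    {y : EuclideanSpace ℝ (Fin n)} (hy : y ∈ U) : DifferentiableAt ℝ h y :=
  (hh.contDiffAt (hU.mem_nhds hy)).differentiableAt (by simp)

lemma coordPartial_smul {h : EuclideanSpace ℝ (Fin n) → V} {g : EuclideanSpace ℝ (Fin n) → ℝ}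
    {y : EuclideanSpace ℝ (Fin n)} (hg : DifferentiableAt ℝ g y) (hh : DifferentiableAt ℝ h y)
    (i : Fin n) : coordPartial i (fun z ↦ g z • h z) y =
      coordPartial i g y • h y + g y • coordPartial i h y := by
  rw [coordPartial, fderiv_fun_smul hg hh]
  simp [coordPartial, add_comm]

lemma coordPartial_piLp {P : EuclideanSpace ℝ (Fin n) → PiLp 2 (fun _ : Fin n ↦ V)}
    {y : EuclideanSpace ℝ (Fin n)} (hP : DifferentiableAt ℝ P y) (k a : Fin n) :
    coordPartial k (fun z ↦ P z a) y = coordPartial k P y a := by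
  have h : HasFDerivAt (fun z ↦ P z a)
      ((PiLp.proj 2 (fun _ : Fin n ↦ V) a : PiLp 2 (fun _ : Fin n ↦ V) →L[ℝ] V).comp
        (fderiv ℝ P y)) y :=
    (PiLp.proj 2 (fun _ : Fin n ↦ V) a :
      PiLp 2 (fun _ : Fin n ↦ V) →L[ℝ] V).hasFDerivAt.comp y hP.hasFDerivAt
  rw [coordPartial, h.fderiv]
  rfl

lemma coordPartial_comm (hU : IsOpen U) {h : EuclideanSpace ℝ (Fin n) → V}
    (hh : ContDiffOn ℝ 2 h U) {y : EuclideanSpace ℝ (Fin n)} (hy : y ∈ U) (i k : Fin n) :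
    coordPartial k (coordPartial i h) y = coordPartial i (coordPartial k h) y := by
  have hc := hh.contDiffAt (hU.mem_nhds hy)
  have hs : IsSymmSndFDerivAt ℝ h y := hc.isSymmSndFDerivAt (by simp)
  have hd : DifferentiableAt ℝ (fderiv ℝ h) y :=
    (hc.fderiv_right (m := 1) (by norm_num)).differentiableAt (by simp)
  have h1 : ∀ i k, coordPartial k (coordPartial i h) y =
      fderiv ℝ (fderiv ℝ h) y (EuclideanSpace.single k 1) (EuclideanSpace.single i 1) := by
    intro i k
    have h2 : HasFDerivAt (coordPartial i h)
        ((ContinuousLinearMap.apply ℝ V (EuclideanSpace.single i (1 : ℝ))).comp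
          (fderiv ℝ (fderiv ℝ h) y)) y :=
      (ContinuousLinearMap.apply ℝ V (EuclideanSpace.single i (1 : ℝ))).hasFDerivAt.comp y
        hd.hasFDerivAt
    rw [coordPartial, h2.fderiv]
    rfl
  rw [h1, h1]
  exact hs _ _

/-- The derivative of the components `μ S_{ai} (ε + |p|²)^τ p_a` of a weighted flux. -/
lemma coordPartial_weightedFlux {ε τ : ℝ} (hε : 0 ≤ ε) (hτ : 0 ≤ τ)
    {μ : EuclideanSpace ℝ (Fin n) → ℝ} {P : EuclideanSpace ℝ (Fin n) → PiLp 2 (fun _ : Fin n ↦ V)}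
    {y : EuclideanSpace ℝ (Fin n)} (hμ : DifferentiableAt ℝ μ y)
    (hS : ∀ a i, DifferentiableAt ℝ (fun y ↦ S y a i) y) (hP : DifferentiableAt ℝ P y)
    (i k : Fin n) :
    coordPartial k (fun z ↦ μ z • ∑ a, S z a i • powFlux ε τ (P z) a) y =
      (∑ a, (coordPartial k μ y * S y a i + μ y * coordPartial k (fun z ↦ S z a i) y) •
        powFlux ε τ (P y) a) +
      μ y • ∑ a, S y a i • powFluxDeriv ε τ (P y) (coordPartial k P y) a := by
  have h1 : HasFDerivAt (fun z ↦ powFlux ε τ (P z)) ((powFluxDeriv ε τ (P y)).comp (fderiv ℝ P y)) y :=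
    (hasFDerivAt_powFlux hε hτ (P y)).comp y hP.hasFDerivAt
  have h2 : ∀ a, DifferentiableAt ℝ (fun z ↦ powFlux ε τ (P z) a) y := fun a ↦
    (differentiableAt_piLp 2).1 h1.differentiableAt a
  have h3 : ∀ a, coordPartial k (fun z ↦ powFlux ε τ (P z) a) y =
      powFluxDeriv ε τ (P y) (coordPartial k P y) a := fun a ↦ by
    rw [coordPartial_piLp h1.differentiableAt, coordPartial, h1.fderiv]; rfl
  have h4 : ∀ a ∈ Finset.univ, DifferentiableAt ℝ (fun z ↦ S z a i • powFlux ε τ (P z) a) y :=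
    fun a _ ↦ (hS a i).smul (h2 a)
  rw [coordPartial_smul hμ (DifferentiableAt.fun_sum h4), coordPartial_sum _ h4]
  simp only [coordPartial_smul (hS _ i) (h2 _), h3, Finset.smul_sum, ← Finset.sum_add_distrib]
  refine Finset.sum_congr rfl fun a _ ↦ ?_
  simp only [smul_add, smul_smul, add_smul]
  abel

lemma coordPartial_eq_sum_frameGrad {h : EuclideanSpace ℝ (Fin n) → V}
    {y : EuclideanSpace ℝ (Fin n)} (hσ : σ y * S y = 1) (i : Fin n) :
    coordPartial i h y = ∑ a, σ y i a • frameGrad S h y a := by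
  have h1 : ∀ i', ∑ a, σ y i a * S y a i' = if i = i' then 1 else 0 := fun i' ↦ by
    rw [← Matrix.mul_apply, hσ, Matrix.one_apply]
  simp only [frameGrad, frameDeriv, Finset.smul_sum, smul_smul]
  rw [Finset.sum_comm]
  simp only [← Finset.sum_smul, h1, ite_smul, one_smul, zero_smul, Finset.sum_ite_eq,
    Finset.mem_univ, if_true]

/-- Frame derivatives commute up to first order terms. -/
lemma norm_frame_commutator_le (hU : IsOpen U)
    (hS : ∀ a i, ContDiffOn ℝ 1 (fun y ↦ S y a i) U) {h : EuclideanSpace ℝ (Fin n) → V}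
    (hh : ContDiffOn ℝ 2 h U) {y : EuclideanSpace ℝ (Fin n)} (hy : y ∈ U) (hσ : σ y * S y = 1)
    {Λ : ℝ} (hΛ : 0 ≤ Λ) (hSΛ : ∀ a i, |S y a i| ≤ Λ) (hσΛ : ∀ a i, |σ y a i| ≤ Λ)
    (hdS : ∀ k a i, |coordPartial k (fun z ↦ S z a i) y| ≤ Λ) (a b : Fin n) :
    ‖(∑ k, S y b k • coordPartial k (frameGrad S h) y) a -
      (∑ k, S y a k • coordPartial k (frameGrad S h) y) b‖ ≤
      n * (n * (2 * Λ ^ 2 * (n * (Λ * ‖frameGrad S h y‖)))) := by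
  have hd := differentiableAt_of_contDiffOn hU (contDiffOn_frameGrad hU hS hh) hy
  have hdh := fun i ↦ differentiableAt_of_contDiffOn hU (contDiffOn_coordPartial_one hU hh i) hy
  have hdS' := fun a i ↦ differentiableAt_of_contDiffOn hU (hS a i) hy
  have h1 : ∀ k a, coordPartial k (frameGrad S h) y a =
      ∑ i, (coordPartial k (fun z ↦ S z a i) y • coordPartial i h y +
        S y a i • coordPartial k (coordPartial i h) y) := fun k a ↦ by
    rw [← coordPartial_piLp hd]
    have h0 : ∀ i ∈ Finset.univ, DifferentiableAt ℝ (fun z ↦ S z a i • coordPartial i h z) y :=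
      fun i _ ↦ (hdS' a i).smul (hdh i)
    refine (coordPartial_sum _ h0 k).trans ?_
    exact Finset.sum_congr rfl fun i _ ↦ coordPartial_smul (hdS' a i) (hdh i) k
  have h2 : ∀ a b, (∑ k, S y b k • coordPartial k (frameGrad S h) y) a =
      (∑ k, ∑ i, (S y b k * coordPartial k (fun z ↦ S z a i) y) • coordPartial i h y) +
        ∑ k, ∑ i, (S y b k * S y a i) • coordPartial k (coordPartial i h) y := fun a b ↦ by
    simp only [WithLp.ofLp_sum, WithLp.ofLp_smul, Finset.sum_apply, Pi.smul_apply, h1,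
      Finset.smul_sum, smul_add, smul_smul, Finset.sum_add_distrib]
  -- The pure second derivatives are symmetric and cancel in the commutator; what survives has a
  -- derivative on the frame.
  have h3 : ∑ k, ∑ i, (S y b k * S y a i) • coordPartial k (coordPartial i h) y =
      ∑ k, ∑ i, (S y a k * S y b i) • coordPartial k (coordPartial i h) y := by
    rw [Finset.sum_comm]
    refine Finset.sum_congr rfl fun k _ ↦ Finset.sum_congr rfl fun i _ ↦ ?_
    rw [coordPartial_comm hU hh hy, mul_comm]
  have h4 : ∀ i, ‖coordPartial i h y‖ ≤ n * (Λ * ‖frameGrad S h y‖) := fun i ↦ by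
    rw [coordPartial_eq_sum_frameGrad hσ]
    exact norm_sum_smul_le _ _ hΛ (hσΛ i) fun a ↦ PiLp.norm_apply_le _ a
  rw [h2, h2, h3, add_sub_add_right_eq_sub, ← Finset.sum_sub_distrib]
  have h5 : ∀ k ∈ Finset.univ, ‖∑ i, (S y b k * coordPartial k (fun z ↦ S z a i) y) •
      coordPartial i h y - ∑ i, (S y a k * coordPartial k (fun z ↦ S z b i) y) •
      coordPartial i h y‖ ≤ n * (2 * Λ ^ 2 * (n * (Λ * ‖frameGrad S h y‖))) := by
    intro k _
    rw [← Finset.sum_sub_distrib]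
    simp only [← sub_smul]
    refine norm_sum_smul_le _ _ (by positivity) (fun i ↦ ?_) h4
    refine (abs_sub _ _).trans ?_
    rw [abs_mul, abs_mul]
    have e1 := mul_le_mul (hSΛ b k) (hdS k a i) (abs_nonneg _) hΛ
    have e2 := mul_le_mul (hSΛ a k) (hdS k b i) (abs_nonneg _) hΛ
    linarith
  refine (norm_sum_le _ _).trans ?_
  have := Finset.sum_le_card_nsmul Finset.univ _ _ h5
  simpa using this

end FrameCalculus

/-! ### The second order estimate in a chart. -/

section SecondOrderIntegral

variable {n : ℕ} {V : Type*} [NormedAddCommGroup V] [InnerProductSpace ℝ V]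
  {U K : Set (EuclideanSpace ℝ (Fin n))}
  {S σ : EuclideanSpace ℝ (Fin n) → Matrix (Fin n) (Fin n) ℝ}

/-- The components `μ (ε + |p|²)^τ S_{ai} p_a` of a weighted flux, for the gradient `p` of `h`
in the frame `S`. -/
def frameFlux (S : EuclideanSpace ℝ (Fin n) → Matrix (Fin n) (Fin n) ℝ) (ε τ : ℝ)
    (μ : EuclideanSpace ℝ (Fin n) → ℝ) (h : EuclideanSpace ℝ (Fin n) → V) (i : Fin n)
    (y : EuclideanSpace ℝ (Fin n)) : V :=
  μ y • ∑ a, S y a i • powFlux ε τ (frameGrad S h y) a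

/-- The square norm of the derivatives of the frame gradient along the frame. -/
def frameHessSq (S : EuclideanSpace ℝ (Fin n) → Matrix (Fin n) (Fin n) ℝ)
    (h : EuclideanSpace ℝ (Fin n) → V) (y : EuclideanSpace ℝ (Fin n)) : ℝ :=
  ∑ b, ‖∑ k, S y b k • coordPartial k (frameGrad S h) y‖ ^ 2

lemma frameHessSq_nonneg (S : EuclideanSpace ℝ (Fin n) → Matrix (Fin n) (Fin n) ℝ)
    (h : EuclideanSpace ℝ (Fin n) → V) (y : EuclideanSpace ℝ (Fin n)) : 0 ≤ frameHessSq S h y :=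
  Finset.sum_nonneg fun _ _ ↦ by positivity

lemma contDiffOn_frameFlux {ε τ : ℝ} (hε : 0 ≤ ε) (hτ : 0 ≤ τ)
    {μ : EuclideanSpace ℝ (Fin n) → ℝ} (hμ : ContDiffOn ℝ 1 μ U)
    (hS : ∀ a i, ContDiffOn ℝ 1 (fun y ↦ S y a i) U) {h : EuclideanSpace ℝ (Fin n) → V}
    (hp : ContDiffOn ℝ 1 (frameGrad S h) U) (i : Fin n) :
    ContDiffOn ℝ 1 (frameFlux S ε τ μ h i) U := by
  have h1 := (contDiff_powFlux (H := PiLp 2 (fun _ : Fin n ↦ V)) hε hτ).comp_contDiffOn hp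
  exact hμ.smul (ContDiffOn.sum (s := Finset.univ) fun a _ ↦
    (hS a i).smul ((contDiffOn_piLp 2).1 h1 a))

/-- The power φ^{2j-1} is split as φ^{j-1} φ^j, the product l m required by
`second_order_pointwise`: one factor accompanies second derivatives, the other the lower order term
with φ^{2j-2}. -/
lemma coordPartial_cutoff_pow {φ : EuclideanSpace ℝ (Fin n) → ℝ} (hφ : ContDiff ℝ 1 φ)
    (hφ0 : ∀ y, 0 ≤ φ y) {j : ℝ} (hj : 1 < j) (y : EuclideanSpace ℝ (Fin n)) (k : Fin n) :
    coordPartial k (fun z ↦ φ z ^ (2 * j)) y =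
      2 * j * (φ y ^ (j - 1) * φ y ^ j) * coordPartial k φ y := by
  have h1 := ((hφ.differentiable (by simp) y).hasFDerivAt).rpow_const (p := 2 * j)
    (Or.inr (by linarith))
  have h2 : φ y ^ (j - 1) * φ y ^ j = φ y ^ (2 * j - 1) := by
    rw [← Real.rpow_add_of_nonneg (hφ0 y) (by linarith) (by linarith)]
    congr 1; ring
  rw [coordPartial, h1.fderiv, h2]
  rfl

lemma norm_zeroth_order_le {ε τ W Λ : ℝ} (hε : 0 ≤ ε) (hW : 0 ≤ W * Λ)
    (w : Fin n → ℝ) (p : PiLp 2 (fun _ : Fin n ↦ V)) (hw : ∀ a, |w a| ≤ W * Λ) :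
    ‖∑ a, w a • powFlux ε τ p a‖ ≤ n * Λ * W * (ε + ‖p‖ ^ 2) ^ τ * ‖p‖ := by
  refine (norm_sum_smul_le w _ hW hw (d := (ε + ‖p‖ ^ 2) ^ τ * ‖p‖) fun a ↦ ?_).trans
    (le_of_eq (by ring))
  refine (PiLp.norm_apply_le _ a).trans (le_of_eq ?_)
  rw [powFlux, norm_smul, Real.norm_eq_abs, abs_of_nonneg (by positivity)]

set_option maxHeartbeats 2000000 in
/-- The pointwise second order estimate in a chart. -/
lemma second_order_chart (hU : IsOpen U) (hK : IsCompact K) (hKU : K ⊆ U)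
    (hS : ∀ a i, ContDiffOn ℝ 1 (fun y ↦ S y a i) U)
    (hσc : ∀ a i, ContinuousOn (fun y ↦ σ y a i) U) (hσ : ∀ y ∈ U, σ y * S y = 1)
    {γ : EuclideanSpace ℝ (Fin n) → ℝ} (hγ : ContDiffOn ℝ 1 γ U) (hγ0 : ∀ y ∈ U, 0 < γ y)
    {φ : EuclideanSpace ℝ (Fin n) → ℝ} (hφ : ContDiff ℝ 1 φ) (hφ0 : ∀ y, 0 ≤ φ y)
    (hφ1 : ∀ y, φ y ≤ 1) {κ β j : ℝ} (hκ : 0 ≤ κ) (hβ : 0 ≤ β) (hj : j = 2 * κ + β + 1)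
    (hj1 : 1 < j) :
    ∃ C : ℝ, 0 ≤ C ∧ ∀ h : EuclideanSpace ℝ (Fin n) → V, ContDiffOn ℝ 2 h U → ∀ ε, 0 ≤ ε →
      ∀ y ∈ K, ∀ R : V, γ y • R = ∑ i, coordPartial i (frameFlux S ε κ γ h i) y →
      γ y * (1 / 2 * (φ y ^ (2 * j) * (ε + ‖frameGrad S h y‖ ^ 2) ^ (j - 1) * frameHessSq S h y) -
          ((n * (1 + 2 * (κ + β))) ^ 2 + 1) *
            (φ y ^ (2 * j) * (ε + ‖frameGrad S h y‖ ^ 2) ^ β * ‖R‖ ^ 2) -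
          C * (φ y ^ (2 * j - 2) * (ε + ‖frameGrad S h y‖ ^ 2) ^ (j - 1) *
            ‖frameGrad S h y‖ ^ 2)) ≤
        ∑ i, ∑ k, inner ℝ (coordPartial k (frameFlux S ε κ γ h i) y)
          (coordPartial i (frameFlux S ε (κ + β) (fun z ↦ φ z ^ (2 * j)) h k) y) -
        inner ℝ (∑ i, coordPartial i (frameFlux S ε κ γ h i) y)
          (∑ k, coordPartial k (frameFlux S ε (κ + β) (fun z ↦ φ z ^ (2 * j)) h k) y) := by
  have hdS : ∀ k a i, ContinuousOn (coordPartial k fun z ↦ S z a i) U := fun k a i ↦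
    continuousOn_coordPartial hU (hS a i) k
  obtain ⟨Λ₁, hΛ₁, h1⟩ := exists_bound_family hK (fun (q : Fin n × Fin n) y ↦ S y q.1 q.2)
    fun q ↦ (hS q.1 q.2).continuousOn.mono hKU
  obtain ⟨Λ₂, hΛ₂, h2⟩ := exists_bound_family hK (fun (q : Fin n × Fin n) y ↦ σ y q.1 q.2)
    fun q ↦ (hσc q.1 q.2).mono hKU
  obtain ⟨Λ₃, hΛ₃, h3⟩ := exists_bound_family hK
    (fun (q : Fin n × Fin n × Fin n) ↦ coordPartial q.1 fun z ↦ S z q.2.1 q.2.2)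
    fun q ↦ (hdS q.1 q.2.1 q.2.2).mono hKU
  obtain ⟨Λ₄, hΛ₄, h4⟩ := exists_bound_family hK (fun k y ↦ (γ y)⁻¹ * coordPartial k γ y)
    fun k ↦ ((hγ.continuousOn.inv₀ fun y hy ↦ (hγ0 y hy).ne').mul
      (continuousOn_coordPartial hU hγ k)).mono hKU
  obtain ⟨Λ₅, hΛ₅, h5⟩ := exists_bound_family hK (fun k ↦ coordPartial k φ)
    fun k ↦ (continuousOn_coordPartial isOpen_univ hφ.contDiffOn k).mono (subset_univ K)
  set Λ := Λ₁ + Λ₂ + Λ₃ + Λ₄ + Λ₅ with hΛ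
  have hΛ0 : 0 ≤ Λ := by positivity
  -- One constant that dominates the frame and its inverse, the commutator, the error from
  -- differentiating γ and S, and the error from differentiating the cutoff and S. It depends on the
  -- chart and the cutoff, not on h or ε.
  set Λ' := Λ + n * (n * (2 * Λ ^ 2 * (n * Λ))) + n * (Λ ^ 2 + Λ) + n * (2 * j * Λ ^ 2 + Λ)
    with hΛ'
  have hj0 : 0 < j := by linarith
  have t1 : 0 ≤ n * (n * (2 * Λ ^ 2 * (n * Λ))) := by positivity
  have t2 : 0 ≤ n * (Λ ^ 2 + Λ) := by positivity
  have t3 : 0 ≤ n * (2 * j * Λ ^ 2 + Λ) := by positivity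
  have hΛ'0 : 0 ≤ Λ' := by positivity
  have u1 : n * (n * (2 * Λ ^ 2 * (n * Λ))) ≤ Λ' := by rw [hΛ']; linarith
  have u2 : n * (Λ ^ 2 + Λ) ≤ Λ' := by rw [hΛ']; linarith
  have u3 : n * (2 * j * Λ ^ 2 + Λ) ≤ Λ' := by rw [hΛ']; linarith
  have hΛΛ' : Λ ≤ Λ' := by rw [hΛ']; linarith
  clear_value Λ'
  obtain ⟨C, hC, hpt⟩ := second_order_pointwise (V := V) n hκ (add_nonneg hκ hβ) hΛ'0
  refine ⟨C, hC, ?_⟩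
  intro h hh ε hε y hy R hR
  have hyU := hKU hy
  have hp1 := contDiffOn_frameGrad hU hS hh
  have hpd := differentiableAt_of_contDiffOn hU hp1 hyU
  have hSd : ∀ a i, DifferentiableAt ℝ (fun y ↦ S y a i) y := fun a i ↦
    differentiableAt_of_contDiffOn hU (hS a i) hyU
  have hφp : ContDiff ℝ 1 fun z ↦ φ z ^ (2 * j) :=
    hφ.rpow_const_of_le (m := 1) (by push_cast; linarith)
  set p := frameGrad S h y with hp
  set e := ε + ‖p‖ ^ 2 with he
  have he0 : 0 ≤ e := by positivity
  have bS : ∀ a i, |S y a i| ≤ Λ := fun a i ↦ (h1 (a, i) y hy).trans (by linarith)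
  have bσ : ∀ a i, |σ y a i| ≤ Λ := fun a i ↦ (h2 (a, i) y hy).trans (by linarith)
  have bdS : ∀ k a i, |coordPartial k (fun z ↦ S z a i) y| ≤ Λ := fun k a i ↦
    (h3 (k, a, i) y hy).trans (by linarith)
  have bγ : ∀ k, |coordPartial k γ y| ≤ γ y * Λ := fun k ↦ by
    have := h4 k y hy
    simp only [abs_mul, abs_inv, abs_of_pos (hγ0 y hyU)] at this
    rw [inv_mul_le_iff₀ (hγ0 y hyU)] at this
    exact this.trans (mul_le_mul_of_nonneg_left (by linarith) (hγ0 y hyU).le)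
  have bφ : ∀ k, |coordPartial k φ y| ≤ Λ := fun k ↦ (h5 k y hy).trans (by linarith)
  clear_value Λ
  set l := φ y ^ (j - 1) with hl
  set m := φ y ^ j with hm
  have hl0 : 0 ≤ l := Real.rpow_nonneg (hφ0 y) _
  have hm0 : 0 ≤ m := Real.rpow_nonneg (hφ0 y) _
  have hml : m ≤ l := Real.rpow_le_rpow_of_exponent_ge_of_imp (hφ0 y) (hφ1 y) (by linarith)
    (fun _ h ↦ absurd h (by linarith))
  have hm2 : m ^ 2 = φ y ^ (2 * j) := by
    rw [hm, ← Real.rpow_natCast, ← Real.rpow_mul (hφ0 y)]; congr 1; push_cast; ring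
  have hl2 : l ^ 2 = φ y ^ (2 * j - 2) := by
    rw [hl, ← Real.rpow_natCast, ← Real.rpow_mul (hφ0 y)]; congr 1; push_cast; ring
  have hm2l : m ^ 2 ≤ l * m := by nlinarith
  have hres := hpt ε (γ y) l m (e ^ ((j - 1) / 2)) (e ^ (β / 2)) (Real.sqrt (frameHessSq S h y))
    (S y) (σ y) p (fun k ↦ coordPartial k (frameGrad S h) y)
    (fun i k ↦ ∑ a, (coordPartial k γ y * S y a i + γ y * coordPartial k (fun z ↦ S z a i) y) •
        powFlux ε κ p a)
    (fun i k ↦ ∑ a, (coordPartial i (fun z ↦ φ z ^ (2 * j)) y * S y a k +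
      φ y ^ (2 * j) * coordPartial i (fun z ↦ S z a k) y) • powFlux ε (κ + β) p a)
    R hε (hγ0 y hyU).le hm0 hml (by positivity) (by positivity) (Real.sqrt_nonneg _)
    (by
      rw [← Real.rpow_natCast, ← Real.rpow_mul he0, ← Real.rpow_add_of_nonneg he0 hκ (by linarith)]
      congr 1; push_cast; linarith)
    (by
      rw [← Real.rpow_add_of_nonneg he0 (by linarith) (by linarith)]
      congr 1; linarith)
    (Real.sq_sqrt (Finset.sum_nonneg fun _ _ ↦ by positivity)) (hσ y hyU)
    (fun a i ↦ (bS a i).trans hΛΛ') (fun a i ↦ (bσ a i).trans hΛΛ')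
    (fun a b ↦ (norm_frame_commutator_le hU hS hh hyU (hσ y hyU) hΛ0 bS bσ bdS a b).trans (by
      rw [show n * (n * (2 * Λ ^ 2 * (n * (Λ * ‖frameGrad S h y‖)))) =
        n * (n * (2 * Λ ^ 2 * (n * Λ))) * ‖p‖ by rw [hp]; ring]
      exact mul_le_mul_of_nonneg_right u1 (norm_nonneg _)))
    (fun i k ↦ by
      refine (norm_zeroth_order_le (W := γ y) (Λ := Λ ^ 2 + Λ) hε
        (mul_nonneg (hγ0 y hyU).le (by positivity)) _ p fun a ↦ ?_).trans ?_
      · refine (abs_add_le _ _).trans ?_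
        rw [abs_mul, abs_mul, abs_of_pos (hγ0 y hyU)]
        have g1 := mul_le_mul (bγ k) (bS a i) (abs_nonneg _)
          (mul_nonneg (hγ0 y hyU).le hΛ0)
        have g2 := mul_le_mul_of_nonneg_left (bdS k a i) (hγ0 y hyU).le
        linarith
      · exact mul_le_mul_of_nonneg_right (mul_le_mul_of_nonneg_right
          (mul_le_mul_of_nonneg_right u2 (hγ0 y hyU).le) (by positivity)) (norm_nonneg _))
    (fun i k ↦ by
      refine (norm_zeroth_order_le (W := l * m) (Λ := 2 * j * Λ ^ 2 + Λ) hε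
        (mul_nonneg (mul_nonneg hl0 hm0) (by positivity)) _ p fun a ↦ ?_).trans ?_
      · refine (abs_add_le _ _).trans ?_
        rw [coordPartial_cutoff_pow hφ hφ0 hj1, ← hl, ← hm, ← hm2, abs_mul _ (S y a k),
          abs_mul _ (coordPartial i φ y), abs_mul (m ^ 2),
          abs_of_nonneg (sq_nonneg m), abs_of_nonneg (by positivity : 0 ≤ 2 * j * (l * m))]
        have g1 := mul_le_mul (bφ i) (bS a k) (abs_nonneg _) hΛ0
        have g2 := mul_le_mul_of_nonneg_left g1 (by positivity : 0 ≤ 2 * j * (l * m))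
        have g3 := mul_le_mul hm2l (bdS i a k) (abs_nonneg _) (by positivity)
        linarith
      · exact mul_le_mul_of_nonneg_right (mul_le_mul_of_nonneg_right
          (mul_le_mul_of_nonneg_right u3 (by positivity)) (by positivity)) (norm_nonneg _))
  have d1 : ∀ i k, coordPartial k (frameFlux S ε κ γ h i) y =
      (∑ a, (coordPartial k γ y * S y a i + γ y * coordPartial k (fun z ↦ S z a i) y) •
        powFlux ε κ p a) + γ y • ∑ a, S y a i • powFluxDeriv ε κ p (coordPartial k (frameGrad S h) y) a :=
    fun i k ↦ coordPartial_weightedFlux hε hκ (differentiableAt_of_contDiffOn hU hγ hyU) hSd hpd i k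
  have d2 : ∀ i k, coordPartial k (frameFlux S ε (κ + β) (fun z ↦ φ z ^ (2 * j)) h i) y =
      (∑ a, (coordPartial k (fun z ↦ φ z ^ (2 * j)) y * S y a i +
        φ y ^ (2 * j) * coordPartial k (fun z ↦ S z a i) y) •
        powFlux ε (κ + β) p a) +
        φ y ^ (2 * j) • ∑ a, S y a i • powFluxDeriv ε (κ + β) p (coordPartial k (frameGrad S h) y) a :=
    fun i k ↦ coordPartial_weightedFlux hε (add_nonneg hκ hβ)
      (hφp.differentiable (by simp) y) hSd hpd i k
  have x2 : (e ^ ((j - 1) / 2)) ^ 2 = e ^ (j - 1) := by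
    rw [← Real.rpow_natCast, ← Real.rpow_mul he0]; congr 1; push_cast; ring
  have z2 : (e ^ (β / 2)) ^ 2 = e ^ β := by
    rw [← Real.rpow_natCast, ← Real.rpow_mul he0]; congr 1; push_cast; ring
  rw [hm2, hl2, x2, z2, Real.sq_sqrt (frameHessSq_nonneg S h y), hR] at hres
  simp only [← d1, ← d2] at hres
  exact hres

lemma integral_sub_sub_const_mul {X : Type*} [MeasurableSpace X] {ν : Measure X} {A B C : X → ℝ}
    (hA : Integrable A ν) (hB : Integrable B ν) (hC : Integrable C ν) (a b c : ℝ) :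
    ∫ x, (a * A x - b * B x - c * C x) ∂ν = a * ∫ x, A x ∂ν - b * ∫ x, B x ∂ν - c * ∫ x, C x ∂ν := by
  have h1 : Integrable (fun x ↦ a * A x - b * B x) ν := (hA.const_mul a).sub (hB.const_mul b)
  rw [integral_sub h1 (hC.const_mul c), integral_sub (hA.const_mul a) (hB.const_mul b),
    integral_const_mul, integral_const_mul, integral_const_mul]

lemma continuousOn_frameHessSq (hU : IsOpen U) (hS : ∀ a i, ContDiffOn ℝ 1 (fun y ↦ S y a i) U)
    {h : EuclideanSpace ℝ (Fin n) → V} (hp : ContDiffOn ℝ 1 (frameGrad S h) U) :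
    ContinuousOn (frameHessSq S h) U :=
  continuousOn_finsetSum _ fun b _ ↦ (continuousOn_finsetSum _ fun k _ ↦
    ((hS b k).continuousOn.smul (continuousOn_coordPartial hU hp k))).norm.pow 2

/-- The local second order estimate: the weighted `L²` norm of the second derivatives is bounded
by the divergence of the flux and first order terms. -/
lemma second_order_integral (hU : IsOpen U) (hK : IsCompact K) (hKU : K ⊆ U)
    (hS : ∀ a i, ContDiffOn ℝ 1 (fun y ↦ S y a i) U)
    (hσc : ∀ a i, ContinuousOn (fun y ↦ σ y a i) U) (hσ : ∀ y ∈ U, σ y * S y = 1)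
    {γ : EuclideanSpace ℝ (Fin n) → ℝ} (hγ : ContDiffOn ℝ 1 γ U) (hγ0 : ∀ y ∈ U, 0 < γ y)
    {φ : EuclideanSpace ℝ (Fin n) → ℝ} (hφ : ContDiff ℝ 1 φ) (hφ0 : ∀ y, 0 ≤ φ y)
    (hφ1 : ∀ y, φ y ≤ 1) (hφK : ∀ y ∉ K, φ y = 0) {κ β j : ℝ} (hκ : 0 ≤ κ) (hβ : 0 ≤ β)
    (hj : j = 2 * κ + β + 1) (hj1 : 1 < j) :
    ∃ C : ℝ, 0 ≤ C ∧ ∀ h : EuclideanSpace ℝ (Fin n) → V, ContDiffOn ℝ 2 h U → ∀ ε, 0 ≤ ε →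
      ∀ R : EuclideanSpace ℝ (Fin n) → V, ContinuousOn R U →
      (∀ y ∈ U, γ y • R y = ∑ i, coordPartial i (frameFlux S ε κ γ h i) y) →
      1 / 2 * ∫ y, γ y * (φ y ^ (2 * j) * (ε + ‖frameGrad S h y‖ ^ 2) ^ (j - 1) *
          frameHessSq S h y) ≤
        ((n * (1 + 2 * (κ + β))) ^ 2 + 1) * (∫ y, γ y *
            (φ y ^ (2 * j) * (ε + ‖frameGrad S h y‖ ^ 2) ^ β * ‖R y‖ ^ 2)) +
          C * ∫ y, γ y * (φ y ^ (2 * j - 2) * (ε + ‖frameGrad S h y‖ ^ 2) ^ (j - 1) *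
            ‖frameGrad S h y‖ ^ 2) := by
  obtain ⟨C, hC, hpt⟩ := second_order_chart (V := V) hU hK hKU hS hσc hσ hγ hγ0 hφ hφ0 hφ1 hκ hβ hj hj1
  refine ⟨C, hC, fun h hh ε hε R hRc hR ↦ ?_⟩
  have hp1 := contDiffOn_frameGrad hU hS hh
  have hφp : ContDiff ℝ 1 fun z ↦ φ z ^ (2 * j) :=
    hφ.rpow_const_of_le (m := 1) (by push_cast; linarith)
  have hφ2 : ∀ y ∉ K, φ y ^ (2 * j) = 0 := fun y hy ↦ by
    rw [hφK y hy, Real.zero_rpow (by linarith)]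
  have hφ3 : ∀ y ∉ K, φ y ^ (2 * j - 2) = 0 := fun y hy ↦ by
    rw [hφK y hy, Real.zero_rpow (by linarith)]
  set P : Fin n → EuclideanSpace ℝ (Fin n) → V := frameFlux S ε κ γ h with hP
  set Q : Fin n → EuclideanSpace ℝ (Fin n) → V :=
    frameFlux S ε (κ + β) (fun z ↦ φ z ^ (2 * j)) h with hQ
  have hP1 : ∀ i, ContDiffOn ℝ 1 (P i) U := contDiffOn_frameFlux hε hκ hγ hS hp1
  have hQ1 : ∀ i, ContDiffOn ℝ 1 (Q i) U :=
    contDiffOn_frameFlux hε (add_nonneg hκ hβ) hφp.contDiffOn hS hp1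
  have hQ0 : ∀ i, ∀ y ∉ K, Q i y = 0 := fun i y hy ↦ by
    simp only [hQ, frameFlux, hφ2 y hy, zero_smul]
  have hdQ0 : ∀ i k, ∀ y ∉ K, coordPartial k (Q i) y = 0 := fun i k y hy ↦ by
    have : Q i =ᶠ[𝓝 y] fun _ ↦ 0 := by
      filter_upwards [hK.isClosed.isOpen_compl.mem_nhds hy] with z hz using hQ0 i z hz
    rw [coordPartial_eventuallyEq this]; simp [coordPartial]
  have hcP : ∀ i k, ContinuousOn (coordPartial k (P i)) K := fun i k ↦
    (continuousOn_coordPartial hU (hP1 i) k).mono hKU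
  have hcQ : ∀ i k, ContinuousOn (coordPartial k (Q i)) K := fun i k ↦
    (continuousOn_coordPartial hU (hQ1 i) k).mono hKU
  have hint : ∀ i k i' k', Integrable fun y ↦
      inner ℝ (coordPartial k (P i) y) (coordPartial k' (Q i') y) := fun i k i' k' ↦
    integrable_of_continuousOn_compact hK ((hcP i k).inner (hcQ i' k')) fun y hy ↦ by
      rw [hdQ0 i' k' y hy, inner_zero_right]
  -- Swapping the derivatives turns ∫ ∂_k Pⁱ ∂_i Qᵏ into ∫ div P · div Q. The right side of the
  -- pointwise estimate therefore integrates to 0.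
  have hsum : ∫ y, ∑ i, ∑ k, inner ℝ (coordPartial k (P i) y) (coordPartial i (Q k) y) =
      ∫ y, inner ℝ (∑ i, coordPartial i (P i) y) (∑ k, coordPartial k (Q k) y) := by
    have e1 : ∀ y, inner ℝ (∑ i, coordPartial i (P i) y) (∑ k, coordPartial k (Q k) y) =
        ∑ i, ∑ k, inner ℝ (coordPartial i (P i) y) (coordPartial k (Q k) y) := fun y ↦ by
      simp only [sum_inner, inner_sum]
      exact Finset.sum_comm
    simp only [e1]
    rw [integral_finsetSum _ fun i _ ↦ integrable_finsetSum _ fun k _ ↦ hint i k k i,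
      integral_finsetSum _ fun i _ ↦ integrable_finsetSum _ fun k _ ↦ hint i i k k]
    refine Finset.sum_congr rfl fun i _ ↦ ?_
    rw [integral_finsetSum _ fun k _ ↦ hint i k k i, integral_finsetSum _ fun k _ ↦ hint i i k k]
    exact Finset.sum_congr rfl fun k _ ↦
      integral_inner_coordPartial_swap hU hK hKU (hP1 i) (hQ1 k) (hQ0 k) k i
  have hint1 : Integrable fun y ↦ ∑ i, ∑ k, inner ℝ (coordPartial k (P i) y) (coordPartial i (Q k) y) :=
    integrable_finsetSum _ fun i _ ↦ integrable_finsetSum _ fun k _ ↦ hint i k k i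
  have hint2 : Integrable fun y ↦
      inner ℝ (∑ i, coordPartial i (P i) y) (∑ k, coordPartial k (Q k) y) :=
    integrable_of_continuousOn_compact hK
      ((continuousOn_finsetSum _ fun i _ ↦ hcP i i).inner
        (continuousOn_finsetSum _ fun i _ ↦ hcQ i i)) fun y hy ↦ by
      simp only [hdQ0 _ _ y hy, Finset.sum_const_zero, inner_zero_right]
  have hce0 : ContinuousOn (fun y ↦ ε + ‖frameGrad S h y‖ ^ 2) K :=
    (continuousOn_const.add (hp1.continuousOn.norm.pow 2)).mono hKU
  have hce : ∀ τ : ℝ, 0 ≤ τ → ContinuousOn (fun y ↦ (ε + ‖frameGrad S h y‖ ^ 2) ^ τ) K := fun τ hτ ↦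
    hce0.rpow_const fun _ _ ↦ Or.inr hτ
  have hcφ : ∀ τ : ℝ, 0 ≤ τ → ContinuousOn (fun y ↦ φ y ^ τ) K := fun τ hτ ↦
    (hφ.continuous.rpow_const fun _ ↦ Or.inr hτ).continuousOn
  have hcγ : ContinuousOn γ K := hγ.continuousOn.mono hKU
  have iA : Integrable fun y ↦ γ y * (φ y ^ (2 * j) * (ε + ‖frameGrad S h y‖ ^ 2) ^ (j - 1) *
      frameHessSq S h y) :=
    integrable_of_continuousOn_compact hK (hcγ.mul (((hcφ _ (by linarith)).mul
      (hce _ (by linarith))).mul ((continuousOn_frameHessSq hU hS hp1).mono hKU)))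
      fun y hy ↦ by rw [hφ2 y hy]; ring
  have iB : Integrable fun y ↦ γ y * (φ y ^ (2 * j) * (ε + ‖frameGrad S h y‖ ^ 2) ^ β *
      ‖R y‖ ^ 2) :=
    integrable_of_continuousOn_compact hK (hcγ.mul (((hcφ _ (by linarith)).mul
      (hce _ hβ)).mul ((hRc.mono hKU).norm.pow 2))) fun y hy ↦ by rw [hφ2 y hy]; ring
  have iC : Integrable fun y ↦ γ y * (φ y ^ (2 * j - 2) * (ε + ‖frameGrad S h y‖ ^ 2) ^ (j - 1) *
      ‖frameGrad S h y‖ ^ 2) :=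
    integrable_of_continuousOn_compact hK (hcγ.mul (((hcφ _ (by linarith)).mul
      (hce _ (by linarith))).mul ((hp1.continuousOn.mono hKU).norm.pow 2)))
      fun y hy ↦ by rw [hφ3 y hy]; ring
  have hmono : ∫ y, (1 / 2 * (γ y * (φ y ^ (2 * j) * (ε + ‖frameGrad S h y‖ ^ 2) ^ (j - 1) *
        frameHessSq S h y)) - ((n * (1 + 2 * (κ + β))) ^ 2 + 1) *
          (γ y * (φ y ^ (2 * j) * (ε + ‖frameGrad S h y‖ ^ 2) ^ β * ‖R y‖ ^ 2)) -
        C * (γ y * (φ y ^ (2 * j - 2) * (ε + ‖frameGrad S h y‖ ^ 2) ^ (j - 1) *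
          ‖frameGrad S h y‖ ^ 2))) ≤
      ∫ y, (∑ i, ∑ k, inner ℝ (coordPartial k (P i) y) (coordPartial i (Q k) y) -
        inner ℝ (∑ i, coordPartial i (P i) y) (∑ k, coordPartial k (Q k) y)) := by
    refine integral_mono (((iA.const_mul _).sub (iB.const_mul _)).sub (iC.const_mul _))
      (hint1.sub hint2) fun y ↦ ?_
    by_cases hy : y ∈ K
    · refine le_trans (le_of_eq ?_) (hpt h hh ε hε y hy (R y) (hR y (hKU hy)))
      ring
    · simp only [hφ2 y hy, hφ3 y hy, hdQ0 _ _ y hy, inner_zero_right, Finset.sum_const_zero]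
      simp
  rw [integral_sub hint1 hint2, hsum, sub_self, integral_sub_sub_const_mul iA iB iC] at hmono
  linarith

end SecondOrderIntegral

/-! ### Sobolev inequalities with constants depending only on n. -/

section Sobolev

variable {n : ℕ}

lemma norm_fderiv_sq_le {g : EuclideanSpace ℝ (Fin n) → ℝ} (z : EuclideanSpace ℝ (Fin n)) :
    ‖fderiv ℝ g z‖ ^ 2 ≤ ∑ b, coordPartial b g z ^ 2 := by
  have h0 : 0 ≤ ∑ b, coordPartial b g z ^ 2 := Finset.sum_nonneg fun _ _ ↦ sq_nonneg _
  rw [← Real.sq_sqrt h0]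
  refine pow_le_pow_left₀ (norm_nonneg _) ?_ 2
  refine ContinuousLinearMap.opNorm_le_bound _ (Real.sqrt_nonneg _) fun v ↦ ?_
  have hv : fderiv ℝ g z v = ∑ b, v b * coordPartial b g z := by
    have h1 : v = ∑ b, v b • EuclideanSpace.single b (1 : ℝ) := by
      have := (EuclideanSpace.basisFun (Fin n) ℝ).sum_repr v
      simpa using this.symm
    conv_lhs => rw [h1]
    simp only [map_sum, map_smul, smul_eq_mul, coordPartial]
  rw [hv, Real.norm_eq_abs, ← Real.sqrt_sq_eq_abs, EuclideanSpace.norm_eq, ← Real.sqrt_mul h0]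
  refine Real.sqrt_le_sqrt ?_
  simp only [Real.norm_eq_abs, sq_abs]
  rw [mul_comm]
  exact Finset.sum_mul_sq_le_sq_mul_sq _ _ _

/-- The Sobolev inequality for the exponent `2`, in terms of integrals. -/
lemma exists_sobolev (hn : 3 ≤ n) : ∃ C : ℝ, 0 ≤ C ∧ ∀ g : EuclideanSpace ℝ (Fin n) → ℝ,
    ContDiff ℝ 1 g → HasCompactSupport g →
    (∫ z, |g z| ^ (2 * (n : ℝ) / (n - 2))) ^ (((n : ℝ) - 2) / n) ≤
      C * ∫ z, ∑ b, coordPartial b g z ^ 2 := by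
  have hn3 : (3 : ℝ) ≤ n := by exact_mod_cast hn
  have hn2 : (0 : ℝ) < n - 2 := by linarith
  set q : NNReal := ⟨2 * (n : ℝ) / (n - 2), by positivity⟩ with hq
  have hqr : (q : ℝ) = 2 * (n : ℝ) / (n - 2) := rfl
  have hq0 : (0 : ℝ) < q := by rw [hqr]; positivity
  set c : NNReal := eLpNormLESNormFDerivOfEqInnerConst (volume : Measure (EuclideanSpace ℝ (Fin n)))
    ((2 : NNReal) : ℝ) with hc
  refine ⟨(c : ℝ) ^ 2, by positivity, fun g hg hgc ↦ ?_⟩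
  have h1 := eLpNorm_le_eLpNorm_fderiv_of_eq_inner (μ := (volume : Measure (EuclideanSpace ℝ (Fin n))))
    hg hgc (p := 2) (p' := q) (by norm_num) (by rw [finrank_euclideanSpace_fin]; omega)
    (by
      rw [hqr, finrank_euclideanSpace_fin]
      push_cast
      field_simp)
  have hdc : HasCompactSupport (fderiv ℝ g) := hgc.fderiv (𝕜 := ℝ)
  have hm1 : MemLp g q volume := hg.continuous.memLp_of_hasCompactSupport hgc
  have hm2 : MemLp (fderiv ℝ g) ((2 : NNReal) : ENNReal) volume :=
    (hg.continuous_fderiv (by simp)).memLp_of_hasCompactSupport hdc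
  rw [hm1.eLpNorm_eq_integral_rpow_norm (by simpa using hq0.ne') ENNReal.coe_ne_top,
    hm2.eLpNorm_eq_integral_rpow_norm (by simp) ENNReal.coe_ne_top, ← hc,
    ← ENNReal.ofReal_coe_nnreal (p := c),
    ← ENNReal.ofReal_mul (by positivity), ENNReal.ofReal_le_ofReal_iff (by positivity)] at h1
  simp only [ENNReal.coe_toReal, hqr, Real.norm_eq_abs] at h1
  set X := ∫ z, |g z| ^ (2 * (n : ℝ) / (n - 2)) with hX
  have hX0 : 0 ≤ X := integral_nonneg fun z ↦ by positivity
  set Y := ∫ z, ‖fderiv ℝ g z‖ ^ ((2 : NNReal) : ℝ) with hY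
  have hY0 : 0 ≤ Y := integral_nonneg fun z ↦ by positivity
  have h2 := pow_le_pow_left₀ (by positivity) h1 2
  have e1 : (X ^ (2 * (n : ℝ) / (n - 2))⁻¹) ^ 2 = X ^ (((n : ℝ) - 2) / n) := by
    rw [← Real.rpow_natCast, ← Real.rpow_mul hX0]
    congr 1; push_cast; field_simp
  have e2 : (c * Y ^ ((2 : NNReal) : ℝ)⁻¹) ^ 2 = c ^ 2 * Y := by
    rw [mul_pow, ← Real.rpow_natCast, ← Real.rpow_natCast, ← Real.rpow_mul hY0]
    norm_num
  have hc2 : ((2 : NNReal) : ENNReal).toReal = ((2 : NNReal) : ℝ) := rfl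
  rw [e1, e2] at h2
  refine h2.trans (mul_le_mul_of_nonneg_left ?_ (by positivity))
  have hcd : ∀ b, Continuous (coordPartial b g) := fun b ↦
    (hg.continuous_fderiv (by simp)).clm_apply continuous_const
  refine integral_mono ?_ ?_ fun z ↦ ?_
  · have h3 : Continuous fun z ↦ ‖fderiv ℝ g z‖ ^ ((2 : NNReal) : ℝ) :=
      ((hg.continuous_fderiv (by simp)).norm).rpow_const fun _ ↦ Or.inr (by norm_num)
    refine h3.integrable_of_hasCompactSupport (HasCompactSupport.intro hdc fun z hz ↦ ?_)
    simp [image_eq_zero_of_notMem_tsupport hz]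
  · have h3 : Continuous fun z ↦ ∑ b, coordPartial b g z ^ 2 :=
      continuous_finsetSum _ fun b _ ↦ (hcd b).pow 2
    refine h3.integrable_of_hasCompactSupport (HasCompactSupport.intro hdc fun z hz ↦ ?_)
    simp [coordPartial, image_eq_zero_of_notMem_tsupport hz]
  · simpa using norm_fderiv_sq_le (g := g) z

/-- The Sobolev inequality with respect to a constant metric. -/
lemma exists_sobolev_frame_const (hn : 3 ≤ n) : ∃ C : ℝ, 0 ≤ C ∧
    ∀ S : Matrix (Fin n) (Fin n) ℝ, S.det ≠ 0 → ∀ ψ : EuclideanSpace ℝ (Fin n) → ℝ,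
    ContDiff ℝ 1 ψ → HasCompactSupport ψ →
    (|S.det|⁻¹ * ∫ y, |ψ y| ^ (2 * (n : ℝ) / (n - 2))) ^ (((n : ℝ) - 2) / n) ≤
      C * (|S.det|⁻¹ * ∫ y, ∑ b, (∑ k, S b k * coordPartial k ψ y) ^ 2) := by
  obtain ⟨C, hC, hsob⟩ := exists_sobolev hn
  refine ⟨C, hC, fun S hS ψ hψ hψc ↦ ?_⟩
  set bas := (EuclideanSpace.basisFun (Fin n) ℝ).toBasis with hbas
  -- The linear change of variables y = Sᵀz turns the frame derivatives into partial derivatives and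
  -- |det S|⁻¹ dy into dz, so the Euclidean constant is kept.
  set A : EuclideanSpace ℝ (Fin n) →L[ℝ] EuclideanSpace ℝ (Fin n) :=
    (Matrix.toLin bas bas S.transpose).toContinuousLinearMap with hA
  have hdet : A.det = S.det := by
    rw [hA, LinearMap.det_toContinuousLinearMap, LinearMap.det_toLin, Matrix.det_transpose]
  set A' : EuclideanSpace ℝ (Fin n) ≃L[ℝ] EuclideanSpace ℝ (Fin n) :=
    A.toContinuousLinearEquivOfDetNeZero (by rw [hdet]; exact hS) with hA'
  have hAA' : ∀ z, A' z = A z := fun z ↦ rfl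
  have hAb : ∀ b, A (EuclideanSpace.single b 1) =
      ∑ k, S b k • EuclideanSpace.single k (1 : ℝ) := fun b ↦ by
    have := Matrix.toLin_self bas bas S.transpose b
    simpa [hbas, hA] using this
  have hcv : ∀ G : EuclideanSpace ℝ (Fin n) → ℝ, |S.det|⁻¹ * ∫ y, G y = ∫ z, G (A z) := by
    intro G
    have h1 := integral_image_eq_integral_abs_det_fderiv_smul (volume) (s := univ)
      MeasurableSet.univ (f := A) (f' := fun _ ↦ A)
      (fun x _ ↦ A.hasFDerivAt.hasFDerivWithinAt) (A'.injective.injOn) G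
    have h2 : A '' univ = univ := image_univ_of_surjective A'.surjective
    rw [h2, setIntegral_univ, setIntegral_univ, hdet] at h1
    simp only [smul_eq_mul] at h1
    rw [h1, integral_const_mul, inv_mul_cancel_left₀ (abs_ne_zero.2 hS)]
  have hg : ContDiff ℝ 1 (fun z ↦ ψ (A z)) := hψ.comp A.contDiff
  have hgc : HasCompactSupport (fun z ↦ ψ (A z)) := hψc.comp_homeomorph A'.toHomeomorph
  have hpart : ∀ b z, coordPartial b (fun z ↦ ψ (A z)) z = ∑ k, S b k * coordPartial k ψ (A z) := by
    intro b z
    have h1 : HasFDerivAt (fun z ↦ ψ (A z)) ((fderiv ℝ ψ (A z)).comp A) z :=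
      (hψ.differentiable (by simp) (A z)).hasFDerivAt.comp z A.hasFDerivAt
    rw [coordPartial, h1.fderiv, ContinuousLinearMap.comp_apply, hAb]
    simp only [map_sum, map_smul, smul_eq_mul, coordPartial]
  have := hsob _ hg hgc
  simp only [hpart] at this
  rw [hcv fun y ↦ |ψ y| ^ (2 * (n : ℝ) / (n - 2)),
    hcv fun y ↦ ∑ b, (∑ k, S b k * coordPartial k ψ y) ^ 2]
  exact this

/-- The Sobolev inequality near a point, with respect to a continuous frame; the constant does not
depend on the frame. -/
lemma exists_sobolev_frame (hn : 3 ≤ n) : ∃ C : ℝ, 0 ≤ C ∧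
    ∀ (U : Set (EuclideanSpace ℝ (Fin n))) (S σ : EuclideanSpace ℝ (Fin n) → Matrix (Fin n) (Fin n) ℝ)
      (γ : EuclideanSpace ℝ (Fin n) → ℝ) (y₀ : EuclideanSpace ℝ (Fin n)), IsOpen U → y₀ ∈ U →
    (∀ a i, ContinuousOn (fun y ↦ S y a i) U) → (∀ a i, ContinuousOn (fun y ↦ σ y a i) U) →
    ContinuousOn γ U → (∀ y ∈ U, σ y * S y = 1) → (∀ y ∈ U, γ y = |(S y).det|⁻¹) →
    (∀ y ∈ U, 0 < γ y) → ∃ W ⊆ U, IsOpen W ∧ y₀ ∈ W ∧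
    ∀ (K : Set (EuclideanSpace ℝ (Fin n))) (ψ : EuclideanSpace ℝ (Fin n) → ℝ), IsCompact K → K ⊆ W →
    ContDiff ℝ 1 ψ → (∀ y ∉ K, ψ y = 0) →
    (∫ y, γ y * |ψ y| ^ (2 * (n : ℝ) / (n - 2))) ^ (((n : ℝ) - 2) / n) ≤
      C * ∫ y, γ y * ∑ b, (∑ k, S y b k * coordPartial k ψ y) ^ 2 := by
  obtain ⟨C, hC, hsob⟩ := exists_sobolev_frame_const hn
  have hn3 : (3 : ℝ) ≤ n := by exact_mod_cast hn
  have hn2 : (0 : ℝ) < n - 2 := by linarith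
  -- The outer 2 and the inner 2 come from comparing the density with its value at y₀ on the left
  -- and on the right; 4n · n comes from expressing the frozen frame through the nearby one, with n
  -- coefficients below 2 for each of its n vectors.
  refine ⟨2 * (C * (2 * (n * (4 * n)))), by positivity, ?_⟩
  intro U S σ γ y₀ hU hy₀ hS hσ hγ hσS hγS hγ0
  have hdet : (S y₀).det ≠ 0 := fun h ↦ by
    have h1 := congrArg Matrix.det (hσS y₀ hy₀)
    rw [Matrix.det_mul, h, mul_zero, Matrix.det_one] at h1
    exact zero_ne_one h1
  have hSσ0 : S y₀ * σ y₀ = 1 := mul_eq_one_comm.1 (hσS y₀ hy₀)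
  -- At y₀ the transition matrix between the frozen and the actual frame is the identity, so near y₀
  -- its entries stay below 2. Shrinking the neighbourhood is what makes the constant independent of
  -- the frame.
  have hev1 : ∀ᶠ y in 𝓝 y₀, ∀ b a, |(S y₀ * σ y) b a| < 2 := by
    rw [eventually_all]; intro b
    rw [eventually_all]; intro a
    have h1 : ContinuousAt (fun y ↦ |(S y₀ * σ y) b a|) y₀ := by
      simp only [Matrix.mul_apply]
      refine ContinuousAt.abs ?_
      exact tendsto_finsetSum _ fun k _ ↦ tendsto_const_nhds.mul
        ((hσ k a).continuousAt (hU.mem_nhds hy₀))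
    refine h1.eventually_lt continuousAt_const ?_
    rw [hSσ0, Matrix.one_apply]
    split_ifs <;> norm_num
  have hγc := hγ.continuousAt (hU.mem_nhds hy₀)
  have hpos := hγ0 y₀ hy₀
  have hev2 : ∀ᶠ y in 𝓝 y₀, γ y < 2 * γ y₀ :=
    hγc.eventually_lt continuousAt_const (by linarith)
  have hev3 : ∀ᶠ y in 𝓝 y₀, γ y₀ < 2 * γ y :=
    continuousAt_const.eventually_lt (continuousAt_const.mul hγc) (by linarith)
  obtain ⟨W, hW, hWo, hyW⟩ := eventually_nhds_iff.1
    (((hev1.and hev2).and hev3).and (hU.mem_nhds hy₀))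
  refine ⟨W, fun y hy ↦ (hW y hy).2, hWo, hyW, fun K ψ hK hKW hψ hψ0 ↦ ?_⟩
  have hKU : K ⊆ U := fun y hy ↦ (hW y (hKW hy)).2
  have hψc : HasCompactSupport ψ := HasCompactSupport.intro hK hψ0
  have hdψ0 : ∀ k, ∀ y ∉ K, coordPartial k ψ y = 0 := fun k y hy ↦ by
    have : ψ =ᶠ[𝓝 y] fun _ ↦ 0 := by
      filter_upwards [hK.isClosed.isOpen_compl.mem_nhds hy] with z hz using hψ0 z hz
    rw [coordPartial_eventuallyEq this]; simp [coordPartial]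
  have hdψ : ∀ k, ContinuousOn (coordPartial k ψ) K := fun k ↦
    (continuousOn_coordPartial isOpen_univ hψ.contDiffOn k).mono (subset_univ K)
  have hq0 : 0 < 2 * (n : ℝ) / (n - 2) := by positivity
  have hψq : ∀ y ∉ K, |ψ y| ^ (2 * (n : ℝ) / (n - 2)) = 0 := fun y hy ↦ by
    rw [hψ0 y hy, abs_zero, Real.zero_rpow hq0.ne']
  have hψqc : ContinuousOn (fun y ↦ |ψ y| ^ (2 * (n : ℝ) / (n - 2))) K :=
    (hψ.continuous.abs.rpow_const fun _ ↦ Or.inr hq0.le).continuousOn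
  have i1 : Integrable fun y ↦ |ψ y| ^ (2 * (n : ℝ) / (n - 2)) :=
    integrable_of_continuousOn_compact hK hψqc hψq
  have i2 : Integrable fun y ↦ γ y * |ψ y| ^ (2 * (n : ℝ) / (n - 2)) :=
    integrable_of_continuousOn_compact hK ((hγ.mono hKU).mul hψqc)
      fun y hy ↦ by rw [hψq y hy, mul_zero]
  have i3 : Integrable fun y ↦ ∑ b, (∑ k, S y₀ b k * coordPartial k ψ y) ^ 2 :=
    integrable_of_continuousOn_compact hK (continuousOn_finsetSum _ fun b _ ↦
      (continuousOn_finsetSum _ fun k _ ↦ continuousOn_const.mul (hdψ k)).pow 2)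
      fun y hy ↦ by simp [hdψ0 _ y hy]
  have i4 : Integrable fun y ↦ γ y * ∑ b, (∑ k, S y b k * coordPartial k ψ y) ^ 2 :=
    integrable_of_continuousOn_compact hK ((hγ.mono hKU).mul (continuousOn_finsetSum _ fun b _ ↦
      (continuousOn_finsetSum _ fun k _ ↦ ((hS b k).mono hKU).mul (hdψ k)).pow 2))
      fun y hy ↦ by simp [hdψ0 _ y hy]
  have hmain := hsob (S y₀) hdet ψ hψ hψc
  rw [← hγS y₀ hy₀] at hmain
  set X := ∫ y, γ y * |ψ y| ^ (2 * (n : ℝ) / (n - 2)) with hX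
  set X₀ := ∫ y, |ψ y| ^ (2 * (n : ℝ) / (n - 2)) with hX₀
  have hX₀0 : 0 ≤ X₀ := integral_nonneg fun y ↦ by positivity
  have hXX : X ≤ 2 * (γ y₀ * X₀) := by
    rw [hX, hX₀, ← mul_assoc, ← integral_const_mul]
    refine integral_mono i2 (i1.const_mul _) fun y ↦ ?_
    by_cases hy : y ∈ K
    · exact mul_le_mul_of_nonneg_right (hW y (hKW hy)).1.1.2.le (by positivity)
    · simp only [hψq y hy, mul_zero, le_refl]
  have hX0 : 0 ≤ X := by
    refine integral_nonneg fun y ↦ ?_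
    by_cases hy : y ∈ K
    · exact mul_nonneg (hγ0 y (hKU hy)).le (by positivity)
    · simp only [Pi.zero_apply, hψq y hy, mul_zero, le_refl]
  have hθ1 : ((n : ℝ) - 2) / n ≤ 1 := by
    rw [div_le_one (by linarith)]; linarith
  have h2 : X ^ (((n : ℝ) - 2) / n) ≤ 2 * (γ y₀ * X₀) ^ (((n : ℝ) - 2) / n) := by
    refine (Real.rpow_le_rpow hX0 hXX (by positivity)).trans ?_
    rw [Real.mul_rpow (by norm_num) (by positivity)]
    refine mul_le_mul_of_nonneg_right ?_ (by positivity)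
    calc (2 : ℝ) ^ (((n : ℝ) - 2) / n) ≤ 2 ^ (1 : ℝ) :=
          Real.rpow_le_rpow_of_exponent_le (by norm_num) hθ1
      _ = 2 := Real.rpow_one 2
  have h3 : γ y₀ * ∫ y, ∑ b, (∑ k, S y₀ b k * coordPartial k ψ y) ^ 2 ≤
      (2 * (n * (4 * n))) * ∫ y, γ y * ∑ b, (∑ k, S y b k * coordPartial k ψ y) ^ 2 := by
    rw [← integral_const_mul, ← integral_const_mul]
    refine integral_mono (i3.const_mul _) (i4.const_mul _) fun y ↦ ?_
    by_cases hy : y ∈ K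
    · have hyU := hKU hy
      have hdec : ∀ b, ∑ k, S y₀ b k * coordPartial k ψ y =
          ∑ a, (S y₀ * σ y) b a * ∑ k, S y a k * coordPartial k ψ y := by
        intro b
        have h4 : ∀ k, S y₀ b k = ∑ a, (S y₀ * σ y) b a * S y a k := fun k ↦ by
          rw [← Matrix.mul_apply, Matrix.mul_assoc, hσS y hyU, Matrix.mul_one]
        simp only [Finset.mul_sum]
        rw [Finset.sum_comm]
        refine Finset.sum_congr rfl fun k _ ↦ ?_
        rw [h4 k, Finset.sum_mul]
        exact Finset.sum_congr rfl fun a _ ↦ by ring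
      set w : Fin n → ℝ := fun a ↦ ∑ k, S y a k * coordPartial k ψ y with hw
      have h5 : ∀ b, (∑ k, S y₀ b k * coordPartial k ψ y) ^ 2 ≤ (4 * n) * ∑ a, w a ^ 2 := by
        intro b
        rw [hdec b]
        refine (Finset.sum_mul_sq_le_sq_mul_sq _ _ _).trans
          (mul_le_mul_of_nonneg_right ?_ (Finset.sum_nonneg fun _ _ ↦ sq_nonneg _))
        have h6 := Finset.sum_le_card_nsmul Finset.univ (fun a ↦ (S y₀ * σ y) b a ^ 2) 4
          fun a _ ↦ by
            have := (hW y (hKW hy)).1.1.1 b a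
            rw [← sq_abs]
            nlinarith [abs_nonneg ((S y₀ * σ y) b a)]
        simpa [mul_comm] using h6
      have h7 := Finset.sum_le_card_nsmul Finset.univ _ _ fun b _ ↦ h5 b
      simp only [Finset.card_univ, Fintype.card_fin, nsmul_eq_mul] at h7
      have h8 : 0 ≤ ∑ a, w a ^ 2 := Finset.sum_nonneg fun _ _ ↦ sq_nonneg _
      calc γ y₀ * ∑ b, (∑ k, S y₀ b k * coordPartial k ψ y) ^ 2
          ≤ (2 * γ y) * (n * (4 * n * ∑ a, w a ^ 2)) :=
            mul_le_mul (hW y (hKW hy)).1.2.le h7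
              (Finset.sum_nonneg fun _ _ ↦ sq_nonneg _) (by linarith [hγ0 y hyU])
        _ = _ := by ring
    · simp [hdψ0 _ y hy]
  calc X ^ (((n : ℝ) - 2) / n) ≤ 2 * (γ y₀ * X₀) ^ (((n : ℝ) - 2) / n) := h2
    _ ≤ 2 * (C * (γ y₀ * ∫ y, ∑ b, (∑ k, S y₀ b k * coordPartial k ψ y) ^ 2)) := by gcongr
    _ ≤ 2 * (C * ((2 * (n * (4 * n))) *
        ∫ y, γ y * ∑ b, (∑ k, S y b k * coordPartial k ψ y) ^ 2)) := by gcongr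
    _ = _ := by ring

end Sobolev

/-! ### Gain of integrability in a small chart. -/

section LocalChart

variable {n : ℕ} {V : Type*} [NormedAddCommGroup V] [InnerProductSpace ℝ V]

/-- The constant of the Sobolev inequality in small charts. -/
def localSobolevConst (hn : 3 ≤ n) : ℝ := (exists_sobolev_frame hn).choose

lemma localSobolevConst_nonneg (hn : 3 ≤ n) : 0 ≤ localSobolevConst hn :=
  (exists_sobolev_frame hn).choose_spec.1

/-- The factor of the divergence term in the local estimate. -/
def divergenceConst (hn : 3 ≤ n) (β : ℝ) : ℝ :=
  localSobolevConst hn * (4 * (n - 1 + β) ^ 2 * ((n * (1 + 2 * ((n : ℝ) / 2 - 1 + β))) ^ 2 + 1))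

lemma divergenceConst_nonneg (hn : 3 ≤ n) (β : ℝ) : 0 ≤ divergenceConst hn β :=
  mul_nonneg (localSobolevConst_nonneg hn) (by positivity)

lemma coordPartial_cutoff_energy {φ : EuclideanSpace ℝ (Fin n) → ℝ} {ε j : ℝ}
    {P : EuclideanSpace ℝ (Fin n) → PiLp 2 (fun _ : Fin n ↦ V)} {y : EuclideanSpace ℝ (Fin n)}
    (hφ : DifferentiableAt ℝ φ y) (hP : DifferentiableAt ℝ P y) (hj : 2 ≤ j) (k : Fin n) :
    coordPartial k (fun z ↦ φ z ^ j * (ε + ‖P z‖ ^ 2) ^ (j / 2)) y =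
      j * (φ y ^ (j - 1) * (ε + ‖P y‖ ^ 2) ^ (j / 2)) * coordPartial k φ y +
        j * (φ y ^ j * (ε + ‖P y‖ ^ 2) ^ (j / 2 - 1)) * inner ℝ (P y) (coordPartial k P y) := by
  have h1 := hφ.hasFDerivAt.rpow_const (p := j) (Or.inr (by linarith))
  have h2 : HasFDerivAt (fun z ↦ ε + ‖P z‖ ^ 2) (2 • (innerSL ℝ (P y)).comp (fderiv ℝ P y)) y :=
    (hP.hasFDerivAt.norm_sq).const_add ε
  have h3 := h2.rpow_const (p := j / 2) (Or.inr (by linarith))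
  have h4 := h1.mul h3
  have h5 : HasFDerivAt (fun z ↦ φ z ^ j * (ε + ‖P z‖ ^ 2) ^ (j / 2)) _ y := h4
  rw [coordPartial, h5.fderiv]
  simp only [add_apply, smul_apply, ContinuousLinearMap.comp_apply, innerSL_apply_apply,
    smul_eq_mul, nsmul_eq_mul, coordPartial]
  push_cast
  ring

lemma sq_frame_deriv_le {j l m x g w u s B : ℝ}
    (hw : |w| ≤ B) (hu : |u| * s ≤ x * g) (hs : 0 ≤ s) (e : ℝ) :
    (j * (l * e) * w + j * (m * s) * u) ^ 2 ≤
      2 * j ^ 2 * B ^ 2 * (l ^ 2 * e ^ 2) + 2 * j ^ 2 * (m ^ 2 * (x ^ 2 * g ^ 2)) := by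
  have h1 : w ^ 2 ≤ B ^ 2 := sq_le_sq' (by linarith [neg_abs_le w]) ((le_abs_self w).trans hw)
  have h2 : (u * s) ^ 2 ≤ (x * g) ^ 2 := by
    rw [← sq_abs (u * s), abs_mul, abs_of_nonneg hs]
    exact pow_le_pow_left₀ (by positivity) hu 2
  have h3 : (j * (l * e)) ^ 2 * w ^ 2 ≤ (j * (l * e)) ^ 2 * B ^ 2 := by gcongr
  have h4 : (j * m) ^ 2 * (u * s) ^ 2 ≤ (j * m) ^ 2 * (x * g) ^ 2 := by gcongr
  have h5 := add_sq_le (a := j * (l * e) * w) (b := j * (m * s) * u)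
  calc _ ≤ _ := h5
    _ = 2 * ((j * (l * e)) ^ 2 * w ^ 2 + (j * m) ^ 2 * (u * s) ^ 2) := by ring
    _ ≤ 2 * ((j * (l * e)) ^ 2 * B ^ 2 + (j * m) ^ 2 * (x * g) ^ 2) := by linarith
    _ = _ := by ring

/-- The local estimate in a small chart. -/
lemma local_estimate_chart (hn : 3 ≤ n) {U : Set (EuclideanSpace ℝ (Fin n))}
    {S σ : EuclideanSpace ℝ (Fin n) → Matrix (Fin n) (Fin n) ℝ}
    {γ : EuclideanSpace ℝ (Fin n) → ℝ} {y₀ : EuclideanSpace ℝ (Fin n)} (hU : IsOpen U)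
    (hy₀ : y₀ ∈ U) (hS : ∀ a i, ContDiffOn ℝ 1 (fun y ↦ S y a i) U)
    (hσc : ∀ a i, ContinuousOn (fun y ↦ σ y a i) U) (hσ : ∀ y ∈ U, σ y * S y = 1)
    (hγ : ContDiffOn ℝ 1 γ U) (hγS : ∀ y ∈ U, γ y = |(S y).det|⁻¹) (hγ0 : ∀ y ∈ U, 0 < γ y) :
    ∃ W ⊆ U, IsOpen W ∧ y₀ ∈ W ∧ ∀ (K : Set (EuclideanSpace ℝ (Fin n)))
      (φ : EuclideanSpace ℝ (Fin n) → ℝ), IsCompact K → K ⊆ W → ContDiff ℝ 1 φ →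
      (∀ y, 0 ≤ φ y) → (∀ y, φ y ≤ 1) → (∀ y ∉ K, φ y = 0) → ∀ β : ℝ, 0 ≤ β → ∀ j : ℝ, j = n - 1 + β →
      ∃ C : ℝ, 0 ≤ C ∧ ∀ h : EuclideanSpace ℝ (Fin n) → V, ContDiffOn ℝ 2 h U → ∀ ε, 0 ≤ ε →
      ∀ R : EuclideanSpace ℝ (Fin n) → V, ContinuousOn R U →
      (∀ y ∈ U, γ y • R y = ∑ i, coordPartial i (frameFlux S ε ((n : ℝ) / 2 - 1) γ h i) y) →
      (∫ y, γ y * (φ y ^ (2 * j * (n / (n - 2))) *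
          (ε + ‖frameGrad S h y‖ ^ 2) ^ (j * (n / (n - 2))))) ^ (((n : ℝ) - 2) / n) ≤
        divergenceConst hn β * (∫ y, γ y *
            (φ y ^ (2 * j) * (ε + ‖frameGrad S h y‖ ^ 2) ^ β * ‖R y‖ ^ 2)) +
          C * ∫ y, γ y * (φ y ^ (2 * j - 2) * (ε + ‖frameGrad S h y‖ ^ 2) ^ j) := by
  have hn3 : (3 : ℝ) ≤ n := by exact_mod_cast hn
  have hn2 : (0 : ℝ) < n - 2 := by linarith
  obtain ⟨W, hWU, hWo, hyW, hsob⟩ := (exists_sobolev_frame hn).choose_spec.2 U S σ γ y₀ hU hy₀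
    (fun a i ↦ (hS a i).continuousOn) hσc hγ.continuousOn hσ hγS hγ0
  refine ⟨W, hWU, hWo, hyW, ?_⟩
  intro K φ hK hKW hφ hφ0 hφ1 hφK β hβ j hj
  have hKU := hKW.trans hWU
  have hj2 : 2 ≤ j := by rw [hj]; linarith
  set κ : ℝ := (n : ℝ) / 2 - 1 with hκdef
  have hκ : 0 ≤ κ := by rw [hκdef]; linarith
  obtain ⟨C, hC, hso⟩ := second_order_integral (V := V) hU hK hKU hS hσc hσ hγ hγ0 hφ hφ0 hφ1 hφK
    (κ := κ) (β := β) (j := j) hκ hβ (by rw [hj, hκdef]; ring) (by linarith)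
  obtain ⟨B, hB, hBb⟩ := exists_bound_family hK (fun b y ↦ ∑ k, S y b k * coordPartial k φ y)
    fun b ↦ (continuousOn_finsetSum _ fun k _ ↦ (hS b k).continuousOn.mul
      ((continuousOn_coordPartial isOpen_univ hφ.contDiffOn k).mono (subset_univ U))).mono hKU
  set Cs := localSobolevConst hn with hCs
  have hCs0 : 0 ≤ Cs := localSobolevConst_nonneg hn
  -- The first summand comes from derivatives of the cutoff in the Sobolev gradient, the second from
  -- the lower order term of the second order estimate. Everything depending on the chart is placed
  -- here, not in the factor of the divergence.
  refine ⟨Cs * (n * (2 * j ^ 2 * B ^ 2) + 4 * j ^ 2 * C), by positivity, ?_⟩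
  intro h hh ε hε R hRc hR
  have hp1 := contDiffOn_frameGrad hU hS hh
  set e : EuclideanSpace ℝ (Fin n) → ℝ := fun y ↦ ε + ‖frameGrad S h y‖ ^ 2 with he
  have he0 : ∀ y, 0 ≤ e y := fun y ↦ by simp only [he]; positivity
  have he1 : ContDiffOn ℝ 1 e U := contDiffOn_const.add (hp1.norm_sq ℝ)
  have hcφ : ∀ τ : ℝ, 0 ≤ τ → ContinuousOn (fun y ↦ φ y ^ τ) K := fun τ hτ ↦
    (hφ.continuous.rpow_const fun _ ↦ Or.inr hτ).continuousOn
  have hce : ∀ τ : ℝ, 0 ≤ τ → ContinuousOn (fun y ↦ e y ^ τ) K := fun τ hτ ↦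
    (he1.continuousOn.mono hKU).rpow_const fun _ _ ↦ Or.inr hτ
  have hcγ : ContinuousOn γ K := hγ.continuousOn.mono hKU
  have hφz : ∀ τ : ℝ, 0 < τ → ∀ y ∉ K, φ y ^ τ = 0 := fun τ hτ y hy ↦ by
    rw [hφK y hy, Real.zero_rpow hτ.ne']
  -- Sobolev is applied to φ^j e^{j/2}. Its power 2n/(n-2) is the left side, and its squared
  -- gradient is bounded by φ^{2j} e^{j-1} times the squared second derivatives plus φ^{2j-2} e^j,
  -- since |p| ≤ e^{1/2}.
  set ψ : EuclideanSpace ℝ (Fin n) → ℝ := fun y ↦ φ y ^ j * e y ^ (j / 2) with hψ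
  have hψ0 : ∀ y ∉ K, ψ y = 0 := fun y hy ↦ by
    simp only [hψ, hφz j (by linarith) y hy, zero_mul]
  have hψ1 : ContDiff ℝ 1 ψ := by
    refine contDiff_of_compact_subset hU hK hKU ?_ hψ0
    exact ((hφ.rpow_const_of_le (m := 1) (by push_cast; linarith)).contDiffOn).mul
      (he1.rpow_const_of_le (m := 1) (by push_cast; linarith))
  have hs := hsob K ψ hK hKW hψ1 hψ0
  have hpow : ∀ y, |ψ y| ^ (2 * (n : ℝ) / (n - 2)) =
      φ y ^ (2 * j * (n / (n - 2))) * e y ^ (j * (n / (n - 2))) := fun y ↦ by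
    have a1 : 0 ≤ φ y ^ j := Real.rpow_nonneg (hφ0 y) _
    have a2 : 0 ≤ e y ^ (j / 2) := Real.rpow_nonneg (he0 y) _
    rw [hψ, abs_of_nonneg (mul_nonneg a1 a2), Real.mul_rpow a1 a2, ← Real.rpow_mul (hφ0 y),
      ← Real.rpow_mul (he0 y)]
    congr 2 <;> ring
  simp only [hpow] at hs
  refine hs.trans ?_
  have iA : Integrable fun y ↦ γ y * (φ y ^ (2 * j) * e y ^ (j - 1) * frameHessSq S h y) :=
    integrable_of_continuousOn_compact hK (hcγ.mul (((hcφ _ (by linarith)).mul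
      (hce _ (by linarith))).mul ((continuousOn_frameHessSq hU hS hp1).mono hKU)))
      fun y hy ↦ by rw [hφz _ (by linarith) y hy]; ring
  have iC : Integrable fun y ↦ γ y * (φ y ^ (2 * j - 2) * e y ^ (j - 1) *
      ‖frameGrad S h y‖ ^ 2) :=
    integrable_of_continuousOn_compact hK (hcγ.mul (((hcφ _ (by linarith)).mul
      (hce _ (by linarith))).mul ((hp1.continuousOn.mono hKU).norm.pow 2)))
      fun y hy ↦ by rw [hφz _ (by linarith) y hy]; ring
  have iD : Integrable fun y ↦ γ y * (φ y ^ (2 * j - 2) * e y ^ j) :=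
    integrable_of_continuousOn_compact hK (hcγ.mul ((hcφ _ (by linarith)).mul
      (hce _ (by linarith)))) fun y hy ↦ by rw [hφz _ (by linarith) y hy]; ring
  have hdψ0 : ∀ k, ∀ y ∉ K, coordPartial k ψ y = 0 := fun k y hy ↦ by
    have : ψ =ᶠ[𝓝 y] fun _ ↦ 0 := by
      filter_upwards [hK.isClosed.isOpen_compl.mem_nhds hy] with z hz using hψ0 z hz
    rw [coordPartial_eventuallyEq this]; simp [coordPartial]
  have iE : Integrable fun y ↦ γ y * ∑ b, (∑ k, S y b k * coordPartial k ψ y) ^ 2 :=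
    integrable_of_continuousOn_compact hK (hcγ.mul (continuousOn_finsetSum _ fun b _ ↦
      (continuousOn_finsetSum _ fun k _ ↦ ((hS b k).continuousOn.mono hKU).mul
        ((continuousOn_coordPartial isOpen_univ hψ1.contDiffOn k).mono (subset_univ K))).pow 2))
      fun y hy ↦ by simp [hdψ0 _ y hy]
  have hgrad : ∫ y, γ y * ∑ b, (∑ k, S y b k * coordPartial k ψ y) ^ 2 ≤
      (n * (2 * j ^ 2 * B ^ 2)) * (∫ y, γ y * (φ y ^ (2 * j - 2) * e y ^ j)) +
        2 * j ^ 2 * ∫ y, γ y * (φ y ^ (2 * j) * e y ^ (j - 1) * frameHessSq S h y) := by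
    rw [← integral_const_mul, ← integral_const_mul, ← integral_add (iD.const_mul _) (iA.const_mul _)]
    refine integral_mono iE ((iD.const_mul _).add (iA.const_mul _)) fun y ↦ ?_
    by_cases hy : y ∈ K
    · have hyU := hKU hy
      have hpd := differentiableAt_of_contDiffOn hU hp1 hyU
      have h1 : ∀ b, ∑ k, S y b k * coordPartial k ψ y =
          j * (φ y ^ (j - 1) * e y ^ (j / 2)) * (∑ k, S y b k * coordPartial k φ y) +
          j * (φ y ^ j * e y ^ (j / 2 - 1)) * inner ℝ (frameGrad S h y)
            (∑ k, S y b k • coordPartial k (frameGrad S h) y) := fun b ↦ by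
        simp only [inner_sum, real_inner_smul_right, Finset.mul_sum, ← Finset.sum_add_distrib]
        refine Finset.sum_congr rfl fun k _ ↦ ?_
        rw [hψ, coordPartial_cutoff_energy (hφ.differentiable (by simp) y) hpd hj2]
        ring
      have h2 : ∀ b, (∑ k, S y b k * coordPartial k ψ y) ^ 2 ≤
          2 * j ^ 2 * B ^ 2 * ((φ y ^ (j - 1)) ^ 2 * (e y ^ (j / 2)) ^ 2) +
          2 * j ^ 2 * ((φ y ^ j) ^ 2 * ((e y ^ ((j - 1) / 2)) ^ 2 *
            ‖∑ k, S y b k • coordPartial k (frameGrad S h) y‖ ^ 2)) := fun b ↦ by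
        rw [h1 b]
        refine sq_frame_deriv_le (hBb b y hy) ?_
          (Real.rpow_nonneg (he0 y) _) _
        have h3 : ‖frameGrad S h y‖ ≤ e y ^ (1 / 2 : ℝ) := by
          rw [← Real.sqrt_eq_rpow]
          exact Real.le_sqrt_of_sq_le (by simp only [he]; linarith)
        have h4 : e y ^ (1 / 2 : ℝ) * e y ^ (j / 2 - 1) = e y ^ ((j - 1) / 2) := by
          rw [← Real.rpow_add_of_nonneg (he0 y) (by norm_num) (by linarith)]
          congr 1; ring
        calc _ ≤ (e y ^ (1 / 2 : ℝ) * ‖∑ k, S y b k • coordPartial k (frameGrad S h) y‖) *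
              e y ^ (j / 2 - 1) := by
              refine mul_le_mul_of_nonneg_right ((abs_real_inner_le_norm _ _).trans ?_)
                (Real.rpow_nonneg (he0 y) _)
              gcongr
          _ = _ := by rw [← h4]; ring
      have e1 : (φ y ^ (j - 1)) ^ 2 = φ y ^ (2 * j - 2) := by
        rw [← Real.rpow_natCast, ← Real.rpow_mul (hφ0 y)]; congr 1; push_cast; ring
      have e2 : (φ y ^ j) ^ 2 = φ y ^ (2 * j) := by
        rw [← Real.rpow_natCast, ← Real.rpow_mul (hφ0 y)]; congr 1; push_cast; ring
      have e3 : (e y ^ (j / 2)) ^ 2 = e y ^ j := by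
        rw [← Real.rpow_natCast, ← Real.rpow_mul (he0 y)]; congr 1; push_cast; ring
      have e4 : (e y ^ ((j - 1) / 2)) ^ 2 = e y ^ (j - 1) := by
        rw [← Real.rpow_natCast, ← Real.rpow_mul (he0 y)]; congr 1; push_cast; ring
      rw [e1, e2, e3, e4] at h2
      have h5 := Finset.sum_le_sum fun b (_ : b ∈ Finset.univ) ↦ h2 b
      rw [Finset.sum_add_distrib, Finset.sum_const, Finset.card_univ, Fintype.card_fin,
        nsmul_eq_mul, ← Finset.mul_sum, ← Finset.mul_sum, ← Finset.mul_sum] at h5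
      refine (mul_le_mul_of_nonneg_left h5 (hγ0 y hyU).le).trans (le_of_eq ?_)
      simp only [frameHessSq]
      ring
    · have z1 := hφz (2 * j - 2) (by linarith) y hy
      have z2 := hφz (2 * j) (by linarith) y hy
      simp [hdψ0 _ y hy, z1, z2]
  have hCD : ∫ y, γ y * (φ y ^ (2 * j - 2) * e y ^ (j - 1) * ‖frameGrad S h y‖ ^ 2) ≤
      ∫ y, γ y * (φ y ^ (2 * j - 2) * e y ^ j) := by
    refine integral_mono iC iD fun y ↦ ?_
    by_cases hy : y ∈ K
    · have h3 : ‖frameGrad S h y‖ ^ 2 ≤ e y := by simp only [he]; linarith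
      have h4 : e y ^ (j - 1) * e y = e y ^ j := by
        rw [← Real.rpow_add_one' (he0 y) (by linarith)]; congr 1; ring
      refine mul_le_mul_of_nonneg_left ?_ (hγ0 y (hKU hy)).le
      rw [mul_assoc, ← h4]
      have := Real.rpow_nonneg (he0 y) (j - 1)
      have := Real.rpow_nonneg (hφ0 y) (2 * j - 2)
      gcongr
    · have z1 := hφz (2 * j - 2) (by linarith) y hy
      simp [z1]
  have hfin := hso h hh ε hε R hRc hR
  have hDC : divergenceConst hn β = Cs * (4 * j ^ 2 * ((n * (1 + 2 * (κ + β))) ^ 2 + 1)) := by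
    rw [divergenceConst, hj]
  change 1 / 2 * ∫ y, γ y * (φ y ^ (2 * j) * e y ^ (j - 1) * frameHessSq S h y) ≤
    ((n * (1 + 2 * (κ + β))) ^ 2 + 1) * (∫ y, γ y * (φ y ^ (2 * j) * e y ^ β * ‖R y‖ ^ 2)) +
      C * ∫ y, γ y * (φ y ^ (2 * j - 2) * e y ^ (j - 1) * ‖frameGrad S h y‖ ^ 2) at hfin
  rw [hDC]
  set IA := ∫ y, γ y * (φ y ^ (2 * j) * e y ^ (j - 1) * frameHessSq S h y)
  set IB := ∫ y, γ y * (φ y ^ (2 * j) * e y ^ β * ‖R y‖ ^ 2)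
  set IC := ∫ y, γ y * (φ y ^ (2 * j - 2) * e y ^ (j - 1) * ‖frameGrad S h y‖ ^ 2)
  set ID := ∫ y, γ y * (φ y ^ (2 * j - 2) * e y ^ j)
  have f1 : IA ≤ 2 * (((n * (1 + 2 * (κ + β))) ^ 2 + 1) * IB + C * ID) := by
    have := mul_le_mul_of_nonneg_left hCD hC
    linarith
  have f2 : 2 * j ^ 2 * IA ≤ 2 * j ^ 2 * (2 * (((n * (1 + 2 * (κ + β))) ^ 2 + 1) * IB + C * ID)) := by
    gcongr
  refine (mul_le_mul_of_nonneg_left (hgrad.trans (add_le_add_right f2 _)) hCs0).trans (le_of_eq ?_)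
  ring

end LocalChart

/-! ### Transfer of the local estimate to M. -/

section LocalManifold

variable {n L : ℕ} {M : Type*} [EMetricSpace M] [ChartedSpace (EuclideanSpace ℝ (Fin n)) M]
  [RiemannianBundle (fun x : M ↦ TangentSpace (𝓡 n) x)] [IsManifold (𝓡 n) ∞ M]
  [IsContMDiffRiemannianBundle (𝓡 n) ∞ (EuclideanSpace ℝ (Fin n))
          (fun x : M ↦ TangentSpace (𝓡 n) x)]

lemma ChartReg.contDiffOn_fluxChart {f : M → EuclideanSpace ℝ (Fin L)} (hf : ChartReg n 2 f)
    {ε κ : ℝ} (hε : 0 ≤ ε) (hκ : 0 ≤ κ) (c : M) (i : Fin n) :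
    ContDiffOn ℝ 1 (fluxChart c ε κ f i) (chartTarget n c) := by
  obtain ⟨S, hS, hSo⟩ := exists_orthoFrame (n := n) c
  have hS1 : ∀ a i, ContDiffOn ℝ 1 (fun y ↦ S y a i) (chartTarget n c) := fun a i ↦
    (hS a i).of_le (by simp)
  exact (contDiffOn_frameFlux hε hκ ((contDiffOn_volDensity c).of_le (by simp)) hS1
    (contDiffOn_frameGrad (isOpen_chartTarget c) hS1 (hf c)) i).congr fun y hy ↦
    fluxChart_eq_frame (hSo y hy) ε κ f i

variable [MeasurableSpace M] [BorelSpace M] [CompactSpace M]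

lemma ChartReg.continuous_regNLaplacian {f : M → EuclideanSpace ℝ (Fin L)} (hf : ChartReg n 2 f)
    {ε : ℝ} (hε : 0 ≤ ε) (hn : 2 ≤ n) : Continuous (regNLaplacian n ε f) := by
  have h2 : (2 : ℝ) ≤ n := by exact_mod_cast hn
  exact _root_.continuous_regNLaplacian (hf.of_le (by norm_num)) hn fun c i ↦
    hf.contDiffOn_fluxChart hε (by linarith) c i

lemma volDensity_smul_regNLaplacian {f : M → EuclideanSpace ℝ (Fin L)} (hf : ChartReg n 2 f)
    {ε : ℝ} (hε : 0 ≤ ε) (hn : 2 ≤ n) {c : M} {y : EuclideanSpace ℝ (Fin n)}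
    (hy : y ∈ chartTarget n c) :
    volDensity c y • inChart (regNLaplacian n ε f) c y =
      ∑ i, coordPartial i (fluxChart c ε ((n : ℝ) / 2 - 1) f i) y := by
  have h2 : (2 : ℝ) ≤ n := by exact_mod_cast hn
  have h1 : inChart (regNLaplacian n ε f) c y =
      divChart (n := n) c ε ((n : ℝ) / 2 - 1) f ((extChartAt (𝓡 n) c).symm y) :=
    divChart_eq (hf.of_le (by norm_num)) (by linarith)
      (fun c i ↦ hf.contDiffOn_fluxChart hε (by linarith) c i) (mem_extChartAt_source _)
      ((extChartAt (𝓡 n) c).map_target hy)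
  rw [h1, divChart]
  simp only [coords, (extChartAt (𝓡 n) c).right_inv hy]
  rw [smul_inv_smul₀ (volDensity_pos hy).ne']

lemma integral_eq_integral_chart {F : M → ℝ} (hF : Continuous F) {c : M}
    (h0 : ∀ x ∉ chartSource n c, F x = 0) {G : EuclideanSpace ℝ (Fin n) → ℝ}
    (hG : ∀ y ∈ chartTarget n c, G y = volDensity c y * inChart F c y)
    (hG0 : ∀ y ∉ chartTarget n c, G y = 0) :
    ∫ x, F x ∂(riemannianVolume n M) = ∫ y, G y := by
  rw [← setIntegral_eq_integral_of_forall_compl_eq_zero h0,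
    setIntegral_chartSource c hF.aestronglyMeasurable,
    ← setIntegral_eq_integral_of_forall_compl_eq_zero hG0]
  exact setIntegral_congr_fun (measurableSet_chartTarget c) fun y hy ↦ (hG y hy).symm

variable (L) in
/-- The local estimate: near every point of `M` a high power of the energy density is bounded by
the regularized `n`-Laplacian and lower powers. -/
lemma exists_local_estimate (hn : 3 ≤ n) (c : M) :
    ∃ O : Set M, IsOpen O ∧ c ∈ O ∧ ∀ η : M → ℝ, ContMDiff (𝓡 n) 𝓘(ℝ, ℝ) ∞ η →
      (∀ x, 0 ≤ η x) → (∀ x, η x ≤ 1) → tsupport η ⊆ O → ∀ β : ℝ, 0 ≤ β → ∀ j : ℝ,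
      j = n - 1 + β → ∃ C : ℝ, 0 ≤ C ∧ ∀ f : M → EuclideanSpace ℝ (Fin L), ChartReg n 2 f →
      ∀ ε, 0 ≤ ε →
      (∫ x, η x ^ (2 * j * (n / (n - 2))) * e2 n ε f x ^ (j * (n / (n - 2)))
          ∂(riemannianVolume n M)) ^ (((n : ℝ) - 2) / n) ≤
        divergenceConst hn β * (∫ x, η x ^ (2 * j) * e2 n ε f x ^ β * ‖regNLaplacian n ε f x‖ ^ 2
          ∂(riemannianVolume n M)) +
        C * ∫ x, η x ^ (2 * j - 2) * e2 n ε f x ^ j ∂(riemannianVolume n M) := by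
  have hn3 : (3 : ℝ) ≤ n := by exact_mod_cast hn
  have hn2 : (0 : ℝ) < n - 2 := by linarith
  obtain ⟨S, hS, hSo⟩ := exists_orthoFrame (n := n) c
  set U := chartTarget n c with hUdef
  have hU : IsOpen U := isOpen_chartTarget c
  have hS1 : ∀ a i, ContDiffOn ℝ 1 (fun y ↦ S y a i) U := fun a i ↦ (hS a i).of_le (by simp)
  -- The inverse of an orthonormal frame matrix S is gSᵀ, which is visibly continuous.
  have hσc : ∀ a i, ContinuousOn (fun y ↦ (metricMatrix c y * (S y).transpose) a i) U := by
    intro a i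
    simp only [Matrix.mul_apply, Matrix.transpose_apply]
    exact continuousOn_finsetSum _ fun k _ ↦
      (contDiffOn_metricMatrix c a k).continuousOn.mul (hS i k).continuousOn
  have hσ : ∀ y ∈ U, metricMatrix c y * (S y).transpose * S y = 1 := fun y hy ↦ by
    refine mul_eq_one_comm.1 ?_
    rw [← Matrix.mul_assoc]
    exact hSo y hy
  have hγ : ContDiffOn ℝ 1 (volDensity (n := n) c) U := (contDiffOn_volDensity c).of_le (by simp)
  obtain ⟨W, hWU, hWo, hcW, hW⟩ := local_estimate_chart (V := EuclideanSpace ℝ (Fin L)) hn hU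
    (mem_extChartAt_target (I := 𝓡 n) c) hS1 hσc hσ hγ (fun y hy ↦ (hSo y hy).volDensity_eq)
    fun y hy ↦ volDensity_pos hy
  have hO : IsOpen (chartSource n c ∩ coords n c ⁻¹' W) :=
    (continuousOn_extChartAt c).isOpen_inter_preimage (isOpen_chartSource c) hWo
  refine ⟨_, hO, ⟨mem_extChartAt_source c, hcW⟩, ?_⟩
  intro η hη hη0 hη1 hηs β hβ j hj
  have hηsrc : tsupport η ⊆ chartSource n c := hηs.trans inter_subset_left
  set K : Set (EuclideanSpace ℝ (Fin n)) := coords n c '' tsupport η with hKdef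
  have hK : IsCompact K := (isClosed_tsupport η).isCompact.image_of_continuousOn
    ((continuousOn_extChartAt c).mono hηsrc)
  have hKW : K ⊆ W := by
    rintro _ ⟨x, hx, rfl⟩
    exact (hηs hx).2
  have hKU : K ⊆ U := hKW.trans hWU
  set φ : EuclideanSpace ℝ (Fin n) → ℝ := U.indicator (inChart η c) with hφdef
  have hφeq : ∀ y ∈ U, φ y = inChart η c y := fun y hy ↦ indicator_of_mem hy _
  have hφU : ∀ y ∉ U, φ y = 0 := fun y hy ↦ indicator_of_notMem hy _
  have hφK : ∀ y ∉ K, φ y = 0 := by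
    intro y hy
    by_cases hyt : y ∈ U
    · rw [hφeq y hyt]
      refine image_eq_zero_of_notMem_tsupport (f := η) fun h ↦ hy ⟨_, h, ?_⟩
      exact (extChartAt (𝓡 n) c).right_inv hyt
    · exact hφU y hyt
  have hφ1 : ContDiff ℝ 1 φ := contDiff_of_compact_subset hU hK hKU
    ((((chartReg_of_contMDiff le_rfl hη).of_le (by simp)) c).congr hφeq) hφK
  have hφnn : ∀ y, 0 ≤ φ y := fun y ↦ indicator_nonneg (fun _ _ ↦ hη0 _) y
  have hφle : ∀ y, φ y ≤ 1 := fun y ↦ by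
    by_cases hy : y ∈ U
    · rw [hφeq y hy]; exact hη1 _
    · rw [hφU y hy]; exact zero_le_one
  obtain ⟨C, hC, hmain⟩ := hW K φ hK hKW hφ1 hφnn hφle hφK β hβ j hj
  refine ⟨C, hC, fun f hf ε hε ↦ ?_⟩
  have hj2 : 2 ≤ j := by rw [hj]; linarith
  have hRc := hf.continuous_regNLaplacian hε (by omega)
  have hη0' : ∀ x ∉ chartSource n c, η x = 0 := fun x hx ↦
    image_eq_zero_of_notMem_tsupport fun h ↦ hx (hηsrc h)
  have he2 : ∀ y ∈ U, inChart (e2 n ε f) c y = ε + ‖frameGrad S (inChart f c) y‖ ^ 2 :=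
    fun y hy ↦ by
      rw [e2_inChart (hf.of_le (by norm_num)) ε hy, e2Chart_eq_frame (hSo y hy)]
  have hcη : ∀ τ : ℝ, 0 ≤ τ → Continuous fun x ↦ η x ^ τ := fun τ hτ ↦
    hη.continuous.rpow_const fun _ ↦ Or.inr hτ
  have hce : ∀ τ : ℝ, 0 ≤ τ → Continuous fun x ↦ e2 n ε f x ^ τ := fun τ hτ ↦
    continuous_e2_rpow (hf.of_le (by norm_num)) ε hτ
  have hν : (0 : ℝ) < j * (n / (n - 2)) := by positivity
  have hν2 : (0 : ℝ) < 2 * j * (n / (n - 2)) := by positivity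
  have hmain' := hmain (inChart f c) (hf c) ε hε (inChart (regNLaplacian n ε f) c)
    (hRc.comp_continuousOn (continuousOn_extChartAt_symm c)) fun y hy ↦ by
      rw [volDensity_smul_regNLaplacian hf hε (by omega) hy]
      refine Finset.sum_congr rfl fun i _ ↦ coordPartial_eventuallyEq ?_ i
      filter_upwards [hU.mem_nhds hy] with z hz
      exact fluxChart_eq_frame (hSo z hz) ε _ f i
  have h1 : ∫ x, η x ^ (2 * j * (n / (n - 2))) * e2 n ε f x ^ (j * (n / (n - 2)))
      ∂(riemannianVolume n M) = ∫ y, volDensity c y * (φ y ^ (2 * j * (n / (n - 2))) *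
          (ε + ‖frameGrad S (inChart f c) y‖ ^ 2) ^ (j * (n / (n - 2)))) := by
    have hF : Continuous fun x ↦ η x ^ (2 * j * (n / (n - 2))) *
        e2 n ε f x ^ (j * (n / (n - 2))) := (hcη _ hν2.le).mul (hce _ hν.le)
    refine integral_eq_integral_chart hF (c := c)
      (fun x hx ↦ by rw [hη0' x hx, Real.zero_rpow hν2.ne', zero_mul]) (fun y hy ↦ ?_)
      fun y hy ↦ by rw [hφU y hy, Real.zero_rpow hν2.ne']; ring
    rw [hφeq y hy, ← he2 y hy]
    rfl
  have h2 : ∫ x, η x ^ (2 * j) * e2 n ε f x ^ β * ‖regNLaplacian n ε f x‖ ^ 2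
      ∂(riemannianVolume n M) = ∫ y, volDensity c y * (φ y ^ (2 * j) *
          (ε + ‖frameGrad S (inChart f c) y‖ ^ 2) ^ β *
          ‖inChart (regNLaplacian n ε f) c y‖ ^ 2) := by
    have hF : Continuous fun x ↦ η x ^ (2 * j) * _root_.e2 n ε f x ^ β *
        ‖regNLaplacian n ε f x‖ ^ 2 :=
      ((hcη _ (by linarith)).mul (hce _ hβ)).mul (hRc.norm.pow 2)
    refine integral_eq_integral_chart hF (c := c)
      (fun x hx ↦ by rw [hη0' x hx, Real.zero_rpow (by linarith)]; ring) (fun y hy ↦ ?_)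
      fun y hy ↦ by rw [hφU y hy, Real.zero_rpow (by linarith)]; ring
    rw [hφeq y hy, ← he2 y hy]
    rfl
  have h3 : ∫ x, η x ^ (2 * j - 2) * _root_.e2 n ε f x ^ j ∂(riemannianVolume n M) =
      ∫ y, volDensity c y * (φ y ^ (2 * j - 2) *
          (ε + ‖frameGrad S (inChart f c) y‖ ^ 2) ^ j) := by
    have hF : Continuous fun x ↦ η x ^ (2 * j - 2) * _root_.e2 n ε f x ^ j :=
      (hcη _ (by linarith)).mul (hce _ (by linarith))
    refine integral_eq_integral_chart hF (c := c)
      (fun x hx ↦ by rw [hη0' x hx, Real.zero_rpow (by linarith)]; ring) (fun y hy ↦ ?_)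
      fun y hy ↦ by rw [hφU y hy, Real.zero_rpow (by linarith)]; ring
    rw [hφeq y hy, ← he2 y hy]
    rfl
  rw [h1, h2, h3]
  exact hmain'

end LocalManifold

/-! ### Absorbing the velocity term and the critical term. -/

section Absorption

variable {M : Type*} [EMetricSpace M] [MeasurableSpace M] [BorelSpace M] [CompactSpace M]
  {n : ℕ} {μ : Measure M} [IsFiniteMeasure μ]

lemma integrable_of_continuous' {F : M → ℝ} (hF : Continuous F) : Integrable F μ :=
  hF.integrable_of_hasCompactSupport (HasCompactSupport.of_compactSpace F)

lemma integral_mul_le_holder (hn : 3 ≤ n) (μ : Measure M) [IsFiniteMeasure μ] {F G : M → ℝ}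
    (hF : Continuous F) (hG : Continuous G) (hF0 : ∀ x, 0 ≤ F x) (hG0 : ∀ x, 0 ≤ G x) :
    ∫ x, F x * G x ∂μ ≤ (∫ x, F x ^ ((n : ℝ) / 2) ∂μ) ^ (2 / (n : ℝ)) *
      (∫ x, G x ^ ((n : ℝ) / (n - 2)) ∂μ) ^ (((n : ℝ) - 2) / n) := by
  have hn3 : (3 : ℝ) ≤ n := by exact_mod_cast hn
  have hn2 : (0 : ℝ) < n - 2 := by linarith
  have hpq : ((n : ℝ) / 2).HolderConjugate ((n : ℝ) / (n - 2)) := by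
    rw [Real.holderConjugate_iff]
    refine ⟨by linarith, ?_⟩
    field_simp
    ring
  have hmem : ∀ {H : M → ℝ} (p : ENNReal), Continuous H → MemLp H p μ := fun p hH ↦
    hH.memLp_of_hasCompactSupport (HasCompactSupport.of_compactSpace _)
  have := integral_mul_le_Lp_mul_Lq_of_nonneg hpq (μ := μ) (Eventually.of_forall hF0)
    (Eventually.of_forall hG0) (hmem _ hF) (hmem _ hG)
  rwa [one_div_div, one_div_div] at this

lemma young_weighted {a y δ α₁ α₂ : ℝ} (ha : 0 ≤ a) (hy : 0 ≤ y) (hδ : 0 < δ) (h₁ : 0 ≤ α₁)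
    (h₂ : 0 < α₂) (h : α₁ + α₂ = 1) :
    a ^ α₁ * y ^ α₂ ≤ δ * a + δ ^ (-(α₁ / α₂)) * y := by
  have hd : 0 < δ ^ (-(α₁ / α₂)) := Real.rpow_pos_of_pos hδ _
  have h1 := Real.geom_mean_le_arith_mean2_weighted h₁ h₂.le (mul_nonneg hδ.le ha)
    (mul_nonneg hd.le hy) h
  have h2 : (δ * a) ^ α₁ * (δ ^ (-(α₁ / α₂)) * y) ^ α₂ = a ^ α₁ * y ^ α₂ := by
    rw [Real.mul_rpow hδ.le ha, Real.mul_rpow hd.le hy, ← Real.rpow_mul hδ.le]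
    have h3 : δ ^ α₁ * δ ^ (-(α₁ / α₂) * α₂) = 1 := by
      rw [← Real.rpow_add hδ, neg_mul, div_mul_cancel₀ _ h₂.ne', add_neg_cancel, Real.rpow_zero]
    linear_combination a ^ α₁ * y ^ α₂ * h3
  rw [h2] at h1
  refine h1.trans (add_le_add ?_ ?_)
  · exact mul_le_of_le_one_left (mul_nonneg hδ.le ha) (by linarith)
  · exact mul_le_of_le_one_left (mul_nonneg hd.le hy) (by linarith)

/-- For a ≥ 1/δ the factor δa is at least 1, which gives the first term; for a ≤ 1/δ the second term
suffices. -/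
lemma rpow_sub_one_le {a δ j : ℝ} (ha : 0 ≤ a) (hδ : 0 < δ) (hj : 1 < j) :
    a ^ (j - 1) ≤ δ * a ^ j + δ ^ (1 - j) := by
  rcases le_total (1 / δ) a with h | h
  · have h1 : a ^ j = a ^ (j - 1) * a := by
      rw [← Real.rpow_add_one' ha (by linarith)]; congr 1; ring
    have h2 : 1 ≤ δ * a := by rwa [div_le_iff₀' hδ] at h
    have h3 : 0 ≤ a ^ (j - 1) := Real.rpow_nonneg ha _
    have h4 : 0 ≤ δ ^ (1 - j) := by positivity
    rw [h1]
    nlinarith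
  · have h1 : a ^ (j - 1) ≤ (1 / δ) ^ (j - 1) := Real.rpow_le_rpow ha h (by linarith)
    have h2 : (1 / δ) ^ (j - 1) = δ ^ (1 - j) := by
      rw [one_div, Real.inv_rpow hδ.le, ← Real.rpow_neg hδ.le]; congr 1; ring
    have h3 : 0 ≤ δ * a ^ j := by positivity
    linarith

lemma le_of_rpow_le {X Y c d θ ν : ℝ} (hX : 0 ≤ X) (hY : 0 ≤ Y) (hc : 0 ≤ c) (hd : 0 ≤ d)
    (hθ : 0 < θ) (hν : 0 < ν) (hθν : θ * ν = 1) (h : X ^ θ ≤ c * Y ^ θ + d) :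
    X ≤ (2 * (c + d)) ^ ν * (1 + Y) := by
  have h1 : Y ^ θ ≤ (1 + Y) ^ θ := Real.rpow_le_rpow hY (by linarith) hθ.le
  have h2 : 1 ≤ (1 + Y) ^ θ := Real.one_le_rpow (by linarith) hθ.le
  have h3 : X ^ θ ≤ 2 * (c + d) * (1 + Y) ^ θ := by
    have := mul_le_mul_of_nonneg_left h1 hc
    have := mul_le_mul_of_nonneg_left h2 hd
    have : 0 ≤ (c + d) * (1 + Y) ^ θ := by positivity
    linarith
  have h4 := Real.rpow_le_rpow (by positivity) h3 hν.le
  rwa [← Real.rpow_mul hX, hθν, Real.rpow_one, Real.mul_rpow (by positivity) (by positivity),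
    ← Real.rpow_mul (by positivity), hθν, Real.rpow_one] at h4

/-- Absorption: the local estimate bounds a high power of the energy density by a power of the
conformal factor, provided that the critical term can be absorbed. -/
lemma energy_le_of_absorb (hn : 3 ≤ n) {β j K₁ C C_N B s A D : ℝ} (hβ : 0 ≤ β)
    (hj : j = n - 1 + β) (hK₁ : 0 ≤ K₁) (hC : 0 ≤ C) (hB : 0 ≤ B) (hA : 0 ≤ A) (hD : 0 ≤ D)
    (hs : (2 * K₁ * C_N ^ 2 + 1) * s ≤ 1 / 4) (μ : Measure M) [IsFiniteMeasure μ] :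
    ∃ C' : ℝ, 0 ≤ C' ∧ ∀ η e w g R : M → ℝ, Continuous η → Continuous e → Continuous w →
      Continuous g → Continuous R → (∀ x, 0 ≤ η x) → (∀ x, 0 ≤ e x) → (∀ x, 0 < w x) →
      (∀ x, 0 ≤ g x) → (∀ x, R x ^ 2 ≤ 2 * w x ^ 2 * g x ^ 2 + 2 * C_N ^ 2 * e x ^ (n : ℝ)) →
      ∫ x, w x * g x ^ n ∂μ ≤ B → ∫ x, e x ∂μ ≤ D →
      ∫ x, η x ^ (2 * j) * e x ^ (j + 1) ∂μ ≤ s * (∫ x, η x ^ (2 * j * (n / (n - 2))) *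
        e x ^ (j * (n / (n - 2))) ∂μ) ^ (((n : ℝ) - 2) / n) + A →
      (∫ x, η x ^ (2 * j * (n / (n - 2))) * e x ^ (j * (n / (n - 2))) ∂μ) ^ (((n : ℝ) - 2) / n) ≤
        K₁ * (∫ x, η x ^ (2 * j) * e x ^ β * R x ^ 2 ∂μ) +
          C * ∫ x, η x ^ (2 * j - 2) * e x ^ j ∂μ →
      ∫ x, η x ^ (2 * j * (n / (n - 2))) * e x ^ (j * (n / (n - 2))) ∂μ ≤
        C' * (1 + ∫ x, η x ^ (2 * j * (n / (n - 2))) * w x ^ (2 * j / (n - 2)) ∂μ) := by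
  have hn3 : (3 : ℝ) ≤ n := by exact_mod_cast hn
  have hn2 : (0 : ℝ) < n - 2 := by linarith
  have hj2 : 2 ≤ j := by rw [hj]; linarith
  set ν : ℝ := n / (n - 2) with hν
  set θ : ℝ := ((n : ℝ) - 2) / n with hθ
  have hν0 : 0 < ν := by positivity
  have hθ0 : 0 < θ := by positivity
  have hθ1 : θ ≤ 1 := by rw [hθ, div_le_one (by linarith)]; linarith
  have hθν : θ * ν = 1 := by rw [hν, hθ]; field_simp
  -- Chosen so that the velocity term costs at most a quarter of X^θ; the hypothesis on s lets the
  -- critical term cost another quarter. The power ν below undoes the later power θ = 1/ν.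
  set δ₀ : ℝ := 1 / (4 * (2 * K₁ * B ^ (2 / (n : ℝ)) + 1)) with hδ₀
  have hδ₀0 : 0 < δ₀ := by positivity
  have hδ₀1 : 2 * K₁ * B ^ (2 / (n : ℝ)) * δ₀ ≤ 1 / 4 := by
    rw [hδ₀, mul_one_div, div_le_div_iff₀ (by positivity) (by norm_num)]
    nlinarith [Real.rpow_nonneg hB (2 / (n : ℝ))]
  set δ := δ₀ ^ ν with hδ
  have hδ0 : 0 < δ := Real.rpow_pos_of_pos hδ₀0 _
  have hδθ : δ ^ θ = δ₀ := by
    rw [hδ, ← Real.rpow_mul hδ₀0.le, mul_comm, hθν, Real.rpow_one]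
  set cδ := δ ^ (-((β / j) / ((n - 1) / j))) with hcδ
  have hcδ0 : 0 ≤ cδ := (Real.rpow_pos_of_pos hδ0 _).le
  set c₄ := 2 * K₁ * B ^ (2 / (n : ℝ)) * cδ ^ θ with hc₄
  set c₃ := C * ((1 / (C + 1)) ^ (1 - j) * D) with hc₃
  have hc₃0 : 0 ≤ c₃ := by positivity
  have hc₄0 : 0 ≤ c₄ := by positivity
  set c₅ := (2 * K₁ * C_N ^ 2 + 1) * A + c₃ with hc₅
  have hc₅0 : 0 ≤ c₅ := by positivity
  refine ⟨(2 * (2 * c₄ + 2 * c₅)) ^ ν, by positivity, ?_⟩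
  intro η e w g R hη he hw hg hR hη0 he0 hw0 hg0 hRb hwB heD hZ hmain
  set X := ∫ x, η x ^ (2 * j * ν) * e x ^ (j * ν) ∂μ with hX
  set Y := ∫ x, η x ^ (2 * j * ν) * w x ^ (2 * j / (n - 2)) ∂μ with hY
  set Z := ∫ x, η x ^ (2 * j) * e x ^ (j + 1) ∂μ with hZdef
  have hX0 : 0 ≤ X := integral_nonneg fun x ↦
    mul_nonneg (Real.rpow_nonneg (hη0 x) _) (Real.rpow_nonneg (he0 x) _)
  have hY0 : 0 ≤ Y := integral_nonneg fun x ↦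
    mul_nonneg (Real.rpow_nonneg (hη0 x) _) (Real.rpow_nonneg (hw0 x).le _)
  have hcη : ∀ τ : ℝ, 0 ≤ τ → Continuous fun x ↦ η x ^ τ := fun τ hτ ↦
    hη.rpow_const fun _ ↦ Or.inr hτ
  have hce : ∀ τ : ℝ, 0 ≤ τ → Continuous fun x ↦ e x ^ τ := fun τ hτ ↦
    he.rpow_const fun _ ↦ Or.inr hτ
  have hcw : ∀ τ : ℝ, Continuous fun x ↦ w x ^ τ := fun τ ↦
    hw.rpow_const fun x ↦ Or.inl (hw0 x).ne'
  have iX : Integrable (fun x ↦ η x ^ (2 * j * ν) * e x ^ (j * ν)) μ :=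
    integrable_of_continuous' ((hcη _ (by positivity)).mul (hce _ (by positivity)))
  have iY : Integrable (fun x ↦ η x ^ (2 * j * ν) * w x ^ (2 * j / (n - 2))) μ :=
    integrable_of_continuous' ((hcη _ (by positivity)).mul (hcw _))
  have iZ : Integrable (fun x ↦ η x ^ (2 * j) * e x ^ (j + 1)) μ :=
    integrable_of_continuous' ((hcη _ (by linarith)).mul (hce _ (by linarith)))
  -- the velocity term
  have hT : ∫ x, η x ^ (2 * j) * e x ^ β * (w x ^ 2 * g x ^ 2) ∂μ ≤
      B ^ (2 / (n : ℝ)) * (δ * X + cδ * Y) ^ θ := by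
    have hFc : Continuous fun x ↦ w x ^ (2 / (n : ℝ)) * g x ^ 2 := (hcw _).mul (hg.pow 2)
    have hGc : Continuous fun x ↦ η x ^ (2 * j) * e x ^ β * w x ^ (2 - 2 / (n : ℝ)) :=
      ((hcη _ (by linarith)).mul (hce _ hβ)).mul (hcw _)
    have h1 := integral_mul_le_holder hn μ hFc hGc
      (fun x ↦ mul_nonneg (Real.rpow_nonneg (hw0 x).le _) (sq_nonneg _))
      (fun x ↦ mul_nonneg (mul_nonneg (Real.rpow_nonneg (hη0 x) _) (Real.rpow_nonneg (he0 x) _))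
        (Real.rpow_nonneg (hw0 x).le _))
    -- Split w² = w^{2/n} w^{2-2/n}. Raised to n/2, the factor w^{2/n} g² is exactly w gⁿ, whose
    -- integral is at most B.
    have e1 : ∀ x, w x ^ (2 / (n : ℝ)) * g x ^ 2 *
        (η x ^ (2 * j) * e x ^ β * w x ^ (2 - 2 / (n : ℝ))) =
        η x ^ (2 * j) * e x ^ β * (w x ^ 2 * g x ^ 2) := fun x ↦ by
      have : w x ^ (2 / (n : ℝ)) * w x ^ (2 - 2 / (n : ℝ)) = w x ^ 2 := by
        rw [← Real.rpow_add (hw0 x), ← Real.rpow_natCast]; congr 1; push_cast; ring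
      linear_combination η x ^ (2 * j) * e x ^ β * g x ^ 2 * this
    have e2 : ∀ x, (w x ^ (2 / (n : ℝ)) * g x ^ 2) ^ ((n : ℝ) / 2) = w x * g x ^ n := fun x ↦ by
      rw [Real.mul_rpow (Real.rpow_nonneg (hw0 x).le _) (sq_nonneg _), ← Real.rpow_mul (hw0 x).le,
        ← Real.rpow_natCast (g x) 2, ← Real.rpow_mul (hg0 x), ← Real.rpow_natCast (g x) n]
      congr 1
      · rw [show 2 / (n : ℝ) * (n / 2) = 1 by field_simp, Real.rpow_one]
      · congr 1; push_cast; ring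
    -- Young with weights β/j and (n-1)/j, which add up to 1 because j = n - 1 + β. They match
    -- e^{βν} with e^{jν} and w^{(2-2/n)ν} with w^{2j/(n-2)}.
    have e3 : ∀ x, (η x ^ (2 * j) * e x ^ β * w x ^ (2 - 2 / (n : ℝ))) ^ ν ≤
        δ * (η x ^ (2 * j * ν) * e x ^ (j * ν)) +
          cδ * (η x ^ (2 * j * ν) * w x ^ (2 * j / (n - 2))) := fun x ↦ by
      have hE := Real.rpow_nonneg (hη0 x) (2 * j)
      have hE' := Real.rpow_nonneg (he0 x) β
      have hW' := Real.rpow_nonneg (hw0 x).le (2 - 2 / (n : ℝ))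
      rw [Real.mul_rpow (mul_nonneg hE hE') hW', Real.mul_rpow hE hE', ← Real.rpow_mul (hη0 x),
        ← Real.rpow_mul (he0 x), ← Real.rpow_mul (hw0 x).le]
      have h2 := young_weighted (Real.rpow_nonneg (he0 x) (j * ν))
        (Real.rpow_nonneg (hw0 x).le (2 * j / (n - 2))) hδ0 (α₁ := β / j) (α₂ := (n - 1) / j)
        (by positivity) (div_pos (by linarith) (by linarith))
        (by rw [← add_div, hj]; rw [add_comm]; exact div_self (by linarith))
      rw [← Real.rpow_mul (he0 x), ← Real.rpow_mul (hw0 x).le] at h2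
      have x1 : j * ν * (β / j) = β * ν := by field_simp
      have x2 : 2 * j / (n - 2) * ((n - 1) / j) = (2 - 2 / (n : ℝ)) * ν := by
        rw [hν]; field_simp
      rw [x1, x2, ← hcδ] at h2
      have h3 := mul_le_mul_of_nonneg_left h2 (Real.rpow_nonneg (hη0 x) (2 * j * ν))
      linarith
    simp only [e1, e2] at h1
    refine h1.trans (mul_le_mul (Real.rpow_le_rpow ?_ hwB (by positivity))
      (Real.rpow_le_rpow ?_ ?_ hθ0.le) (Real.rpow_nonneg ?_ _) (by positivity))
    · exact integral_nonneg fun x ↦ mul_nonneg (hw0 x).le (pow_nonneg (hg0 x) _)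
    · exact integral_nonneg fun x ↦ Real.rpow_nonneg (mul_nonneg (mul_nonneg
        (Real.rpow_nonneg (hη0 x) _) (Real.rpow_nonneg (he0 x) _)) (Real.rpow_nonneg (hw0 x).le _)) _
    · rw [hX, hY, ← integral_const_mul, ← integral_const_mul,
        ← integral_add (iX.const_mul _) (iY.const_mul _)]
      refine integral_mono (integrable_of_continuous' (hGc.rpow_const fun _ ↦ Or.inr hν0.le))
        ((iX.const_mul _).add (iY.const_mul _)) e3
    · exact integral_nonneg fun x ↦ Real.rpow_nonneg (mul_nonneg (mul_nonneg
        (Real.rpow_nonneg (hη0 x) _) (Real.rpow_nonneg (he0 x) _)) (Real.rpow_nonneg (hw0 x).le _)) _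
  have hT' : (δ * X + cδ * Y) ^ θ ≤ δ₀ * X ^ θ + cδ ^ θ * Y ^ θ := by
    refine (Real.rpow_add_le_add_rpow (by positivity) (by positivity) hθ0.le hθ1).trans ?_
    rw [Real.mul_rpow hδ0.le hX0, Real.mul_rpow hcδ0 hY0, hδθ]
  have hRint : ∫ x, η x ^ (2 * j) * e x ^ β * R x ^ 2 ∂μ ≤
      2 * (∫ x, η x ^ (2 * j) * e x ^ β * (w x ^ 2 * g x ^ 2) ∂μ) + 2 * C_N ^ 2 * Z := by
    have i1 : Integrable (fun x ↦ η x ^ (2 * j) * e x ^ β * (w x ^ 2 * g x ^ 2)) μ :=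
      integrable_of_continuous' (((hcη _ (by linarith)).mul (hce _ hβ)).mul
        ((hw.pow 2).mul (hg.pow 2)))
    have i2 : Integrable (fun x ↦ η x ^ (2 * j) * e x ^ β * R x ^ 2) μ :=
      integrable_of_continuous' (((hcη _ (by linarith)).mul (hce _ hβ)).mul (hR.pow 2))
    rw [hZdef, ← integral_const_mul, ← integral_const_mul,
      ← integral_add (i1.const_mul _) (iZ.const_mul _)]
    refine integral_mono i2 ((i1.const_mul _).add (iZ.const_mul _)) fun x ↦ ?_
    have h1 : e x ^ β * e x ^ (n : ℝ) = e x ^ (j + 1) := by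
      rw [← Real.rpow_add_of_nonneg (he0 x) hβ (by linarith)]; congr 1; rw [hj]; ring
    have h2 := mul_le_mul_of_nonneg_left (hRb x) (mul_nonneg (Real.rpow_nonneg (hη0 x) (2 * j))
      (Real.rpow_nonneg (he0 x) β))
    refine h2.trans (le_of_eq ?_)
    simp only [← h1]
    ring
  -- With η^{2j-2} e^j = (η²e)^{j-1} e and η^{2j} e^{j+1} = (η²e)^j e, the lower order term is at
  -- most one copy of Z plus a multiple of ∫ e. The extra copy is the summand 1 in 2K₁C_N² + 1.
  have hlow : C * ∫ x, η x ^ (2 * j - 2) * e x ^ j ∂μ ≤ Z + c₃ := by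
    have i1 : Integrable (fun x ↦ η x ^ (2 * j - 2) * e x ^ j) μ :=
      integrable_of_continuous' ((hcη _ (by linarith)).mul (hce _ (by linarith)))
    have hd0 : 0 < 1 / (C + 1) := by positivity
    have h1 : ∫ x, η x ^ (2 * j - 2) * e x ^ j ∂μ ≤
        1 / (C + 1) * Z + (1 / (C + 1)) ^ (1 - j) * ∫ x, e x ∂μ := by
      rw [hZdef, ← integral_const_mul, ← integral_const_mul,
        ← integral_add (iZ.const_mul _) ((integrable_of_continuous' he).const_mul _)]
      refine integral_mono i1 ((iZ.const_mul _).add ((integrable_of_continuous' he).const_mul _))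
        fun x ↦ ?_
      have hη2 : 0 ≤ η x ^ 2 := sq_nonneg _
      have y1 : η x ^ (2 * j - 2) * e x ^ j = (η x ^ 2 * e x) ^ (j - 1) * e x := by
        rw [Real.mul_rpow hη2 (he0 x), ← Real.rpow_natCast, ← Real.rpow_mul (hη0 x), mul_assoc,
          ← Real.rpow_add_one' (he0 x) (by linarith)]
        congr 2 <;> push_cast <;> ring
      have y2 : η x ^ (2 * j) * e x ^ (j + 1) = (η x ^ 2 * e x) ^ j * e x := by
        rw [Real.mul_rpow hη2 (he0 x), ← Real.rpow_natCast, ← Real.rpow_mul (hη0 x), mul_assoc,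
          ← Real.rpow_add_one' (he0 x) (by linarith)]
        congr 2
      have h3 := mul_le_mul_of_nonneg_right (rpow_sub_one_le (mul_nonneg hη2 (he0 x)) hd0
        (by linarith : 1 < j)) (he0 x)
      simp only [y1, y2]
      linarith
    have h2 := mul_le_mul_of_nonneg_left h1 hC
    have h4 : C * (1 / (C + 1)) ≤ 1 := by
      rw [mul_one_div, div_le_one (by positivity)]; linarith
    have h5 : 0 ≤ Z := integral_nonneg fun x ↦
      mul_nonneg (Real.rpow_nonneg (hη0 x) _) (Real.rpow_nonneg (he0 x) _)
    have h6 : C * ((1 / (C + 1)) ^ (1 - j) * ∫ x, e x ∂μ) ≤ c₃ := by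
      rw [hc₃]; gcongr
    have h7 : C * (1 / (C + 1)) * Z ≤ 1 * Z := by gcongr
    linarith
  -- Two quarters of X^θ are absorbed; the remaining half explains the factors 2 in front of c₄ and
  -- c₅.
  refine le_of_rpow_le hX0 hY0 (by positivity) (by positivity) hθ0 hν0 hθν ?_
  have k1 := mul_le_mul_of_nonneg_left hRint hK₁
  have k2 := mul_le_mul_of_nonneg_left (hT.trans (mul_le_mul_of_nonneg_left hT'
    (Real.rpow_nonneg hB _))) (by positivity : 0 ≤ 2 * K₁)
  have k3 := mul_le_mul_of_nonneg_left hZ (by positivity : 0 ≤ 2 * K₁ * C_N ^ 2 + 1)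
  have hXθ : 0 ≤ X ^ θ := Real.rpow_nonneg hX0 _
  have k4 := mul_le_mul_of_nonneg_right hδ₀1 hXθ
  have k5 := mul_le_mul_of_nonneg_right hs hXθ
  have k6 : 2 * K₁ * (B ^ (2 / (n : ℝ)) * (δ₀ * X ^ θ + cδ ^ θ * Y ^ θ)) =
      2 * K₁ * B ^ (2 / (n : ℝ)) * δ₀ * X ^ θ + c₄ * Y ^ θ := by rw [hc₄]; ring
  linarith

/-- Hölder with exponents n/2 and n/(n-2) on the support of the cutoff. The case q = 1 uses the
local n-energy; q = 1 + ν uses the improved integrability of the first round. -/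
lemma critical_le_of_small (hn : 3 ≤ n) {j D : ℝ} (hj0 : 0 < j) (μ : Measure M)
    [IsFiniteMeasure μ] {A : Set M} {η e : M → ℝ} (hη : Continuous η)
    (he : Continuous e) (hη0 : ∀ x, 0 ≤ η x) (he0 : ∀ x, 0 ≤ e x) (hηA : ∀ x ∉ A, η x = 0)
    {q : ℝ} (hq : 0 ≤ q)
    (hD : ∫ x in A, e x ^ (q * (n / 2)) ∂μ ≤ D) :
    ∫ x, η x ^ (2 * j) * e x ^ j * e x ^ q ∂μ ≤ D ^ (2 / (n : ℝ)) *
      (∫ x, η x ^ (2 * j * (n / (n - 2))) * e x ^ (j * (n / (n - 2))) ∂μ) ^ (((n : ℝ) - 2) / n) := by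
  have hn3 : (3 : ℝ) ≤ n := by exact_mod_cast hn
  have hn2 : (0 : ℝ) < n - 2 := by linarith
  have hFc : Continuous fun x ↦ e x ^ q := he.rpow_const fun _ ↦ Or.inr hq
  have hGc : Continuous fun x ↦ η x ^ (2 * j) * e x ^ j :=
    (hη.rpow_const fun _ ↦ Or.inr (by linarith)).mul (he.rpow_const fun _ ↦ Or.inr hj0.le)
  have hG0 : ∀ x, 0 ≤ η x ^ (2 * j) * e x ^ j := fun x ↦
    mul_nonneg (Real.rpow_nonneg (hη0 x) _) (Real.rpow_nonneg (he0 x) _)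
  have h1 := integral_mul_le_holder hn (μ.restrict A) hFc hGc
    (fun x ↦ Real.rpow_nonneg (he0 x) _) hG0
  have e1 : ∫ x in A, e x ^ q * (η x ^ (2 * j) * e x ^ j) ∂μ =
      ∫ x, η x ^ (2 * j) * e x ^ j * e x ^ q ∂μ := by
    rw [setIntegral_eq_integral_of_forall_compl_eq_zero fun x hx ↦ by
      rw [hηA x hx, Real.zero_rpow (by linarith)]; ring]
    exact integral_congr_ae (Eventually.of_forall fun x ↦ mul_comm _ _)
  have e2 : ∀ x, (η x ^ (2 * j) * e x ^ j) ^ ((n : ℝ) / (n - 2)) =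
      η x ^ (2 * j * (n / (n - 2))) * e x ^ (j * (n / (n - 2))) := fun x ↦ by
    rw [Real.mul_rpow (Real.rpow_nonneg (hη0 x) _) (Real.rpow_nonneg (he0 x) _),
      ← Real.rpow_mul (hη0 x), ← Real.rpow_mul (he0 x)]
  have e3 : ∀ x, (e x ^ q) ^ ((n : ℝ) / 2) = e x ^ (q * (n / 2)) := fun x ↦
    (Real.rpow_mul (he0 x) _ _).symm
  simp only [e2, e3] at h1
  rw [e1] at h1
  have hXnn : ∀ x, 0 ≤ η x ^ (2 * j * (n / (n - 2))) * e x ^ (j * (n / (n - 2))) := fun x ↦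
    mul_nonneg (Real.rpow_nonneg (hη0 x) _) (Real.rpow_nonneg (he0 x) _)
  have hXi : Integrable (fun x ↦ η x ^ (2 * j * (n / (n - 2))) * e x ^ (j * (n / (n - 2)))) μ :=
    integrable_of_continuous' ((hη.rpow_const fun _ ↦ Or.inr (by positivity)).mul
      (he.rpow_const fun _ ↦ Or.inr (by positivity)))
  have h0 : 0 ≤ ∫ x in A, e x ^ (q * (n / 2)) ∂μ :=
    integral_nonneg fun x ↦ Real.rpow_nonneg (he0 x) _
  refine h1.trans (mul_le_mul (Real.rpow_le_rpow h0 hD (by positivity))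
    (Real.rpow_le_rpow (integral_nonneg hXnn) ?_ (by positivity))
    (Real.rpow_nonneg (integral_nonneg hXnn) _) (Real.rpow_nonneg (h0.trans hD) _))
  exact setIntegral_le_integral hXi (Eventually.of_forall hXnn)

/-- Supercritical integrability replaces smallness. For a large level τ one has e ≤ τ + t e^{1+ν}
with t = τ^{-ν} small, and e^{1+ν} lies in L^{n/2} because (1+ν)n/2 = (n-1)ν. The part with τ has
the lower power e^j and is split again at level 2τ, which returns half of the left side and a
constant. -/
lemma critical_le_of_bound (hn : 3 ≤ n) {j D s : ℝ} (hj0 : 0 < j) (hD0 : 0 ≤ D) (hs : 0 < s)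
    (μ : Measure M) [IsFiniteMeasure μ] :
    ∃ A' : ℝ, 0 ≤ A' ∧ ∀ (A : Set M) (η e : M → ℝ), Continuous η →
      Continuous e → (∀ x, 0 ≤ η x) → (∀ x, η x ≤ 1) → (∀ x, 0 ≤ e x) → (∀ x ∉ A, η x = 0) →
      ∫ x in A, e x ^ ((n - 1 : ℝ) * (n / (n - 2))) ∂μ ≤ D →
      ∫ x, η x ^ (2 * j) * e x ^ (j + 1) ∂μ ≤ s * (∫ x, η x ^ (2 * j * (n / (n - 2))) *
        e x ^ (j * (n / (n - 2))) ∂μ) ^ (((n : ℝ) - 2) / n) + A' := by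
  have hn3 : (3 : ℝ) ≤ n := by exact_mod_cast hn
  have hn2 : (0 : ℝ) < n - 2 := by linarith
  set ν : ℝ := n / (n - 2) with hν
  have hν0 : 0 < ν := by positivity
  -- So large that 2tD^{2/n} ≤ s; the 2 compensates for the half that is absorbed on the left.
  set τ : ℝ := (2 * D ^ (2 / (n : ℝ)) / s + 1) ^ ν⁻¹ with hτ
  have hτ0 : 0 < τ := by positivity
  have hτν : τ ^ ν = 2 * D ^ (2 / (n : ℝ)) / s + 1 := by
    rw [hτ, ← Real.rpow_mul (by positivity), inv_mul_cancel₀ hν0.ne', Real.rpow_one]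
  set t := (τ ^ ν)⁻¹ with ht
  have ht0 : 0 < t := by positivity
  have hts : 2 * t * D ^ (2 / (n : ℝ)) ≤ s := by
    rw [ht, hτν]
    have h1 : 2 * D ^ (2 / (n : ℝ)) ≤ s * (2 * D ^ (2 / (n : ℝ)) / s + 1) := by
      rw [mul_add, mul_div_cancel₀ _ hs.ne']; linarith
    rw [mul_right_comm, mul_inv_le_iff₀ (by positivity)]
    exact h1
  refine ⟨2 * τ * ((2 * τ) ^ j * μ.real univ), by positivity, ?_⟩
  intro A η e hη he hη0 hη1 he0 hηA hD
  have hcη : Continuous fun x ↦ η x ^ (2 * j) := hη.rpow_const fun _ ↦ Or.inr (by linarith)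
  have hce : ∀ τ : ℝ, 0 ≤ τ → Continuous fun x ↦ e x ^ τ := fun τ hτ ↦
    he.rpow_const fun _ ↦ Or.inr hτ
  have h1 := critical_le_of_small hn hj0 μ hη he hη0 he0 hηA (q := 1 + ν) (D := D)
    (by positivity) (by
      rw [show (1 + ν) * (n / 2) = (n - 1 : ℝ) * ν by rw [hν]; field_simp; ring]
      exact hD)
  rw [← hν] at h1
  set Xθ := (∫ x, η x ^ (2 * j * ν) * e x ^ (j * ν) ∂μ) ^ (((n : ℝ) - 2) / n)
  set Z := ∫ x, η x ^ (2 * j) * e x ^ (j + 1) ∂μ with hZ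
  have iZ : Integrable (fun x ↦ η x ^ (2 * j) * e x ^ (j + 1)) μ :=
    integrable_of_continuous' (hcη.mul (hce _ (by linarith)))
  have iW : Integrable (fun x ↦ η x ^ (2 * j) * e x ^ j) μ :=
    integrable_of_continuous' (hcη.mul (hce _ (by linarith)))
  have iV : Integrable (fun x ↦ η x ^ (2 * j) * e x ^ j * e x ^ (1 + ν)) μ :=
    integrable_of_continuous' ((hcη.mul (hce _ (by linarith))).mul (hce _ (by positivity)))
  have hej : ∀ x, e x ^ (j + 1) = e x ^ j * e x := fun x ↦
    Real.rpow_add_one' (he0 x) (by linarith)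
  have h2 : Z ≤ τ * (∫ x, η x ^ (2 * j) * e x ^ j ∂μ) +
      t * ∫ x, η x ^ (2 * j) * e x ^ j * e x ^ (1 + ν) ∂μ := by
    rw [hZ, ← integral_const_mul, ← integral_const_mul,
      ← integral_add (iW.const_mul _) (iV.const_mul _)]
    refine integral_mono iZ ((iW.const_mul _).add (iV.const_mul _)) fun x ↦ ?_
    have h3 : e x ≤ τ + t * e x ^ (1 + ν) := by
      rcases le_total (e x) τ with h | h
      · have := mul_nonneg ht0.le (Real.rpow_nonneg (he0 x) (1 + ν))
        linarith
      · have h4 : τ ^ ν ≤ e x ^ ν := Real.rpow_le_rpow hτ0.le h hν0.le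
        have h5 : e x ^ (1 + ν) = e x * e x ^ ν := by
          rw [add_comm, Real.rpow_add_one' (he0 x) (by positivity), mul_comm]
        have h6 : 1 ≤ t * e x ^ ν := by
          rw [ht, ← div_eq_inv_mul, one_le_div (by positivity)]; exact h4
        rw [h5]
        nlinarith [he0 x]
    have h7 : 0 ≤ η x ^ (2 * j) * e x ^ j :=
      mul_nonneg (Real.rpow_nonneg (hη0 x) _) (Real.rpow_nonneg (he0 x) _)
    have h8 := mul_le_mul_of_nonneg_left h3 h7
    simp only [hej]
    linarith
  have h3 : ∫ x, η x ^ (2 * j) * e x ^ j ∂μ ≤ (2 * τ)⁻¹ * Z + (2 * τ) ^ j * μ.real univ := by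
    have h4 : (2 * τ) ^ j * μ.real univ = ∫ _, (2 * τ) ^ j ∂μ := by
      rw [integral_const, smul_eq_mul, mul_comm]
    rw [h4, hZ, ← integral_const_mul, ← integral_add (iZ.const_mul _) (integrable_const _)]
    refine integral_mono iW ((iZ.const_mul _).add (integrable_const _)) fun x ↦ ?_
    have h5 : 0 ≤ η x ^ (2 * j) := Real.rpow_nonneg (hη0 x) _
    have h5' : η x ^ (2 * j) ≤ 1 := Real.rpow_le_one (hη0 x) (hη1 x) (by linarith)
    have h6 : 0 ≤ e x ^ j := Real.rpow_nonneg (he0 x) _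
    have h9 : 0 ≤ (2 * τ) ^ j := by positivity
    simp only [hej]
    rcases le_total (e x) (2 * τ) with h | h
    · have h7 : e x ^ j ≤ (2 * τ) ^ j := Real.rpow_le_rpow (he0 x) h hj0.le
      have h8 : 0 ≤ (2 * τ)⁻¹ * (η x ^ (2 * j) * (e x ^ j * e x)) :=
        mul_nonneg (by positivity) (mul_nonneg h5 (mul_nonneg h6 (he0 x)))
      have h10 : η x ^ (2 * j) * e x ^ j ≤ 1 * e x ^ j := by gcongr
      linarith
    · have h7 : 1 ≤ (2 * τ)⁻¹ * e x := by
        rw [← div_eq_inv_mul, one_le_div (by positivity)]; exact h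
      have h8 := mul_le_mul_of_nonneg_left h7 (mul_nonneg h5 h6)
      linarith
  have h4 := mul_le_mul_of_nonneg_left h3 hτ0.le
  have h5 : τ * ((2 * τ)⁻¹ * Z) = 1 / 2 * Z := by field_simp
  have h6 := mul_le_mul_of_nonneg_left h1 ht0.le
  have hX0 : 0 ≤ Xθ := Real.rpow_nonneg (integral_nonneg fun x ↦
    mul_nonneg (Real.rpow_nonneg (hη0 x) _) (Real.rpow_nonneg (he0 x) _)) _
  have h7 := mul_le_mul_of_nonneg_right hts hX0
  linarith

end Absorption

lemma rpow_sub_one_mul_le {w z p : ℝ} (hw : 0 < w) (hz : 0 ≤ z) (hp : 1 < p) :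
    w ^ (p - 1) * z ≤ w ^ p + z ^ p := by
  have hsplit : ∀ y : ℝ, 0 ≤ y → y ^ p = y ^ (p - 1) * y := fun y hy ↦ by
    rw [← Real.rpow_add_one' hy (by linarith)]; congr 1; ring
  rcases le_total z w with h | h
  · have h1 := mul_le_mul_of_nonneg_left h (Real.rpow_nonneg hw.le (p - 1))
    rw [hsplit w hw.le]
    linarith [Real.rpow_nonneg hz p]
  · have h1 := mul_le_mul_of_nonneg_right (Real.rpow_le_rpow hw.le h (by linarith : 0 ≤ p - 1)) hz
    rw [hsplit z hz]
    linarith [Real.rpow_nonneg hw.le p]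

/-! ### Closing the estimate in time by Grönwall. -/

section FlowBound

variable {n L : ℕ} {M : Type*} [EMetricSpace M] [ChartedSpace (EuclideanSpace ℝ (Fin n)) M]
  [RiemannianBundle (fun x : M ↦ TangentSpace (𝓡 n) x)] [IsManifold (𝓡 n) ∞ M]
  [IsContMDiffRiemannianBundle (𝓡 n) ∞ (EuclideanSpace ℝ (Fin n))
          (fun x : M ↦ TangentSpace (𝓡 n) x)]
  [MeasurableSpace M] [BorelSpace M] [CompactSpace M]
  {N : Set (EuclideanSpace ℝ (Fin L))} {ε a b T C_N : ℝ}
  {f : ℝ → M → EuclideanSpace ℝ (Fin L)} {u : ℝ → M → ℝ}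

namespace IsRegularizedCHF

lemma norm_regNLaplacian_sq_le (hC : SecondFFBoundedBy N C_N) (hC0 : 0 ≤ C_N) (hε : 0 ≤ ε)
    (hn : 3 ≤ n) (hfl : IsRegularizedCHF n N ε a b T f u) {t : ℝ} (ht : t ∈ Ioo 0 T) (x : M) :
    ‖regNLaplacian n ε (f t) x‖ ^ 2 ≤
      2 * confFactor n u t x ^ 2 * ‖vel f t x‖ ^ 2 + 2 * C_N ^ 2 * e2 n ε (f t) x ^ (n : ℝ) := by
  have he := e2_nonneg (n := n) hε (f t) x
  have h1 : regNLaplacian n ε (f t) x = confFactor n u t x • vel f t x - flowDefect n ε f u t x := by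
    rw [flowDefect, sub_sub_cancel]
  have h2 : ‖regNLaplacian n ε (f t) x‖ ≤
      confFactor n u t x * ‖vel f t x‖ + C_N * e2 n ε (f t) x ^ ((n : ℝ) / 2) := by
    rw [h1]
    refine (norm_sub_le _ _).trans (add_le_add (le_of_eq ?_) (hfl.norm_flowDefect_le hC hC0 hε hn ht x))
    rw [norm_smul, Real.norm_of_nonneg (confFactor_pos u t x).le]
  have h3 : e2 n ε (f t) x ^ (n : ℝ) = (e2 n ε (f t) x ^ ((n : ℝ) / 2)) ^ 2 := by
    rw [← Real.rpow_natCast, ← Real.rpow_mul he]; congr 1; push_cast; ring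
  rw [h3]
  have h4 := pow_le_pow_left₀ (norm_nonneg _) h2 2
  nlinarith [sq_nonneg (confFactor n u t x * ‖vel f t x‖ - C_N * e2 n ε (f t) x ^ ((n : ℝ) / 2))]

lemma integral_e2_le (hemb : IsEmbeddedSubmanifold N) (hε : 0 ≤ ε) (hn : 3 ≤ n)
    (hfl : IsRegularizedCHF n N ε a b T f u) {E₀ : ℝ} (hE : regNEnergy n ε (f 0) ≤ E₀)
    {t : ℝ} (ht : t ∈ Ioo 0 T) :
    ∫ x, e2 n ε (f t) x ∂(riemannianVolume n M) ≤ (riemannianVolume n M).real univ + n * E₀ := by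
  have := isFiniteMeasure_riemannianVolume (n := n) (M := M)
  have hn3 : (3 : ℝ) ≤ n := by exact_mod_cast hn
  have hc := hfl.continuous_e2_rpow ht (κ := (n : ℝ) / 2) (by linarith)
  have hc1 : Continuous fun x ↦ e2 n ε (f t) x := by
    simpa using hfl.continuous_e2_rpow ht (κ := 1) zero_le_one
  have h1 : ∫ x, e2 n ε (f t) x ^ ((n : ℝ) / 2) ∂(riemannianVolume n M) =
      n * regNEnergy n ε (f t) := by rw [regNEnergy]; field_simp
  have h2 := (hfl.regNEnergy_le hemb hε hn ht).trans hE
  calc _ ≤ ∫ x, (1 + e2 n ε (f t) x ^ ((n : ℝ) / 2)) ∂(riemannianVolume n M) := by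
        refine integral_mono (integrable_of_continuous' hc1)
          ((integrable_const _).add (integrable_of_continuous' hc)) fun x ↦ ?_
        have he := e2_nonneg (n := n) hε (f t) x
        dsimp only
        rcases le_total (e2 n ε (f t) x) 1 with h | h
        · linarith [Real.rpow_nonneg he ((n : ℝ) / 2)]
        · have := Real.rpow_le_rpow_of_exponent_le h (by linarith : 1 ≤ (n : ℝ) / 2)
          rw [Real.rpow_one] at this
          linarith
    _ = (riemannianVolume n M).real univ + n * regNEnergy n ε (f t) := by
        rw [integral_add (integrable_const _) (integrable_of_continuous' hc), h1, integral_const,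
          smul_eq_mul, mul_one]
    _ ≤ _ := by gcongr

lemma hasDerivAt_integral_confFactor_rpow (hn : 3 ≤ n) {κ p : ℝ} (hκ : 0 ≤ κ)
    {η : M → ℝ} (hη : Continuous η)
    (hfl : IsRegularizedCHF n N ε a b T f u) {t : ℝ} (ht : t ∈ Ioo 0 T) :
    HasDerivAt (fun s ↦ ∫ x, η x ^ κ * confFactor n u s x ^ p ∂(riemannianVolume n M))
      (∫ x, η x ^ κ * ((n * b * e2 n ε (f t) x ^ ((n : ℝ) / 2) - n * a * confFactor n u t x) * p *
        confFactor n u t x ^ (p - 1)) ∂(riemannianVolume n M)) t := by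
  have hT : 0 < T := ht.1.trans ht.2
  have hηc : Continuous fun x ↦ η x ^ κ := hη.rpow_const fun _ ↦ Or.inr hκ
  have hw : ContinuousOn (fun z : ℝ × M ↦ confFactor n u z.1 z.2) (Ioo 0 T ×ˢ univ) :=
    (hfl.flowReg_confFactor.of_le (s := 0) (by simp)).continuousOn
  have hwp : ∀ κ : ℝ, ContinuousOn (fun z : ℝ × M ↦ confFactor n u z.1 z.2 ^ κ)
      (Ioo 0 T ×ˢ univ) := fun κ ↦ hw.rpow_const fun z _ ↦ Or.inl (confFactor_pos u _ _).ne'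
  have hep : ContinuousOn (fun z : ℝ × M ↦ e2 n ε (f z.1) z.2 ^ ((n : ℝ) / 2))
      (Ioo 0 T ×ˢ univ) :=
    ((continuousOn_e2_of_contMDiffOn hT hfl.smooth_f ε).mono
      (prod_mono_left Ioo_subset_Icc_self)).rpow_const fun _ _ ↦ Or.inr (by positivity)
  refine hasDerivAt_integral_flow (n := n) ht
    (k := fun s x ↦ η x ^ κ * confFactor n u s x ^ p)
    (k' := fun s x ↦ η x ^ κ * ((n * b * e2 n ε (f s) x ^ ((n : ℝ) / 2) -
      n * a * confFactor n u s x) * p * confFactor n u s x ^ (p - 1)))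
    (fun s hs ↦ hηc.mul (continuous_slice hs (k := fun s x ↦ confFactor n u s x ^ p) (hwp p)))
    (fun s hs x ↦ ?_) ?_
  · exact ((hfl.hasDerivAt_confFactor hs x).rpow_const
      (Or.inl (confFactor_pos u s x).ne')).const_mul _
  · exact (hηc.comp_continuousOn continuousOn_snd).mul
      ((((continuousOn_const.mul hep).sub (continuousOn_const.mul hw)).mul
        continuousOn_const).mul (hwp _))

/-- If the critical term can be absorbed on a time interval, then the local energy of high order
is controlled by its conformal factor at the initial time. -/
lemma exists_bound_of_critical (hC0 : 0 ≤ C_N) (hn : 3 ≤ n) (hn' : n ≤ 4)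
    (ha : 0 < a) (hb : 0 < b) (hCb : 0 < n * b / 2 - C_N - 2 * C_N ^ 2) (E₀ T : ℝ) {τ : ℝ}
    (hτ : 0 < τ) {β j C s A Y₀ : ℝ} (hβ : 0 ≤ β) (hj : j = n - 1 + β) {η : M → ℝ}
    (hη : Continuous η) (hη0 : ∀ x, 0 ≤ η x) (hC : 0 ≤ C)
    (hest : ∀ f : M → EuclideanSpace ℝ (Fin L), ChartReg n 2 f → ∀ ε, 0 ≤ ε →
      (∫ x, η x ^ (2 * j * (n / (n - 2))) * e2 n ε f x ^ (j * (n / (n - 2)))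
          ∂(riemannianVolume n M)) ^ (((n : ℝ) - 2) / n) ≤
        divergenceConst hn β * (∫ x, η x ^ (2 * j) * e2 n ε f x ^ β * ‖regNLaplacian n ε f x‖ ^ 2
          ∂(riemannianVolume n M)) +
        C * ∫ x, η x ^ (2 * j - 2) * e2 n ε f x ^ j ∂(riemannianVolume n M))
    (hA : 0 ≤ A) (hs : (2 * divergenceConst hn β * C_N ^ 2 + 1) * s ≤ 1 / 4) :
    ∃ B : ℝ, 0 ≤ B ∧ ∀ (N : Set (EuclideanSpace ℝ (Fin L))), IsEmbeddedSubmanifold N →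
      SecondFFBoundedBy N C_N → ∀ ε : ℝ, 0 ≤ ε →
      ∀ (f : ℝ → M → EuclideanSpace ℝ (Fin L)) (u : ℝ → M → ℝ),
        IsRegularizedCHF n N ε a b T f u → regNEnergy n ε (f 0) ≤ E₀ →
        (∀ t ∈ Ico τ T, ∫ x, η x ^ (2 * j) * e2 n ε (f t) x ^ (j + 1) ∂(riemannianVolume n M) ≤
          s * (∫ x, η x ^ (2 * j * (n / (n - 2))) * e2 n ε (f t) x ^ (j * (n / (n - 2)))
            ∂(riemannianVolume n M)) ^ (((n : ℝ) - 2) / n) + A) →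
        ∫ x, η x ^ (2 * j * (n / (n - 2))) * confFactor n u τ x ^ (2 * j / (n - 2))
          ∂(riemannianVolume n M) ≤ Y₀ →
        ∀ t ∈ Ico τ T, ∫ x, η x ^ (2 * j * (n / (n - 2))) * e2 n ε (f t) x ^ (j * (n / (n - 2)))
          ∂(riemannianVolume n M) ≤ B := by
  have := isFiniteMeasure_riemannianVolume (n := n) (M := M)
  have hn3 : (3 : ℝ) ≤ n := by exact_mod_cast hn
  have hn4 : (n : ℝ) ≤ 4 := by exact_mod_cast hn'
  have hn2 : (0 : ℝ) < n - 2 := by linarith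
  have hj2 : 2 ≤ j := by rw [hj]; linarith
  set ν : ℝ := n / (n - 2) with hν
  have hν0 : 0 < ν := by positivity
  -- The exponent for which (n/2)p = jν: the source e^{n/2} of w, raised to the power p, is exactly
  -- the power of e controlled by the elliptic estimate.
  set p : ℝ := 2 * j / (n - 2) with hp
  have hp1 : 1 < p := by rw [hp, lt_div_iff₀ hn2]; linarith
  obtain ⟨B, hB0, hB⟩ := exists_velocity_bound n L M hC0 hn hn' ha hb hCb E₀ T hτ
  set D := max 0 ((riemannianVolume n M).real univ + n * E₀)
  obtain ⟨C', hC'0, hC'⟩ := energy_le_of_absorb (M := M) hn hβ hj (divergenceConst_nonneg hn β) hC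
    hB0 hA (le_max_left 0 _ : 0 ≤ D) hs (riemannianVolume n M)
  set c := p * (n * b) * (1 + C') with hc
  have hc0 : 0 ≤ c := by positivity
  refine ⟨C' * (Real.exp (c * (T - τ)) * (1 + |Y₀|)), by positivity, ?_⟩
  intro N hemb hA' ε hε f u hfl hE hcrit hY₀
  have hmem : ∀ t ∈ Ico τ T, t ∈ Ioo 0 T := fun t ht ↦ ⟨hτ.trans_le ht.1, ht.2⟩
  have hηκ : Continuous fun x ↦ η x ^ (2 * j * ν) := hη.rpow_const fun _ ↦ Or.inr (by positivity)
  set X : ℝ → ℝ := fun t ↦ ∫ x, η x ^ (2 * j * ν) * e2 n ε (f t) x ^ (j * ν)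
    ∂(riemannianVolume n M)
  set Y : ℝ → ℝ := fun t ↦ ∫ x, η x ^ (2 * j * ν) * confFactor n u t x ^ p
    ∂(riemannianVolume n M)
  have hY0 : ∀ t, 0 ≤ Y t := fun t ↦ integral_nonneg fun x ↦
    mul_nonneg (Real.rpow_nonneg (hη0 x) _) (Real.rpow_nonneg (confFactor_pos u t x).le _)
  have hcont : ∀ t ∈ Ioo 0 T, Continuous fun x ↦ confFactor n u t x := fun t ht ↦
    (hfl.flowReg_confFactor.slice ht |>.of_le (by simp) : ChartReg n 1 _).continuous
  have hXY : ∀ t ∈ Ico τ T, X t ≤ C' * (1 + Y t) := by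
    intro t ht
    have htm := hmem t ht
    have hreg : ChartReg n 2 (f t) := (hfl.flowReg_f.slice htm).of_le two_le_infty
    have hv : ChartReg n 1 (vel f t) := (hfl.flowReg_vel.slice htm).of_le (by simp)
    have hec : Continuous fun x ↦ e2 n ε (f t) x := by
      simpa using hfl.continuous_e2_rpow htm (κ := 1) zero_le_one
    exact hC' η (fun x ↦ e2 n ε (f t) x) (fun x ↦ confFactor n u t x) (fun x ↦ ‖vel f t x‖)
      (fun x ↦ ‖regNLaplacian n ε (f t) x‖) hη hec (hcont t htm) hv.continuous.norm
      (hreg.continuous_regNLaplacian hε (by omega)).norm hη0 (fun x ↦ e2_nonneg hε (f t) x)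
      (fun x ↦ confFactor_pos u t x) (fun x ↦ norm_nonneg _)
      (fun x ↦ hfl.norm_regNLaplacian_sq_le hA' hC0 hε hn htm x)
      (hB N hemb hA' ε hε f u hfl hE t ht)
      ((hfl.integral_e2_le hemb hε hn hE htm).trans (le_max_right _ _))
      (hcrit t ht) (hest (f t) hreg ε hε)
  -- Dropping the damping term -na w, the derivative of Y is at most p nb (Y + X), and X ≤ C'(1 + Y)
  -- makes this a linear inequality for 1 + Y.
  have hderiv : ∀ t ∈ Ico τ T, ∃ d, HasDerivAt (fun t ↦ 1 + Y t) d t ∧ d ≤ c * (1 + Y t) := by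
    intro t ht
    have htm := hmem t ht
    refine ⟨_, (hfl.hasDerivAt_integral_confFactor_rpow hn (by positivity) hη htm).const_add 1, ?_⟩
    have hwc := hcont t htm
    have hwp : ∀ κ : ℝ, Continuous fun x ↦ confFactor n u t x ^ κ := fun κ ↦
      hwc.rpow_const fun x ↦ Or.inl (confFactor_pos u t x).ne'
    have hep : ∀ κ : ℝ, 0 ≤ κ → Continuous fun x ↦ e2 n ε (f t) x ^ κ := fun κ hκ ↦
      hfl.continuous_e2_rpow htm hκ
    have iX : Integrable (fun x ↦ η x ^ (2 * j * ν) * e2 n ε (f t) x ^ (j * ν))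
        (riemannianVolume n M) := integrable_of_continuous' (hηκ.mul (hep _ (by positivity)))
    have iY : Integrable (fun x ↦ η x ^ (2 * j * ν) * confFactor n u t x ^ p)
        (riemannianVolume n M) := integrable_of_continuous' (hηκ.mul (hwp _))
    have h1 : ∫ x, η x ^ (2 * j * ν) * ((n * b * e2 n ε (f t) x ^ ((n : ℝ) / 2) -
        n * a * confFactor n u t x) * p * confFactor n u t x ^ (p - 1)) ∂(riemannianVolume n M) ≤
        p * (n * b) * Y t + p * (n * b) * X t := by
      have i0 : Integrable (fun x ↦ η x ^ (2 * j * ν) * ((n * b * e2 n ε (f t) x ^ ((n : ℝ) / 2) -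
          n * a * confFactor n u t x) * p * confFactor n u t x ^ (p - 1)))
          (riemannianVolume n M) := by
        refine integrable_of_continuous' (hηκ.mul ((Continuous.mul ?_ continuous_const).mul (hwp _)))
        exact (continuous_const.mul (hep _ (by positivity))).sub (continuous_const.mul hwc)
      rw [← integral_const_mul, ← integral_const_mul,
        ← integral_add (iY.const_mul _) (iX.const_mul _)]
      refine integral_mono i0 ((iY.const_mul _).add (iX.const_mul _)) fun x ↦ ?_
      have he := e2_nonneg (n := n) hε (f t) x
      have hw := confFactor_pos (n := n) u t x
      have h2 := rpow_sub_one_mul_le hw (Real.rpow_nonneg he ((n : ℝ) / 2)) hp1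
      rw [← Real.rpow_mul he, show (n : ℝ) / 2 * p = j * ν by rw [hp, hν]; field_simp] at h2
      have h3 : 0 ≤ n * a * confFactor n u t x * p * confFactor n u t x ^ (p - 1) := by positivity
      have h4 := mul_le_mul_of_nonneg_left h2 (by positivity : 0 ≤ p * (n * b))
      have h5 : (n * b * e2 n ε (f t) x ^ ((n : ℝ) / 2) - n * a * confFactor n u t x) * p *
          confFactor n u t x ^ (p - 1) ≤
          p * (n * b) * (confFactor n u t x ^ p + e2 n ε (f t) x ^ (j * ν)) := by linarith
      have h6 := mul_le_mul_of_nonneg_left h5 (Real.rpow_nonneg (hη0 x) (2 * j * ν))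
      dsimp only
      linarith
    refine h1.trans ?_
    have h2 := mul_le_mul_of_nonneg_left (hXY t ht) (by positivity : 0 ≤ p * (n * b))
    have h3 : c * (1 + Y t) = p * (n * b) * (1 + Y t) + p * (n * b) * (C' * (1 + Y t)) := by
      rw [hc]; ring
    have h4 : 0 ≤ p * (n * b) := by positivity
    linarith
  intro t ht
  have h1 := le_exp_mul_of_deriv_le ht.1 fun r hr ↦ hderiv r ⟨hr.1, hr.2.trans_lt ht.2⟩
  refine (hXY t ht).trans (mul_le_mul_of_nonneg_left (h1.trans ?_) hC'0)
  refine mul_le_mul (Real.exp_le_exp.2 ?_) ?_ (by linarith [hY0 τ]) (Real.exp_pos _).le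
  · exact mul_le_mul_of_nonneg_left (by linarith [ht.2]) hc0
  · have : Y τ ≤ Y₀ := hY₀
    linarith [le_abs_self Y₀]

end IsRegularizedCHF

end FlowBound

lemma rpow_le_one_add_rpow {x p q : ℝ} (hx : 0 ≤ x) (hp : 0 ≤ p) (hpq : p ≤ q) :
    x ^ p ≤ 1 + x ^ q := by
  rcases le_total x 1 with h | h
  · linarith [Real.rpow_le_one hx h hp, Real.rpow_nonneg hx q]
  · linarith [Real.rpow_le_rpow_of_exponent_le h hpq]

/-! ### Comparison of cutoff integrals with integrals over sets. -/

section Localization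

variable {M : Type*} [EMetricSpace M] [MeasurableSpace M] [BorelSpace M] [CompactSpace M]
  {μ : Measure M} [IsFiniteMeasure μ]

lemma integral_cutoff_mul_le {η F : M → ℝ} {κ : ℝ} {A : Set M} (hη : Continuous η)
    (hη0 : ∀ x, 0 ≤ η x) (hη1 : ∀ x, η x ≤ 1) (hηA : ∀ x ∉ A, η x = 0) (hκ : 0 < κ)
    (hF : Continuous F) (hF0 : ∀ x, 0 ≤ F x) :
    ∫ x, η x ^ κ * F x ∂μ ≤ ∫ x in A, F x ∂μ := by
  rw [← setIntegral_eq_integral_of_forall_compl_eq_zero (s := A) fun x hx ↦ by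
    rw [hηA x hx, Real.zero_rpow hκ.ne', zero_mul]]
  refine integral_mono (integrable_of_continuous' ((hη.rpow_const fun _ ↦ Or.inr hκ.le).mul hF))
    (integrable_of_continuous' hF) fun x ↦ ?_
  exact mul_le_of_le_one_left (hF0 x) (Real.rpow_le_one (hη0 x) (hη1 x) hκ.le)

lemma setIntegral_le_integral_cutoff_mul {η F : M → ℝ} {κ : ℝ} {G : Set M} (hG : MeasurableSet G)
    (hη : Continuous η) (hη0 : ∀ x, 0 ≤ η x) (hηG : ∀ x ∈ G, η x = 1) (hκ : 0 ≤ κ)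
    (hF : Continuous F) (hF0 : ∀ x, 0 ≤ F x) :
    ∫ x in G, F x ∂μ ≤ ∫ x, η x ^ κ * F x ∂μ := by
  rw [setIntegral_congr_fun (g := fun x ↦ η x ^ κ * F x) hG fun x hx ↦ by
    simp only [hηG x hx, Real.one_rpow, one_mul]]
  exact setIntegral_le_integral
    (integrable_of_continuous' ((hη.rpow_const fun _ ↦ Or.inr hκ).mul hF))
    (Eventually.of_forall fun x ↦ mul_nonneg (Real.rpow_nonneg (hη0 x) _) (hF0 x))

lemma setIntegral_le_sum_setIntegral {ι : Type*} (s : Finset ι) {A : Set M} {G : ι → Set M}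
    (hA : MeasurableSet A) (hG : ∀ i, MeasurableSet (G i)) (hcov : A ⊆ ⋃ i ∈ s, G i) {F : M → ℝ}
    (hF : Continuous F) (hF0 : ∀ x, 0 ≤ F x) :
    ∫ x in A, F x ∂μ ≤ ∑ i ∈ s, ∫ x in G i ∩ A, F x ∂μ := by
  have hi := integrable_of_continuous' (μ := μ) hF
  rw [← integral_indicator hA, Finset.sum_congr rfl fun i _ ↦
    (integral_indicator ((hG i).inter hA)).symm, ← integral_finsetSum _ fun i _ ↦ hi.indicator ((hG i).inter hA)]
  refine integral_mono (hi.indicator hA)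
    (integrable_finsetSum _ fun i _ ↦ hi.indicator ((hG i).inter hA)) fun x ↦ ?_
  have hnn : ∀ i, 0 ≤ (G i ∩ A).indicator F x := fun i ↦ indicator_nonneg (fun x _ ↦ hF0 x) x
  by_cases hx : x ∈ A
  · obtain ⟨i, his, hxi⟩ := mem_iUnion₂.1 (hcov hx)
    rw [indicator_of_mem hx]
    calc F x = (G i ∩ A).indicator F x := (indicator_of_mem (show x ∈ G i ∩ A from ⟨hxi, hx⟩) F).symm
      _ ≤ _ := Finset.single_le_sum (f := fun i ↦ (G i ∩ A).indicator F x) (fun i _ ↦ hnn i) his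
  · rw [indicator_of_notMem hx]
    exact Finset.sum_nonneg fun i _ ↦ hnn i

end Localization

/-! ### The two rounds near a point. -/

section LocalBound

variable {n L : ℕ} {M : Type*} [EMetricSpace M] [ChartedSpace (EuclideanSpace ℝ (Fin n)) M]
  [RiemannianBundle (fun x : M ↦ TangentSpace (𝓡 n) x)] [IsManifold (𝓡 n) ∞ M]
  [IsContMDiffRiemannianBundle (𝓡 n) ∞ (EuclideanSpace ℝ (Fin n))
          (fun x : M ↦ TangentSpace (𝓡 n) x)]
  [MeasurableSpace M] [BorelSpace M] [CompactSpace M]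
  {N : Set (EuclideanSpace ℝ (Fin L))} {ε a b T C_N : ℝ}
  {f : ℝ → M → EuclideanSpace ℝ (Fin L)} {u : ℝ → M → ℝ}

lemma exists_smooth_cutoff {W : Set M} (hW : IsOpen W) {c : M} (hc : c ∈ W) :
    ∃ η : M → ℝ, ContMDiff (𝓡 n) 𝓘(ℝ, ℝ) ∞ η ∧ (∀ x, 0 ≤ η x) ∧ (∀ x, η x ≤ 1) ∧
      tsupport η ⊆ W ∧ ∃ G : Set M, IsOpen G ∧ c ∈ G ∧ G ⊆ W ∧ ∀ x ∈ G, η x = 1 := by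
  obtain ⟨K, hK, hKc, hKW⟩ := exists_mem_nhds_isClosed_subset (hW.mem_nhds hc)
  obtain ⟨η, h1, h0, h01⟩ := exists_contMDiffMap_one_nhds_of_subset_interior (n := ⊤) (𝓡 n)
    (isClosed_singleton (x := c)) (singleton_subset_iff.2 (mem_interior_iff_mem_nhds.2 hK))
  rw [nhdsSet_singleton] at h1
  obtain ⟨G, hG1, hG, hcG⟩ := eventually_nhds_iff.1 h1
  refine ⟨η, η.contMDiff, fun x ↦ (h01 x).1, fun x ↦ (h01 x).2, ?_, G ∩ W, hG.inter hW, ⟨hcG, hc⟩,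
    inter_subset_right, fun x hx ↦ hG1 x hx.1⟩
  refine (closure_minimal (fun x hx ↦ ?_) hKc).trans hKW
  by_contra hxK
  exact hx (h0 x hxK)

/-- The smallness constant for the `n`-energy. -/
def energyThreshold (hn : 3 ≤ n) (C_N : ℝ) : ℝ :=
  (1 / (4 * (2 * divergenceConst hn 0 * C_N ^ 2 + 1))) ^ ((n : ℝ) / 2)

lemma energyThreshold_pos (hn : 3 ≤ n) (C_N : ℝ) : 0 < energyThreshold hn C_N := by
  have := divergenceConst_nonneg hn 0
  exact Real.rpow_pos_of_pos (by positivity) _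

/-- Local bound of high powers of the energy density near a point. -/
lemma exists_local_bound (L : ℕ) (hC0 : 0 ≤ C_N) (hn : 3 ≤ n) (hn' : n ≤ 4)
    (ha : 0 < a) (hb : 0 < b) (hCb : 0 < n * b / 2 - C_N - 2 * C_N ^ 2) (E₀ T : ℝ) {τ : ℝ}
    (hτ : 0 < τ) {β : ℝ} (hβ : 0 ≤ β) (Cβ : ℝ) {V : Set M} (hV : IsOpen V) {c : M} (hc : c ∈ V) :
    ∃ G : Set M, IsOpen G ∧ c ∈ G ∧ G ⊆ V ∧ ∃ B : ℝ, 0 ≤ B ∧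
      ∀ (N : Set (EuclideanSpace ℝ (Fin L))), IsEmbeddedSubmanifold N →
      SecondFFBoundedBy N C_N → ∀ ε : ℝ, 0 ≤ ε →
      ∀ (f : ℝ → M → EuclideanSpace ℝ (Fin L)) (u : ℝ → M → ℝ),
        IsRegularizedCHF n N ε a b T f u → regNEnergy n ε (f 0) ≤ E₀ →
        (∀ t ∈ Ico τ T, ∫ x in V, e2 n ε (f t) x ^ ((n : ℝ) / 2) ∂(riemannianVolume n M) ≤
          energyThreshold hn C_N) →
        ∫ x in V, confFactor n u τ x ^ (2 * (n - 1 + β) / (n - 2)) ∂(riemannianVolume n M) ≤ Cβ →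
        ∀ t ∈ Ico τ T, ∫ x in G, e2 n ε (f t) x ^ ((n - 1 + β) * (n / (n - 2)))
          ∂(riemannianVolume n M) ≤ B := by
  have := isFiniteMeasure_riemannianVolume (n := n) (M := M)
  have hn3 : (3 : ℝ) ≤ n := by exact_mod_cast hn
  have hn2 : (0 : ℝ) < n - 2 := by linarith
  have hν0 : (0 : ℝ) < n / (n - 2) := by positivity
  have hK := divergenceConst_nonneg hn (n := n)
  obtain ⟨O, hO, hcO, hest⟩ := exists_local_estimate (M := M) L hn c
  -- Nested cutoffs: the first lives in V and equals 1 on G, where the first round gives its bound;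
  -- the second lives in G and is used for the exponent j of the second round.
  obtain ⟨η, hη, hη0, hη1, hηs, G, hG, hcG, hGW, hηG⟩ :=
    exists_smooth_cutoff (n := n) (hO.inter hV) ⟨hcO, hc⟩
  obtain ⟨η', hη', hη'0, hη'1, hη's, G', hG', hcG', hGG', hηG'⟩ :=
    exists_smooth_cutoff (n := n) hG hcG
  have hηV : ∀ x ∉ V, η x = 0 := fun x hx ↦
    image_eq_zero_of_notMem_tsupport fun h ↦ hx (hηs h).2
  have hη'G : ∀ x ∉ G, η' x = 0 := fun x hx ↦
    image_eq_zero_of_notMem_tsupport fun h ↦ hx (hη's h)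
  have hη'V : ∀ x ∉ V, η' x = 0 := fun x hx ↦ hη'G x fun h ↦ hx (hGW h).2
  set j : ℝ := n - 1 + β with hj
  have hj0 : 0 < j := by rw [hj]; linarith
  have hn1 : (0 : ℝ) < (n : ℝ) - 1 := by linarith
  obtain ⟨C, hC, hest₀⟩ := hest η hη hη0 hη1 (hηs.trans inter_subset_left) 0 le_rfl (n - 1)
    (by ring)
  obtain ⟨C', hC', hest₁⟩ := hest η' hη' hη'0 hη'1 ((hη's.trans hGW).trans inter_subset_left) β hβ
    j hj
  have hs₀ : (2 * divergenceConst hn 0 * C_N ^ 2 + 1) * energyThreshold hn C_N ^ (2 / (n : ℝ)) ≤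
      1 / 4 := by
    have h0 := hK 0
    rw [energyThreshold, ← Real.rpow_mul (by positivity), show (n : ℝ) / 2 * (2 / n) = 1 by
      field_simp, Real.rpow_one]
    refine le_of_eq ?_
    field_simp
  -- First round: β = 0, critical term absorbed by the energy threshold with no additive constant.
  -- The lower power of w needed here is at most 1 plus the given one, hence the volume in `Y₀`.
  obtain ⟨B₀, hB₀, hbound₀⟩ := IsRegularizedCHF.exists_bound_of_critical (L := L) (M := M) (A := 0)
    (Y₀ := (riemannianVolume n M).real univ + Cβ) hC0 hn hn' ha hb hCb E₀ T hτ le_rfl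
    (by ring : (n : ℝ) - 1 = n - 1 + 0) hη.continuous hη0 hC hest₀ le_rfl hs₀
  set s : ℝ := 1 / (4 * (2 * divergenceConst hn β * C_N ^ 2 + 1)) with hs
  have hs0 : 0 < s := by have := hK β; positivity
  have hs₁ : (2 * divergenceConst hn β * C_N ^ 2 + 1) * s ≤ 1 / 4 := by
    have h0 := hK β
    rw [hs]
    refine le_of_eq ?_
    field_simp
  -- Second round: the bound `B₀` just obtained makes the critical term absorbable for the given β,
  -- at the price of an additive constant.
  obtain ⟨A, hA, hcrit⟩ := critical_le_of_bound (M := M) hn hj0 hB₀ hs0 (riemannianVolume n M)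
  obtain ⟨B₁, hB₁, hbound₁⟩ := IsRegularizedCHF.exists_bound_of_critical (L := L) (M := M)
    (Y₀ := Cβ) hC0 hn hn' ha hb hCb E₀ T hτ hβ hj hη'.continuous hη'0 hC' hest₁ hA hs₁
  refine ⟨G', hG', hcG', fun x hx ↦ (hGW (hGG' hx)).2, B₁, hB₁, ?_⟩
  intro N hemb hSF ε hε f u hfl hE hsmall hconf t ht
  have hmem : ∀ t ∈ Ico τ T, t ∈ Ioo 0 T := fun t ht ↦ ⟨hτ.trans_le ht.1, ht.2⟩
  have hτT : τ ∈ Ioo 0 T := ⟨hτ, ht.1.trans_lt ht.2⟩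
  have he0 : ∀ t, ∀ x, 0 ≤ e2 n ε (f t) x := fun t x ↦ e2_nonneg hε (f t) x
  have hep : ∀ t ∈ Ico τ T, ∀ κ : ℝ, 0 ≤ κ → Continuous fun x ↦ e2 n ε (f t) x ^ κ :=
    fun t ht κ hκ ↦ hfl.continuous_e2_rpow (hmem t ht) hκ
  have hec : ∀ t ∈ Ico τ T, Continuous fun x ↦ e2 n ε (f t) x := fun t ht ↦ by
    simpa using hep t ht 1 zero_le_one
  have hwc : Continuous fun x ↦ confFactor n u τ x :=
    (hfl.flowReg_confFactor.slice hτT |>.of_le (by simp) : ChartReg n 1 _).continuous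
  have hwp : ∀ κ : ℝ, Continuous fun x ↦ confFactor n u τ x ^ κ := fun κ ↦
    hwc.rpow_const fun x ↦ Or.inl (confFactor_pos u τ x).ne'
  have hw0 : ∀ κ : ℝ, ∀ x, 0 ≤ confFactor n u τ x ^ κ := fun κ x ↦
    Real.rpow_nonneg (confFactor_pos u τ x).le _
  have hY₀ : ∫ x, η x ^ (2 * ((n : ℝ) - 1) * (n / (n - 2))) *
      confFactor n u τ x ^ (2 * ((n : ℝ) - 1) / (n - 2)) ∂(riemannianVolume n M) ≤
      (riemannianVolume n M).real univ + Cβ := by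
    refine (integral_cutoff_mul_le hη.continuous hη0 hη1 hηV (by positivity) (hwp _)
      (hw0 _)).trans ?_
    calc _ ≤ ∫ x in V, (1 + confFactor n u τ x ^ (2 * j / (n - 2))) ∂(riemannianVolume n M) := by
          refine integral_mono (integrable_of_continuous' (hwp _))
            ((integrable_const _).add (integrable_of_continuous' (hwp _))) fun x ↦ ?_
          refine rpow_le_one_add_rpow (confFactor_pos u τ x).le (by positivity) ?_
          gcongr
          rw [hj]; linarith
      _ = (riemannianVolume n M).real V +
          ∫ x in V, confFactor n u τ x ^ (2 * j / (n - 2)) ∂(riemannianVolume n M) := by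
          rw [integral_add (integrable_const _) (integrable_of_continuous' (hwp _)),
            integral_const, smul_eq_mul, mul_one, measureReal_restrict_apply_univ]
      _ ≤ _ := add_le_add (measureReal_mono (subset_univ _)) hconf
  have hY₁ := (integral_cutoff_mul_le (κ := 2 * j * (n / (n - 2))) hη'.continuous hη'0 hη'1 hη'V
    (by positivity) (hwp _) (hw0 _)).trans hconf
  have hfirst := hbound₀ N hemb hSF ε hε f u hfl hE (fun t ht ↦ by
    have h1 := critical_le_of_small hn (j := (n : ℝ) - 1) hn1 (riemannianVolume n M) hη.continuous
      (hec t ht) hη0 (he0 t) hηV (q := 1) zero_le_one (D := energyThreshold hn C_N)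
      (by rw [one_mul]; exact hsmall t ht)
    rw [add_zero]
    refine le_trans (le_of_eq (integral_congr_ae (Eventually.of_forall fun x ↦ ?_))) h1
    dsimp only
    rw [Real.rpow_add_one' (he0 t x) (by linarith), Real.rpow_one, mul_assoc]) hY₀
  have hsecond := hbound₁ N hemb hSF ε hε f u hfl hE (fun t ht ↦
    hcrit G η' (fun x ↦ e2 n ε (f t) x) hη'.continuous (hec t ht) hη'0 hη'1 (he0 t) hη'G
      ((setIntegral_le_integral_cutoff_mul hG.measurableSet hη.continuous hη0 hηG (by positivity)
        (hep t ht _ (by positivity)) fun x ↦ Real.rpow_nonneg (he0 t x) _).trans (hfirst t ht)))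
    hY₁
  exact (setIntegral_le_integral_cutoff_mul hG'.measurableSet hη'.continuous hη'0 hηG'
    (by positivity) (hep t ht _ (by positivity)) fun x ↦ Real.rpow_nonneg (he0 t x) _).trans
      (hsecond t ht)

end LocalBound

/-! ### From points to balls by compactness. -/

section GlobalBound

variable {n L : ℕ} {M : Type*} [EMetricSpace M] [ChartedSpace (EuclideanSpace ℝ (Fin n)) M]
  [RiemannianBundle (fun x : M ↦ TangentSpace (𝓡 n) x)] [IsManifold (𝓡 n) ∞ M]
  [IsContMDiffRiemannianBundle (𝓡 n) ∞ (EuclideanSpace ℝ (Fin n))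
          (fun x : M ↦ TangentSpace (𝓡 n) x)]
  [MeasurableSpace M] [BorelSpace M] [CompactSpace M]
  {a b C_N : ℝ}

variable (L M) in
/-- Bound of high powers of the energy density on a ball where the `n`-energy is small. -/
lemma exists_ball_bound (hC0 : 0 ≤ C_N) (hn : 3 ≤ n) (hn' : n ≤ 4)
    (ha : 0 < a) (hb : 0 < b) (hCb : 0 < n * b / 2 - C_N - 2 * C_N ^ 2) (E₀ : ℝ) {T τ r ρ : ℝ}
    (hτ : 0 < τ) (hτT : τ < T) (hρ : 0 < ρ) (hρr : ρ < r) {β : ℝ} (hβ : 0 ≤ β) (Cβ : ℝ) {q : ℝ}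
    (hq : 0 < q) (hqβ : q ≤ (n - 1 + β) * (n / (n - 2))) :
    ∃ B : ℝ, ∀ (N : Set (EuclideanSpace ℝ (Fin L))), IsEmbeddedSubmanifold N →
      SecondFFBoundedBy N C_N → ∀ ε : ℝ, 0 ≤ ε →
      ∀ (x₀ : M) (f : ℝ → M → EuclideanSpace ℝ (Fin L)) (u : ℝ → M → ℝ),
        IsRegularizedCHF n N ε a b T f u → regNEnergy n ε (f 0) ≤ E₀ →
        (∀ t ∈ Ico τ T, ∫ x in Metric.eball x₀ (ENNReal.ofReal r), e2 n ε (f t) x ^ ((n : ℝ) / 2)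
          ∂(riemannianVolume n M) ≤ energyThreshold hn C_N) →
        ∫ x in Metric.eball x₀ (ENNReal.ofReal r),
          confFactor n u τ x ^ (2 * (n - 1 + β) / (n - 2)) ∂(riemannianVolume n M) ≤ Cβ →
        ∀ t ∈ Icc τ T, ∫ x in Metric.eball x₀ (ENNReal.ofReal ρ), e2 n ε (f t) x ^ q
          ∂(riemannianVolume n M) ≤ B := by
  have := isFiniteMeasure_riemannianVolume (n := n) (M := M)
  have hn3 : (3 : ℝ) ≤ n := by exact_mod_cast hn
  have hn2 : (0 : ℝ) < n - 2 := by linarith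
  have hT : 0 < T := hτ.trans hτT
  set Q : ℝ := (n - 1 + β) * (n / (n - 2)) with hQ
  have hQ0 : 0 ≤ Q := hq.le.trans hqβ
  -- If the d-ball around c contains a point of B_ρ, it lies in B_r, since d + d + ρ = r. The
  -- smallness assumptions on B_r then hold on it.
  set d : ℝ := (r - ρ) / 2 with hd
  have hd0 : 0 < d := by rw [hd]; linarith
  choose G hG hcG hGV B hB hbound using fun c : M ↦ exists_local_bound (M := M) (β := β) L hC0 hn
    hn' ha hb hCb E₀ T hτ hβ Cβ (Metric.isOpen_eball (x := c) (ε := ENNReal.ofReal d))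
    (Metric.mem_eball_self (ENNReal.ofReal_pos.2 hd0))
  -- All of M is covered at once, before the centre of the ball is given; this makes the final
  -- constant independent of `x₀`. Pieces that do not meet B_ρ contribute nothing.
  obtain ⟨s, hs⟩ := CompactSpace.elim_nhds_subcover G fun c ↦ (hG c).mem_nhds (hcG c)
  refine ⟨(riemannianVolume n M).real univ + ∑ c ∈ s, B c, ?_⟩
  intro N hemb hSF ε hε x₀ f u hfl hE hsmall hconf
  set A := Metric.eball x₀ (ENNReal.ofReal ρ) with hA
  have hAm : MeasurableSet A := Metric.isOpen_eball.measurableSet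
  have he0 : ∀ t, ∀ x, 0 ≤ e2 n ε (f t) x := fun t x ↦ e2_nonneg hε (f t) x
  have hsub : ∀ c, (G c ∩ A).Nonempty →
      Metric.eball c (ENNReal.ofReal d) ⊆ Metric.eball x₀ (ENNReal.ofReal r) := by
    rintro c ⟨y, hyG, hyA⟩ z hz
    have hy : edist y c < ENNReal.ofReal d := hGV c hyG
    have hz : edist z c < ENNReal.ofReal d := hz
    have hyA : edist y x₀ < ENNReal.ofReal ρ := hyA
    have h1 : edist z x₀ ≤ edist z c + (edist y c + edist y x₀) := by
      refine (edist_triangle z c x₀).trans (add_le_add le_rfl ?_)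
      rw [edist_comm y c]
      exact edist_triangle c y x₀
    have h2 : ENNReal.ofReal r =
        ENNReal.ofReal d + (ENNReal.ofReal d + ENNReal.ofReal ρ) := by
      rw [← ENNReal.ofReal_add hd0.le hρ.le, ← ENNReal.ofReal_add hd0.le (by linarith)]
      congr 1
      rw [hd]; ring
    show edist z x₀ < ENNReal.ofReal r
    rw [h2]
    exact h1.trans_lt (ENNReal.add_lt_add hz (ENNReal.add_lt_add hy hyA))
  have hIco : ∀ t ∈ Ico τ T, ∫ x in A, e2 n ε (f t) x ^ q ∂(riemannianVolume n M) ≤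
      (riemannianVolume n M).real univ + ∑ c ∈ s, B c := by
    intro t ht
    have htm : t ∈ Ioo 0 T := ⟨hτ.trans_le ht.1, ht.2⟩
    have hQc : Continuous fun x ↦ e2 n ε (f t) x ^ Q := hfl.continuous_e2_rpow htm hQ0
    have hqc : Continuous fun x ↦ e2 n ε (f t) x ^ q := hfl.continuous_e2_rpow htm hq.le
    have hlocal : ∀ c, ∫ x in G c ∩ A, e2 n ε (f t) x ^ Q ∂(riemannianVolume n M) ≤ B c := by
      intro c
      rcases (G c ∩ A).eq_empty_or_nonempty with h | h
      · rw [h, setIntegral_empty]; exact hB c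
      refine (setIntegral_mono_set (integrable_of_continuous' hQc).integrableOn
        (Eventually.of_forall fun x ↦ Real.rpow_nonneg (he0 t x) _)
        inter_subset_left.eventuallyLE).trans (hbound c N hemb hSF ε hε f u hfl hE
          (fun t ht ↦ ?_) ?_ t ht)
      · have hc := hfl.continuous_e2_rpow ⟨hτ.trans_le ht.1, ht.2⟩ (κ := (n : ℝ) / 2)
          (by positivity)
        exact (setIntegral_mono_set (integrable_of_continuous' hc).integrableOn
          (Eventually.of_forall fun x ↦ Real.rpow_nonneg (he0 t x) _)
          (hsub c h).eventuallyLE).trans (hsmall t ht)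
      · have hwc : Continuous fun x ↦ confFactor n u τ x :=
          (hfl.flowReg_confFactor.slice ⟨hτ, hτT⟩ |>.of_le (by simp) : ChartReg n 1 _).continuous
        have hwp : Continuous fun x ↦ confFactor n u τ x ^ (2 * (n - 1 + β) / (n - 2)) :=
          hwc.rpow_const fun x ↦ Or.inl (confFactor_pos u τ x).ne'
        exact (setIntegral_mono_set (integrable_of_continuous' hwp).integrableOn
          (Eventually.of_forall fun x ↦ Real.rpow_nonneg (confFactor_pos u τ x).le _)
          (hsub c h).eventuallyLE).trans hconf
    calc _ ≤ ∫ x in A, (1 + e2 n ε (f t) x ^ Q) ∂(riemannianVolume n M) :=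
          integral_mono (integrable_of_continuous' hqc)
            ((integrable_const _).add (integrable_of_continuous' hQc)) fun x ↦
              rpow_le_one_add_rpow (he0 t x) hq.le hqβ
      _ = (riemannianVolume n M).real A + ∫ x in A, e2 n ε (f t) x ^ Q ∂(riemannianVolume n M) := by
          rw [integral_add (integrable_const _) (integrable_of_continuous' hQc),
            integral_const, smul_eq_mul, mul_one, measureReal_restrict_apply_univ]
      _ ≤ _ := add_le_add (measureReal_mono (subset_univ _))
          ((setIntegral_le_sum_setIntegral s hAm (fun c ↦ (hG c).measurableSet)
            (hs ▸ subset_univ A) hQc fun x ↦ Real.rpow_nonneg (he0 t x) _).trans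
              (Finset.sum_le_sum fun c _ ↦ hlocal c))
  -- The estimates hold before the final time, where the flow is differentiated on an open interval;
  -- the final time is reached by continuity.
  have hclosure : closure (Ico τ T) = Icc τ T := closure_Ico hτT.ne
  have hcont : ContinuousOn (fun t ↦ ∫ x in A, e2 n ε (f t) x ^ q ∂(riemannianVolume n M))
      (Icc τ T) :=
    continuousOn_integral_flow ((riemannianVolume n M).restrict A) isCompact_Icc
      (k := fun t x ↦ e2 n ε (f t) x ^ q)
      (((continuousOn_e2_of_contMDiffOn hT hfl.smooth_f ε).mono
        (prod_mono_left (Icc_subset_Icc_left hτ.le))).rpow_const fun _ _ ↦ Or.inr hq.le)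
  intro t ht
  exact le_on_closure hIco (hclosure ▸ hcont) continuousOn_const (hclosure ▸ ht)

end GlobalBound

end

theorem theorem5p3 (n L : ℕ) (hn : 3 ≤ n) (hn' : n ≤ 4) (C_N K : ℝ) (hC_N : 0 ≤ C_N) :
    -- `ε₂` depends only on `n`, `L`, `C_N` and the bound `K` for the Ricci curvature
    ∃ ε₂ : ℝ, 0 < ε₂ ∧
      ∀ (M : Type*) [EMetricSpace M] [CompactSpace M] [MeasurableSpace M] [BorelSpace M]
        [ChartedSpace (EuclideanSpace ℝ (Fin n)) M] [IsManifold (𝓡 n) ∞ M]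
        [RiemannianBundle (fun x : M ↦ TangentSpace (𝓡 n) x)]
        [IsContMDiffRiemannianBundle (𝓡 n) ∞ (EuclideanSpace ℝ (Fin n))
          (fun x : M ↦ TangentSpace (𝓡 n) x)]
        [IsRiemannianManifold (𝓡 n) M],
      RicciBoundedBy n M K →
      ∀ a b : ℝ, 0 < a → 0 < b → 0 < n * b / 2 - C_N - 2 * C_N ^ 2 →
      ∀ t₁ t₂ r ρ E₀ : ℝ, 0 ≤ t₁ → t₁ < t₂ → 0 < ρ → ρ < r →
      -- the theorem is the case `β ≤ n`, `q = (n - 1 + β) n / (n - 2)`;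
      -- larger `β` give all finite exponents `q`
      ∀ β Cβ q : ℝ, 0 ≤ β → 0 < q → q ≤ (n - 1 + β) * (n / (n - 2)) →
      ∃ C₁₅ : ℝ,
        ∀ (N : Set (EuclideanSpace ℝ (Fin L))), IsEmbeddedSubmanifold N →
          SecondFFBoundedBy N C_N →
        ∀ (ε : ℝ), 0 ≤ ε → ε ≤ 1 →
        ∀ (x₀ : M) (f : ℝ → M → EuclideanSpace ℝ (Fin L)) (u : ℝ → M → ℝ),
          IsRegularizedCHF n N ε a b t₂ f u →
          regNEnergy n ε (f 0) ≤ E₀ →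
          (∀ t ∈ Icc t₁ t₂,
            ∫ x in Metric.eball x₀ (ENNReal.ofReal r), e2 n ε (f t) x ^ ((n : ℝ) / 2)
              ∂(riemannianVolume n M) ≤ ε₂) →
          ∫ x in Metric.eball x₀ (ENNReal.ofReal r),
              Real.exp (n * u t₁ x) * ‖timeDeriv t₂ f t₁ x‖ ^ 2 ∂(riemannianVolume n M) ≤ ε₂ →
          ∫ x in Metric.eball x₀ (ENNReal.ofReal r),
              Real.exp (2 * (n - 1 + β) / (n - 2) * n * u ((t₁ + t₂) / 2) x)
              ∂(riemannianVolume n M) ≤ Cβ →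
          ∀ t ∈ Icc ((t₁ + t₂) / 2) t₂,
            ∫ x in Metric.eball x₀ (ENNReal.ofReal ρ), e2 n ε (f t) x ^ q
              ∂(riemannianVolume n M) ≤ C₁₅ := by
  refine ⟨energyThreshold hn C_N, energyThreshold_pos hn C_N, ?_⟩
  intro M _ _ _ _ _ _ _ _ _ _ a b ha hb hCb t₁ t₂ r ρ E₀ ht₁ ht₁₂ hρ hρr β Cβ q hβ hq hqβ
  obtain ⟨B, hB⟩ := exists_ball_bound L M hC_N hn hn' ha hb hCb E₀ (T := t₂)
    (τ := (t₁ + t₂) / 2) (by linarith) (by linarith) hρ hρr hβ Cβ hq hqβ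
  refine ⟨B, fun N hemb hSF ε hε _ x₀ f u hfl hE hsmall _ hconf ↦
    hB N hemb hSF ε hε x₀ f u hfl hE (fun t ht ↦ hsmall t ⟨by linarith [ht.1], ht.2.le⟩) ?_⟩
  refine le_trans (le_of_eq (integral_congr_ae (Filter.Eventually.of_forall fun x ↦ ?_))) hconf
  dsimp only
  rw [confFactor, ← Real.exp_mul]
  congr 1
  ring
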